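/- Let $0<r_1<r_2<\infty$, $\omega>0$, $\varsigma>0$, and let $\mathfrak n\in L^\infty(r_1,r_2)$ be real-valued. Let $T$ be the unbounded operator in $L^2(r_1,r_2)$ given by $$T\phi=-r(r\phi')'-\omega^2\mathfrak n r^2\phi,\qquad D(T)=\{\phi\in H^2(r_1,r_2):\ \phi'(r_1)=0,\ \phi'(r_2)+i\omega\varsigma\phi(r_2)=0\}.$$ A system of root vectors of $T$ is an enumeration $\lambda_1,\lambda_2,\dots$ without repetition of the spectrum of $T$, together with, for each $n$, a Jordan chain $\phi_{n,1},\dots,\phi_{n,J_n}$ ($J_n\ge 1$, $T\phi_{n,j}=\lambda_n\phi_{n,j}+\phi_{n,j-1}$, $\phi_{n,0}:=0$) that is a basis of the root space $\bigcup_m\ker(T-\lambda_n)^m$. Write $\lambda_n=-\beta_n^2$ with $\operatorname{Im}\beta_n>0$, and let $C_m$ denote the Catalan numbers. Define $\operatorname{DtN}$ on each set of root vectors by $$\operatorname{DtN}\sum_{j=1}^{J_n}p_j\phi_{n,j}=\frac1r\sum_{j=1}^{J_n}\Big(i\beta_n p_j+\sum_{k=j+1}^{J_n}(-1)^{k-j-1}C_{k-j-1}\frac{p_k}{(2i\beta_n)^{2(k-j)-1}}\Big)\phi_{n,j},\qquad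 p_1,\dots,p_{J_n}\in\mathbb C .$$ Then a system of root vectors exists, and for every such system the linear operator $\operatorname{DtN}$ extends uniquely to a bounded linear operator $H^1(r_1,r_2)\to L^2(r_1,r_2)$, uniquely to a bounded linear operator $L^2(r_1,r_2)\to (H^1(r_1,r_2))'$, and (by interpolation) uniquely to a bounded linear operator $H^{1/2}(r_1,r_2)\to (H^{1/2}(r_1,r_2))'$. Here $X'$ is the space of bounded conjugate-linear functionals on $X$, a function $f$ acts by $\xi\mapsto\int_{r_1}^{r_2}f\,\overline{\xi}\,dr$, and $H^{1/2}$ carries the norm $\|u\|^2=\|u\|_{L^2}^2+\iint|u(x)-u(y)|^2|x-y|^{-2}\,dx\,dy$. The three extensions are compatible with each other. They depend only on the operator $T$, i.e. on $r_1,r_2,\omega,\mathfrak n,\varsigma$, and not on the chosen root vectors; in particular, their operator norms depend only on $T$. -/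

import Mathlib

open MeasureTheory Set
open scoped ComplexConjugate

noncomputable section

/-! ### Function spaces on the interval `(a, b)` -/

/-- The space `L²(a, b)` of complex valued square integrable functions. -/
abbrev L2 (a b : ℝ) : Type := Lp ℂ 2 (volume.restrict (Ioo a b))

/-- `v` is the weak derivative of `u` on `(a, b)`:
`∫ u η' = - ∫ v η` for all smooth `η` with compact support in `(a, b)`. -/
def HasWeakDeriv {a b : ℝ} (u v : L2 a b) : Prop :=
  ∀ η : ℝ → ℂ, ContDiff ℝ (⊤ : ℕ∞) η → HasCompactSupport η → tsupport η ⊆ Ioo a b →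
    ∫ x in Ioo a b, u x * deriv η x = - ∫ x in Ioo a b, v x * η x

lemma integrable_L2_mul_test {a b : ℝ} (u : L2 a b) {η : ℝ → ℂ} (hη : Continuous η)
    (hs : HasCompactSupport η) :
    Integrable (fun x => u x * η x) (volume.restrict (Ioo a b)) :=
  (Lp.memLp u).integrable_mul (p := 2) (q := 2) (hη.memLp_of_hasCompactSupport hs)

lemma HasWeakDeriv.add {a b : ℝ} {u v u' v' : L2 a b} (h : HasWeakDeriv u v)
    (h' : HasWeakDeriv u' v') : HasWeakDeriv (u + u') (v + v') := by
  intro η hη hs ht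
  have e1 : ∫ x in Ioo a b, (u + u') x * deriv η x
      = ∫ x in Ioo a b, (u x * deriv η x + u' x * deriv η x) := by
    refine integral_congr_ae ?_
    filter_upwards [Lp.coeFn_add u u'] with x hx
    rw [hx, Pi.add_apply, add_mul]
  have e2 : ∫ x in Ioo a b, (v + v') x * η x
      = ∫ x in Ioo a b, (v x * η x + v' x * η x) := by
    refine integral_congr_ae ?_
    filter_upwards [Lp.coeFn_add v v'] with x hx
    rw [hx, Pi.add_apply, add_mul]
  have hd : Continuous (deriv η) := hη.continuous_deriv (by simp)
  rw [e1, e2, integral_add (integrable_L2_mul_test u hd hs.deriv)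
      (integrable_L2_mul_test u' hd hs.deriv),
    integral_add (integrable_L2_mul_test v hη.continuous hs)
      (integrable_L2_mul_test v' hη.continuous hs), h η hη hs ht, h' η hη hs ht]
  ring

lemma HasWeakDeriv.smul {a b : ℝ} {u v : L2 a b} (c : ℂ) (h : HasWeakDeriv u v) :
    HasWeakDeriv (c • u) (c • v) := by
  intro η hη hs ht
  have e1 : ∫ x in Ioo a b, (c • u) x * deriv η x
      = ∫ x in Ioo a b, c * (u x * deriv η x) := by
    refine integral_congr_ae ?_
    filter_upwards [Lp.coeFn_smul c u] with x hx
    rw [hx, Pi.smul_apply, smul_eq_mul, mul_assoc]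
  have e2 : ∫ x in Ioo a b, (c • v) x * η x = ∫ x in Ioo a b, c * (v x * η x) := by
    refine integral_congr_ae ?_
    filter_upwards [Lp.coeFn_smul c v] with x hx
    rw [hx, Pi.smul_apply, smul_eq_mul, mul_assoc]
  rw [e1, e2, integral_const_mul, integral_const_mul, h η hη hs ht, mul_neg]

lemma HasWeakDeriv.zero {a b : ℝ} : HasWeakDeriv (0 : L2 a b) 0 := by
  have h : ∀ w : L2 a b, w = 0 → ∀ η : ℝ → ℂ, ∫ x in Ioo a b, w x * η x = 0 := by
    rintro w rfl η
    rw [integral_eq_zero_of_ae]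
    filter_upwards [Lp.coeFn_zero ℂ 2 (volume.restrict (Ioo a b))] with x hx
    rw [hx]; simp
  intro η _ _ _
  rw [h 0 rfl, h 0 rfl, neg_zero]

/-- The Sobolev space `H¹(a, b)`, realised as the space of pairs `(u, u')` in `L² × L²` with `u'`
the weak derivative of `u`, so that `‖u‖² = ‖u‖²_{L²} + ‖u'‖²_{L²}`. -/
def H1 (a b : ℝ) : Submodule ℂ (WithLp 2 (L2 a b × L2 a b)) where
  carrier := {p | HasWeakDeriv p.fst p.snd}
  add_mem' := fun h h' => HasWeakDeriv.add h h'
  zero_mem' := HasWeakDeriv.zero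
  smul_mem' := fun c _ h => HasWeakDeriv.smul c h

/-- The `L²` function underlying an element of `H¹`. -/
def H1.fn {a b : ℝ} (u : H1 a b) : L2 a b := (u : WithLp 2 (L2 a b × L2 a b)).fst

/-- The space `L²((a, b) × (a, b))`. -/
abbrev L2sq (a b : ℝ) : Type :=
  Lp ℂ 2 ((volume.restrict (Ioo a b)).prod (volume.restrict (Ioo a b)))

/-- `q(x, y) = (u(x) - u(y)) / |x - y|` for almost every `(x, y)`. -/
def HasDiffQuotient {a b : ℝ} (u : L2 a b) (q : L2sq a b) : Prop :=
  q =ᵐ[(volume.restrict (Ioo a b)).prod (volume.restrict (Ioo a b))]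
    fun z => (u z.1 - u z.2) / ((|z.1 - z.2| : ℝ) : ℂ)

/-- The fractional (Sobolev-Slobodeckij) space `H^{1/2}(a, b)`, realised as the space of pairs
`(u, q)` with `u` in `L²(a, b)` and `q(x, y) = (u(x) - u(y)) / |x - y|` in `L²((a, b)²)`, so that
`‖u‖² = ‖u‖²_{L²} + ∫∫ |u(x) - u(y)|² / |x - y|² dx dy`. -/
def Hhalf (a b : ℝ) : Submodule ℂ (WithLp 2 (L2 a b × L2sq a b)) where
  carrier := {p | HasDiffQuotient p.fst p.snd}
  add_mem' := by
    rintro p p' h h'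
    have hs := Lp.coeFn_add p.fst p'.fst
    have h1 := Measure.quasiMeasurePreserving_fst (μ := volume.restrict (Ioo a b))
      (ν := volume.restrict (Ioo a b)) |>.ae hs
    have h2 := Measure.quasiMeasurePreserving_snd (μ := volume.restrict (Ioo a b))
      (ν := volume.restrict (Ioo a b)) |>.ae hs
    change HasDiffQuotient (p.fst + p'.fst) (p.snd + p'.snd)
    unfold HasDiffQuotient
    filter_upwards [h, h', h1, h2, Lp.coeFn_add p.snd p'.snd] with z e e' e1 e2 e3
    rw [e3, Pi.add_apply, e, e', e1, e2, Pi.add_apply, Pi.add_apply]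
    ring
  zero_mem' := by
    have hs := Lp.coeFn_zero ℂ 2 (volume.restrict (Ioo a b))
    have h1 := Measure.quasiMeasurePreserving_fst (μ := volume.restrict (Ioo a b))
      (ν := volume.restrict (Ioo a b)) |>.ae hs
    have h2 := Measure.quasiMeasurePreserving_snd (μ := volume.restrict (Ioo a b))
      (ν := volume.restrict (Ioo a b)) |>.ae hs
    change HasDiffQuotient 0 0
    unfold HasDiffQuotient
    filter_upwards [h1, h2, Lp.coeFn_zero ℂ 2
      ((volume.restrict (Ioo a b)).prod (volume.restrict (Ioo a b)))] with z e1 e2 e3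
    rw [e3, e1, e2]
    simp
  smul_mem' := by
    rintro c p h
    have hs := Lp.coeFn_smul c p.fst
    have h1 := Measure.quasiMeasurePreserving_fst (μ := volume.restrict (Ioo a b))
      (ν := volume.restrict (Ioo a b)) |>.ae hs
    have h2 := Measure.quasiMeasurePreserving_snd (μ := volume.restrict (Ioo a b))
      (ν := volume.restrict (Ioo a b)) |>.ae hs
    change HasDiffQuotient (c • p.fst) (c • p.snd)
    unfold HasDiffQuotient
    filter_upwards [h, h1, h2, Lp.coeFn_smul c p.snd] with z e e1 e2 e3
    rw [e3, Pi.smul_apply, e, e1, e2, Pi.smul_apply, Pi.smul_apply]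
    simp only [smul_eq_mul]
    ring

/-- The `L²` function underlying an element of `H^{1/2}`. -/
def Hhalf.fn {a b : ℝ} (u : Hhalf a b) : L2 a b := (u : WithLp 2 (L2 a b × L2sq a b)).fst

/-- The dual space `(H¹(a, b))'` (bounded conjugate linear functionals). -/
abbrev H1Dual (a b : ℝ) : Type := H1 a b →L⋆[ℂ] ℂ

/-- The dual space `(H^{1/2}(a, b))'` (bounded conjugate linear functionals). -/
abbrev HhalfDual (a b : ℝ) : Type := Hhalf a b →L⋆[ℂ] ℂ

/-- The value at `x ∈ [a, b]` of (the continuous representative on `[a, b]` of) `u` is `c`. -/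
def HasTrace {a b : ℝ} (u : L2 a b) (x : ℝ) (c : ℂ) : Prop :=
  ∃ g : ℝ → ℂ, ContinuousOn g (Icc a b) ∧ u =ᵐ[volume.restrict (Ioo a b)] g ∧ g x = c

/-! ### The transversal operator, its spectrum and its root vectors -/

/-- The graph of the unbounded operator `T φ = - r (r φ')' - ω² 𝔫 r² φ` in `L²(r₁, r₂)` with domain
`{φ ∈ H²(r₁, r₂) : φ'(r₁) = 0, φ'(r₂) + i ω ς φ(r₂) = 0}`:
the statement `IsModalImage r₁ r₂ ω ς 𝔫 φ f` says that `φ` is in the domain and `T φ = f`.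
Here `φ₁` and `φ₂` are the first and second weak derivatives of `φ`. -/
def IsModalImage (r₁ r₂ ω ς : ℝ) (𝔫 : ℝ → ℝ) (φ f : L2 r₁ r₂) : Prop :=
  ∃ φ₁ φ₂ : L2 r₁ r₂, HasWeakDeriv φ φ₁ ∧ HasWeakDeriv φ₁ φ₂ ∧
    HasTrace φ₁ r₁ 0 ∧
    (∃ c c' : ℂ, HasTrace φ r₂ c ∧ HasTrace φ₁ r₂ c' ∧ c' + Complex.I * ω * ς * c = 0) ∧
    f =ᵐ[volume.restrict (Ioo r₁ r₂)] fun r =>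
      -(r : ℂ) * (φ₁ r + (r : ℂ) * φ₂ r) - (ω : ℂ) ^ 2 * (𝔫 r : ℂ) * (r : ℂ) ^ 2 * φ r

/-- The spectrum of `T`: the set of those `z` for which `T - z` has no bounded inverse that is
defined on all of `L²(r₁, r₂)`. -/
def modalSpectrum (r₁ r₂ ω ς : ℝ) (𝔫 : ℝ → ℝ) : Set ℂ :=
  {z | ¬ ∃ R : L2 r₁ r₂ →L[ℂ] L2 r₁ r₂,
    (∀ f, IsModalImage r₁ r₂ ω ς 𝔫 (R f) (f + z • R f)) ∧
    ∀ φ g, IsModalImage r₁ r₂ ω ς 𝔫 φ g → R (g - z • φ) = φ}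

/-- The root space `⋃ₘ ker (T - z)ᵐ` of `T` at `z`. -/
def modalRootSpace (r₁ r₂ ω ς : ℝ) (𝔫 : ℝ → ℝ) (z : ℂ) : Set (L2 r₁ r₂) :=
  {φ | ∃ (m : ℕ) (x : ℕ → L2 r₁ r₂), x 0 = 0 ∧ x m = φ ∧
    ∀ i < m, IsModalImage r₁ r₂ ω ς 𝔫 (x (i + 1)) (z • x (i + 1) + x i)}

/-- A system of root vectors of `T`: the spectrum of `T` is enumerated, without repetition, as
`λ₀, λ₁, …`, and `φ_{n,1}, …, φ_{n,Jₙ}` with `Jₙ ≥ 1` is a Jordan chain,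
`T φ_{n,j} = λₙ φ_{n,j} + φ_{n,j-1}` with `φ_{n,0} = 0`, that is a basis of the root space
of `λₙ`. (`vec n j` with `j > len n` is never used.) -/
structure RootSystem (r₁ r₂ ω ς : ℝ) (𝔫 : ℝ → ℝ) where
  eig : ℕ → ℂ
  eig_injective : Function.Injective eig
  range_eig : Set.range eig = modalSpectrum r₁ r₂ ω ς 𝔫
  len : ℕ → ℕ
  len_pos : ∀ n, 1 ≤ len n
  vec : ℕ → ℕ → L2 r₁ r₂
  vec_zero : ∀ n, vec n 0 = 0
  chain : ∀ n, ∀ j ∈ Finset.Icc 1 (len n),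
    IsModalImage r₁ r₂ ω ς 𝔫 (vec n j) (eig n • vec n j + vec n (j - 1))
  linearIndepOn : ∀ n, LinearIndepOn ℂ (vec n) (Set.Icc 1 (len n))
  span_eq : ∀ n, (Submodule.span ℂ (vec n '' Set.Icc 1 (len n)) : Set (L2 r₁ r₂)) =
    modalRootSpace r₁ r₂ ω ς 𝔫 (eig n)

/-! ### The modewise DtN operator -/

/-- The root `β` of `λ = - β²` with `Im β > 0` (for `λ` outside `(-∞, 0]`). -/
def modalBeta (z : ℂ) : ℂ := Complex.I * z ^ (1 / 2 : ℂ)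

lemma modalBeta_sq (z : ℂ) : z = -(modalBeta z) ^ 2 := by
  have h : (z ^ (1 / 2 : ℂ)) ^ 2 = z := by
    simp
  rw [modalBeta, mul_pow, Complex.I_sq, h]; ring

lemma modalBeta_im_pos {z : ℂ} (hz : z ∈ Complex.slitPlane) : 0 < (modalBeta z).im := by
  have h0 : z ≠ 0 := Complex.slitPlane_ne_zero hz
  have harg : z.arg ≠ Real.pi := (Complex.mem_slitPlane_iff_arg.mp hz).1
  have h1 := Complex.neg_pi_lt_arg z
  have h2 : z.arg < Real.pi := lt_of_le_of_ne (Complex.arg_le_pi z) harg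
  have : (modalBeta z).im = (z ^ (1 / 2 : ℂ)).re := by simp [modalBeta]
  rw [this, Complex.cpow_def_of_ne_zero h0, Complex.exp_re]
  refine mul_pos (Real.exp_pos _) (Real.cos_pos_of_mem_Ioo ?_)
  have : (Complex.log z * (1 / 2 : ℂ)).im = z.arg / 2 := by
    have e : (1 / 2 : ℂ) = ((1 / 2 : ℝ) : ℂ) := by push_cast; ring
    rw [e, Complex.im_mul_ofReal, Complex.log_im]; ring
  rw [this]
  constructor <;> linarith

namespace RootSystem

variable {r₁ r₂ ω ς : ℝ} {𝔫 : ℝ → ℝ} (Φ : RootSystem r₁ r₂ ω ς 𝔫)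

/-- The modal sum `∑_{j=1}^{Jₙ} p_j φ_{n,j}`. -/
def modeSum (n : ℕ) (p : ℕ → ℂ) : L2 r₁ r₂ :=
  ∑ j ∈ Finset.Icc 1 (Φ.len n), p j • Φ.vec n j

/-- The coefficient `F_{n,j} = i βₙ p_j + ∑_{k=j+1}^{Jₙ} (-1)^{k-j-1} C_{k-j-1} p_k /
(2 i βₙ)^{2(k-j)-1}` with the Catalan numbers `C_m`. -/
def dtnCoeff (n : ℕ) (p : ℕ → ℂ) (j : ℕ) : ℂ :=
  Complex.I * modalBeta (Φ.eig n) * p j +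
    ∑ k ∈ Finset.Icc (j + 1) (Φ.len n),
      (-1) ^ (k - j - 1) * (catalan (k - j - 1) : ℂ) *
        (p k / (2 * Complex.I * modalBeta (Φ.eig n)) ^ (2 * (k - j) - 1))

/-- The function `r⁻¹ ∑_{j=1}^{Jₙ} F_{n,j} φ_{n,j}(r)`, the value of the `DtN` operator at the modal
sum `∑_{j=1}^{Jₙ} p_j φ_{n,j}`. -/
def dtnMode (n : ℕ) (p : ℕ → ℂ) : ℝ → ℂ :=
  fun r => (r : ℂ)⁻¹ * Φ.modeSum n (Φ.dtnCoeff n p) r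

/-- `D : H¹ → L²` is given by the modewise formula on every root vector set. -/
def ExtendsDtNH1 (D : H1 r₁ r₂ →L[ℂ] L2 r₁ r₂) : Prop :=
  ∀ (n : ℕ) (p : ℕ → ℂ) (u : H1 r₁ r₂), H1.fn u = Φ.modeSum n p →
    D u =ᵐ[volume.restrict (Ioo r₁ r₂)] Φ.dtnMode n p

/-- `D : L² → (H¹)'` is given by the modewise formula on every root vector set, where an `L²`
function is understood as a functional through the `L²` inner product. -/
def ExtendsDtNL2 (D : L2 r₁ r₂ →L[ℂ] H1Dual r₁ r₂) : Prop :=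
  ∀ (n : ℕ) (p : ℕ → ℂ) (ξ : H1 r₁ r₂),
    D (Φ.modeSum n p) ξ = ∫ r in Ioo r₁ r₂, Φ.dtnMode n p r * conj (H1.fn ξ r)

/-- `D : H^{1/2} → (H^{1/2})'` is given by the modewise formula on every root vector set. -/
def ExtendsDtNHhalf (D : Hhalf r₁ r₂ →L[ℂ] HhalfDual r₁ r₂) : Prop :=
  ∀ (n : ℕ) (p : ℕ → ℂ) (u : Hhalf r₁ r₂), Hhalf.fn u = Φ.modeSum n p → ∀ ξ : Hhalf r₁ r₂,
    D u ξ = ∫ r in Ioo r₁ r₂, Φ.dtnMode n p r * conj (Hhalf.fn ξ r)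

end RootSystem

end

noncomputable section

open Filter Topology

/-! ### Square summable sequences and diagonal operators -/

/-! In the variable log r the operator r d/dr is a plain derivative, and expansion in cosine modes
for the measure dr/r turns T into diag(ρ²n²) + iκ δ⊗δ plus a bounded symmetric operator on ℓ²
(`LogCos.isModalImage_iff`). The rank one term is the Robin condition: κ = ως r₂, and δₙ are the
values of the modes at r₂, which are bounded but not square summable. As β = i√λ, the modewise
formula says DtN = -r⁻¹√T: the Catalan numbers are, up to signs and powers of 2w, the Taylor
coefficients of √(w² + N), and N is the nilpotent part of T on a root space
(`tendsto_integral_sqrtKernel`, `RootSystem.neg_dtnCoeff`).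

The core is that √T differs from √Λ, Λ = diag(ρ²n² + 1), by a bounded operator B
(`ModalData.exists_sqrt_sub_sqrt`). By Balakrishnan's formula the difference is (2/π)∫ t²((Λ + t²)⁻¹
- (T + t²)⁻¹) dt. The difference of resolvents is a rank one term, controlled by a Hilbert type
inequality (`integral_sq_tsum_le`), plus a term of order t⁻⁴. The norms of H¹ and H^{1/2} are
equivalent to those of Λ^{1/2}x and Λ^{1/4}x in ℓ² (`exists_J1`, `exists_E1`, `exists_Jh`,
`exists_Eh`). Hence the form ⟨ξ, √Λ u⟩ + ⟨ξ, Bu⟩ is bounded on each of the three pairs of spaces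
once √Λ is distributed suitably over ξ and u. No interpolation theorem enters, the three operators
are visibly compatible, and B does not see the choice of root vectors.

Uniqueness of the extensions is completeness of the root vectors (`ModalData.roots_orthogonal`). On
the orthogonal complement of all root spaces the adjoint of the compact resolvent K has no nonzero
eigenvalue, so its own resolvent is entire; it tends to zero on circles running between the points
of the diagonal, so it vanishes, and K has dense range. Density in the form domain follows because K
= Λ^{-1/2}L with L of dense range, while K preserves the span of the root vectors.

A root system exists because the Cauchy problem at r₂ has a unique solution. Eigenspaces are
therefore one dimensional and each root space is spanned by a single finite Jordan chain. The same
uniqueness puts all eigenvalues in the open upper half plane, so that T + t² is invertible for real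
t and the principal root is harmless. -/

lemma HasSum.of_eq {ι α : Type*} [AddCommMonoid α] [TopologicalSpace α] {f g : ι → α} {a b : α}
    (h : HasSum f a) (hfg : ∀ i, g i = f i) (hab : b = a) : HasSum g b := by
  rw [hab, funext hfg]
  exact h

/-- The Hilbert space `ℓ²(ℕ, ℂ)`. -/
abbrev SeqL2 : Type := lp (fun _ : ℕ => ℂ) 2

namespace SeqL2

lemma memℓp_iff {x : ℕ → ℂ} : Memℓp x 2 ↔ Summable fun n => ‖x n‖ ^ 2 := by
  rw [memℓp_gen_iff (by norm_num)]
  simp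

lemma summable_norm_sq (x : SeqL2) : Summable fun n => ‖x n‖ ^ 2 :=
  memℓp_iff.mp (lp.memℓp x)

lemma hasSum_norm_sq (x : SeqL2) : HasSum (fun n => ‖x n‖ ^ 2) (‖x‖ ^ 2) := by
  have := lp.hasSum_norm (p := 2) (by norm_num) x
  simpa using this

lemma norm_sq_eq (x : SeqL2) : ‖x‖ ^ 2 = ∑' n, ‖x n‖ ^ 2 := (hasSum_norm_sq x).tsum_eq.symm

lemma hasSum_inner (x y : SeqL2) : HasSum (fun n => conj (x n) * y n) (inner ℂ x y) := by
  have := lp.hasSum_inner (𝕜 := ℂ) x y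
  simpa [RCLike.inner_apply, mul_comm] using this

lemma norm_apply_le (x : SeqL2) (n : ℕ) : ‖x n‖ ≤ ‖x‖ := lp.norm_apply_le_norm (by norm_num) x n

lemma norm_le_of_sq_le {x : SeqL2} {C : ℝ} (hC : 0 ≤ C) (h : ∀ s : Finset ℕ, ∑ n ∈ s, ‖x n‖ ^ 2 ≤ C ^ 2) :
    ‖x‖ ≤ C := by
  refine lp.norm_le_of_forall_sum_le (by norm_num) hC fun s => ?_
  simpa using h s

/-- The diagonal operator with bounded diagonal `a`. -/
def diag (a : ℕ → ℂ) {C : ℝ} (h : ∀ n, ‖a n‖ ≤ C) : SeqL2 →L[ℂ] SeqL2 :=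
  LinearMap.mkContinuous
    { toFun := fun x => ⟨fun n => a n * x n, memℓp_iff.mpr <|
        Summable.of_nonneg_of_le (fun _ => by positivity) (fun n => by
          rw [norm_mul, mul_pow]
          gcongr
          exact h n) ((summable_norm_sq x).mul_left (C ^ 2))⟩
      map_add' := fun x y => by
        ext n; change a n * (x n + y n) = a n * x n + a n * y n; ring
      map_smul' := fun c x => by
        ext n; change a n * (c * x n) = c * (a n * x n); ring }
    C (fun x => by
      have hC : 0 ≤ C := (norm_nonneg _).trans (h 0)
      refine norm_le_of_sq_le (by positivity) fun s => ?_
      calc ∑ n ∈ s, ‖a n * x n‖ ^ 2 ≤ ∑ n ∈ s, C ^ 2 * ‖x n‖ ^ 2 := by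
            gcongr with n
            rw [norm_mul, mul_pow]
            gcongr
            exact h n
        _ ≤ C ^ 2 * ‖x‖ ^ 2 := by
            rw [← Finset.mul_sum]
            gcongr
            exact sum_le_hasSum s (fun _ _ => by positivity) (hasSum_norm_sq x)
        _ = (C * ‖x‖) ^ 2 := by ring)

@[simp] lemma diag_apply (a : ℕ → ℂ) {C : ℝ} (h : ∀ n, ‖a n‖ ≤ C) (x : SeqL2) (n : ℕ) :
    diag a h x n = a n * x n := rfl

lemma norm_diag_le (a : ℕ → ℂ) {C C' : ℝ} (h : ∀ n, ‖a n‖ ≤ C) (h' : ∀ n, ‖a n‖ ≤ C') :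
    ‖diag a h‖ ≤ C' := by
  have hC : 0 ≤ C' := (norm_nonneg _).trans (h' 0)
  have e : diag a h = diag a h' := by ext x n; simp
  rw [e]
  exact LinearMap.mkContinuous_norm_le _ hC _

end SeqL2

open SeqL2


/-! ### Rank one and bounded perturbations of a diagonal operator -/

/-- The data of an operator `diag (ρ² n² + 1) + i κ (δ ⊗ δ) + W` in `ℓ²`. -/
structure ModalData where
  rho : ℝ
  rho_pos : 0 < rho
  del : ℕ → ℝ
  bd : ℝ
  abs_del_le : ∀ n, |del n| ≤ bd
  kap : ℝ
  kap_pos : 0 < kap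
  W : SeqL2 →L[ℂ] SeqL2
  W_symm : ∀ x y, inner ℂ (W x) y = inner ℂ x (W y)
  -- In the application this is uniqueness for the Cauchy problem at the right end point: the
  -- vanishing sum says φ(b) = 0, and the Robin condition then gives φ'(b) = 0. It makes eigenspaces
  -- one dimensional and eigenvalues non-real.
  unique' : ∀ (z : ℂ) (φ : SeqL2), HasSum (fun n => (del n : ℂ) * φ n) 0 →
    (∀ n : ℕ, ((rho ^ 2 * n ^ 2 + 1 : ℝ) : ℂ) * φ n + W φ n = z * φ n) → φ = 0

namespace ModalData

variable (D : ModalData)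

/-- The diagonal entries. -/
def lam (n : ℕ) : ℝ := D.rho ^ 2 * n ^ 2 + 1

lemma one_le_lam (n : ℕ) : 1 ≤ D.lam n := by
  have : 0 ≤ D.rho ^ 2 * n ^ 2 := by positivity
  unfold lam; linarith

lemma lam_pos (n : ℕ) : 0 < D.lam n := lt_of_lt_of_le one_pos (D.one_le_lam n)

lemma bd_nonneg : 0 ≤ D.bd := (abs_nonneg _).trans (D.abs_del_le 0)

/-- `T φ = f` for the operator `T = diag (ρ² n² + 1) + i κ (δ ⊗ δ) + W` given by the data. -/
def Rel (φ f : SeqL2) : Prop :=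
  -- `c` plays the role of the boundary value of φ at the right end point. Since δ is merely
  -- bounded, δ ⊗ δ is not an operator on `ℓ²`; convergence of this sum and square summability of
  -- the expression below define the domain.
  ∃ c : ℂ, HasSum (fun n => (D.del n : ℂ) * φ n) c ∧
    ∀ n, (D.lam n : ℂ) * φ n + D.W φ n + Complex.I * D.kap * D.del n * c = f n

/-- The entries grow like ρ²n². No condition on `z` is needed, since a vanishing denominator
contributes `0⁻¹ = 0`. -/
lemma summable_inv (z : ℂ) : Summable fun n => ‖((D.lam n : ℂ) - z)⁻¹‖ := by
  have h1 : Summable fun n : ℕ => (2 / D.rho ^ 2) * (1 / (n : ℝ) ^ 2) :=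
    (Real.summable_one_div_nat_pow.mpr one_lt_two).mul_left _
  refine h1.of_norm_bounded_eventually_nat ?_
  have hr := D.rho_pos
  have h2 : Filter.Tendsto (fun n : ℕ => D.rho ^ 2 * (n : ℝ) ^ 2) Filter.atTop Filter.atTop :=
    ((Filter.tendsto_pow_atTop two_ne_zero).comp tendsto_natCast_atTop_atTop).const_mul_atTop
      (by positivity)
  filter_upwards [h2.eventually_ge_atTop (2 * ‖z‖), Filter.eventually_gt_atTop 0] with n hn hn0
  have hn0' : (0 : ℝ) < n := by exact_mod_cast hn0
  have h3 : D.rho ^ 2 * n ^ 2 / 2 ≤ ‖(D.lam n : ℂ) - z‖ := by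
    have := norm_sub_norm_le (D.lam n : ℂ) z
    rw [Complex.norm_of_nonneg (D.lam_pos n).le] at this
    unfold lam at *
    linarith
  rw [norm_norm, norm_inv]
  calc ‖(D.lam n : ℂ) - z‖⁻¹ ≤ (D.rho ^ 2 * n ^ 2 / 2)⁻¹ := by gcongr
    _ = _ := by field_simp

/-- The resolvent of the diagonal part. -/
def R0 (z : ℂ) : SeqL2 →L[ℂ] SeqL2 :=
  diag (fun n => ((D.lam n : ℂ) - z)⁻¹) (C := ∑' n, ‖((D.lam n : ℂ) - z)⁻¹‖) fun n =>
    (D.summable_inv z).le_tsum n fun _ _ => norm_nonneg _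

@[simp] lemma R0_apply (z : ℂ) (x : SeqL2) (n : ℕ) :
    D.R0 z x n = ((D.lam n : ℂ) - z)⁻¹ * x n := rfl

lemma norm_R0_le {z : ℂ} {d : ℝ} (hd : 0 < d) (h : ∀ n, d ≤ ‖(D.lam n : ℂ) - z‖) :
    ‖D.R0 z‖ ≤ d⁻¹ := by
  refine norm_diag_le _ _ fun n => ?_
  rw [norm_inv]
  gcongr
  exact h n

lemma summable_del_sq (z : ℂ) : Summable fun n => D.del n ^ 2 * ‖((D.lam n : ℂ) - z)⁻¹‖ := by
  refine Summable.of_nonneg_of_le (fun _ => by positivity) (fun n => ?_)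
    ((D.summable_inv z).mul_left (D.bd ^ 2))
  gcongr ?_ * _
  rw [← sq_abs]
  exact pow_le_pow_left₀ (abs_nonneg _) (D.abs_del_le n) 2

/-- The sequence `δₙ / (λₙ - z)`. -/
def g (z : ℂ) : SeqL2 :=
  ⟨fun n => D.del n * ((D.lam n : ℂ) - z)⁻¹, memℓp_iff.mpr <| by
    refine Summable.of_nonneg_of_le (fun _ => by positivity) (fun n => ?_)
      ((D.summable_del_sq z).mul_right (∑' n, ‖((D.lam n : ℂ) - z)⁻¹‖))
    rw [norm_mul, mul_pow, Complex.norm_real, Real.norm_eq_abs, sq_abs, sq ‖_‖, ← mul_assoc]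
    gcongr
    exact (D.summable_inv z).le_tsum n fun _ _ => norm_nonneg _⟩

@[simp] lemma g_apply (z : ℂ) (n : ℕ) : D.g z n = D.del n * ((D.lam n : ℂ) - z)⁻¹ := rfl

/-- The sum of `δₙ² / (λₙ - z)`. -/
def gam (z : ℂ) : ℂ := ∑' n, (D.del n : ℂ) * D.g z n

lemma hasSum_gam (z : ℂ) : HasSum (fun n => (D.del n : ℂ) * D.g z n) (D.gam z) := by
  refine Summable.hasSum (Summable.of_norm ?_)
  convert D.summable_del_sq z using 2 with n
  rw [g_apply, ← mul_assoc, norm_mul, ← sq, norm_pow, Complex.norm_real, Real.norm_eq_abs, sq_abs]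

/-- The functional `f ↦ ∑ δₙ fₙ / (λₙ - z)`. -/
def ell (z : ℂ) : SeqL2 →L[ℂ] ℂ := innerSL ℂ (D.g (conj z))

lemma hasSum_ell (z : ℂ) (f : SeqL2) :
    HasSum (fun n => (D.del n : ℂ) * (((D.lam n : ℂ) - z)⁻¹ * f n)) (D.ell z f) := by
  refine (SeqL2.hasSum_inner (D.g (conj z)) f).of_eq (fun n => ?_) rfl
  simp [mul_assoc]

/-- The resolvent of `diag λ + i κ (δ ⊗ δ)`. -/
def RB (z : ℂ) : SeqL2 →L[ℂ] SeqL2 :=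
  -- Sherman–Morrison formula; it is the resolvent only at points where no denominator vanishes, as
  -- ensured by `Good`.
  D.R0 z - (Complex.I * D.kap / (1 + Complex.I * D.kap * D.gam z)) •
    (D.ell z).smulRight (D.g z)

lemma RB_apply (z : ℂ) (f : SeqL2) : D.RB z f =
    D.R0 z f - (Complex.I * D.kap / (1 + Complex.I * D.kap * D.gam z) * D.ell z f) • D.g z := by
  simp [RB, smul_smul]

/-- Points at which the rank one perturbation is harmless. -/
structure Good (z : ℂ) (d : ℝ) : Prop where
  pos : 0 < d
  dist : ∀ n, d ≤ ‖(D.lam n : ℂ) - z‖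
  -- As `‖g‖²` is at most `d⁻¹` times this sum, the condition makes the rank one term of `RB` no
  -- larger than the bound `d⁻¹` of the diagonal term.
  bound : D.kap * ∑' n, D.del n ^ 2 * ‖((D.lam n : ℂ) - z)⁻¹‖ ≤ ‖1 + Complex.I * D.kap * D.gam z‖

variable {D}

lemma norm_gam_le (z : ℂ) : ‖D.gam z‖ ≤ ∑' n, D.del n ^ 2 * ‖((D.lam n : ℂ) - z)⁻¹‖ := by
  refine tsum_of_norm_bounded (D.summable_del_sq z).hasSum fun n => le_of_eq ?_
  rw [g_apply, ← mul_assoc, norm_mul, ← sq, norm_pow, Complex.norm_real, Real.norm_eq_abs, sq_abs]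

lemma Good.ne {z : ℂ} {d : ℝ} (h : D.Good z d) (n : ℕ) : (D.lam n : ℂ) - z ≠ 0 :=
  norm_pos_iff.mp (h.pos.trans_le (h.dist n))

/-- A vanishing denominator would force `gam z = 0` through `bound`, but then the denominator equals
1. -/
lemma Good.den_ne {z : ℂ} {d : ℝ} (h : D.Good z d) : 1 + Complex.I * D.kap * D.gam z ≠ 0 := by
  intro h0
  have h1 := h.bound
  rw [h0, norm_zero] at h1
  have h2 := norm_gam_le (D := D) z
  have h3 := D.kap_pos
  have h4 : D.gam z = 0 := by
    rw [← norm_le_zero_iff]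
    nlinarith [norm_nonneg (D.gam z)]
  rw [h4] at h0
  simp at h0

lemma norm_g_sq_le {z : ℂ} {d : ℝ} (hd : 0 < d) (h : ∀ n, d ≤ ‖(D.lam n : ℂ) - z‖) :
    ‖D.g z‖ ^ 2 ≤ d⁻¹ * ∑' n, D.del n ^ 2 * ‖((D.lam n : ℂ) - z)⁻¹‖ := by
  rw [SeqL2.norm_sq_eq, ← tsum_mul_left]
  refine Summable.tsum_le_tsum (fun n => ?_) (SeqL2.summable_norm_sq _)
    ((D.summable_del_sq z).mul_left _)
  rw [g_apply, norm_mul, mul_pow, Complex.norm_real, Real.norm_eq_abs, sq_abs, sq ‖_‖,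
    mul_left_comm]
  gcongr
  rw [norm_inv]
  gcongr
  exact h n

lemma norm_sub_conj (z : ℂ) (n : ℕ) : ‖(D.lam n : ℂ) - conj z‖ = ‖(D.lam n : ℂ) - z‖ := by
  rw [← Complex.norm_conj]; simp

lemma norm_g_conj (z : ℂ) : ‖D.g (conj z)‖ = ‖D.g z‖ := by
  have : ‖D.g (conj z)‖ ^ 2 = ‖D.g z‖ ^ 2 := by
    rw [SeqL2.norm_sq_eq, SeqL2.norm_sq_eq]
    congr 1 with n
    rw [g_apply, g_apply, norm_mul, norm_mul, norm_inv, norm_inv, norm_sub_conj]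
  exact (sq_eq_sq₀ (norm_nonneg _) (norm_nonneg _)).mp this

lemma norm_ell (z : ℂ) : ‖D.ell z‖ = ‖D.g z‖ := by
  rw [ell, innerSL_apply_norm, norm_g_conj]

lemma Good.norm_RB_le {z : ℂ} {d : ℝ} (h : D.Good z d) : ‖D.RB z‖ ≤ 2 / d := by
  have h1 := D.norm_R0_le h.pos h.dist
  have h2 := norm_g_sq_le (D := D) h.pos h.dist
  have hp : 0 < ‖1 + Complex.I * D.kap * D.gam z‖ := norm_pos_iff.mpr h.den_ne
  have hk := D.kap_pos
  have hd := h.pos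
  have h3 : ‖(Complex.I * D.kap / (1 + Complex.I * D.kap * D.gam z)) •
    (D.ell z).smulRight (D.g z)‖ ≤ d⁻¹ := by
    rw [norm_smul, ContinuousLinearMap.norm_smulRight_apply, norm_ell, ← sq, norm_div, norm_mul,
      Complex.norm_I, one_mul, Complex.norm_of_nonneg hk.le, div_mul_eq_mul_div, div_le_iff₀ hp]
    calc D.kap * ‖D.g z‖ ^ 2 ≤ D.kap * (d⁻¹ * ∑' n, D.del n ^ 2 * ‖((D.lam n : ℂ) - z)⁻¹‖) := by
          gcongr
      _ = d⁻¹ * (D.kap * ∑' n, D.del n ^ 2 * ‖((D.lam n : ℂ) - z)⁻¹‖) := by ring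
      _ ≤ _ := by gcongr; exact h.bound
  calc ‖D.RB z‖ ≤ _ := norm_sub_le _ _
    _ ≤ d⁻¹ + d⁻¹ := add_le_add h1 h3
    _ = 2 / d := by ring

lemma Good.hasSum_RB {z : ℂ} {d : ℝ} (h : D.Good z d) (f : SeqL2) :
    HasSum (fun n => (D.del n : ℂ) * D.RB z f n)
      (D.ell z f / (1 + Complex.I * D.kap * D.gam z)) := by
  have h1 := (D.hasSum_ell z f).sub ((D.hasSum_gam z).mul_left
    (Complex.I * D.kap / (1 + Complex.I * D.kap * D.gam z) * D.ell z f))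
  have hne := h.den_ne
  refine h1.of_eq (fun n => ?_) ?_
  · rw [RB_apply]
    simp only [lp.coeFn_sub, Pi.sub_apply, lp.coeFn_smul, Pi.smul_apply, smul_eq_mul, R0_apply]
    ring
  · field_simp
    ring

lemma Good.RB_eq_iff {z : ℂ} {d : ℝ} (h : D.Good z d) (φ f : SeqL2) :
    D.RB z f = φ ↔ ∃ c : ℂ, HasSum (fun n => (D.del n : ℂ) * φ n) c ∧
      ∀ n, ((D.lam n : ℂ) - z) * φ n + Complex.I * D.kap * D.del n * c = f n := by
  have hne := h.den_ne
  constructor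
  · rintro rfl
    refine ⟨_, h.hasSum_RB f, fun n => ?_⟩
    have := h.ne n
    rw [RB_apply]
    simp only [lp.coeFn_sub, Pi.sub_apply, lp.coeFn_smul, Pi.smul_apply, smul_eq_mul, R0_apply,
      g_apply]
    field_simp
    ring
  · rintro ⟨c, hc, hf⟩
    have h1 : ∀ n, φ n = ((D.lam n : ℂ) - z)⁻¹ * f n - Complex.I * D.kap * c * D.g z n := by
      intro n
      have := h.ne n
      rw [← hf n, g_apply]
      field_simp
      ring
    have h2 : c = D.ell z f - Complex.I * D.kap * c * D.gam z := by
      refine hc.unique ?_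
      refine ((D.hasSum_ell z f).sub ((D.hasSum_gam z).mul_left
        (Complex.I * D.kap * c))).of_eq (fun n => ?_) rfl
      rw [h1 n]; ring
    have h3 : D.ell z f = c * (1 + Complex.I * D.kap * D.gam z) := by
      linear_combination -h2
    ext n
    rw [RB_apply]
    simp only [lp.coeFn_sub, Pi.sub_apply, lp.coeFn_smul, Pi.smul_apply, smul_eq_mul, R0_apply]
    rw [h1 n, h3]
    field_simp

/-- `T φ = f` in terms of the resolvent of the unperturbed operator. -/
lemma Good.rel_iff {z : ℂ} {d : ℝ} (h : D.Good z d) (φ f : SeqL2) :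
    D.Rel φ f ↔ D.RB z (f - D.W φ - z • φ) = φ := by
  rw [h.RB_eq_iff, Rel]
  refine exists_congr fun c => and_congr_right fun _ => forall_congr' fun n => ?_
  simp only [lp.coeFn_sub, Pi.sub_apply, lp.coeFn_smul, Pi.smul_apply, smul_eq_mul]
  constructor <;> intro h <;> linear_combination h

end ModalData

/-! ### Resolvent bounds on the negative axis and on large circles -/

namespace ModalData
variable (D : ModalData)

lemma le_norm_one_add_I_mul (a : ℝ) : a ≤ ‖(1 : ℂ) + Complex.I * a‖ := by
  have := Complex.abs_im_le_norm (1 + Complex.I * a)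
  simp at this
  exact (le_abs_self a).trans this

lemma norm_lam_add (n : ℕ) {τ : ℝ} (hτ : 0 ≤ τ) : ‖(D.lam n : ℂ) - ((-τ : ℝ) : ℂ)‖ = D.lam n + τ := by
  rw [← Complex.ofReal_sub, Complex.norm_of_nonneg] <;> linarith [D.lam_pos n]

lemma gam_neg {τ : ℝ} (hτ : 0 ≤ τ) :
    D.gam ((-τ : ℝ) : ℂ) = ((∑' n, D.del n ^ 2 * ‖((D.lam n : ℂ) - ((-τ : ℝ) : ℂ))⁻¹‖ : ℝ) : ℂ) := by
  rw [gam, Complex.ofReal_tsum]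
  congr 1 with n
  rw [g_apply, norm_inv, norm_lam_add D n hτ]
  push_cast
  ring

/-- On the negative axis `gam` is real and equal to the sum in `bound`. It enters with the factor `i
κ`, so it cannot cancel the 1 and the modulus is at least `κ gam`. This needs no smallness of κ. -/
lemma good_neg {τ : ℝ} (hτ : 0 ≤ τ) : D.Good ((-τ : ℝ) : ℂ) (1 + τ) where
  pos := by linarith
  dist n := by rw [norm_lam_add D n hτ]; linarith [D.one_le_lam n]
  bound := by
    rw [gam_neg D hτ, mul_assoc, ← Complex.ofReal_mul]
    exact le_norm_one_add_I_mul _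

/-- The circle is centred at 1 and passes between the diagonal entries of index `k` and `k + 1`. The
reverse triangle inequality gives `ρ² |n² - (k + 1/2)²|` whatever the angle. -/
lemma lower_bound_circle {z : ℂ} {k : ℕ} (hz : ‖z - 1‖ = D.rho ^ 2 * (k + 1 / 2) ^ 2) (n : ℕ) :
    D.rho ^ 2 * (|(n : ℝ) - k - 1 / 2| * (n + k + 1 / 2)) ≤ ‖(D.lam n : ℂ) - z‖ := by
  have h1 : ((D.lam n : ℂ) - z) = ((D.rho ^ 2 * n ^ 2 : ℝ) : ℂ) - (z - 1) := by
    unfold lam; push_cast; ring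
  have h2 : |(n : ℝ) - k - 1 / 2| * (n + k + 1 / 2) = |(n : ℝ) ^ 2 - (k + 1 / 2) ^ 2| := by
    rw [← abs_of_nonneg (by positivity : (0 : ℝ) ≤ n + k + 1 / 2), ← abs_mul]
    congr 1
    ring
  rw [h1, h2, ← abs_of_nonneg (by positivity : 0 ≤ D.rho ^ 2), ← abs_mul, mul_sub]
  rw [abs_of_nonneg (by positivity : 0 ≤ D.rho ^ 2), ← hz]
  have := abs_norm_sub_norm_le ((D.rho ^ 2 * n ^ 2 : ℝ) : ℂ) (z - 1)
  rwa [Complex.norm_of_nonneg (by positivity)] at this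

lemma half_le_abs_sub (n k : ℕ) : (1 : ℝ) / 2 ≤ |(n : ℝ) - k - 1 / 2| := by
  rcases le_or_gt n k with h | h
  · have : (n : ℝ) ≤ k := by exact_mod_cast h
    rw [abs_of_nonpos (by linarith)]; linarith
  · have : (k : ℝ) + 1 ≤ n := by exact_mod_cast h
    rw [abs_of_nonneg (by linarith)]; linarith

/-- The factor `n + k + 1/2` dominates the geometric mean of `|n - k - 1/2|` and `k + 1/2`. One half
power makes the sum over `n` converge uniformly in `k`, the other supplies decay in `k`. The rate is
not sharp; any decay suffices. -/
lemma tsum_circle_le {z : ℂ} {k : ℕ} (hz : ‖z - 1‖ = D.rho ^ 2 * (k + 1 / 2) ^ 2) :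
    ∑' n, D.del n ^ 2 * ‖((D.lam n : ℂ) - z)⁻¹‖ ≤ D.bd ^ 2 / D.rho ^ 2 *
      (∑' m : ℤ, 1 / |(m : ℝ) + (-1 / 2)| ^ (3 / 2 : ℝ)) * (k + 1 / 2 : ℝ) ^ (-(1 / 2) : ℝ) := by
  have hs : Summable fun m : ℤ => 1 / |(m : ℝ) + (-1 / 2)| ^ (3 / 2 : ℝ) :=
    Real.summable_one_div_int_add_rpow (-1 / 2) (3 / 2) |>.mpr (by norm_num)
  have hinj : Function.Injective fun n : ℕ => (n : ℤ) - k := fun a b h => by simpa using h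
  have h1 := tsum_comp_le_tsum_of_inj hs (fun m => by positivity) hinj
  have hr := D.rho_pos
  have hs' : Summable fun n : ℕ => 1 / |(((n : ℤ) - k : ℤ) : ℝ) + (-1 / 2)| ^ (3 / 2 : ℝ) :=
    hs.comp_injective hinj
  have hx : (0 : ℝ) < k + 1 / 2 := by positivity
  calc ∑' n, D.del n ^ 2 * ‖((D.lam n : ℂ) - z)⁻¹‖
      ≤ ∑' n : ℕ, (D.bd ^ 2 / D.rho ^ 2 * (k + 1 / 2 : ℝ) ^ (-(1 / 2) : ℝ)) *
        (1 / |(((n : ℤ) - k : ℤ) : ℝ) + (-1 / 2)| ^ (3 / 2 : ℝ)) := by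
        refine (D.summable_del_sq z).tsum_le_tsum (fun n => ?_) (hs'.mul_left _)
        have ha := half_le_abs_sub n k
        have hb := D.lower_bound_circle hz n
        set a := |(n : ℝ) - k - 1 / 2| with ha'
        have ha0 : 0 < a := by linarith
        have e1 : (((n : ℤ) - k : ℤ) : ℝ) + (-1 / 2) = (n : ℝ) - k - 1 / 2 := by push_cast; ring
        rw [e1, ← ha', norm_inv]
        have h3 : a ^ (1 / 2 : ℝ) * (k + 1 / 2 : ℝ) ^ (1 / 2 : ℝ) ≤ n + k + 1 / 2 := by
          have hbn : a ≤ n + k + 1 / 2 := by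
            rw [ha', abs_le]; constructor <;> linarith [Nat.cast_nonneg (α := ℝ) n, Nat.cast_nonneg (α := ℝ) k]
          have hbk : (k + 1 / 2 : ℝ) ≤ n + k + 1 / 2 := by linarith [Nat.cast_nonneg (α := ℝ) n]
          have hB : (0 : ℝ) < n + k + 1 / 2 := by positivity
          calc a ^ (1 / 2 : ℝ) * (k + 1 / 2 : ℝ) ^ (1 / 2 : ℝ)
              ≤ (n + k + 1 / 2 : ℝ) ^ (1 / 2 : ℝ) * (n + k + 1 / 2 : ℝ) ^ (1 / 2 : ℝ) := by
                gcongr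
            _ = n + k + 1 / 2 := by rw [← Real.rpow_add hB]; norm_num
        have h4 : a ^ (3 / 2 : ℝ) = a * a ^ (1 / 2 : ℝ) := by
          conv_rhs => rw [← Real.rpow_one_add' ha0.le (by norm_num)]
          norm_num
        have h5 : D.rho ^ 2 * (a ^ (3 / 2 : ℝ) * (k + 1 / 2 : ℝ) ^ (1 / 2 : ℝ))
            ≤ ‖(D.lam n : ℂ) - z‖ := by
          refine le_trans ?_ hb
          rw [h4, mul_assoc a]
          gcongr
        have h6 : D.del n ^ 2 ≤ D.bd ^ 2 := by
          rw [← sq_abs]; exact pow_le_pow_left₀ (abs_nonneg _) (D.abs_del_le n) 2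
        calc D.del n ^ 2 * ‖(D.lam n : ℂ) - z‖⁻¹ ≤ D.bd ^ 2 *
              (D.rho ^ 2 * (a ^ (3 / 2 : ℝ) * (k + 1 / 2 : ℝ) ^ (1 / 2 : ℝ)))⁻¹ := by gcongr
          _ = _ := by
            rw [Real.rpow_neg hx.le]
            field_simp
    _ = (D.bd ^ 2 / D.rho ^ 2 * (k + 1 / 2 : ℝ) ^ (-(1 / 2) : ℝ)) *
        ∑' n : ℕ, (1 / |(((n : ℤ) - k : ℤ) : ℝ) + (-1 / 2)| ^ (3 / 2 : ℝ)) := tsum_mul_left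
    _ ≤ (D.bd ^ 2 / D.rho ^ 2 * (k + 1 / 2 : ℝ) ^ (-(1 / 2) : ℝ)) *
        ∑' m : ℤ, 1 / |(m : ℝ) + (-1 / 2)| ^ (3 / 2 : ℝ) := mul_le_mul_of_nonneg_left h1 (by positivity)
    _ = _ := by ring

/-- Once `κ` times the sum is below `1/2`, the denominator `1 + i κ gam` has modulus at least `1/2`.
The distance to the diagonal grows linearly in `k`, which lets the circles absorb the bounded part
`W`. -/
lemma eventually_good_circle : ∀ᶠ k : ℕ in atTop, ∀ z : ℂ,
    ‖z - 1‖ = D.rho ^ 2 * (k + 1 / 2) ^ 2 → D.Good z (D.rho ^ 2 * ((k + 1 / 2) / 2)) := by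
  have hr := D.rho_pos
  have hk := D.kap_pos
  have h1 : Tendsto (fun k : ℕ => D.bd ^ 2 / D.rho ^ 2 *
      (∑' m : ℤ, 1 / |(m : ℝ) + (-1 / 2)| ^ (3 / 2 : ℝ)) * ((k : ℝ) + 1 / 2) ^ (-(1 / 2) : ℝ))
      atTop (𝓝 (D.bd ^ 2 / D.rho ^ 2 *
      (∑' m : ℤ, 1 / |(m : ℝ) + (-1 / 2)| ^ (3 / 2 : ℝ)) * 0)) :=
    ((tendsto_rpow_neg_atTop (by norm_num)).comp
      (tendsto_atTop_add_const_right _ _ tendsto_natCast_atTop_atTop)).const_mul _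
  rw [mul_zero] at h1
  filter_upwards [h1.eventually_le_const (show 0 < 1 / (2 * D.kap) by positivity)] with k hle z hz
  have hs := (D.tsum_circle_le hz).trans hle
  have hs2 : D.kap * ∑' n, D.del n ^ 2 * ‖((D.lam n : ℂ) - z)⁻¹‖ ≤ 1 / 2 := by
    calc _ ≤ D.kap * (1 / (2 * D.kap)) := by gcongr
      _ = 1 / 2 := by field_simp
  refine ⟨by positivity, fun n => le_trans ?_ (D.lower_bound_circle hz n), hs2.trans ?_⟩
  · have := half_le_abs_sub n k
    gcongr D.rho ^ 2 * ?_
    calc ((k : ℝ) + 1 / 2) / 2 = (1 / 2) * (k + 1 / 2) := by ring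
      _ ≤ |(n : ℝ) - k - 1 / 2| * (n + k + 1 / 2) := by
        gcongr
        linarith [Nat.cast_nonneg (α := ℝ) n]
  · have h3 : ‖Complex.I * D.kap * D.gam z‖ ≤ 1 / 2 := by
      rw [norm_mul, norm_mul, Complex.norm_I, one_mul, Complex.norm_of_nonneg hk.le]
      exact le_trans (by gcongr; exact norm_gam_le z) hs2
    have := norm_sub_le_norm_add (1 : ℂ) (Complex.I * D.kap * D.gam z)
    rw [norm_one] at this
    linarith

/-- `R` is the resolvent of `T` at `z`. -/
def IsResolvent (R : SeqL2 →L[ℂ] SeqL2) (z : ℂ) : Prop :=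
  ∀ φ f, D.Rel φ f ↔ R (f - z • φ) = φ

variable {D}

lemma IsResolvent.rel {R : SeqL2 →L[ℂ] SeqL2} {z : ℂ} (h : D.IsResolvent R z) (f : SeqL2) :
    D.Rel (R f) (f + z • R f) := (h _ _).mpr (by simp)

lemma IsResolvent.unique {R R' : SeqL2 →L[ℂ] SeqL2} {z : ℂ} (h : D.IsResolvent R z)
    (h' : D.IsResolvent R' z) : R = R' := by
  ext1 f
  have := (h' _ _).mp (h.rel f)
  rwa [add_sub_cancel_right, eq_comm] at this

/-- Neumann series: the assumption on `d` gives `‖W RB‖ ≤ 1/2`, and the resolvent is `RB (1 + W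
RB)⁻¹`. The factorisation with an invertible `V` transfers compactness and range properties from
`RB`. -/
lemma Good.exists_resolvent {z : ℂ} {d : ℝ} (h : D.Good z d) (hd : 4 * ‖D.W‖ ≤ d) :
    ∃ R : SeqL2 →L[ℂ] SeqL2, D.IsResolvent R z ∧ ‖R‖ ≤ 4 / d ∧
      ∃ V : (SeqL2 →L[ℂ] SeqL2)ˣ, R = D.RB z * V := by
  have hdp := h.pos
  have hW : ‖D.W * D.RB z‖ ≤ 1 / 2 := by
    calc ‖D.W * D.RB z‖ ≤ ‖D.W‖ * ‖D.RB z‖ := norm_mul_le _ _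
      _ ≤ (d / 4) * (2 / d) := by
        gcongr
        · linarith
        · exact h.norm_RB_le
      _ = 1 / 2 := by field_simp; norm_num
  have hlt : ‖-(D.W * D.RB z)‖ < 1 := by rw [norm_neg]; linarith
  set u := Units.oneSub _ hlt with hu
  have hu1 : ∀ y, (u : SeqL2 →L[ℂ] SeqL2) y = y + D.W (D.RB z y) := fun y => by
    rw [hu, Units.val_oneSub]; simp
  have hu2 : ∀ x, (u : SeqL2 →L[ℂ] SeqL2) ((↑u⁻¹ : SeqL2 →L[ℂ] SeqL2) x) = x := fun x => by
    rw [← mul_apply_eq_comp, u.mul_inv]; rfl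
  have hu3 : ∀ x, (↑u⁻¹ : SeqL2 →L[ℂ] SeqL2) ((u : SeqL2 →L[ℂ] SeqL2) x) = x := fun x => by
    rw [← mul_apply_eq_comp, u.inv_mul]; rfl
  refine ⟨D.RB z * ↑u⁻¹, ?_, ?_, u⁻¹, rfl⟩
  · intro φ f
    rw [h.rel_iff, mul_apply_eq_comp]
    constructor
    · intro hφ
      have h1 : (u : SeqL2 →L[ℂ] SeqL2) (f - D.W φ - z • φ) = f - z • φ := by
        rw [hu1, hφ]; abel
      rw [← h1, hu3, hφ]
    · intro hφ
      have h1 := hu2 (f - z • φ)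
      rw [hu1, hφ] at h1
      have h2 : f - D.W φ - z • φ = (↑u⁻¹ : SeqL2 →L[ℂ] SeqL2) (f - z • φ) := by
        rw [sub_right_comm]; exact (eq_sub_of_add_eq h1).symm
      rw [h2, hφ]
  · have hV : ‖(↑u⁻¹ : SeqL2 →L[ℂ] SeqL2)‖ ≤ 2 := by
      refine ContinuousLinearMap.opNorm_le_bound _ (by norm_num) fun x => ?_
      have h1 := hu2 x
      rw [hu1] at h1
      have h2 := norm_sub_le_norm_add ((↑u⁻¹ : SeqL2 →L[ℂ] SeqL2) x)
        (D.W (D.RB z ((↑u⁻¹ : SeqL2 →L[ℂ] SeqL2) x)))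
      rw [h1] at h2
      have h3 := (D.W * D.RB z).le_of_opNorm_le hW ((↑u⁻¹ : SeqL2 →L[ℂ] SeqL2) x)
      rw [mul_apply_eq_comp] at h3
      linarith
    calc _ ≤ _ := norm_mul_le _ _
      _ ≤ 2 / d * 2 := by gcongr; exact h.norm_RB_le
      _ = 4 / d := by ring

end ModalData

/-! ### Compactness -/

lemma isCompactOperator_smulRight {F G : Type*} [NormedAddCommGroup F] [NormedSpace ℂ F]
    [NormedAddCommGroup G] [NormedSpace ℂ G] (l : F →L[ℂ] ℂ) (x : G) :
    IsCompactOperator (l.smulRight x) := by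
  have h : IsCompactOperator l := (isCompactOperator_id (E := ℂ)).comp_clm l
  exact h.clm_comp (ContinuousLinearMap.toSpanSingleton ℂ x)

/-- Truncating the diagonal gives finite rank operators that converge in norm. -/
lemma SeqL2.isCompactOperator_diag (a : ℕ → ℂ) {C : ℝ} (h : ∀ n, ‖a n‖ ≤ C)
    (h0 : Tendsto a atTop (𝓝 0)) : IsCompactOperator (SeqL2.diag a h) := by
  have hC : 0 ≤ C := (norm_nonneg _).trans (h 0)
  have hb : ∀ N n, ‖(if n < N then a n else 0)‖ ≤ C := fun N n => by
    split_ifs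
    · exact h n
    · simpa using hC
  refine isCompactOperator_of_tendsto (l := atTop)
    (F := fun N => SeqL2.diag (fun n => if n < N then a n else 0) (hb N)) ?_ (.of_forall fun N => ?_)
  · rw [tendsto_iff_norm_sub_tendsto_zero, Metric.tendsto_atTop]
    intro ε hε
    obtain ⟨N, hN⟩ := Metric.tendsto_atTop.mp h0 (ε / 2) (by positivity)
    refine ⟨N, fun M hM => ?_⟩
    have e : SeqL2.diag (fun n => if n < M then a n else 0) (hb M) - SeqL2.diag a h =
        SeqL2.diag (fun n => if n < M then 0 else -a n) (C := C) (fun n => by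
          split_ifs
          · simpa using hC
          · simpa using h n) := by
      ext x n
      simp only [sub_apply, lp.coeFn_sub, Pi.sub_apply, SeqL2.diag_apply]
      split_ifs <;> ring
    rw [e, dist_zero_right, norm_norm]
    refine lt_of_le_of_lt (SeqL2.norm_diag_le _ _ (C' := ε / 2) fun n => ?_) (by linarith)
    split_ifs with hn
    · simp; positivity
    · rw [norm_neg]
      have := hN n (by omega)
      rw [dist_zero_right] at this
      exact this.le
  · have e : SeqL2.diag (fun n => if n < N then a n else 0) (hb N) =
        ∑ n ∈ Finset.range N, (lp.evalCLM ℂ (fun _ : ℕ => ℂ) 2 n).smulRight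
          (lp.single 2 n (a n) : SeqL2) := by
      ext x m
      simp only [sum_apply, lp.coeFn_sum, Finset.sum_apply, SeqL2.diag_apply,
        ContinuousLinearMap.smulRight_apply, lp.coeFn_smul, Pi.smul_apply, smul_eq_mul,
        lp.single_apply]
      split_ifs with hm
      · rw [Finset.sum_eq_single m]
        · rw [Pi.single_eq_same]; exact mul_comm _ _
        · intro b _ hb
          simp [hb.symm]
        · simp [hm]
      · rw [zero_mul, eq_comm]
        refine Finset.sum_eq_zero fun b hb => ?_
        have : m ≠ b := fun h => hm (h ▸ Finset.mem_range.mp hb)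
        simp [this]
    rw [e]
    exact (compactOperator (RingHom.id ℂ) SeqL2 SeqL2).sum_mem fun n _ =>
      isCompactOperator_smulRight _ _

namespace ModalData
variable (D : ModalData)

lemma isCompactOperator_R0 (z : ℂ) : IsCompactOperator (D.R0 z) :=
  SeqL2.isCompactOperator_diag _ _ (tendsto_zero_iff_norm_tendsto_zero.mpr
    (D.summable_inv z).tendsto_atTop_zero)

lemma isCompactOperator_RB (z : ℂ) : IsCompactOperator (D.RB z) :=
  (D.isCompactOperator_R0 z).sub ((isCompactOperator_smulRight _ _).smul _)

lemma adjoint_R0 (z : ℂ) : ContinuousLinearMap.adjoint (D.R0 z) = D.R0 (conj z) := by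
  symm
  rw [ContinuousLinearMap.eq_adjoint_iff]
  intro x y
  refine (SeqL2.hasSum_inner (D.R0 (conj z) x) y).unique
    ((SeqL2.hasSum_inner x (D.R0 z y)).of_eq (fun n => ?_) rfl)
  simp only [R0_apply, map_mul, map_inv₀, map_sub, Complex.conj_ofReal, Complex.conj_conj]
  ring

/-- The adjoint is again a diagonal resolvent plus a rank one operator. -/
lemma isCompactOperator_adjoint_RB (z : ℂ) :
    IsCompactOperator (ContinuousLinearMap.adjoint (D.RB z)) := by
  have : D.RB z = D.R0 z - (Complex.I * D.kap / (1 + Complex.I * D.kap * D.gam z)) •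
    InnerProductSpace.rankOne ℂ (D.g z) (D.g (conj z)) := rfl
  rw [this, map_sub, map_smulₛₗ, adjoint_R0, InnerProductSpace.adjoint_rankOne]
  exact (D.isCompactOperator_R0 _).sub
    ((isCompactOperator_smulRight (innerSL ℂ (D.g z)) (D.g (conj z))).smul _)

/-- The shift at which the resolvent is used as a compact model operator. -/
def tau : ℝ := 4 * ‖D.W‖

lemma tau_nonneg : 0 ≤ D.tau := by unfold tau; positivity

/-- At `-τ` the distance `1 + τ` to the diagonal exceeds `4 ‖W‖`, so the Neumann series converges.
-/
lemma exists_K : ∃ R : SeqL2 →L[ℂ] SeqL2, D.IsResolvent R ((-D.tau : ℝ) : ℂ) ∧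
    ∃ V : (SeqL2 →L[ℂ] SeqL2)ˣ, R = D.RB ((-D.tau : ℝ) : ℂ) * V := by
  obtain ⟨R, h1, -, h3⟩ := (D.good_neg D.tau_nonneg).exists_resolvent
    (by unfold tau; linarith)
  exact ⟨R, h1, h3⟩

/-- The compact resolvent of `T` at `- tau`. -/
def K : SeqL2 →L[ℂ] SeqL2 := D.exists_K.choose

lemma isResolvent_K : D.IsResolvent D.K ((-D.tau : ℝ) : ℂ) := D.exists_K.choose_spec.1

lemma K_eq : ∃ V : (SeqL2 →L[ℂ] SeqL2)ˣ, D.K = D.RB ((-D.tau : ℝ) : ℂ) * V :=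
  D.exists_K.choose_spec.2

lemma isCompactOperator_K : IsCompactOperator D.K := by
  obtain ⟨V, hV⟩ := D.K_eq
  rw [hV]
  exact (D.isCompactOperator_RB _).comp_clm _

lemma isCompactOperator_adjoint_K : IsCompactOperator (ContinuousLinearMap.adjoint D.K) := by
  obtain ⟨V, hV⟩ := D.K_eq
  rw [hV]
  change IsCompactOperator (ContinuousLinearMap.adjoint (D.RB _ ∘L (V : SeqL2 →L[ℂ] SeqL2)))
  rw [ContinuousLinearMap.adjoint_comp]
  exact (D.isCompactOperator_adjoint_RB _).clm_comp
    (ContinuousLinearMap.adjoint (V : SeqL2 →L[ℂ] SeqL2))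

variable {D}

/-! ### The relation `T φ = f` -/

lemma Rel.unique {φ f f' : SeqL2} (h : D.Rel φ f) (h' : D.Rel φ f') : f = f' := by
  obtain ⟨c, hc, h⟩ := h
  obtain ⟨c', hc', h'⟩ := h'
  obtain rfl := hc.unique hc'
  ext n
  rw [← h n, ← h' n]

lemma Rel.add {φ f φ' f' : SeqL2} (h : D.Rel φ f) (h' : D.Rel φ' f') :
    D.Rel (φ + φ') (f + f') := by
  obtain ⟨c, hc, h⟩ := h
  obtain ⟨c', hc', h'⟩ := h'
  refine ⟨c + c', (hc.add hc').of_eq (fun n => ?_) rfl, fun n => ?_⟩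
  · simp [mul_add]
  · simp only [lp.coeFn_add, Pi.add_apply, map_add]
    rw [← h n, ← h' n]; ring

lemma Rel.smul {φ f : SeqL2} (a : ℂ) (h : D.Rel φ f) : D.Rel (a • φ) (a • f) := by
  obtain ⟨c, hc, h⟩ := h
  refine ⟨a * c, (hc.mul_left a).of_eq (fun n => ?_) rfl, fun n => ?_⟩
  · simp only [lp.coeFn_smul, Pi.smul_apply, smul_eq_mul]; ring
  · simp only [lp.coeFn_smul, Pi.smul_apply, smul_eq_mul, map_smul]
    rw [← h n]; ring

lemma Rel.sub {φ f φ' f' : SeqL2} (h : D.Rel φ f) (h' : D.Rel φ' f') :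
    D.Rel (φ - φ') (f - f') := by
  have := h.add (h'.smul (-1))
  simpa [sub_eq_add_neg] using this

lemma unique {z : ℂ} {φ : SeqL2} (h : HasSum (fun n => (D.del n : ℂ) * φ n) 0)
    (h' : D.Rel φ (z • φ)) : φ = 0 := by
  obtain ⟨c, hc, h'⟩ := h'
  obtain rfl := hc.unique h
  refine D.unique' z φ h fun n => ?_
  have := h' n
  simpa [lam] using this

/-- Eigenvalues lie in the open upper half plane. -/
lemma Rel.im_pos {z : ℂ} {φ : SeqL2} (h : D.Rel φ (z • φ)) (h0 : φ ≠ 0) : 0 < z.im := by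
  have h' := h
  obtain ⟨c, hc, h⟩ := h
  have hc0 : c ≠ 0 := by
    rintro rfl
    exact h0 (ModalData.unique hc h')
  have hcc : HasSum (fun n => conj (φ n) * (D.del n : ℂ)) (conj c) := by
    refine (hc.map (starRingEnd ℂ) Complex.continuous_conj).of_eq (fun n => ?_) rfl
    simp [mul_comm]
  -- Pairing the eigenvalue equation with φ: each summand equals `λₙ |φₙ|²` and is real. Taking
  -- imaginary parts of the total leaves `Im z ‖φ‖² = κ |c|²`, because `W` is symmetric.
  have h1 : HasSum (fun n => conj (φ n) * ((z • φ - D.W φ : SeqL2) n -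
      Complex.I * D.kap * D.del n * c)) (inner ℂ φ (z • φ - D.W φ) - conj c * (Complex.I * D.kap * c)) := by
    refine ((SeqL2.hasSum_inner φ (z • φ - D.W φ)).sub
      (hcc.mul_right (Complex.I * D.kap * c))).of_eq (fun n => ?_) rfl
    ring
  have h2 : HasSum (fun _ : ℕ => (0 : ℝ)) (inner ℂ φ (z • φ - D.W φ) -
      conj c * (Complex.I * D.kap * c)).im := by
    refine (Complex.hasSum_im h1).of_eq (fun n => ?_) rfl
    have : (z • φ - D.W φ : SeqL2) n - Complex.I * D.kap * D.del n * c = D.lam n * φ n := by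
      rw [lp.coeFn_sub, Pi.sub_apply, ← h n]; ring
    rw [this, ← mul_assoc, mul_comm (conj (φ n)), mul_assoc, ← Complex.normSq_eq_conj_mul_self,
      ← Complex.ofReal_mul, Complex.ofReal_im]
  have h3 := h2.unique hasSum_zero
  have h4 : (inner ℂ φ (D.W φ) : ℂ).im = 0 := by
    rw [← Complex.conj_eq_iff_im, inner_conj_symm, D.W_symm]
  rw [inner_sub_right, inner_smul_right, inner_self_eq_norm_sq_to_K] at h3
  have e1 : conj c * (Complex.I * D.kap * c) = Complex.I * ((D.kap * Complex.normSq c : ℝ) : ℂ) := by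
    rw [Complex.ofReal_mul, Complex.normSq_eq_conj_mul_self]; ring
  rw [e1] at h3
  have e2 : ((‖φ‖ : ℝ) : ℂ) ^ 2 = ((‖φ‖ ^ 2 : ℝ) : ℂ) := by push_cast; rfl
  simp only [Complex.sub_im, h4, Complex.coe_algebraMap, e2, Complex.im_mul_ofReal, Complex.I_im]
    at h3
  have h5 := mul_pos D.kap_pos (Complex.normSq_pos.mpr hc0)
  have h6 : 0 < ‖φ‖ ^ 2 := by positivity
  nlinarith

/-- The eigenspaces are one dimensional. -/
lemma Rel.exists_smul {z : ℂ} {φ ψ : SeqL2} (h : D.Rel φ (z • φ)) (h' : D.Rel ψ (z • ψ))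
    (h0 : φ ≠ 0) : ∃ a : ℂ, ψ = a • φ := by
  obtain ⟨c, hc, h1⟩ := id h
  obtain ⟨c', hc', h2⟩ := id h'
  have hc0 : c ≠ 0 := by
    rintro rfl
    exact h0 (ModalData.unique hc h)
  -- With this factor the difference has boundary value zero, so uniqueness applies.
  refine ⟨c' / c, ?_⟩
  rw [← sub_eq_zero]
  refine ModalData.unique (D := D) (z := z) ((hc'.sub (hc.mul_left (c' / c))).of_eq (fun n => ?_) ?_) ?_
  · simp only [lp.coeFn_sub, Pi.sub_apply, lp.coeFn_smul, Pi.smul_apply, smul_eq_mul]; ring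
  · field_simp; ring
  · have := h'.sub (h.smul (c' / c))
    rwa [smul_comm (c' / c) z, ← smul_sub] at this

/-- Formally `T - z = (T + τ)(1 - w K)`, with `K` inverting `T + τ`. -/
lemma IsResolvent.isResolvent_of_isUnit {z : ℂ} {w : ℂ} (hw : w = z + D.tau)
    (hu : IsUnit (1 - w • D.K)) : D.IsResolvent (Ring.inverse (1 - w • D.K) * D.K) z := by
  obtain ⟨u, hu⟩ := hu
  intro φ f
  rw [D.isResolvent_K, ← hu, Ring.inverse_unit, mul_apply_eq_comp]
  have hu1 : ∀ y, (u : SeqL2 →L[ℂ] SeqL2) y = y - w • D.K y := fun y => by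
    rw [hu]; simp
  have hu2 : ∀ x, (u : SeqL2 →L[ℂ] SeqL2) ((↑u⁻¹ : SeqL2 →L[ℂ] SeqL2) x) = x := fun x => by
    rw [← mul_apply_eq_comp, u.mul_inv]; rfl
  have hu3 : ∀ x, (↑u⁻¹ : SeqL2 →L[ℂ] SeqL2) ((u : SeqL2 →L[ℂ] SeqL2) x) = x := fun x => by
    rw [← mul_apply_eq_comp, u.inv_mul]; rfl
  have e : f - ((-D.tau : ℝ) : ℂ) • φ = (f - z • φ) + w • φ := by
    rw [hw, add_smul, Complex.ofReal_neg, neg_smul]; abel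
  rw [e, map_add, map_smul]
  constructor
  · intro h
    have : (u : SeqL2 →L[ℂ] SeqL2) φ = D.K (f - z • φ) := by
      rw [hu1]; exact (eq_sub_of_add_eq h).symm
    rw [← this, hu3]
  · intro h
    have := hu2 (D.K (f - z • φ))
    rw [h, hu1] at this
    rw [← this, sub_add_cancel]

/-- Fredholm alternative for the compact `K`: an eigenvalue `(z + τ)⁻¹` of `K` is an eigenvalue `z`
of `T`. -/
lemma isUnit_of_forall {z : ℂ} (h : ∀ φ, D.Rel φ (z • φ) → φ = 0) :
    IsUnit (1 - (z + D.tau) • D.K) := by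
  set w := z + D.tau with hw
  rcases eq_or_ne w 0 with h0 | h0
  · simp [h0]
  rcases D.isCompactOperator_K.hasEigenvalue_or_mem_resolventSet (inv_ne_zero h0) with h1 | h1
  · obtain ⟨v, hv⟩ := h1.exists_hasEigenvector
    refine absurd (h v ?_) hv.2
    rw [D.isResolvent_K]
    have e : z • v - ((-D.tau : ℝ) : ℂ) • v = w • v := by
      rw [hw, add_smul, Complex.ofReal_neg, neg_smul]; abel
    have := hv.apply_eq_smul
    rw [e, map_smul]
    change w • D.K v = v
    rw [show D.K v = w⁻¹ • v from this, smul_inv_smul₀ h0]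
  · rw [spectrum.mem_resolventSet_iff] at h1
    have h2 := h1.smul (Units.mk0 w h0)
    convert h2 using 1
    rw [Units.smul_mk0, smul_sub, Algebra.algebraMap_eq_smul_one, smul_inv_smul₀ h0]

end ModalData

/-- A compact operator has no strictly increasing sequence of closed invariant subspaces on whose
successive quotients it acts by scalars bounded away from zero. -/
lemma IsCompactOperator.false_of_strictMono {X : Type*} [NormedAddCommGroup X] [NormedSpace ℂ X]
    {T : X →L[ℂ] X} (hT : IsCompactOperator T) {V : ℕ → Submodule ℂ X} (hV : StrictMono V)
    (hcl : ∀ n, IsClosed (V n : Set X)) (hinv : ∀ n, ∀ x ∈ V n, T x ∈ V n) {μ : ℕ → ℂ} {ε : ℝ}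
    (hε : 0 < ε) (hμ : ∀ n, ε ≤ ‖μ n‖) (hsub : ∀ n, ∀ x ∈ V (n + 1), T x - μ n • x ∈ V n) :
    False := by
  -- Riesz's lemma; 3 is any bound exceeding the norm of the scalar 2. Modulo `V n` the operator
  -- acts on `x n` as `μ n`, hence the images of these bounded vectors stay `ε` apart, against
  -- compactness.
  have hx (n : ℕ) : ∃ x ∈ V (n + 1), ‖x‖ ≤ 3 ∧ ∀ y ∈ V n, 1 ≤ ‖x - y‖ := by
    have h₁ : IsClosed ((V n).comap (V (n + 1)).subtype : Set (V (n + 1))) :=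
      (hcl n).preimage continuous_subtype_val
    have h₂ : ∃ x : V (n + 1), x ∉ (V n).comap (V (n + 1)).subtype := by
      obtain ⟨x, hx, hx'⟩ := SetLike.exists_of_lt (hV n.lt_succ_self)
      exact ⟨⟨x, hx⟩, hx'⟩
    obtain ⟨⟨x, hx⟩, hxn, hxy⟩ := riesz_lemma_of_norm_lt (c := (2 : ℂ)) (by simp)
      (R := 3) (by norm_num) h₁ h₂
    exact ⟨x, hx, hxn, fun y hy => hxy ⟨y, hV.monotone n.le_succ hy⟩ hy⟩
  choose x hxV hxn hxy using hx
  have hfar : ∀ m n, m < n → ε ≤ ‖T (x n) - T (x m)‖ := by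
    intro m n hmn
    have hne : μ n ≠ 0 := norm_pos_iff.mp (hε.trans_le (hμ n))
    have hmem : T (x m) - (T (x n) - μ n • x n) ∈ V n := by
      refine (V n).sub_mem ?_ (hsub n _ (hxV n))
      exact hV.monotone (Nat.succ_le_of_lt hmn) (hinv _ _ (hxV m))
    have h1 := hxy n _ ((V n).smul_mem (μ n)⁻¹ hmem)
    have h2 : T (x n) - T (x m) = μ n • (x n - (μ n)⁻¹ • (T (x m) - (T (x n) - μ n • x n))) := by
      rw [smul_sub, smul_inv_smul₀ hne]; abel
    rw [h2, norm_smul]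
    calc ε = ε * 1 := (mul_one _).symm
      _ ≤ _ := mul_le_mul (hμ n) h1 zero_le_one (norm_nonneg _)
  obtain ⟨C, hC, hC'⟩ := hT.image_closedBall_subset_compact 3
  obtain ⟨y, -, ψ, hψ, hψy⟩ := hC.tendsto_subseq
    (fun n => hC' ⟨x n, by simpa using hxn n, rfl⟩)
  have := hψy.cauchySeq
  rw [Metric.cauchySeq_iff'] at this
  obtain ⟨N, hN⟩ := this ε hε
  have h3 := hN (N + 1) (Nat.le_succ N)
  rw [dist_eq_norm] at h3
  exact absurd h3 (not_lt.mpr (hfar _ _ (hψ N.lt_succ_self)))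

/-! ### Root spaces, Jordan chains and discreteness of the spectrum -/

namespace ModalData
variable (D : ModalData)

/-- The kernel of `(T - z) ^ m`. -/
def rootN (z : ℂ) (m : ℕ) : Submodule ℂ SeqL2 :=
  ((1 - (z + D.tau) • D.K) ^ m : SeqL2 →L[ℂ] SeqL2).ker

variable {D}

lemma rel_iff_K {φ f : SeqL2} : D.Rel φ f ↔ D.K (f + (D.tau : ℂ) • φ) = φ := by
  rw [D.isResolvent_K, Complex.ofReal_neg, neg_smul, sub_neg_eq_add]

lemma rel_K (f : SeqL2) : D.Rel (D.K f) (f - (D.tau : ℂ) • D.K f) := by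
  rw [rel_iff_K, sub_add_cancel]

@[simp] lemma rootN_zero (z : ℂ) : D.rootN z 0 = ⊥ := by
  ext x; simp [rootN]

lemma mem_rootN_succ {z : ℂ} {m : ℕ} {φ : SeqL2} :
    φ ∈ D.rootN z (m + 1) ↔ φ - (z + D.tau) • D.K φ ∈ D.rootN z m := by
  rw [rootN, rootN, LinearMap.mem_ker, LinearMap.mem_ker, pow_succ]
  rfl

lemma isClosed_rootN (z : ℂ) (m : ℕ) : IsClosed (D.rootN z m : Set SeqL2) :=
  ContinuousLinearMap.isClosed_ker _

lemma K_mem_rootN {z : ℂ} {m : ℕ} {φ : SeqL2} (h : φ ∈ D.rootN z m) : D.K φ ∈ D.rootN z m := by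
  induction m generalizing φ with
  | zero => simp_all
  | succ m ih =>
    rw [mem_rootN_succ] at h ⊢
    have := ih h
    rwa [map_sub, map_smul] at this

lemma rootN_mono (z : ℂ) : Monotone (D.rootN z) := by
  refine monotone_nat_of_le_succ fun m φ h => ?_
  rw [mem_rootN_succ]
  exact (D.rootN z m).sub_mem h ((D.rootN z m).smul_mem _ (K_mem_rootN h))

/-- This identifies kernels of powers of the bounded operator `1 - w K`, `w = z + τ`, with kernels
of powers of `T - z`. The point is that `y = φ - w K φ` must be the image under `K` of an element of
the same root space. By induction `y - w K y = K ψ`, so `y = K (w y + ψ)`. -/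
lemma mem_rootN_succ_iff {z : ℂ} {m : ℕ} {φ : SeqL2} :
    φ ∈ D.rootN z (m + 1) ↔ ∃ ψ ∈ D.rootN z m, D.Rel φ (z • φ + ψ) := by
  constructor
  · intro h
    have key : ∃ ψ ∈ D.rootN z m, D.K ψ = φ - (z + D.tau) • D.K φ := by
      induction m generalizing φ with
      | zero =>
        rw [mem_rootN_succ] at h
        rw [rootN_zero, Submodule.mem_bot] at h
        exact ⟨0, by simp, by rw [map_zero, h]⟩
      | succ m ih =>
        rw [mem_rootN_succ] at h
        obtain ⟨ψ, hψ, e⟩ := ih h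
        set y := φ - (z + D.tau) • D.K φ with hy
        refine ⟨(z + D.tau) • y + ψ, Submodule.add_mem _ (Submodule.smul_mem _ _ h)
          (rootN_mono z m.le_succ hψ), ?_⟩
        rw [map_add, map_smul, e]
        abel
    obtain ⟨ψ, hψ, e⟩ := key
    refine ⟨ψ, hψ, ?_⟩
    rw [rel_iff_K]
    have : z • φ + ψ + (D.tau : ℂ) • φ = (z + D.tau) • φ + ψ := by rw [add_smul]; abel
    rw [this, map_add, map_smul, e]
    abel
  · rintro ⟨ψ, hψ, h⟩
    rw [rel_iff_K] at h
    have : z • φ + ψ + (D.tau : ℂ) • φ = (z + D.tau) • φ + ψ := by rw [add_smul]; abel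
    rw [this, map_add, map_smul] at h
    rw [mem_rootN_succ, (eq_sub_of_add_eq' h).symm]
    exact K_mem_rootN hψ

lemma mem_rootN_iff_chain {z : ℂ} {m : ℕ} {φ : SeqL2} :
    φ ∈ D.rootN z m ↔ ∃ x : ℕ → SeqL2, x 0 = 0 ∧ x m = φ ∧
      ∀ i < m, D.Rel (x (i + 1)) (z • x (i + 1) + x i) := by
  constructor
  · intro h
    induction m generalizing φ with
    | zero =>
      rw [rootN_zero, Submodule.mem_bot] at h
      exact ⟨0, rfl, h.symm, fun i hi => by omega⟩
    | succ m ih =>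
      obtain ⟨ψ, hψ, hr⟩ := mem_rootN_succ_iff.mp h
      obtain ⟨x, h0, hm, hx⟩ := ih hψ
      refine ⟨fun i => if i = m + 1 then φ else x i, by simp [h0], by simp, fun i hi => ?_⟩
      rcases Nat.lt_succ_iff_lt_or_eq.mp hi with h1 | rfl
      · have := hx i h1
        dsimp only
        rw [if_neg (by omega), if_neg (by omega)]
        exact this
      · simpa [hm] using hr
  · rintro ⟨x, h0, rfl, hx⟩
    have : ∀ i ≤ m, x i ∈ D.rootN z i := by
      intro i
      induction i with
      | zero => simp [h0]
      | succ i ih =>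
        intro hi
        exact mem_rootN_succ_iff.mpr ⟨x i, ih (by omega), hx i (by omega)⟩
    exact this m le_rfl

lemma rootN_stable {z : ℂ} {m : ℕ} (h : D.rootN z (m + 1) = D.rootN z m) (k : ℕ) :
    D.rootN z k ≤ D.rootN z m := by
  have : ∀ j, D.rootN z (m + j) ≤ D.rootN z m := by
    intro j
    induction j with
    | zero => rfl
    | succ j ih =>
      intro φ hφ
      rw [← add_assoc, mem_rootN_succ] at hφ
      rw [← h, mem_rootN_succ]
      exact ih hφ
  exact (rootN_mono z (Nat.le_add_left k m)).trans (this k)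

/-- On `rootN z (n + 1)` modulo `rootN z n` the operator `K` acts as the scalar `(z + τ)⁻¹`, so a
strictly increasing sequence would contradict compactness. -/
lemma exists_rootN_stable (z : ℂ) : ∃ m, D.rootN z (m + 1) = D.rootN z m := by
  by_contra! hne
  rcases eq_or_ne (z + D.tau) 0 with hw | hw
  · refine hne 0 ?_
    ext φ
    rw [mem_rootN_succ, hw, zero_smul, sub_zero]
  · refine D.isCompactOperator_K.false_of_strictMono
      (strictMono_nat_of_lt_succ fun n => lt_of_le_of_ne (rootN_mono z n.le_succ) (hne n).symm)
      (isClosed_rootN z) (fun n x hx => K_mem_rootN hx) (μ := fun _ => (z + D.tau)⁻¹)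
      (norm_pos_iff.mpr (inv_ne_zero hw)) (fun _ => le_rfl) (fun n x hx => ?_)
    rw [mem_rootN_succ] at hx
    have := (D.rootN z n).smul_mem (-(z + D.tau)⁻¹) hx
    rwa [neg_smul, smul_sub, inv_smul_smul₀ hw, neg_sub] at this

/-- One dimensional eigenspaces leave room for a single chain. It descends from a vector of the last
root space outside the previous one. The bottom of any other chain is a multiple `b` of `y 1`;
subtracting `b` times this chain leaves a chain that starts with zero, which lies one level lower.
-/
lemma exists_jordan_basis {z : ℂ} (hz : ∃ φ, D.Rel φ (z • φ) ∧ φ ≠ 0) :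
    ∃ (J : ℕ) (y : ℕ → SeqL2), 1 ≤ J ∧ y 0 = 0 ∧
      (∀ i < J, D.Rel (y (i + 1)) (z • y (i + 1) + y i)) ∧ LinearIndepOn ℂ y (Icc 1 J) ∧
      Submodule.span ℂ (y '' Icc 1 J) = D.rootN z J ∧ ∀ k, D.rootN z k ≤ D.rootN z J := by
  classical
  set J := Nat.find (D.exists_rootN_stable z) with hJ
  have hst := Nat.find_spec (D.exists_rootN_stable z)
  obtain ⟨φ, hφ, hφ0⟩ := hz
  have hφ1 : φ ∈ D.rootN z 1 :=
    mem_rootN_succ_iff.mpr ⟨0, by simp, by simpa using hφ⟩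
  have hJ1 : 1 ≤ J := by
    rw [Nat.one_le_iff_ne_zero]
    intro h0
    rw [← hJ, h0, zero_add, rootN_zero] at hst
    rw [hst] at hφ1
    exact hφ0 (by simpa using hφ1)
  have hlt : D.rootN z (J - 1) < D.rootN z J := by
    refine lt_of_le_of_ne (rootN_mono z (Nat.sub_le _ _)) fun h => ?_
    refine Nat.find_min (D.exists_rootN_stable z) (m := J - 1) (by omega) ?_
    rw [Nat.sub_add_cancel hJ1, h]
  obtain ⟨v, hv, hv'⟩ := SetLike.exists_of_lt hlt
  obtain ⟨y, y0, yJ, hy⟩ := mem_rootN_iff_chain.mp hv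
  -- a chain that starts with zero can be shortened
  have hshift : ∀ (m : ℕ) (x : ℕ → SeqL2), x 1 = 0 →
      (∀ i < m + 1, D.Rel (x (i + 1)) (z • x (i + 1) + x i)) → x (m + 1) ∈ D.rootN z m :=
    fun m x h1 hx => mem_rootN_iff_chain.mpr
      ⟨fun i => x (i + 1), h1, rfl, fun i hi => hx (i + 1) (by omega)⟩
  have hy1 : y 1 ≠ 0 := by
    intro h1
    refine hv' ?_
    rw [← yJ, ← Nat.sub_add_cancel hJ1]
    exact hshift (J - 1) y h1 (by rwa [Nat.sub_add_cancel hJ1])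
  have hy1r : D.Rel (y 1) (z • y 1) := by
    have := hy 0 (by omega)
    simpa [y0] using this
  have hspan : ∀ m ≤ J, Submodule.span ℂ (y '' Icc 1 m) = D.rootN z m := by
    intro m
    induction m with
    | zero => simp
    | succ m ih =>
      intro hm
      have hI : Icc 1 (m + 1) = insert (m + 1) (Icc 1 m) := by
        ext i; simp only [mem_Icc, mem_insert_iff]; omega
      rw [hI, image_insert_eq, Submodule.span_insert, ih (by omega)]
      apply le_antisymm
      · refine sup_le ?_ (rootN_mono z m.le_succ)
        rw [Submodule.span_singleton_le_iff_mem]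
        exact mem_rootN_iff_chain.mpr ⟨y, y0, rfl, fun i hi => hy i (by omega)⟩
      · intro φ hφ
        obtain ⟨x, x0, hxm, hx⟩ := mem_rootN_iff_chain.mp hφ
        have hx1r : D.Rel (x 1) (z • x 1) := by
          have := hx 0 (by omega)
          simpa [x0] using this
        obtain ⟨b, hb⟩ := hy1r.exists_smul hx1r hy1
        have h2 := hshift m (fun i => x i - b • y i) (by simp [hb]) (fun i hi => by
          have := (hx i hi).sub ((hy i (by omega)).smul b)
          convert this using 1
          rw [smul_sub, smul_add, smul_comm b z]; abel)
        rw [Submodule.mem_sup]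
        refine ⟨b • y (m + 1), Submodule.smul_mem _ _ (Submodule.mem_span_singleton_self _), _, h2, ?_⟩
        rw [← hxm]; abel
  have hnot : ∀ m < J, y (m + 1) ∉ D.rootN z m := by
    intro m
    induction m with
    | zero =>
      intro _ h
      exact hy1 (by simpa using h)
    | succ m ih =>
      intro hm h
      obtain ⟨ψ, hψ, hr⟩ := mem_rootN_succ_iff.mp h
      have := hr.unique (hy (m + 1) hm)
      rw [add_right_inj] at this
      exact ih (by omega) (this ▸ hψ)
  have hli : ∀ m ≤ J, LinearIndepOn ℂ y (Icc 1 m) := by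
    intro m
    induction m with
    | zero => intro _; simp
    | succ m ih =>
      intro hm
      have hI : Icc 1 (m + 1) = insert (m + 1) (Icc 1 m) := by
        ext i; simp only [mem_Icc, mem_insert_iff]; omega
      rw [hI]
      refine (ih (by omega)).insert ?_
      rw [hspan m (by omega)]
      exact hnot m (by omega)
  exact ⟨J, y, hJ1, y0, hy, hli J le_rfl, hspan J le_rfl, rootN_stable hst⟩

variable (D) in
/-- The eigenvalues of `T`. -/
def eigs : Set ℂ := {z | ∃ φ, D.Rel φ (z • φ) ∧ φ ≠ 0}

/-- Infinitely many eigenvectors would span an increasing sequence of invariant subspaces on whose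
quotients `K` acts by scalars of modulus at least `1 / r`. -/
lemma eigs_inter_finite (r : ℝ) : {z ∈ D.eigs | ‖z + D.tau‖ ≤ r}.Finite := by
  by_contra hinf
  have hinf : {z ∈ D.eigs | ‖z + D.tau‖ ≤ r}.Infinite := hinf
  set s := hinf.natEmbedding with hs
  have hinj : Function.Injective fun n => ((s n : ℂ)) := Subtype.val_injective.comp s.injective
  have hv : ∀ n, ∃ φ, D.Rel φ ((s n : ℂ) • φ) ∧ φ ≠ 0 := fun n => (s n).2.1
  choose v hv hv0 using hv
  have hK : ∀ n, ((s n : ℂ) + D.tau) • D.K (v n) = v n := fun n => by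
    have := rel_iff_K.mp (hv n)
    rwa [← add_smul, map_smul] at this
  have hne : ∀ n, (s n : ℂ) + D.tau ≠ 0 := fun n h => by
    have := hK n
    rw [h, zero_smul] at this
    exact hv0 n this.symm
  have hK' : ∀ n, D.K (v n) = ((s n : ℂ) + D.tau)⁻¹ • v n := fun n => by
    conv_rhs => rw [← hK n]
    rw [inv_smul_smul₀ (hne n)]
  have hli : LinearIndependent ℂ v := by
    refine Module.End.eigenvectors_linearIndependent' (D.K : SeqL2 →ₗ[ℂ] SeqL2)
      (fun n => ((s n : ℂ) + D.tau)⁻¹) (fun a b h => hinj ?_) v (fun n => ?_)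
    · simpa using h
    · exact ⟨Module.End.mem_eigenspace_iff.mpr (hK' n), hv0 n⟩
  set V : ℕ → Submodule ℂ SeqL2 := fun n => Submodule.span ℂ (v '' Iio n) with hV
  have hfin : ∀ n, FiniteDimensional ℂ (V n) := fun n =>
    FiniteDimensional.span_of_finite ℂ ((finite_Iio n).image v)
  have hr : 0 < r := by
    have := (s 0).2.2
    exact (norm_pos_iff.mpr (hne 0)).trans_le this
  refine D.isCompactOperator_K.false_of_strictMono (V := V)
    (strictMono_nat_of_lt_succ fun n => ?_) (fun n => (V n).closed_of_finiteDimensional)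
    (fun n x hx => ?_) (μ := fun n => ((s n : ℂ) + D.tau)⁻¹) (ε := r⁻¹) (by positivity)
    (fun n => ?_) (fun n x hx => ?_)
  · refine lt_of_le_of_ne (Submodule.span_mono (image_mono (Iio_subset_Iio n.le_succ))) fun h => ?_
    have h1 : v n ∈ V n := h ▸ Submodule.subset_span ⟨n, n.lt_succ_self, rfl⟩
    exact hli.notMem_span_image (s := Iio n) (by simp) h1
  · induction hx using Submodule.span_induction with
    | mem x hx =>
      obtain ⟨k, hk, rfl⟩ := hx
      rw [hK']
      exact (V n).smul_mem _ (Submodule.subset_span ⟨k, hk, rfl⟩)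
    | zero => simp
    | add x y _ _ hx hy => rw [map_add]; exact (V n).add_mem hx hy
    | smul a x _ hx => rw [map_smul]; exact (V n).smul_mem a hx
  · rw [norm_inv]
    exact inv_anti₀ (norm_pos_iff.mpr (hne n)) (s n).2.2
  · induction hx using Submodule.span_induction with
    | mem x hx =>
      obtain ⟨k, hk, rfl⟩ := hx
      rw [hK', ← sub_smul]
      rcases Nat.lt_succ_iff_lt_or_eq.mp hk with h | rfl
      · exact (V n).smul_mem _ (Submodule.subset_span ⟨k, h, rfl⟩)
      · simp
    | zero => simp
    | add x y _ _ hx hy =>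
      rw [map_add, smul_add, add_sub_add_comm]; exact (V n).add_mem hx hy
    | smul a x _ hx =>
      rw [map_smul, smul_comm, ← smul_sub]; exact (V n).smul_mem a hx

lemma eigs_countable : D.eigs.Countable := by
  have : D.eigs = ⋃ n : ℕ, {z ∈ D.eigs | ‖z + D.tau‖ ≤ n} := by
    ext z
    simp only [mem_iUnion, mem_ofPred_eq]
    constructor
    · intro hz
      obtain ⟨n, hn⟩ := exists_nat_ge ‖z + D.tau‖
      exact ⟨n, hz, hn⟩
    · rintro ⟨_, hz, _⟩
      exact hz
  rw [this]
  exact countable_iUnion fun n => (eigs_inter_finite n).countable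

end ModalData

/-! ### Completeness of the root vectors -/

lemma denseRange_of_forall_inner {F : Type*} [NormedAddCommGroup F] [InnerProductSpace ℂ F]
    [CompleteSpace F] (A : F →L[ℂ] F) (h : ∀ v, (∀ f, inner ℂ v (A f) = 0) → v = 0) :
    DenseRange A := by
  have : Dense ((A : F →ₗ[ℂ] F).range : Set F) := by
    rw [Submodule.dense_iff_topologicalClosure_eq_top, Submodule.topologicalClosure_eq_top_iff,
      Submodule.eq_bot_iff]
    intro v hv
    refine h v fun f => ?_
    rw [Submodule.mem_orthogonal'] at hv
    exact hv _ ⟨f, rfl⟩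
  rwa [LinearMap.coe_range] at this

/-- For a compact operator `K` and a closed subspace `Y` with `K x - μ x ∈ Y → x ∈ Y`, every vector
is the sum of an element of `Y` and one of the range of `K - μ`. -/
lemma IsCompactOperator.exists_add_mem {F : Type*} [NormedAddCommGroup F] [InnerProductSpace ℂ F]
    [CompleteSpace F] {K : F →L[ℂ] F} (hK : IsCompactOperator K) {Y : Submodule ℂ F}
    (hY : IsClosed (Y : Set F)) {μ : ℂ} (hμ : μ ≠ 0) (h : ∀ x, K x - μ • x ∈ Y → x ∈ Y) (x : F) :
    ∃ x', x - (μ • x' - K x') ∈ Y := by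
  have : CompleteSpace Y := hY.completeSpace_coe
  have hYY : Yᗮᗮ = Y := Submodule.orthogonal_orthogonal Y
  set Q := Yᗮ.orthogonalProjectionOnto with hQ
  -- Compression of `K` to the orthogonal complement of `Y`. An eigenvector for `μ` would have `K v
  -- - μ v` in `Y`, hence would itself lie in `Y`; so `C - μ` is onto by the Fredholm alternative.
  set C : Yᗮ →L[ℂ] Yᗮ := Q ∘L K ∘L Yᗮ.subtypeL with hC
  have hCc : IsCompactOperator C := (hK.comp_clm Yᗮ.subtypeL).clm_comp Q
  have hQv : ∀ v : Yᗮ, Q (v : F) = v := fun v =>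
    Submodule.orthogonalProjectionOnto_mem_subspace_eq_self v
  rcases hCc.hasEigenvalue_or_mem_resolventSet hμ with h1 | h1
  · obtain ⟨v, hv⟩ := h1.exists_hasEigenvector
    have h2 : C v = μ • v := hv.apply_eq_smul
    have h3 : Q (K v - μ • (v : F)) = 0 := by
      rw [map_sub, map_smul, hQv]
      exact sub_eq_zero.mpr h2
    rw [hQ, Submodule.orthogonalProjectionOnto_eq_zero_iff, hYY] at h3
    have h4 := h _ h3
    refine absurd ?_ hv.2
    have := Y.inner_right_of_mem_orthogonal h4 v.2
    rw [inner_self_eq_zero] at this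
    exact Subtype.ext this
  · rw [spectrum.mem_resolventSet_iff, ContinuousLinearMap.isUnit_iff_bijective] at h1
    obtain ⟨x', hx'⟩ := h1.2 (Q x)
    refine ⟨x', ?_⟩
    have h2 : Q (x - (μ • (x' : F) - K x')) = 0 := by
      rw [map_sub, map_sub, map_smul, hQv, ← hx', sub_eq_zero]
      simp [hC, Algebra.algebraMap_eq_smul_one]
    rwa [hQ, Submodule.orthogonalProjectionOnto_eq_zero_iff, hYY] at h2

/-- An operator whose resolvent is everywhere defined and tends to zero on a sequence of circles
vanishes. -/
lemma eq_zero_of_resolvent_bound {F : Type*} [NormedAddCommGroup F] [NormedSpace ℂ F]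
    [CompleteSpace F] (A : F →L[ℂ] F) (hunit : ∀ w : ℂ, IsUnit (1 - w • A)) (c : ℂ) {r C : ℕ → ℝ}
    (hr : Tendsto r atTop atTop) (hC : Tendsto C atTop (𝓝 0)) (hC0 : ∀ k, 0 ≤ C k)
    (h : ∀ᶠ k in atTop, ∀ w : ℂ, ‖w - c‖ = r k → ∀ x y : F, y - w • A y = A x → ‖y‖ ≤ C k * ‖x‖) :
    A = 0 := by
  have hGd : Differentiable ℂ fun w : ℂ => Ring.inverse (1 - w • A) * A := by
    refine (Differentiable.inverse ?_ hunit).mul_const A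
    fun_prop
  -- The entire function `(1 - w A)⁻¹ A` takes the value `A` at `w = 0`. The maximum principle
  -- bounds it by its supremum over the circle as soon as the disc contains 0.
  have hbound : ∀ᶠ k : ℕ in atTop, ‖A‖ ≤ C k := by
    filter_upwards [h, hr.eventually_ge_atTop ‖c‖, hr.eventually_gt_atTop 0] with k hk hk2 hp
    have h0 : A = Ring.inverse (1 - (0 : ℂ) • A) * A := by rw [zero_smul, sub_zero, Ring.inverse_one, one_mul]
    rw [h0]
    refine Complex.norm_le_of_forall_mem_frontier_norm_le (U := Metric.ball c (r k)) (z := (0 : ℂ))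
      (f := fun w : ℂ => Ring.inverse (1 - w • A) * A)
      Metric.isBounded_ball hGd.diffContOnCl (fun w hw => ?_) ?_
    · rw [frontier_ball _ hp.ne', mem_sphere_iff_norm] at hw
      refine ContinuousLinearMap.opNorm_le_bound _ (hC0 k) fun x => hk w hw x _ ?_
      have : (1 - w • A) * (Ring.inverse (1 - w • A) * A) = A := by
        rw [← mul_assoc, Ring.mul_inverse_cancel _ (hunit w), one_mul]
      conv_rhs => rw [← this]
      rfl
    · rw [closure_ball _ hp.ne', mem_closedBall_iff_norm, zero_sub, norm_neg]
      exact hk2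
  rw [← norm_le_zero_iff]
  exact ge_of_tendsto hC hbound

lemma IsCompactOperator.isUnit_one_sub {F : Type*} [NormedAddCommGroup F] [NormedSpace ℂ F]
    [CompleteSpace F] {A : F →L[ℂ] F} (hA : IsCompactOperator A) {w : ℂ}
    (h : ∀ v, w • A v = v → v = 0) : IsUnit (1 - w • A) := by
  rcases eq_or_ne w 0 with h0 | h0
  · rw [h0, zero_smul, sub_zero]; exact isUnit_one
  rcases hA.hasEigenvalue_or_mem_resolventSet (inv_ne_zero h0) with h1 | h1
  · obtain ⟨v, hv⟩ := h1.exists_hasEigenvector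
    have h2 : A v = w⁻¹ • v := hv.apply_eq_smul
    exact absurd (h v (by rw [h2, smul_inv_smul₀ h0])) hv.2
  · rw [spectrum.mem_resolventSet_iff] at h1
    have h2 := h1.smul (Units.mk0 w h0)
    convert h2 using 1
    rw [Units.smul_mk0, smul_sub, Algebra.algebraMap_eq_smul_one, smul_inv_smul₀ h0]

namespace ModalData
variable (D : ModalData)

/-- The span of all root vectors. -/
def roots : Submodule ℂ SeqL2 := ⨆ z : ℂ, ⨆ m : ℕ, D.rootN z m

variable {D}

lemma rootN_le_roots (z : ℂ) (m : ℕ) : D.rootN z m ≤ D.roots :=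
  le_iSup_of_le z (le_iSup_of_le m le_rfl)

lemma K_mem_roots {x : SeqL2} (hx : x ∈ D.roots) : D.K x ∈ D.roots := by
  have : D.roots ≤ D.roots.comap (D.K : SeqL2 →ₗ[ℂ] SeqL2) :=
    iSup_le fun z => iSup_le fun m x hx => rootN_le_roots z m (K_mem_rootN hx)
  exact this hx

lemma adjoint_K_mem {x : SeqL2} (hx : x ∈ D.rootsᗮ) :
    ContinuousLinearMap.adjoint D.K x ∈ D.rootsᗮ := by
  rw [Submodule.mem_orthogonal] at hx ⊢
  intro u hu
  rw [ContinuousLinearMap.adjoint_inner_right]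
  exact hx _ (K_mem_roots hu)

/-- Such a `v` is orthogonal to the range of `μ - K`, `μ` the conjugate of `ν`, and to the
stabilised root space of the corresponding `z`. By `IsCompactOperator.exists_add_mem` the two
together give the whole space, so `v` is orthogonal to itself. -/
lemma eq_zero_of_adjoint_K_eigenvector {v : SeqL2} (hv : v ∈ D.rootsᗮ) {ν : ℂ} (hν : ν ≠ 0)
    (h : ContinuousLinearMap.adjoint D.K v = ν • v) : v = 0 := by
  set μ := conj ν with hμ
  have hμ0 : μ ≠ 0 := by simpa [hμ] using hν
  set z := μ⁻¹ - D.tau with hz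
  have hw : z + D.tau = μ⁻¹ := by simp [hz]
  obtain ⟨J, hJ⟩ := D.exists_rootN_stable z
  have hst : ∀ x, D.K x - μ • x ∈ D.rootN z J → x ∈ D.rootN z J := by
    intro x hx
    rw [← hJ, mem_rootN_succ, hw]
    have := (D.rootN z J).smul_mem (-μ⁻¹) hx
    rwa [neg_smul, smul_sub, inv_smul_smul₀ hμ0, neg_sub] at this
  obtain ⟨x', hx'⟩ := D.isCompactOperator_K.exists_add_mem (isClosed_rootN z J) hμ0 hst v
  rw [Submodule.mem_orthogonal'] at hv
  have h1 := hv _ (rootN_le_roots z J hx')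
  have h2 : inner ℂ v (μ • x' - D.K x') = 0 := by
    rw [inner_sub_right, inner_smul_right, ← ContinuousLinearMap.adjoint_inner_left, h,
      inner_smul_left, hμ, sub_self]
  rw [inner_sub_right, h2, sub_zero, inner_self_eq_zero] at h1
  exact h1

/-- The values of the resolvent on large circles. -/
lemma exists_resolvent_circle : ∀ᶠ k : ℕ in atTop, ∀ w : ℂ,
    ‖w - ((D.tau + 1 : ℝ) : ℂ)‖ = D.rho ^ 2 * (k + 1 / 2) ^ 2 →
    ∃ R : SeqL2 →L[ℂ] SeqL2, (∀ h, R h - w • R (D.K h) = D.K h) ∧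
      (∀ h, R h - w • D.K (R h) = D.K h) ∧ ‖R‖ ≤ 4 / (D.rho ^ 2 * ((k + 1 / 2) / 2)) := by
  have hr := D.rho_pos
  have h1 : Tendsto (fun k : ℕ => D.rho ^ 2 * (((k : ℝ) + 1 / 2) / 2)) atTop atTop :=
    ((tendsto_atTop_add_const_right _ _ tendsto_natCast_atTop_atTop).atTop_div_const
      two_pos).const_mul_atTop (by positivity)
  filter_upwards [D.eventually_good_circle, h1.eventually_ge_atTop (4 * ‖D.W‖)] with k hk hk2 w hw
  -- With `w = z + τ`, a circle around `τ + 1` for `w` is one around 1 for `z`. The two identities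
  -- obtained below say that `R` is `(1 - w K)⁻¹ K` from either side.
  have hg := hk (w - D.tau) (by rw [← hw]; congr 1; push_cast; ring)
  obtain ⟨R, hR, hRn, -⟩ := hg.exists_resolvent hk2
  refine ⟨R, fun h => ?_, fun h => ?_, hRn⟩
  · have := (hR _ _).mp (rel_K (D := D) h)
    rw [sub_smul, sub_sub, add_sub_cancel, map_sub, map_smul] at this
    exact this
  · have := rel_iff_K.mp (hR.rel h)
    rw [sub_smul, add_assoc, sub_add_cancel, map_add, map_smul] at this
    exact (eq_sub_of_add_eq this).symm

/-- The restriction `A` of the adjoint of `K` to the orthogonal complement is compact without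
nonzero eigenvalues, so `1 - w A` is invertible for every `w`. Its resolvent tends to zero on the
large circles, which forces `A = 0`. Dense range of `K` makes its adjoint injective, and the
complement is trivial. -/
lemma roots_orthogonal (hK : DenseRange D.K) : D.rootsᗮ = ⊥ := by
  set N := D.rootsᗮ with hN
  set Ka := ContinuousLinearMap.adjoint D.K with hKa
  set A : N →L[ℂ] N := (Ka ∘L N.subtypeL).codRestrict N (fun x => adjoint_K_mem x.2) with hA
  have hAv : ∀ x : N, ((A x : N) : SeqL2) = Ka x := fun x => rfl
  have hNc : IsClosed (N : Set SeqL2) := Submodule.isClosed_orthogonal _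
  have hAc : IsCompactOperator A :=
    (D.isCompactOperator_adjoint_K.comp_clm N.subtypeL).codRestrict _ hNc
  have hr := D.rho_pos
  have h1 : Tendsto (fun k : ℕ => (k : ℝ) + 1 / 2) atTop atTop :=
    tendsto_atTop_add_const_right _ _ tendsto_natCast_atTop_atTop
  have hC : Tendsto (fun k : ℕ => 4 / (D.rho ^ 2 * (((k : ℝ) + 1 / 2) / 2))) atTop (𝓝 0) :=
    tendsto_const_nhds.div_atTop ((h1.atTop_div_const two_pos).const_mul_atTop
      (by positivity : 0 < D.rho ^ 2))
  have hA0 : A = 0 := by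
    refine eq_zero_of_resolvent_bound A (fun w => hAc.isUnit_one_sub fun v hv => ?_)
      ((D.tau + 1 : ℝ) : ℂ)
      (((tendsto_pow_atTop two_ne_zero).comp h1).const_mul_atTop (by positivity : 0 < D.rho ^ 2))
      hC (fun k => by positivity) ?_
    · have hv' : w • Ka v = v := by
        have := congrArg (fun v : N => (v : SeqL2)) hv
        simpa [hAv] using this
      by_cases hw : w = 0
      · rw [← hv, hw, zero_smul]
      refine Subtype.ext (eq_zero_of_adjoint_K_eigenvector v.2 (inv_ne_zero hw) ?_)
      rw [eq_inv_smul_iff₀ hw]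
      exact hv'
    · filter_upwards [D.exists_resolvent_circle] with k hk w hw x y hxy
      -- The resolvent of the adjoint at `w` is the adjoint of the resolvent at the conjugate of
      -- `w`; the circles have real centre and are preserved.
      obtain ⟨R, hR1, hR2, hRn⟩ := hk (conj w) (by
        have := hw
        dsimp only [Function.comp_apply] at this
        rw [← Complex.norm_conj, ← this]; simp)
      have hy2 : (y : SeqL2) - w • Ka y = Ka x := by
        have := congrArg (fun v : N => (v : SeqL2)) hxy
        simpa [hAv] using this
      set Ra := ContinuousLinearMap.adjoint R with hRa
      have e1 : ∀ v, Ra v - w • Ka (Ra v) = Ka v := fun v => ext_inner_right ℂ fun u => by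
        have := congrArg (inner ℂ v) (hR1 u)
        simpa [inner_sub_left, inner_sub_right, inner_smul_left, inner_smul_right, hRa, hKa,
          ContinuousLinearMap.adjoint_inner_left] using this
      have e2 : ∀ v, Ra v - w • Ra (Ka v) = Ka v := fun v => ext_inner_right ℂ fun u => by
        have := congrArg (inner ℂ v) (hR2 u)
        simpa [inner_sub_left, inner_sub_right, inner_smul_left, inner_smul_right, hRa, hKa,
          ContinuousLinearMap.adjoint_inner_left] using this
      -- The difference `u` satisfies `u = w Ka u`, so `Ka u = Ra (u - w Ka u) = 0` and `u`
      -- vanishes.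
      have hyR : (y : SeqL2) = Ra x := by
        rw [← sub_eq_zero]
        set u := (y : SeqL2) - Ra x with hu
        have h3 : u = w • Ka u := by
          rw [← sub_eq_zero, hu, map_sub, smul_sub, sub_sub_sub_comm, hy2, e1, sub_self]
        have h4 : Ka u = 0 := by
          rw [← e2 u]
          nth_rw 1 [h3]
          rw [map_smul, sub_self]
        rw [h3, h4, smul_zero]
      change ‖(y : SeqL2)‖ ≤ _ * ‖(x : SeqL2)‖
      rw [hyR]
      refine (Ra.le_opNorm _).trans ?_
      rw [hRa, LinearIsometryEquiv.norm_map]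
      exact mul_le_mul_of_nonneg_right hRn (norm_nonneg _)
  rw [Submodule.eq_bot_iff]
  intro v hv
  have hv0 : Ka v = 0 := by
    have := hAv ⟨v, hv⟩
    rw [hA0] at this
    exact this.symm
  have h2 : ∀ u, inner ℂ v u = 0 := fun u => by
    refine hK.induction_on (p := fun u => inner ℂ v u = 0) u (isClosed_eq (by fun_prop) continuous_const) fun f => ?_
    rw [← ContinuousLinearMap.adjoint_inner_left, ← hKa, hv0, inner_zero_left]
  exact inner_self_eq_zero.mp (h2 v)

/-! ### Density of the root vectors in the domains of the square and fourth roots -/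

variable (D) in
/-- The square roots of the diagonal entries. -/
def sq (n : ℕ) : ℝ := √(D.lam n)

lemma one_le_sq (n : ℕ) : 1 ≤ D.sq n := Real.one_le_sqrt.mpr (D.one_le_lam n)

lemma sq_pos (n : ℕ) : 0 < D.sq n := one_pos.trans_le (one_le_sq n)

lemma sq_mul_sq (n : ℕ) : D.sq n * D.sq n = D.lam n := Real.mul_self_sqrt (D.lam_pos n).le

variable (D) in
/-- The fourth roots of the diagonal entries. -/
def qr (n : ℕ) : ℝ := √(D.sq n)

lemma one_le_qr (n : ℕ) : 1 ≤ D.qr n := Real.one_le_sqrt.mpr (one_le_sq n)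

lemma qr_pos (n : ℕ) : 0 < D.qr n := one_pos.trans_le (one_le_qr n)

lemma qr_mul_qr (n : ℕ) : D.qr n * D.qr n = D.sq n := Real.mul_self_sqrt (sq_pos n).le

lemma norm_inv_ofReal_le_one {a : ℝ} (h : 1 ≤ a) : ‖((a : ℂ))⁻¹‖ ≤ 1 := by
  rw [norm_inv, Complex.norm_of_nonneg (by linarith)]
  exact inv_le_one_of_one_le₀ h

variable (D) in
/-- The inverse square root of the diagonal part. -/
def sInv : SeqL2 →L[ℂ] SeqL2 :=
  diag (fun n => (D.sq n : ℂ)⁻¹) fun n => norm_inv_ofReal_le_one (one_le_sq n)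

variable (D) in
/-- The inverse fourth root of the diagonal part. -/
def qInv : SeqL2 →L[ℂ] SeqL2 :=
  diag (fun n => (D.qr n : ℂ)⁻¹) fun n => norm_inv_ofReal_le_one (one_le_qr n)

@[simp] lemma sInv_apply (x : SeqL2) (n : ℕ) : D.sInv x n = (D.sq n : ℂ)⁻¹ * x n := rfl

@[simp] lemma qInv_apply (x : SeqL2) (n : ℕ) : D.qInv x n = (D.qr n : ℂ)⁻¹ * x n := rfl

lemma qInv_qInv (x : SeqL2) : D.qInv (D.qInv x) = D.sInv x := by
  ext n
  rw [qInv_apply, qInv_apply, sInv_apply, ← mul_assoc, ← mul_inv, ← Complex.ofReal_mul, qr_mul_qr]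

lemma denseRange_diag {a : ℕ → ℂ} {C : ℝ} (h : ∀ n, ‖a n‖ ≤ C) (h0 : ∀ n, a n ≠ 0) :
    DenseRange (diag a h) := by
  refine denseRange_of_forall_inner _ fun v hv => ?_
  ext n
  have h1 := hv (lp.single 2 n 1)
  have h2 := (SeqL2.hasSum_inner v (diag a h (lp.single 2 n 1)))
  rw [h1] at h2
  have h3 := h2.unique (hasSum_single n fun m hm => by simp [hm])
  simpa [h0 n] using h3.symm

lemma denseRange_sInv : DenseRange D.sInv :=
  denseRange_diag _ fun n => inv_ne_zero (by exact_mod_cast (sq_pos n).ne')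

lemma denseRange_qInv : DenseRange D.qInv :=
  denseRange_diag _ fun n => inv_ne_zero (by exact_mod_cast (qr_pos n).ne')

/-- The resolvent of `T` maps onto a dense subspace of the form domain. -/
lemma exists_sqrt_K : ∃ L : SeqL2 →L[ℂ] SeqL2, DenseRange L ∧ ∀ f, D.sInv (L f) = D.K f := by
  obtain ⟨V, hV⟩ := D.K_eq
  set z : ℂ := ((-D.tau : ℝ) : ℂ) with hz
  have hg : D.Good z (1 + D.tau) := D.good_neg D.tau_nonneg
  have hτ := D.tau_nonneg
  have hlam : ∀ n, (D.lam n : ℂ) - z = ((D.lam n + D.tau : ℝ) : ℂ) := fun n => by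
    rw [hz]; push_cast; ring
  have hsqn : ∀ n, (D.sq n : ℂ) * D.sq n = D.lam n := fun n => by
    rw [← Complex.ofReal_mul, sq_mul_sq]
  have hsq0 : ∀ n, (D.sq n : ℂ) ≠ 0 := fun n => by exact_mod_cast (sq_pos n).ne'
  have hle : ∀ n, D.lam n * (D.lam n + D.tau)⁻¹ ≤ 1 := fun n => by
    have := D.lam_pos n
    rw [← div_eq_mul_inv, div_le_one (by linarith)]; linarith
  have hb : ∀ n, ‖(D.sq n : ℂ) * ((D.lam n : ℂ) - z)⁻¹‖ ≤ 1 := fun n => by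
    have := D.lam_pos n
    rw [hlam, ← Complex.ofReal_inv, ← Complex.ofReal_mul, Complex.norm_of_nonneg (by
      have := sq_pos (D := D) n; positivity)]
    refine le_trans ?_ (hle n)
    gcongr
    rw [← sq_mul_sq]
    exact le_mul_of_one_le_left (sq_pos n).le (one_le_sq n)
  -- `Λ^{1/2} g` is square summable since `λₙ δₙ² / (λₙ + τ)² ≤ δₙ² / (λₙ + τ)`. Thus `L0 = Λ^{1/2}
  -- RB` is a bounded operator.
  have hgm : Memℓp (fun n => (D.sq n : ℂ) * D.g z n) 2 := by
    refine memℓp_iff.mpr (Summable.of_nonneg_of_le (fun _ => by positivity) (fun n => ?_)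
      (D.summable_del_sq z))
    have := D.lam_pos n
    rw [g_apply, hlam, norm_mul, norm_mul, norm_inv, Complex.norm_real, Complex.norm_real,
      Complex.norm_of_nonneg (by positivity : 0 ≤ D.lam n + D.tau), Real.norm_eq_abs,
      Real.norm_eq_abs, mul_pow, mul_pow, sq_abs, sq_abs, pow_two (D.sq n), sq_mul_sq]
    calc D.lam n * (D.del n ^ 2 * (D.lam n + D.tau)⁻¹ ^ 2)
        = (D.lam n * (D.lam n + D.tau)⁻¹) * (D.del n ^ 2 * (D.lam n + D.tau)⁻¹) := by ring
      _ ≤ 1 * (D.del n ^ 2 * (D.lam n + D.tau)⁻¹) := by gcongr; exact hle n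
      _ = _ := one_mul _
  set Lg : SeqL2 := ⟨_, hgm⟩ with hLg
  set a := Complex.I * D.kap / (1 + Complex.I * D.kap * D.gam z) with ha
  set L0 : SeqL2 →L[ℂ] SeqL2 := diag _ hb - a • (D.ell z).smulRight Lg with hL0
  have hL0n : ∀ f n, L0 f n = D.sq n * D.RB z f n := fun f n => by
    rw [RB_apply]
    simp only [hL0, hLg, sub_apply, smul_apply, ContinuousLinearMap.smulRight_apply,
      lp.coeFn_sub, Pi.sub_apply, lp.coeFn_smul, Pi.smul_apply, smul_eq_mul, diag_apply, R0_apply]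
    ring
  -- A vector `v` orthogonal to the range satisfies `conj (vₙ) √λₙ = a δₙ c` with `c = ⟨v, Λ^{1/2}
  -- g⟩`. Pairing with `g` gives `c = a γ c`, and `a γ = i κ γ / (1 + i κ γ)` is never 1, so `c` and
  -- then `v` vanish.
  have hL0d : DenseRange L0 := by
    refine denseRange_of_forall_inner _ fun v hv => ?_
    set c := inner ℂ v Lg with hc
    have key : ∀ n, conj (v n) * D.sq n = a * D.del n * c := fun n => by
      have h1 := hv (lp.single 2 n 1)
      have hs : D.ell z (lp.single 2 n 1) = D.del n * ((D.lam n : ℂ) - z)⁻¹ := by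
        have h2 := (D.hasSum_ell z (lp.single 2 n 1)).unique
          (hasSum_single n fun m hm => by simp [hm])
        simpa using h2
      have hd : inner ℂ v (diag _ hb (lp.single 2 n 1)) =
          conj (v n) * (D.sq n * ((D.lam n : ℂ) - z)⁻¹) := by
        have h2 := (SeqL2.hasSum_inner v (diag _ hb (lp.single 2 n 1))).unique
          (hasSum_single n fun m hm => by simp [hm])
        simpa using h2
      rw [hL0, sub_apply, smul_apply, ContinuousLinearMap.smulRight_apply, inner_sub_right,
        inner_smul_right, inner_smul_right, hd, hs, ← hc] at h1
      have := hg.ne n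
      field_simp at h1
      linear_combination h1
    have hcc : c = a * D.gam z * c := by
      refine (SeqL2.hasSum_inner v Lg).unique
        (((D.hasSum_gam z).mul_left (a * c)).of_eq (fun n => ?_) (by ring))
      change conj (v n) * (D.sq n * D.g z n) = _
      rw [← mul_assoc, key n]; ring
    have hc0 : c = 0 := by
      have hne := hg.den_ne
      rw [ha] at hcc
      field_simp at hcc
      linear_combination hcc
    ext n
    have := key n
    rw [hc0, mul_zero] at this
    simpa [hsq0 n] using this
  refine ⟨L0 * V, ?_, fun f => ?_⟩
  · have hVs : Function.Surjective (V : SeqL2 →L[ℂ] SeqL2) :=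
      (ContinuousLinearMap.isUnit_iff_bijective.mp V.isUnit).2
    exact hL0d.comp hVs.denseRange L0.continuous
  · ext n
    rw [hV, sInv_apply, mul_apply_eq_comp, mul_apply_eq_comp, hL0n, inv_mul_cancel_left₀ (hsq0 n)]

lemma denseRange_K : DenseRange D.K := by
  obtain ⟨L, hL, hLK⟩ := D.exists_sqrt_K
  have : (D.K : SeqL2 → SeqL2) = D.sInv ∘ L := funext fun f => (hLK f).symm
  rw [this]
  exact denseRange_sInv.comp hL D.sInv.continuous

lemma dense_roots : Dense (D.roots : Set SeqL2) := by
  rw [Submodule.dense_iff_topologicalClosure_eq_top, Submodule.topologicalClosure_eq_top_iff]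
  exact roots_orthogonal denseRange_K

/-- Density in the form domain, which the plain density of `roots` does not give. Under `L` a dense
set stays dense, and `sInv (L x) = K x` remains a combination of root vectors. -/
lemma dense_roots_sInv : Dense {x | D.sInv x ∈ D.roots} := by
  obtain ⟨L, hL, hLK⟩ := D.exists_sqrt_K
  refine (hL.dense_image L.continuous (dense_roots (D := D))).mono ?_
  rintro _ ⟨x, hx, rfl⟩
  change D.sInv (L x) ∈ D.roots
  rw [hLK]
  exact K_mem_roots hx

lemma dense_roots_qInv : Dense {x | D.qInv x ∈ D.roots} := by
  refine (denseRange_qInv.dense_image D.qInv.continuous (dense_roots_sInv (D := D))).mono ?_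
  rintro _ ⟨x, hx, rfl⟩
  change D.qInv (D.qInv x) ∈ D.roots
  rw [qInv_qInv]
  exact hx

lemma rootN_eq_bot {z : ℂ} (hz : z ∉ D.eigs) (m : ℕ) : D.rootN z m = ⊥ := by
  have h1 : D.rootN z (0 + 1) = D.rootN z 0 := by
    rw [rootN_zero, Submodule.eq_bot_iff]
    intro φ hφ
    obtain ⟨ψ, hψ, hr⟩ := mem_rootN_succ_iff.mp hφ
    rw [rootN_zero, Submodule.mem_bot] at hψ
    rw [hψ, add_zero] at hr
    by_contra h0
    exact hz ⟨φ, hr, h0⟩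
  rw [eq_bot_iff, ← rootN_zero (D := D) z]
  exact rootN_stable h1 m

lemma finiteDimensional_rootN (z : ℂ) (m : ℕ) : FiniteDimensional ℂ (D.rootN z m) := by
  by_cases hz : z ∈ D.eigs
  · obtain ⟨J, y, -, -, -, -, hs, hle⟩ := exists_jordan_basis hz
    have : FiniteDimensional ℂ (D.rootN z J) := by
      rw [← hs]
      exact FiniteDimensional.span_of_finite ℂ ((finite_Icc 1 J).image y)
    exact Submodule.finiteDimensional_of_le (hle m)
  · rw [rootN_eq_bot hz]
    infer_instance

/-- With finitely many eigenvalues the span of the root vectors would be finite dimensional, hence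
closed, and being dense it would be all of `ℓ²`. An enumeration of the spectrum by `ℕ` relies on
this. -/
lemma eigs_infinite : D.eigs.Infinite := by
  intro hfin
  have h1 : ∀ z : ℂ, ∃ J, ∀ k, D.rootN z k ≤ D.rootN z J := fun z =>
    (D.exists_rootN_stable z).imp fun m hm => rootN_stable hm
  choose J hJ using h1
  have : Finite D.eigs := hfin
  have hle : D.roots ≤ ⨆ z : D.eigs, D.rootN z (J z) := by
    refine iSup_le fun z => iSup_le fun m => ?_
    by_cases hz : z ∈ D.eigs
    · exact (hJ z m).trans (le_iSup (fun z : D.eigs => D.rootN z (J z)) ⟨z, hz⟩)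
    · rw [rootN_eq_bot hz]; exact bot_le
  have hfd : FiniteDimensional ℂ D.roots := by
    have := fun z : D.eigs => finiteDimensional_rootN (D := D) z (J z)
    exact Submodule.finiteDimensional_of_le hle
  have htop : D.roots = ⊤ := by
    rw [← Submodule.dense_iff_topologicalClosure_eq_top.mp dense_roots]
    exact (D.roots.closed_of_finiteDimensional.submodule_topologicalClosure_eq).symm
  have hfd' : FiniteDimensional ℂ SeqL2 := by
    rw [htop] at hfd
    exact Module.Finite.of_surjective (⊤ : Submodule ℂ SeqL2).subtype
      (fun x => ⟨⟨x, trivial⟩, rfl⟩)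
  have hb := (⟨LinearIsometryEquiv.refl ℂ SeqL2⟩ : HilbertBasis ℕ ℂ SeqL2).orthonormal
  have := hb.linearIndependent.finite
  exact not_finite ℕ

end ModalData

/-! ### The integrals defining the square root -/

section SqrtIntegrals

variable {w : ℂ}

lemma sq_add_sq_ne_zero (hw : 0 < w.re) (t : ℝ) : w ^ 2 + (t : ℂ) ^ 2 ≠ 0 := by
  have h : w ^ 2 + (t : ℂ) ^ 2 = (w + Complex.I * t) * (w - Complex.I * t) := by
    linear_combination ((t : ℂ) ^ 2) * Complex.I_sq
  rw [h]
  refine mul_ne_zero (fun h0 => ?_) (fun h0 => ?_)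
  · have := congrArg Complex.re h0
    simp at this
    linarith
  · have := congrArg Complex.re h0
    simp at this
    linarith

lemma continuous_inv_pow (hw : 0 < w.re) (k : ℕ) :
    Continuous fun t : ℝ => ((w ^ 2 + (t : ℂ) ^ 2) ^ k)⁻¹ :=
  Continuous.inv₀ (by fun_prop) fun t => pow_ne_zero _ (sq_add_sq_ne_zero hw t)

/-- The integral of `(w² + t²)⁻ᵏ` over `[0, M]`. -/
def intInvPow (w : ℂ) (k : ℕ) (M : ℝ) : ℂ := ∫ t in (0 : ℝ)..M, ((w ^ 2 + (t : ℂ) ^ 2) ^ k)⁻¹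

/-- The integral of `t² (w² + t²)⁻ᵏ⁻¹` over `[0, M]`. -/
def intSqInvPow (w : ℂ) (k : ℕ) (M : ℝ) : ℂ :=
  ∫ t in (0 : ℝ)..M, (t : ℂ) ^ 2 * ((w ^ 2 + (t : ℂ) ^ 2) ^ (k + 1))⁻¹

lemma intInvPow_sub (hw : 0 < w.re) (k : ℕ) (M : ℝ) :
    w ^ 2 * intInvPow w (k + 1) M = intInvPow w k M - intSqInvPow w k M := by
  rw [intInvPow, intInvPow, intSqInvPow, ← intervalIntegral.integral_const_mul,
    ← intervalIntegral.integral_sub]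
  · congr 1 with t
    have := sq_add_sq_ne_zero hw t
    field_simp
    ring
  · exact (continuous_inv_pow hw k).intervalIntegrable _ _
  · exact (Continuous.mul (by fun_prop) (continuous_inv_pow hw (k + 1))).intervalIntegrable _ _

/-- The derivative of `t (w² + t²)⁻ᵏ`, integrated over `[0, M]`. Together with `intInvPow_sub` it
gives a recursion in `k` of Wallis type. -/
lemma intSqInvPow_eq (hw : 0 < w.re) (k : ℕ) (M : ℝ) :
    2 * k * intSqInvPow w k M = intInvPow w k M - M * ((w ^ 2 + (M : ℂ) ^ 2) ^ k)⁻¹ := by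
  have h1 : ∀ t : ℝ, HasDerivAt (fun t : ℝ => (t : ℂ) * ((w ^ 2 + (t : ℂ) ^ 2) ^ k)⁻¹)
      (((w ^ 2 + (t : ℂ) ^ 2) ^ k)⁻¹ - 2 * k * ((t : ℂ) ^ 2 * ((w ^ 2 + (t : ℂ) ^ 2) ^ (k + 1))⁻¹))
      t := by
    intro t
    have hne := sq_add_sq_ne_zero hw t
    have ht : HasDerivAt (fun t : ℝ => (t : ℂ)) 1 t := Complex.ofRealCLM.hasDerivAt
    have h2 : HasDerivAt (fun t : ℝ => w ^ 2 + (t : ℂ) ^ 2) (2 * t) t := by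
      simpa using (ht.pow 2).const_add (w ^ 2)
    have h3 := ht.mul ((h2.pow k).inv (pow_ne_zero k hne))
    refine h3.congr_deriv ?_
    rcases k with _ | k
    · simp
    · simp only [Nat.add_sub_cancel, Pi.pow_apply, Pi.inv_apply]
      field_simp
      push_cast
      ring
  have hc : Continuous fun t : ℝ => 2 * (k : ℂ) * ((t : ℂ) ^ 2 * ((w ^ 2 + (t : ℂ) ^ 2) ^ (k + 1))⁻¹) :=
    continuous_const.mul (Continuous.mul (by fun_prop) (continuous_inv_pow hw (k + 1)))
  have h2 := intervalIntegral.integral_eq_sub_of_hasDerivAt (a := 0) (b := M) (fun t _ => h1 t)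
    (((continuous_inv_pow hw k).sub hc).intervalIntegrable _ _)
  rw [intervalIntegral.integral_sub ((continuous_inv_pow hw k).intervalIntegrable _ _)
    (hc.intervalIntegrable _ _), intervalIntegral.integral_const_mul] at h2
  rw [intInvPow, intSqInvPow]
  simp only [Complex.ofReal_zero, zero_mul, sub_zero] at h2
  linear_combination -h2

lemma tendsto_boundary_term (hw : 0 < w.re) (k : ℕ) :
    Tendsto (fun M : ℝ => (M : ℂ) * ((w ^ 2 + (M : ℂ) ^ 2) ^ (k + 1))⁻¹) atTop (𝓝 0) := by
  have h1 : Tendsto (fun M : ℝ => ((M : ℂ))⁻¹) atTop (𝓝 0) := by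
    have := (Complex.continuous_ofReal.tendsto 0).comp tendsto_inv_atTop_zero
    simpa [Function.comp_def] using this
  have h2 : Tendsto (fun M : ℝ => ((M : ℂ))⁻¹ ^ (2 * k + 1) *
      ((w ^ 2 * ((M : ℂ))⁻¹ ^ 2 + 1) ^ (k + 1))⁻¹) atTop (𝓝 (0 ^ (2 * k + 1) *
      ((w ^ 2 * 0 ^ 2 + 1) ^ (k + 1))⁻¹)) :=
    (h1.pow _).mul (((((h1.pow 2).const_mul (w ^ 2)).add_const 1).pow _).inv₀ (by simp))
  rw [zero_pow (by omega), zero_mul] at h2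
  refine h2.congr' ?_
  filter_upwards [eventually_gt_atTop 0] with M hM
  have hM' : (M : ℂ) ≠ 0 := by exact_mod_cast hM.ne'
  have hne := sq_add_sq_ne_zero hw M
  have e : w ^ 2 * ((M : ℂ))⁻¹ ^ 2 + 1 = (w ^ 2 + (M : ℂ) ^ 2) * ((M : ℂ))⁻¹ ^ 2 := by
    field_simp
  have e' : (((M : ℂ))⁻¹ ^ 2) ^ (k + 1) = ((M : ℂ))⁻¹ ^ (2 * k + 1) * ((M : ℂ))⁻¹ := by ring
  rw [e, mul_pow, e', mul_inv, mul_inv, inv_inv, mul_comm (_)⁻¹, ← mul_assoc, ← mul_assoc,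
    mul_inv_cancel₀ (pow_ne_zero _ (inv_ne_zero hM')), one_mul]

/-- The antiderivative is a difference of principal logarithms of `w ± i t`, which stay in the right
half plane. After the positive factor `M` is split off they tend to `log (± i)`. -/
lemma tendsto_intInvPow_one (hw : 0 < w.re) :
    Tendsto (intInvPow w 1) atTop (𝓝 (Real.pi / (2 * w))) := by
  have hw0 : w ≠ 0 := fun h => by simp [h] at hw
  have hp : ∀ t : ℝ, w + Complex.I * t ∈ Complex.slitPlane := fun t => Or.inl (by simpa using hw)
  have hm : ∀ t : ℝ, w - Complex.I * t ∈ Complex.slitPlane := fun t => Or.inl (by simpa using hw)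
  have hder : ∀ t : ℝ, HasDerivAt (fun t : ℝ => (2 * Complex.I * w)⁻¹ *
      (Complex.log (w + Complex.I * t) - Complex.log (w - Complex.I * t)))
      ((w ^ 2 + (t : ℂ) ^ 2) ^ 1)⁻¹ t := by
    intro t
    have ht : HasDerivAt (fun t : ℝ => Complex.I * (t : ℂ)) Complex.I t := by
      simpa using (Complex.ofRealCLM.hasDerivAt (x := t)).const_mul Complex.I
    have h1 := ((ht.const_add w).clog_real (hp t)).sub ((ht.const_sub w).clog_real (hm t))
    refine (h1.const_mul (2 * Complex.I * w)⁻¹).congr_deriv ?_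
    have e1 := Complex.slitPlane_ne_zero (hp t)
    have e2 := Complex.slitPlane_ne_zero (hm t)
    have e3 := sq_add_sq_ne_zero hw t
    have e4 : w ^ 2 + (t : ℂ) ^ 2 = (w + Complex.I * t) * (w - Complex.I * t) := by
      linear_combination ((t : ℂ) ^ 2) * Complex.I_sq
    rw [e4]
    have := Complex.I_ne_zero
    field_simp
    ring
  have hF : ∀ M : ℝ, intInvPow w 1 M = (2 * Complex.I * w)⁻¹ *
      (Complex.log (w + Complex.I * M) - Complex.log (w - Complex.I * M)) := by
    intro M
    rw [intInvPow, intervalIntegral.integral_eq_sub_of_hasDerivAt (fun t _ => hder t)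
      ((continuous_inv_pow hw 1).intervalIntegrable _ _)]
    simp
  have h1 : Tendsto (fun M : ℝ => ((M : ℂ))⁻¹) atTop (𝓝 0) := by
    have := (Complex.continuous_ofReal.tendsto 0).comp tendsto_inv_atTop_zero
    simpa [Function.comp_def] using this
  have h2 : Tendsto (fun M : ℝ => (2 * Complex.I * w)⁻¹ *
      (Complex.log (w * ((M : ℂ))⁻¹ + Complex.I) - Complex.log (w * ((M : ℂ))⁻¹ - Complex.I))) atTop
      (𝓝 ((2 * Complex.I * w)⁻¹ * (Complex.log (w * 0 + Complex.I) -
        Complex.log (w * 0 - Complex.I)))) := by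
    refine ((Tendsto.clog ((h1.const_mul w).add_const _) ?_).sub
      (Tendsto.clog ((h1.const_mul w).sub_const _) ?_)).const_mul _
    · exact Or.inr (by simp)
    · exact Or.inr (by simp)
  rw [mul_zero, zero_add, zero_sub, Complex.log_I, Complex.log_neg_I] at h2
  have e : (2 * Complex.I * w)⁻¹ * ((Real.pi : ℂ) / 2 * Complex.I - -((Real.pi : ℂ) / 2) * Complex.I)
      = Real.pi / (2 * w) := by
    have := Complex.I_ne_zero
    field_simp
    ring
  have h2' : Tendsto (fun M : ℝ => (2 * Complex.I * w)⁻¹ *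
      (Complex.log (w * ((M : ℂ))⁻¹ + Complex.I) - Complex.log (w * ((M : ℂ))⁻¹ - Complex.I))) atTop
      (𝓝 (Real.pi / (2 * w))) := by
    rw [← e]
    simpa using h2
  refine h2'.congr' ?_
  filter_upwards [eventually_gt_atTop 0] with M hM
  have hM' : (M : ℂ) ≠ 0 := by exact_mod_cast hM.ne'
  rw [hF]
  have e1 : w + Complex.I * M = (M : ℂ) * (w * ((M : ℂ))⁻¹ + Complex.I) := by field_simp
  have e2 : w - Complex.I * M = (M : ℂ) * (w * ((M : ℂ))⁻¹ - Complex.I) := by field_simp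
  have n1 : w * ((M : ℂ))⁻¹ + Complex.I ≠ 0 := fun h => by
    rw [h, mul_zero] at e1; exact Complex.slitPlane_ne_zero (hp M) e1
  have n2 : w * ((M : ℂ))⁻¹ - Complex.I ≠ 0 := fun h => by
    rw [h, mul_zero] at e2; exact Complex.slitPlane_ne_zero (hm M) e2
  rw [e1, e2, Complex.log_ofReal_mul hM n1, Complex.log_ofReal_mul hM n2]
  ring

lemma catalan_succ_mul (k : ℕ) : ((k : ℂ) + 2) * catalan (k + 1) = 2 * (2 * k + 1) * catalan k := by
  have h1 := succ_mul_catalan_eq_centralBinom (k + 1)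
  have h2 := succ_mul_catalan_eq_centralBinom k
  have h3 := Nat.succ_mul_centralBinom_succ k
  rw [← h1, ← h2] at h3
  have h4 : (k + 1) * ((k + 2) * catalan (k + 1)) = (k + 1) * (2 * (2 * k + 1) * catalan k) := by
    rw [h3]; ring
  have h5 := Nat.eq_of_mul_eq_mul_left k.succ_pos h4
  exact_mod_cast h5

/-- The recursion for the integrals is that of the Catalan numbers, `(k + 2) C_{k+1} = 2 (2k + 1)
C_k`, and the boundary terms vanish in the limit. -/
lemma tendsto_intInvPow (hw : 0 < w.re) (k : ℕ) : Tendsto (intInvPow w (k + 1)) atTop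
    (𝓝 (Real.pi * (k + 1) * catalan k / (2 * w) ^ (2 * k + 1))) ∧
    Tendsto (intSqInvPow w (k + 1)) atTop
    (𝓝 (Real.pi / 2 * catalan k / (2 * w) ^ (2 * k + 1))) := by
  have hw0 : w ≠ 0 := fun h => by simp [h] at hw
  have step : ∀ k : ℕ, Tendsto (intInvPow w (k + 1)) atTop
      (𝓝 (Real.pi * (k + 1) * catalan k / (2 * w) ^ (2 * k + 1))) →
      Tendsto (intSqInvPow w (k + 1)) atTop
      (𝓝 (Real.pi / 2 * catalan k / (2 * w) ^ (2 * k + 1))) := by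
    intro k h
    have h1 := (h.sub (tendsto_boundary_term hw k)).const_mul (2 * ((k + 1 : ℕ) : ℂ))⁻¹
    have hk : ((k : ℂ) + 1) ≠ 0 := by exact_mod_cast k.succ_ne_zero
    have e : (2 * ((k + 1 : ℕ) : ℂ))⁻¹ *
        (Real.pi * (k + 1) * catalan k / (2 * w) ^ (2 * k + 1) - 0) =
        Real.pi / 2 * catalan k / (2 * w) ^ (2 * k + 1) := by
      push_cast
      field_simp
      ring
    rw [e] at h1
    refine h1.congr fun M => ?_
    rw [← intSqInvPow_eq hw (k + 1) M, inv_mul_cancel_left₀]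
    push_cast
    exact mul_ne_zero two_ne_zero hk
  induction k with
  | zero =>
    have h1 : Tendsto (intInvPow w (0 + 1)) atTop
        (𝓝 (Real.pi * ((0 : ℕ) + 1) * catalan 0 / (2 * w) ^ (2 * 0 + 1))) := by
      simpa using tendsto_intInvPow_one hw
    exact ⟨h1, step 0 h1⟩
  | succ k ih =>
    have h1 : Tendsto (intInvPow w (k + 1 + 1)) atTop
        (𝓝 (Real.pi * ((k + 1 : ℕ) + 1) * catalan (k + 1) / (2 * w) ^ (2 * (k + 1) + 1))) := by
      have h2 := (ih.1.sub ih.2).const_mul (w ^ 2)⁻¹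
      have e : (w ^ 2)⁻¹ * (Real.pi * (k + 1) * catalan k / (2 * w) ^ (2 * k + 1) -
          Real.pi / 2 * catalan k / (2 * w) ^ (2 * k + 1)) =
          Real.pi * ((k + 1 : ℕ) + 1) * catalan (k + 1) / (2 * w) ^ (2 * (k + 1) + 1) := by
        have h3 := catalan_succ_mul k
        have e2 : (2 * w) ^ (2 * (k + 1) + 1) = (2 * w) ^ (2 * k + 1) * (4 * w ^ 2) := by ring
        rw [e2]
        push_cast
        field_simp
        linear_combination (-2 : ℂ) * h3
      rw [e] at h2
      refine h2.congr fun M => ?_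
      rw [← intInvPow_sub hw (k + 1) M, inv_mul_cancel_left₀ (pow_ne_zero 2 hw0)]
    exact ⟨h1, step (k + 1) h1⟩

/-- The coefficients of `1 - t² (z + N + t²)⁻¹`, `z = w²`, in powers of `N`. -/
def sqrtKernel (w : ℂ) : ℕ → ℝ → ℂ
  | 0, t => w ^ 2 * ((w ^ 2 + (t : ℂ) ^ 2) ^ 1)⁻¹
  | k + 1, t => (-1) ^ k * ((t : ℂ) ^ 2 * ((w ^ 2 + (t : ℂ) ^ 2) ^ (k + 1 + 1))⁻¹)

/-- The coefficients of the square root of `w² + N` in powers of `N`. -/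
def sqrtCoeff (w : ℂ) : ℕ → ℂ
  | 0 => w
  | k + 1 => (-1) ^ k * catalan k / (2 * w) ^ (2 * k + 1)

lemma continuous_sqrtKernel (hw : 0 < w.re) (k : ℕ) : Continuous (sqrtKernel w k) := by
  cases k with
  | zero => exact continuous_const.mul (continuous_inv_pow hw 1)
  | succ k => exact continuous_const.mul (Continuous.mul (by fun_prop) (continuous_inv_pow hw _))

/-- Balakrishnan's formula for the square root of `w² + N`, compared coefficientwise in powers of
`N`. This is where the Catalan numbers acquire their meaning. -/
lemma tendsto_integral_sqrtKernel (hw : 0 < w.re) (k : ℕ) :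
    Tendsto (fun M : ℝ => (2 / Real.pi : ℂ) * ∫ t in (0 : ℝ)..M, sqrtKernel w k t) atTop
      (𝓝 (sqrtCoeff w k)) := by
  have hw0 : w ≠ 0 := fun h => by simp [h] at hw
  have hpi : (Real.pi : ℂ) ≠ 0 := by exact_mod_cast Real.pi_ne_zero
  cases k with
  | zero =>
    have h1 := ((tendsto_intInvPow_one hw).const_mul (w ^ 2)).const_mul (2 / Real.pi : ℂ)
    have e : (2 / Real.pi : ℂ) * (w ^ 2 * (Real.pi / (2 * w))) = sqrtCoeff w 0 := by
      rw [sqrtCoeff]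
      field_simp
    rw [e] at h1
    refine h1.congr fun M => ?_
    rw [intInvPow, ← intervalIntegral.integral_const_mul]
    rfl
  | succ k =>
    have h1 := ((tendsto_intInvPow hw k).2.const_mul ((-1) ^ k)).const_mul (2 / Real.pi : ℂ)
    have e : (2 / Real.pi : ℂ) * ((-1) ^ k * (Real.pi / 2 * catalan k / (2 * w) ^ (2 * k + 1)))
        = sqrtCoeff w (k + 1) := by
      rw [sqrtCoeff]
      field_simp
    rw [e] at h1
    refine h1.congr fun M => ?_
    rw [intSqInvPow, ← intervalIntegral.integral_const_mul]
    rfl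

end SqrtIntegrals

/-! ### A Hilbert type inequality -/

section Hilbert

/-- A telescoping majorant. The function `√(k / (k + t))` has derivative `t / (2 √k (k + t)^{3/2})`,
and its increment over `[k - 1, k]` is at least that, by writing the increment as a difference of
squares over a sum. The rest is `√t ≤ √(k + t)` and `(k + t)² ≤ 2 (k² + t²)`. -/
lemma hilbert_weight_le {k t : ℝ} (hk : 1 ≤ k) (ht : 0 < t) :
    1 / (√k * (k ^ 2 + t ^ 2)) ≤ 4 / √t ^ 3 * (√(k / (k + t)) - √((k - 1) / (k - 1 + t))) := by
  have hk0 : 0 < k := by linarith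
  set s := √k with hs
  set r := √t with hr
  set u := √(k + t) with hu
  have s0 : 0 < s := Real.sqrt_pos.mpr hk0
  have r0 : 0 < r := Real.sqrt_pos.mpr ht
  have u0 : 0 < u := Real.sqrt_pos.mpr (by linarith)
  have s2 : s ^ 2 = k := Real.sq_sqrt hk0.le
  have r2 : r ^ 2 = t := Real.sq_sqrt ht.le
  have u2 : u ^ 2 = k + t := Real.sq_sqrt (by linarith)
  have ru : r ≤ u := Real.sqrt_le_sqrt (by linarith)
  have e1 : √(k / (k + t)) = s / u := Real.sqrt_div hk0.le _
  set b := √((k - 1) / (k - 1 + t)) with hb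
  have b0 : 0 ≤ b := Real.sqrt_nonneg _
  have b2 : b ^ 2 = (k - 1) / (k - 1 + t) := Real.sq_sqrt (div_nonneg (by linarith) (by linarith))
  have hba : b ≤ s / u := by
    rw [← e1]
    refine Real.sqrt_le_sqrt ?_
    rw [div_le_div_iff₀ (by linarith) (by linarith)]
    nlinarith
  rw [e1]
  have a0 : 0 < s / u := by positivity
  have a2 : (s / u) ^ 2 = k / (k + t) := by rw [div_pow, s2, u2]
  have hd : t / (k + t) ^ 2 ≤ (s / u) ^ 2 - b ^ 2 := by
    rw [a2, b2, div_sub_div _ _ (by linarith) (by linarith),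
      div_le_div_iff₀ (by positivity) (by nlinarith)]
    nlinarith [mul_pos ht (mul_pos (by linarith : 0 < k + t) (by linarith : 0 < k + t)),
      mul_pos ht (by linarith : 0 < k + t)]
  have h1 : t / (k + t) ^ 2 ≤ (s / u - b) * (2 * (s / u)) := by nlinarith
  have h2 : t / (2 * u ^ 3 * s) ≤ s / u - b := by
    have : t / (2 * u ^ 3 * s) = t / (k + t) ^ 2 / (2 * (s / u)) := by
      rw [← u2]; field_simp
    rw [this, div_le_iff₀ (by positivity)]
    exact h1
  refine le_trans ?_ (mul_le_mul_of_nonneg_left h2 (by positivity))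
  have e2 : 4 / r ^ 3 * (t / (2 * u ^ 3 * s)) = 2 / (r * u ^ 3 * s) := by
    rw [← r2]; field_simp; norm_num
  rw [e2, div_le_div_iff₀ (by positivity) (by positivity)]
  have h3 : r * u ^ 3 ≤ 2 * (k ^ 2 + t ^ 2) := by
    calc r * u ^ 3 ≤ u * u ^ 3 := by gcongr
      _ = (k + t) ^ 2 := by rw [← u2]; ring
      _ ≤ _ := by nlinarith [sq_nonneg (k - t)]
  nlinarith

lemma sum_hilbert_weight_le {t : ℝ} (ht : 0 < t) (N : ℕ) :
    ∑ n ∈ Finset.range N, 1 / (√((n : ℝ) + 1) * (((n : ℝ) + 1) ^ 2 + t ^ 2)) ≤ 4 / √t ^ 3 := by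
  calc _ ≤ ∑ n ∈ Finset.range N, 4 / √t ^ 3 *
        (√(((n + 1 : ℕ) : ℝ) / ((n + 1 : ℕ) + t)) - √((n : ℝ) / (n + t))) := by
        refine Finset.sum_le_sum fun n _ => ?_
        have := hilbert_weight_le (k := (n : ℝ) + 1) (by linarith [n.cast_nonneg (α := ℝ)]) ht
        simpa using this
    _ = 4 / √t ^ 3 * √((N : ℝ) / (N + t)) := by
        rw [← Finset.mul_sum, Finset.sum_range_sub (fun n : ℕ => √((n : ℝ) / (n + t)))]
        simp
    _ ≤ 4 / √t ^ 3 * 1 := by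
        gcongr
        rw [Real.sqrt_le_one]
        exact div_le_one_of_le₀ (by linarith) (by positivity)
    _ = _ := mul_one _

/-- The integrand of the Hilbert inequality for a single mode. -/
def hilbertKernel (n : ℕ) (t : ℝ) : ℝ := √t * √((n : ℝ) + 1) / (((n : ℝ) + 1) ^ 2 + t ^ 2)

lemma continuous_hilbertKernel (n : ℕ) : Continuous (hilbertKernel n) := by
  unfold hilbertKernel
  exact Continuous.div (by fun_prop) (by fun_prop) fun t => by positivity

lemma hilbertKernel_nonneg (n : ℕ) (t : ℝ) : 0 ≤ hilbertKernel n t := by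
  unfold hilbertKernel; positivity

lemma hilbertKernel_le_one (n : ℕ) (t : ℝ) : hilbertKernel n t ≤ 1 := by
  unfold hilbertKernel
  refine div_le_one_of_le₀ ?_ (by positivity)
  rcases le_or_gt t 0 with ht | ht
  · rw [Real.sqrt_eq_zero_of_nonpos ht, zero_mul]; positivity
  have hn : (0 : ℝ) ≤ n := n.cast_nonneg
  have h1 := Real.sq_sqrt ht.le
  have h2 := Real.sq_sqrt (show (0 : ℝ) ≤ n + 1 by linarith)
  nlinarith [sq_nonneg (√t - √((n : ℝ) + 1)), sq_nonneg (t - 1)]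

/-- The kernel is below `2 √k (t + k)^{-3/2}`, whose integral over the half line is 4 for every `k`.
-/
lemma integral_hilbertKernel_le (n : ℕ) {M : ℝ} (hM : 0 ≤ M) :
    ∫ t in (0 : ℝ)..M, hilbertKernel n t ≤ 4 := by
  set k : ℝ := (n : ℝ) + 1 with hk
  have hk0 : 0 < k := by positivity
  have hp : ∀ t ∈ Set.uIcc 0 M, 0 < t + k := fun t ht => by
    rw [Set.uIcc_of_le hM] at ht; linarith [ht.1]
  have hd : ∀ t ∈ Set.uIcc 0 M, HasDerivAt (fun t => -4 * √k * (√(t + k))⁻¹)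
      (2 * √k / ((t + k) * √(t + k))) t := by
    intro t ht
    have h0 := hp t ht
    have h1 := (((hasDerivAt_id t).add_const k).sqrt h0.ne').inv (Real.sqrt_pos.mpr h0).ne'
    refine (h1.const_mul (-4 * √k)).congr_deriv ?_
    have h2 := Real.sq_sqrt h0.le
    have h3 : √(t + k) ≠ 0 := (Real.sqrt_pos.mpr h0).ne'
    simp only [id]
    rw [h2]
    field_simp
    norm_num
  have hc : ContinuousOn (fun t => 2 * √k / ((t + k) * √(t + k))) (Set.uIcc 0 M) := by
    refine ContinuousOn.div (by fun_prop) (by fun_prop) fun t ht => ?_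
    have h0 := hp t ht
    have := Real.sqrt_pos.mpr h0
    positivity
  have hle : ∫ t in (0 : ℝ)..M, hilbertKernel n t ≤
      ∫ t in (0 : ℝ)..M, 2 * √k / ((t + k) * √(t + k)) := by
    refine intervalIntegral.integral_mono_on hM
      ((continuous_hilbertKernel n).intervalIntegrable _ _) hc.intervalIntegrable fun t ht => ?_
    have h0 : 0 < t + k := by linarith [ht.1]
    have hs := Real.sqrt_pos.mpr h0
    rw [hilbertKernel, ← hk, div_le_div_iff₀ (by positivity) (by positivity)]
    have h1 : √t ≤ √(t + k) := Real.sqrt_le_sqrt (by linarith)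
    calc √t * √k * ((t + k) * √(t + k)) ≤ √(t + k) * √k * ((t + k) * √(t + k)) := by gcongr
      _ = √k * ((t + k) * √(t + k) ^ 2) := by ring
      _ = √k * (t + k) ^ 2 := by rw [Real.sq_sqrt h0.le]; ring
      _ ≤ √k * (2 * (k ^ 2 + t ^ 2)) := by
        gcongr; nlinarith [sq_nonneg (k - t)]
      _ = _ := by ring
  refine hle.trans ?_
  rw [intervalIntegral.integral_eq_sub_of_hasDerivAt hd hc.intervalIntegrable, zero_add]
  have h1 : √k ≠ 0 := (Real.sqrt_pos.mpr hk0).ne'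
  have h2 : 0 ≤ 4 * √k * (√(M + k))⁻¹ := by positivity
  have h3 : -4 * √k * (√k)⁻¹ = -4 := by field_simp
  rw [h3]
  linarith

/-- Cauchy–Schwarz with the Schur weight `√(n + 1)`. The complementary factor is at most `4
t^{-3/2}` by `sum_hilbert_weight_le`. -/
lemma sq_tsum_le_hilbertKernel (a : ℕ → ℝ) (ha : ∀ n, 0 ≤ a n) (hs : Summable fun n => a n ^ 2)
    {t : ℝ} (ht : 0 ≤ t) :
    t ^ 2 * (∑' n, a n / (((n : ℝ) + 1) ^ 2 + t ^ 2)) ^ 2 ≤ 4 * ∑' n, a n ^ 2 * hilbertKernel n t := by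
  have hs' : Summable fun n => a n ^ 2 * hilbertKernel n t :=
    hs.of_nonneg_of_le (fun n => mul_nonneg (sq_nonneg _) (hilbertKernel_nonneg n t)) fun n =>
      mul_le_of_le_one_right (sq_nonneg _) (hilbertKernel_le_one n t)
  have hpos : 0 ≤ ∑' n, a n ^ 2 * hilbertKernel n t :=
    tsum_nonneg fun n => mul_nonneg (sq_nonneg _) (hilbertKernel_nonneg n t)
  rcases ht.eq_or_lt with rfl | ht
  · simpa using hpos
  have r0 : 0 < √t := Real.sqrt_pos.mpr ht
  have r2 : √t ^ 2 = t := Real.sq_sqrt ht.le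
  have hX0 : 0 ≤ ∑' n, a n / (((n : ℝ) + 1) ^ 2 + t ^ 2) :=
    tsum_nonneg fun n => div_nonneg (ha n) (by positivity)
  have key : ∑' n, a n / (((n : ℝ) + 1) ^ 2 + t ^ 2) ≤
      √(4 * (∑' n, a n ^ 2 * hilbertKernel n t) / t ^ 2) := by
    refine Real.tsum_le_of_sum_range_le (fun n => div_nonneg (ha n) (by positivity)) fun N => ?_
    refine Real.le_sqrt_of_sq_le ?_
    have h1 := Finset.sum_sq_le_sum_mul_sum_of_sq_le_mul (Finset.range N)
      (r := fun n : ℕ => a n / (((n : ℝ) + 1) ^ 2 + t ^ 2))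
      (f := fun n : ℕ => a n ^ 2 * (√((n : ℝ) + 1) / (((n : ℝ) + 1) ^ 2 + t ^ 2)))
      (g := fun n : ℕ => 1 / (√((n : ℝ) + 1) * (((n : ℝ) + 1) ^ 2 + t ^ 2)))
      (fun n _ => by positivity) (fun n _ => by positivity) (fun n _ => by
        have : 0 < √((n : ℝ) + 1) := Real.sqrt_pos.mpr (by positivity)
        refine le_of_eq ?_
        field_simp)
    refine h1.trans ?_
    have h2 : ∑ n ∈ Finset.range N, a n ^ 2 * (√((n : ℝ) + 1) / (((n : ℝ) + 1) ^ 2 + t ^ 2)) ≤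
        (√t)⁻¹ * ∑' n, a n ^ 2 * hilbertKernel n t := by
      refine le_trans (le_of_eq ?_) (mul_le_mul_of_nonneg_left (hs'.sum_le_tsum (Finset.range N)
        fun n _ => mul_nonneg (sq_nonneg _) (hilbertKernel_nonneg n t)) (inv_nonneg.mpr r0.le))
      rw [Finset.mul_sum]
      refine Finset.sum_congr rfl fun n _ => ?_
      rw [hilbertKernel]
      field_simp
    calc _ ≤ ((√t)⁻¹ * ∑' n, a n ^ 2 * hilbertKernel n t) * (4 / √t ^ 3) := by
          refine mul_le_mul h2 (sum_hilbert_weight_le ht N)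
            (Finset.sum_nonneg fun n _ => by positivity) (by positivity)
      _ = _ := by
          have : t ^ 2 = √t ^ 4 := by linear_combination (-(√t ^ 2) - t) * r2
          rw [this]
          field_simp
  calc _ ≤ t ^ 2 * √(4 * (∑' n, a n ^ 2 * hilbertKernel n t) / t ^ 2) ^ 2 := by gcongr
    _ = _ := by
      rw [Real.sq_sqrt (by positivity)]
      field_simp

/-- Schur's test: one factor 4 comes from the sum over `n`, the other from the integral over `t`.
The bound is uniform in `M`. -/
lemma integral_sq_tsum_le (a : ℕ → ℝ) (ha : ∀ n, 0 ≤ a n) (hs : Summable fun n => a n ^ 2)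
    (F : ℝ → ℝ) (hF : Continuous F) {C : ℝ} (hC : 0 ≤ C)
    (hFa : ∀ t, 0 ≤ t → F t ≤ C * (t ^ 2 * (∑' n, a n / (((n : ℝ) + 1) ^ 2 + t ^ 2)) ^ 2)) {M : ℝ}
    (hM : 0 ≤ M) : ∫ t in (0 : ℝ)..M, F t ≤ C * 16 * ∑' n, a n ^ 2 := by
  have hb : ∀ n t, ‖a n ^ 2 * hilbertKernel n t‖ ≤ a n ^ 2 := fun n t => by
    rw [Real.norm_of_nonneg (mul_nonneg (sq_nonneg _) (hilbertKernel_nonneg n t))]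
    exact mul_le_of_le_one_right (sq_nonneg _) (hilbertKernel_le_one n t)
  have hcont : Continuous fun t => ∑' n, a n ^ 2 * hilbertKernel n t :=
    continuous_tsum (fun n => continuous_const.mul (continuous_hilbertKernel n)) hs hb
  have h1 : ∫ t in (0 : ℝ)..M, F t ≤
      ∫ t in (0 : ℝ)..M, C * 4 * ∑' n, a n ^ 2 * hilbertKernel n t := by
    refine intervalIntegral.integral_mono_on hM (hF.intervalIntegrable _ _)
      ((continuous_const.mul hcont).intervalIntegrable _ _) fun t ht => (hFa t ht.1).trans ?_
    rw [mul_assoc C 4]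
    exact mul_le_mul_of_nonneg_left (sq_tsum_le_hilbertKernel a ha hs ht.1) hC
  have h2 : HasSum (fun n => ∫ t in (0 : ℝ)..M, a n ^ 2 * hilbertKernel n t)
      (∫ t in (0 : ℝ)..M, ∑' n, a n ^ 2 * hilbertKernel n t) := by
    refine intervalIntegral.hasSum_integral_of_dominated_convergence (fun n _ => a n ^ 2)
      (fun n => (continuous_const.mul (continuous_hilbertKernel n)).aestronglyMeasurable)
      (fun n => .of_forall fun t _ => hb n t) (.of_forall fun t _ => hs)
      intervalIntegrable_const (.of_forall fun t _ => ?_)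
    exact (Summable.of_norm_bounded hs (hb · t)).hasSum
  have h3 : ∫ t in (0 : ℝ)..M, ∑' n, a n ^ 2 * hilbertKernel n t ≤ 4 * ∑' n, a n ^ 2 := by
    refine hasSum_le (fun n => ?_) h2 (hs.hasSum.mul_left 4)
    rw [intervalIntegral.integral_const_mul, mul_comm]
    gcongr
    exact integral_hilbertKernel_le n hM
  refine h1.trans ?_
  rw [intervalIntegral.integral_const_mul]
  calc _ ≤ C * 4 * (4 * ∑' n, a n ^ 2) := by gcongr
    _ = _ := by ring

end Hilbert

/-! ### Bounds for and limits of operators on sequences -/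

namespace SeqL2

/-- The coordinate functionals. -/
def coord (n : ℕ) : SeqL2 →L[ℂ] ℂ :=
  LinearMap.mkContinuous ⟨⟨fun x => x n, fun _ _ => rfl⟩, fun _ _ => rfl⟩ 1 fun x => by
    rw [one_mul]; exact norm_apply_le x n

@[simp] lemma coord_apply (n : ℕ) (x : SeqL2) : coord n x = x n := rfl

lemma opNorm_le_of_inner_le {T : SeqL2 →L[ℂ] SeqL2} {C : ℝ} (hC : 0 ≤ C)
    (h : ∀ x y, ‖inner ℂ y (T x)‖ ≤ C * (‖x‖ ^ 2 + ‖y‖ ^ 2)) : ‖T‖ ≤ 2 * C := by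
  refine T.opNorm_le_bound (by positivity) fun x => ?_
  rcases eq_or_ne (T x) 0 with h0 | h0
  · rw [h0, norm_zero]; positivity
  have hp : 0 < ‖T x‖ := norm_pos_iff.mpr h0
  -- The test vector is `T x` rescaled to the norm of `x`, which makes the two terms on the right
  -- equal.
  have h1 := h x (((‖x‖ / ‖T x‖ : ℝ) : ℂ) • T x)
  rw [inner_smul_left, inner_self_eq_norm_sq_to_K, norm_mul, norm_smul, Complex.norm_conj,
    Complex.norm_of_nonneg (by positivity)] at h1
  have e1 : ‖((‖T x‖ : ℂ)) ^ 2‖ = ‖T x‖ ^ 2 := by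
    rw [norm_pow, Complex.norm_of_nonneg hp.le]
  have e2 : ‖x‖ / ‖T x‖ * ‖T x‖ = ‖x‖ := by field_simp
  have e3 : ‖x‖ / ‖T x‖ * ‖T x‖ ^ 2 = ‖x‖ * ‖T x‖ := by field_simp
  rw [e2] at h1
  erw [e1] at h1
  rw [e3] at h1
  rcases (norm_nonneg x).eq_or_lt with hx | hx
  · have : x = 0 := norm_eq_zero.mp hx.symm
    exact absurd (by rw [this, map_zero]) h0
  nlinarith

/-- Convergence is known only on particular vectors. A limit along an ultrafilter exists in every
coordinate for every `x`, is linear and bounded, and agrees with the ordinary limit wherever there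
is one. -/
lemma exists_limit (T : ℕ → SeqL2 →L[ℂ] SeqL2) {C : ℝ} (hT : ∀ M, ‖T M‖ ≤ C) :
    ∃ B : SeqL2 →L[ℂ] SeqL2, ∀ x y : SeqL2,
      (∀ n, Tendsto (fun M => T M x n) atTop (𝓝 (y n))) → B x = y := by
  set U : Ultrafilter ℕ := Filter.hyperfilter ℕ with hU
  have hUle : (U : Filter ℕ) ≤ atTop := by
    rw [← Nat.cofinite_eq_atTop]; exact hyperfilter_le_cofinite
  have hC : 0 ≤ C := (norm_nonneg _).trans (hT 0)
  have hb : ∀ M x, ‖T M x‖ ≤ C * ‖x‖ := fun M x => (T M).le_of_opNorm_le (hT M) x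
  have hex : ∀ x n, ∃ y : ℂ, Tendsto (fun M => T M x n) U (𝓝 y) := by
    intro x n
    have hmem : ∀ M, T M x n ∈ Metric.closedBall (0 : ℂ) (C * ‖x‖) := fun M => by
      rw [mem_closedBall_zero_iff]
      exact (norm_apply_le _ n).trans (hb M x)
    obtain ⟨y, -, hy⟩ := (isCompact_closedBall (0 : ℂ) (C * ‖x‖)).ultrafilter_le_nhds
      (U.map fun M => T M x n) (by
        rw [le_principal_iff]
        exact Filter.mem_map.mpr (Filter.univ_mem' hmem))
    exact ⟨y, hy⟩
  choose L hL using hex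
  have hmem : ∀ x, Memℓp (L x) 2 := fun x =>
    lp.memℓp_of_tendsto (F := fun M => T M x) (l := (U : Filter ℕ))
      (isBounded_iff_forall_norm_le.mpr ⟨C * ‖x‖, by rintro _ ⟨M, rfl⟩; exact hb M x⟩) (tendsto_pi_nhds.mpr (hL x))
  have hn : ∀ x, ‖(⟨L x, hmem x⟩ : SeqL2)‖ ≤ C * ‖x‖ := fun x =>
    lp.norm_le_of_tendsto (F := fun M => T M x) (l := (U : Filter ℕ))
      (.of_forall fun M => hb M x) (tendsto_pi_nhds.mpr (hL x))
  refine ⟨LinearMap.mkContinuous ⟨⟨fun x => ⟨L x, hmem x⟩, fun x y => ?_⟩, fun a x => ?_⟩ C hn,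
    fun x y h => ?_⟩
  · ext n
    refine tendsto_nhds_unique (hL (x + y) n) ?_
    exact ((hL x n).add (hL y n)).congr fun M => by simp
  · ext n
    refine tendsto_nhds_unique (hL (a • x) n) ?_
    exact ((hL x n).const_mul a).congr fun M => by simp
  · ext n
    exact tendsto_nhds_unique (hL x n) ((h n).mono_left hUle)

end SeqL2

namespace ModalData

variable (D : ModalData)

/-! ### The resolvent on the negative real axis -/

/-- The point `-t²`. -/
def negSq (t : ℝ) : ℂ := ((-(t ^ 2) : ℝ) : ℂ)

/-- The resolvent of `T` at `-t²`. -/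
def Q (t : ℝ) : SeqL2 →L[ℂ] SeqL2 := Ring.inverse (1 - (negSq t + D.tau) • D.K) * D.K

variable {D}

lemma isUnit_negSq (t : ℝ) : IsUnit (1 - (negSq t + D.tau) • D.K) := by
  refine isUnit_of_forall fun φ h => ?_
  by_contra h0
  have := h.im_pos h0
  rw [negSq, Complex.ofReal_im] at this
  exact this.false

lemma isResolvent_Q (t : ℝ) : D.IsResolvent (D.Q t) (negSq t) :=
  IsResolvent.isResolvent_of_isUnit rfl (isUnit_negSq t)

lemma continuous_Q : Continuous D.Q := by
  refine Continuous.mul (continuous_iff_continuousAt.mpr fun t => ?_) continuous_const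
  obtain ⟨u, hu⟩ := isUnit_negSq (D := D) t
  refine ContinuousAt.comp (g := Ring.inverse) (f := fun t : ℝ => 1 - (negSq t + D.tau) • D.K) ?_ ?_
  · rw [← hu]
    exact NormedRing.inverse_continuousAt u
  · unfold negSq
    fun_prop

lemma good_negSq (t : ℝ) : D.Good (negSq t) (1 + t ^ 2) := D.good_neg (sq_nonneg t)

/-- Where `t² ≥ 4 ‖W‖` the Neumann series gives `4 / (1 + t²)`; the remaining `t` form a compact
interval, on which `Q` is continuous. -/
lemma exists_norm_Q_le : ∃ C, 0 ≤ C ∧ ∀ t, ‖D.Q t‖ ≤ C / (1 + t ^ 2) := by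
  set s := √(4 * ‖D.W‖) with hs
  have hc : Continuous fun t => ‖D.Q t‖ * (1 + t ^ 2) := by
    have := (continuous_Q (D := D)).norm
    fun_prop
  obtain ⟨C, hC⟩ := (isCompact_Icc (a := -s) (b := s)).bddAbove_image hc.continuousOn
  refine ⟨max C 4, le_max_of_le_right (by norm_num), fun t => ?_⟩
  rw [le_div_iff₀ (by positivity)]
  by_cases ht : t ∈ Icc (-s) s
  · exact (hC ⟨t, ht, rfl⟩).trans (le_max_left _ _)
  · have h1 : s ^ 2 ≤ t ^ 2 := by
      rw [sq_le_sq, abs_of_nonneg (Real.sqrt_nonneg _)]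
      by_contra! h
      rw [abs_lt] at h
      exact ht ⟨h.1.le, h.2.le⟩
    rw [hs, Real.sq_sqrt (by positivity)] at h1
    obtain ⟨R, hR, hn, -⟩ := (good_negSq (D := D) t).exists_resolvent (by linarith)
    rw [(isResolvent_Q t).unique hR]
    refine le_trans ?_ (le_max_right _ _)
    rwa [le_div_iff₀ (by positivity)] at hn

/-- The difference of the resolvents of the diagonal part and of `T`. -/
lemma R0_sub_Q (t : ℝ) : D.R0 (negSq t) - D.Q t =
    (Complex.I * D.kap / (1 + Complex.I * D.kap * D.gam (negSq t))) •
      (D.ell (negSq t)).smulRight (D.g (negSq t)) + D.RB (negSq t) * D.W * D.Q t := by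
  ext1 f
  have h1 := ((good_negSq t).rel_iff _ _).mp ((isResolvent_Q (D := D) t).rel f)
  have h2 : D.Q t f = D.RB (negSq t) f - D.RB (negSq t) (D.W (D.Q t f)) := by
    conv_lhs => rw [← h1]
    rw [← map_sub]
    congr 1
    abel
  rw [sub_apply]
  conv_lhs => rw [h2]
  rw [RB_apply]
  simp only [add_apply, smul_apply,
    ContinuousLinearMap.smulRight_apply, mul_apply_eq_comp, smul_smul]
  abel

/-- `gam` is real on the negative axis, so the denominator has real part 1. -/
lemma norm_rankOne_coeff_le (t : ℝ) :
    ‖Complex.I * D.kap / (1 + Complex.I * D.kap * D.gam (negSq t))‖ ≤ D.kap := by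
  have hk := D.kap_pos
  rw [norm_div, norm_mul, Complex.norm_I, one_mul, Complex.norm_of_nonneg hk.le]
  refine div_le_self hk.le ?_
  have h1 := Complex.abs_re_le_norm (1 + Complex.I * D.kap * D.gam (negSq t))
  have h2 : (1 + Complex.I * D.kap * D.gam (negSq t)).re = 1 := by
    rw [negSq, gam_neg D (sq_nonneg t), mul_assoc, ← Complex.ofReal_mul]
    simp
  rwa [h2, abs_one] at h1

lemma norm_inner_g (t : ℝ) (y : SeqL2) :
    ‖inner ℂ y (D.g (negSq t))‖ = ‖D.ell (negSq t) y‖ := by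
  rw [norm_inner_symm, ell, innerSL_apply_apply, negSq, Complex.conj_ofReal]

lemma min_mul_le_lam (n : ℕ) : min (D.rho ^ 2) 1 / 2 * ((n : ℝ) + 1) ^ 2 ≤ D.lam n := by
  have h1 : min (D.rho ^ 2) 1 ≤ D.rho ^ 2 := min_le_left _ _
  have h2 : min (D.rho ^ 2) 1 ≤ 1 := min_le_right _ _
  have h3 : 0 ≤ min (D.rho ^ 2) 1 := by positivity
  unfold lam
  have h4 : ((n : ℝ) + 1) ^ 2 ≤ 2 * n ^ 2 + 2 := by nlinarith [sq_nonneg ((n : ℝ) - 1)]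
  calc _ ≤ min (D.rho ^ 2) 1 / 2 * (2 * n ^ 2 + 2) := by gcongr
    _ = min (D.rho ^ 2) 1 * n ^ 2 + min (D.rho ^ 2) 1 := by ring
    _ ≤ _ := by gcongr

lemma norm_ell_apply_le (t : ℝ) (f : SeqL2) : ‖D.ell (negSq t) f‖ ≤
    (D.bd / (min (D.rho ^ 2) 1 / 2)) * ∑' n, ‖f n‖ / (((n : ℝ) + 1) ^ 2 + t ^ 2) := by
  have hr := D.rho_pos
  set m := min (D.rho ^ 2) 1 / 2 with hm
  have hm0 : 0 < m := by positivity
  have hm1 : m ≤ 1 := by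
    have := min_le_right (D.rho ^ 2) 1
    rw [hm]; linarith
  have hsum : Summable fun n : ℕ => ‖f n‖ / (((n : ℝ) + 1) ^ 2 + t ^ 2) := by
    have h1 : Summable fun n : ℕ => ‖f‖ * (1 / ((n : ℝ) + 1) ^ 2) := by
      refine Summable.mul_left _ ?_
      have := (summable_nat_add_iff 1).mpr (Real.summable_one_div_nat_pow.mpr one_lt_two)
      simpa using this
    refine h1.of_nonneg_of_le (fun n => by positivity) fun n => ?_
    rw [mul_one_div]
    gcongr
    · exact norm_apply_le f n
    · nlinarith [sq_nonneg t]
  rw [← (D.hasSum_ell (negSq t) f).tsum_eq]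
  refine tsum_of_norm_bounded (hsum.hasSum.mul_left _) fun n => ?_
  have hl := min_mul_le_lam (D := D) n
  rw [← hm] at hl
  have hpos := D.lam_pos n
  have hle : m * (((n : ℝ) + 1) ^ 2 + t ^ 2) ≤ D.lam n + t ^ 2 := by
    nlinarith [sq_nonneg t, mul_le_of_le_one_left (sq_nonneg t) hm1]
  have e : ‖(D.lam n : ℂ) - negSq t‖ = D.lam n + t ^ 2 := norm_lam_add D n (sq_nonneg t)
  rw [norm_mul, norm_mul, norm_inv, e, Complex.norm_real, Real.norm_eq_abs]
  calc |D.del n| * ((D.lam n + t ^ 2)⁻¹ * ‖f n‖)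
      ≤ D.bd * ((m * (((n : ℝ) + 1) ^ 2 + t ^ 2))⁻¹ * ‖f n‖) := by
        have := D.abs_del_le n
        have := D.bd_nonneg
        gcongr
    _ = _ := by field_simp

lemma continuous_inv_lam (n : ℕ) : Continuous fun t : ℝ => ((D.lam n : ℂ) - negSq t)⁻¹ := by
  refine Continuous.inv₀ ?_ fun t => (good_negSq t).ne n
  unfold negSq
  fun_prop

lemma R0_sub_R0 (s t : ℝ) : ‖D.R0 (negSq s) - D.R0 (negSq t)‖ ≤ |s ^ 2 - t ^ 2| := by
  have hb : ∀ t, ‖D.R0 (negSq t)‖ ≤ 1 := fun t => by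
    refine (D.norm_R0_le (good_negSq (D := D) t).pos (good_negSq (D := D) t).dist).trans ?_
    exact inv_le_one_of_one_le₀ (by nlinarith [sq_nonneg t])
  have h : D.R0 (negSq s) - D.R0 (negSq t) =
      ((t ^ 2 - s ^ 2 : ℝ) : ℂ) • (D.R0 (negSq s) * D.R0 (negSq t)) := by
    ext x n
    have h1 := (good_negSq (D := D) s).ne n
    have h2 := (good_negSq (D := D) t).ne n
    simp only [sub_apply, smul_apply, mul_apply_eq_comp,
      lp.coeFn_sub, lp.coeFn_smul, Pi.sub_apply, Pi.smul_apply, R0_apply, smul_eq_mul]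
    field_simp
    rw [negSq, negSq]
    push_cast
    ring
  rw [h, norm_smul, Complex.norm_real, Real.norm_eq_abs, abs_sub_comm]
  refine mul_le_of_le_one_right (abs_nonneg _) ((norm_mul_le _ _).trans ?_)
  exact mul_le_one₀ (hb s) (norm_nonneg _) (hb t)

lemma continuous_R0 : Continuous fun t => D.R0 (negSq t) := by
  rw [continuous_iff_continuousAt]
  intro t
  rw [ContinuousAt, tendsto_iff_norm_sub_tendsto_zero]
  have h : Tendsto (fun s : ℝ => |s ^ 2 - t ^ 2|) (𝓝 t) (𝓝 |t ^ 2 - t ^ 2|) :=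
    Continuous.tendsto (by fun_prop) t
  rw [sub_self, abs_zero] at h
  exact squeeze_zero (fun _ => norm_nonneg _) (fun s => R0_sub_R0 s t) h

lemma continuous_ell (f : SeqL2) : Continuous fun t => D.ell (negSq t) f := by
  have h : (fun t => D.ell (negSq t) f) =
      fun t => ∑' n, (D.del n : ℂ) * (((D.lam n : ℂ) - negSq t)⁻¹ * f n) := by
    funext t
    exact (D.hasSum_ell (negSq t) f).tsum_eq.symm
  rw [h]
  have hs : Summable fun n => D.bd * (‖((D.lam n : ℂ) - negSq 0)⁻¹‖ * ‖f‖) :=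
    ((D.summable_inv _).mul_right _).mul_left _
  refine continuous_tsum (fun n => ?_) hs fun n t => ?_
  · exact continuous_const.mul ((continuous_inv_lam n).mul continuous_const)
  · rw [norm_mul, norm_mul, Complex.norm_real, Real.norm_eq_abs]
    have := D.bd_nonneg
    have e : ∀ t, ‖(D.lam n : ℂ) - negSq t‖ = D.lam n + t ^ 2 := fun t =>
      norm_lam_add D n (sq_nonneg t)
    have hp := D.lam_pos n
    gcongr
    · exact D.abs_del_le n
    · rw [norm_inv, norm_inv, e, e]
      refine inv_anti₀ (by positivity) ?_
      nlinarith [sq_nonneg t]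
    · exact norm_apply_le f n

/-- Hilbert's inequality in the form in which it enters: `t ↦ t · ell(-t²) f` is square integrable,
uniformly over unit vectors `f`. -/
lemma exists_integral_ell_le : ∃ C, 0 ≤ C ∧ ∀ (f : SeqL2) (M : ℝ), 0 ≤ M →
    ∫ t in (0 : ℝ)..M, t ^ 2 * ‖D.ell (negSq t) f‖ ^ 2 ≤ C * ‖f‖ ^ 2 := by
  have hb := D.bd_nonneg
  have hr := D.rho_pos
  set c := D.bd / (min (D.rho ^ 2) 1 / 2) with hc
  have hc0 : 0 ≤ c := by positivity
  refine ⟨c ^ 2 * 16, by positivity, fun f M hM => ?_⟩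
  rw [SeqL2.norm_sq_eq]
  refine integral_sq_tsum_le (fun n => ‖f n‖) (fun n => norm_nonneg _) (summable_norm_sq f)
    (fun t => t ^ 2 * ‖D.ell (negSq t) f‖ ^ 2) ?_
    (by positivity) (fun t _ => ?_) hM
  · have := (continuous_ell (D := D) f).norm
    fun_prop
  · have := norm_ell_apply_le (D := D) t f
    rw [← hc] at this
    calc t ^ 2 * ‖D.ell (negSq t) f‖ ^ 2
        ≤ t ^ 2 * (c * ∑' n, ‖f n‖ / (((n : ℝ) + 1) ^ 2 + t ^ 2)) ^ 2 := by gcongr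
      _ = _ := by ring

/-! ### The difference of the square roots of `T` and of its diagonal part -/

variable (D) in
/-- The truncated integral for the difference of the square roots of `T` and of its diagonal
part. -/
def truncB (M : ℝ) : SeqL2 →L[ℂ] SeqL2 :=
  (2 / Real.pi : ℂ) • ∫ t in (0 : ℝ)..M, ((t : ℂ) ^ 2) • (D.R0 (negSq t) - D.Q t)

lemma continuous_truncB_integrand :
    Continuous fun t : ℝ => ((t : ℂ) ^ 2) • (D.R0 (negSq t) - D.Q t) :=
  (Complex.continuous_ofReal.pow 2).smul (continuous_R0.sub continuous_Q)

lemma apply_truncB (L : (SeqL2 →L[ℂ] SeqL2) →L[ℂ] ℂ) (M : ℝ) : L (D.truncB M) =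
    (2 / Real.pi : ℂ) * ∫ t in (0 : ℝ)..M, (t : ℂ) ^ 2 * (L (D.R0 (negSq t)) - L (D.Q t)) := by
  rw [truncB, map_smul, smul_eq_mul, ← ContinuousLinearMap.intervalIntegral_comp_comm _
    (continuous_truncB_integrand.intervalIntegrable _ _)]
  simp only [map_smul, map_sub, smul_eq_mul]

/-- An estimate in operator norm would leave an integrand of order `1 / t` for the rank one part.
The sesquilinear form is estimated instead: `t² |ell x| |ell y|` is split by the
arithmetic-geometric mean inequality and integrated by `exists_integral_ell_le`. The part with `W`
contains two resolvents, and `t² (1 + t²)⁻²` is integrable. -/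
lemma exists_norm_truncB_le : ∃ C, ∀ M : ℕ, ‖D.truncB M‖ ≤ C := by
  obtain ⟨C₁, hC₁, h₁⟩ := exists_norm_Q_le (D := D)
  obtain ⟨C₂, hC₂, h₂⟩ := exists_integral_ell_le (D := D)
  have hk := D.kap_pos
  set c := D.kap / 2 * C₂ + Real.pi / 2 * (2 * ‖D.W‖ * C₁) with hc
  have hc0 : 0 ≤ c := by positivity
  refine ⟨2 * (2 / Real.pi * c), fun M => opNorm_le_of_inner_le (by positivity) fun x y => ?_⟩
  have hM : (0 : ℝ) ≤ M := M.cast_nonneg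
  set L : (SeqL2 →L[ℂ] SeqL2) →L[ℂ] ℂ := (innerSL ℂ y).comp (ContinuousLinearMap.apply ℂ SeqL2 x)
    with hL
  have hLa : ∀ T : SeqL2 →L[ℂ] SeqL2, L T = inner ℂ y (T x) := fun T => rfl
  rw [← hLa, apply_truncB, norm_mul, norm_div, Complex.norm_ofNat,
    Complex.norm_of_nonneg Real.pi_pos.le, mul_assoc]
  refine mul_le_mul_of_nonneg_left ?_ (by positivity)
  have hct : ∀ f : SeqL2, Continuous fun t : ℝ => t ^ 2 * ‖D.ell (negSq t) f‖ ^ 2 := fun f => by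
    have := (continuous_ell (D := D) f).norm
    fun_prop
  have hci : Continuous fun t : ℝ => (1 + t ^ 2)⁻¹ :=
    Continuous.inv₀ (by fun_prop) fun t => by positivity
  have hpt : ∀ t : ℝ, ‖(t : ℂ) ^ 2 * (L (D.R0 (negSq t)) - L (D.Q t))‖ ≤
      (D.kap / 2 * (t ^ 2 * ‖D.ell (negSq t) x‖ ^ 2) + D.kap / 2 * (t ^ 2 * ‖D.ell (negSq t) y‖ ^ 2)) +
      (2 * ‖D.W‖ * C₁ * (‖x‖ * ‖y‖)) * (1 + t ^ 2)⁻¹ := by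
    intro t
    rw [← map_sub, R0_sub_Q, map_add, map_smul, hLa, hLa, ContinuousLinearMap.smulRight_apply,
      inner_smul_right, norm_mul, norm_pow, Complex.norm_real, Real.norm_eq_abs, sq_abs]
    have e1 : ‖(Complex.I * D.kap / (1 + Complex.I * D.kap * D.gam (negSq t))) •
        (D.ell (negSq t) x * inner ℂ y (D.g (negSq t)))‖ ≤
        D.kap * (‖D.ell (negSq t) x‖ * ‖D.ell (negSq t) y‖) := by
      rw [norm_smul, norm_mul, norm_inner_g]
      gcongr
      exact norm_rankOne_coeff_le t
    have e2 : ‖inner ℂ y ((D.RB (negSq t) * D.W * D.Q t) x)‖ ≤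
        ‖y‖ * (2 / (1 + t ^ 2) * ‖D.W‖ * (C₁ / (1 + t ^ 2)) * ‖x‖) := by
      refine (norm_inner_le_norm _ _).trans ?_
      gcongr
      refine ContinuousLinearMap.le_of_opNorm_le _ ?_ x
      refine (norm_mul_le _ _).trans (mul_le_mul ((norm_mul_le _ _).trans ?_) (h₁ t)
        (norm_nonneg _) (by positivity))
      gcongr
      exact (good_negSq t).norm_RB_le
    calc _ ≤ t ^ 2 * (D.kap * (‖D.ell (negSq t) x‖ * ‖D.ell (negSq t) y‖) +
          ‖y‖ * (2 / (1 + t ^ 2) * ‖D.W‖ * (C₁ / (1 + t ^ 2)) * ‖x‖)) := by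
          gcongr
          exact (norm_add_le _ _).trans (add_le_add e1 e2)
      _ ≤ _ := by
          rw [mul_add]
          refine add_le_add ?_ ?_
          · have := mul_nonneg (mul_nonneg hk.le (sq_nonneg t))
              (sq_nonneg (‖D.ell (negSq t) x‖ - ‖D.ell (negSq t) y‖))
            nlinarith
          · have e3 : t ^ 2 * (1 + t ^ 2)⁻¹ ≤ 1 := by
              rw [← div_eq_mul_inv]
              exact div_le_one_of_le₀ (by linarith) (by positivity)
            calc _ = (2 * ‖D.W‖ * C₁ * (‖x‖ * ‖y‖)) * (1 + t ^ 2)⁻¹ * (t ^ 2 * (1 + t ^ 2)⁻¹) := by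
                  field_simp
              _ ≤ _ := mul_le_of_le_one_right (by positivity) e3
  refine (intervalIntegral.norm_integral_le_of_norm_le hM (.of_forall fun t _ => hpt t)
    (Continuous.intervalIntegrable (by fun_prop) _ _)).trans ?_
  rw [intervalIntegral.integral_add (Continuous.intervalIntegrable (by fun_prop) _ _)
      (Continuous.intervalIntegrable (by fun_prop) _ _),
    intervalIntegral.integral_add (Continuous.intervalIntegrable (by fun_prop) _ _)
      (Continuous.intervalIntegrable (by fun_prop) _ _),
    intervalIntegral.integral_const_mul, intervalIntegral.integral_const_mul,
    intervalIntegral.integral_const_mul, integral_inv_one_add_sq]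
  have ha : Real.arctan M - Real.arctan 0 ≤ Real.pi / 2 := by
    rw [Real.arctan_zero, sub_zero]; exact (Real.arctan_lt_pi_div_two _).le
  have hx := h₂ x M hM
  have hy := h₂ y M hM
  have hxy : ‖x‖ * ‖y‖ ≤ ‖x‖ ^ 2 + ‖y‖ ^ 2 := by
    nlinarith [sq_nonneg (‖x‖ - ‖y‖), sq_nonneg (‖x‖ + ‖y‖)]
  calc _ ≤ (D.kap / 2 * (C₂ * ‖x‖ ^ 2) + D.kap / 2 * (C₂ * ‖y‖ ^ 2)) +
        (2 * ‖D.W‖ * C₁ * (‖x‖ ^ 2 + ‖y‖ ^ 2)) * (Real.pi / 2) := by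
        gcongr
        rw [Real.arctan_zero, sub_zero]
        exact Real.arctan_nonneg.mpr hM
    _ = _ := by rw [hc]; ring

/-- On a Jordan chain `T = w² + N` with `N` lowering the index, so `(T + t²)⁻¹` is a finite
geometric series in `N`. -/
lemma Q_apply_chain {w : ℂ} (hw : 0 < w.re) {m : ℕ} {x : ℕ → SeqL2} (h0 : x 0 = 0)
    (h : ∀ i < m, D.Rel (x (i + 1)) (w ^ 2 • x (i + 1) + x i)) (t : ℝ) (j : ℕ) (hj : j ≤ m) :
    D.Q t (x j) = ∑ l ∈ Finset.range j,
      ((-1) ^ l * ((w ^ 2 + (t : ℂ) ^ 2) ^ (l + 1))⁻¹) • x (j - l) := by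
  have ha := sq_add_sq_ne_zero hw t
  set a := w ^ 2 + (t : ℂ) ^ 2 with hadef
  induction j with
  | zero => simp [h0]
  | succ i ih =>
    have h1 := (isResolvent_Q t _ _).mp (h i hj)
    have h2 : w ^ 2 • x (i + 1) + x i - negSq t • x (i + 1) = a • x (i + 1) + x i := by
      rw [hadef, negSq]
      push_cast
      module
    rw [h2, map_add, map_smul, ih (by omega)] at h1
    have h3 : D.Q t (x (i + 1)) = a⁻¹ • (x (i + 1) - ∑ l ∈ Finset.range i,
        ((-1) ^ l * (a ^ (l + 1))⁻¹) • x (i - l)) := by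
      rw [eq_inv_smul_iff₀ ha]
      exact eq_sub_of_add_eq h1
    rw [h3, Finset.sum_range_succ', smul_sub, Finset.smul_sum, sub_eq_neg_add, ← Finset.sum_neg_distrib]
    congr 1
    · refine Finset.sum_congr rfl fun l _ => ?_
      rw [smul_smul, ← neg_smul, Nat.add_sub_add_right]
      congr 1
      rw [pow_succ a (l + 1), mul_inv]
      ring
    · simp

lemma sub_smul_Q_chain {w : ℂ} (hw : 0 < w.re) {m : ℕ} {x : ℕ → SeqL2} (h0 : x 0 = 0)
    (h : ∀ i < m, D.Rel (x (i + 1)) (w ^ 2 • x (i + 1) + x i)) (t : ℝ) (j : ℕ) (hj : j ≤ m) :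
    x j - ((t : ℂ) ^ 2) • D.Q t (x j) =
      ∑ l ∈ Finset.range j, sqrtKernel w l t • x (j - l) := by
  have ha := sq_add_sq_ne_zero hw t
  rw [Q_apply_chain hw h0 h t j hj]
  cases j with
  | zero => simp [h0]
  | succ i =>
    rw [Finset.sum_range_succ', Finset.sum_range_succ', smul_add, Finset.smul_sum, ← sub_sub,
      sub_right_comm, sub_eq_neg_add, ← Finset.sum_neg_distrib]
    congr 1
    · refine Finset.sum_congr rfl fun l _ => ?_
      rw [smul_smul, ← neg_smul]
      congr 1
      rw [sqrtKernel]
      ring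
    · rw [smul_smul]
      simp only [Nat.sub_zero, pow_zero, one_mul, zero_add, pow_one, sqrtKernel]
      conv_lhs => enter [1]; rw [← one_smul ℂ (x (i + 1))]
      rw [← sub_smul]
      congr 1
      field_simp
      ring

/-- The integrand is `(1 - t² Q) - (1 - t² R0)`, and each bracket has a convergent integral in every
coordinate. The limit is taken coordinatewise because `√Λ x_j` alone is not known to be square
summable. -/
lemma tendsto_truncB_chain {w : ℂ} (hw : 0 < w.re) {m : ℕ} {x : ℕ → SeqL2} (h0 : x 0 = 0)
    (h : ∀ i < m, D.Rel (x (i + 1)) (w ^ 2 • x (i + 1) + x i)) {j : ℕ} (hj : j ≤ m) (n : ℕ) :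
    Tendsto (fun M : ℕ => D.truncB M (x j) n) atTop
      (𝓝 ((∑ l ∈ Finset.range j, sqrtCoeff w l * x (j - l) n) - D.sq n * x j n)) := by
  set L : (SeqL2 →L[ℂ] SeqL2) →L[ℂ] ℂ := (coord n).comp (ContinuousLinearMap.apply ℂ SeqL2 (x j))
    with hL
  have hs : 0 < ((D.sq n : ℂ)).re := by simpa using sq_pos (D := D) n
  have hint : ∀ t : ℝ, (t : ℂ) ^ 2 * (L (D.R0 (negSq t)) - L (D.Q t)) =
      (∑ l ∈ Finset.range j, sqrtKernel w l t * x (j - l) n) - sqrtKernel (D.sq n) 0 t * x j n := by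
    intro t
    have h1 := congrArg (coord n) (sub_smul_Q_chain hw h0 h t j hj)
    simp only [map_sub, map_sum, map_smul, smul_eq_mul, coord_apply] at h1
    rw [← h1]
    have h2 : L (D.R0 (negSq t)) = ((D.lam n : ℂ) - negSq t)⁻¹ * x j n := rfl
    have h3 : L (D.Q t) = D.Q t (x j) n := rfl
    have h4 := (good_negSq (D := D) t).ne n
    have h5 : (D.sq n : ℂ) ^ 2 = D.lam n := by
      rw [← sq_mul_sq]; push_cast; ring
    have h6 : (D.lam n : ℂ) - negSq t = D.lam n + (t : ℂ) ^ 2 := by rw [negSq]; push_cast; ring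
    rw [h6] at h4
    rw [h2, h3, h6, sqrtKernel, h5]
    field_simp
    ring
  have hTe : ∀ M : ℕ, D.truncB M (x j) n =
      (∑ l ∈ Finset.range j, ((2 / Real.pi : ℂ) * ∫ t in (0 : ℝ)..M, sqrtKernel w l t) * x (j - l) n) -
        ((2 / Real.pi : ℂ) * ∫ t in (0 : ℝ)..M, sqrtKernel (D.sq n) 0 t) * x j n := by
    intro M
    have h1 : D.truncB M (x j) n = L (D.truncB M) := rfl
    have hc : ∀ l, Continuous fun t => sqrtKernel w l t * x (j - l) n := fun l =>
      (continuous_sqrtKernel hw l).mul continuous_const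
    have hc' : Continuous fun t => sqrtKernel (D.sq n) 0 t * x j n :=
      (continuous_sqrtKernel hs 0).mul continuous_const
    rw [h1, apply_truncB]
    simp only [hint]
    rw [intervalIntegral.integral_sub
      ((continuous_finsetSum _ fun l _ => hc l).intervalIntegrable _ _)
      (hc'.intervalIntegrable _ _),
      intervalIntegral.integral_finsetSum fun l _ => (hc l).intervalIntegrable _ _]
    simp only [intervalIntegral.integral_mul_const]
    rw [mul_sub, Finset.mul_sum]
    simp only [mul_assoc]
  simp only [hTe]
  refine Tendsto.sub (tendsto_finsetSum _ fun l _ => ?_) ?_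
  · exact ((tendsto_integral_sqrtKernel hw l).comp tendsto_natCast_atTop_atTop).mul_const _
  · exact ((tendsto_integral_sqrtKernel hs 0).comp tendsto_natCast_atTop_atTop).mul_const _

variable (D) in
/-- The square root of `T` differs from the square root of its diagonal part by a bounded
operator. -/
lemma exists_sqrt_sub_sqrt : ∃ B : SeqL2 →L[ℂ] SeqL2, ∀ (w : ℂ), 0 < w.re → ∀ (m : ℕ) (x : ℕ → SeqL2),
    x 0 = 0 → (∀ i < m, D.Rel (x (i + 1)) (w ^ 2 • x (i + 1) + x i)) → ∀ j ≤ m, ∀ n,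
    D.sq n * x j n + B (x j) n = ∑ l ∈ Finset.range j, sqrtCoeff w l * x (j - l) n := by
  obtain ⟨C, hC⟩ := exists_norm_truncB_le (D := D)
  obtain ⟨B, hB⟩ := exists_limit (fun M : ℕ => D.truncB M) hC
  refine ⟨B, fun w hw m x h0 h j hj n => ?_⟩
  -- Coordinatewise limits of a norm bounded sequence stay in `ℓ²`, so `hB` applies to an actual
  -- element.
  have hmem : Memℓp (fun n => (∑ l ∈ Finset.range j, sqrtCoeff w l * x (j - l) n) - D.sq n * x j n)
      2 :=
    lp.memℓp_of_tendsto (F := fun M : ℕ => D.truncB M (x j)) (l := atTop)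
      (isBounded_iff_forall_norm_le.mpr ⟨C * ‖x j‖, by
        rintro _ ⟨M, rfl⟩; exact (D.truncB M).le_of_opNorm_le (hC M) _⟩)
      (tendsto_pi_nhds.mpr fun n => tendsto_truncB_chain hw h0 h hj n)
  rw [hB (x j) ⟨_, hmem⟩ fun n => tendsto_truncB_chain hw h0 h hj n]
  ring

end ModalData

/-! ### Weak derivatives on an interval -/

section WeakDeriv

variable {a b : ℝ}

lemma L2.integrable (u : L2 a b) : Integrable u (volume.restrict (Ioo a b)) :=
  (Lp.memLp u).integrable one_le_two

lemma L2.integrable_mul (u : L2 a b) {η : ℝ → ℂ} (hη : ContinuousOn η (Icc a b)) :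
    Integrable (fun x => u x * η x) (volume.restrict (Ioo a b)) := by
  obtain ⟨C, hC⟩ := isCompact_Icc.exists_bound_of_continuousOn hη
  refine u.integrable.mul_bdd (c := C) ?_ ?_
  · exact (hη.mono Ioo_subset_Icc_self).aestronglyMeasurable measurableSet_Ioo
  · filter_upwards [ae_restrict_mem measurableSet_Ioo] with x hx
    exact hC x (Ioo_subset_Icc_self hx)

/-- The primitive of `v` that vanishes at `a`. -/
def prim (v : L2 a b) (x : ℝ) : ℂ := ∫ t in a..x, (Ioo a b).indicator v t

lemma continuous_prim (v : L2 a b) : Continuous (prim v) :=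
  intervalIntegral.continuous_primitive
    (fun _ _ => ((integrable_indicator_iff measurableSet_Ioo).mpr v.integrable).intervalIntegrable) _

@[simp] lemma prim_left (v : L2 a b) : prim v a = 0 := intervalIntegral.integral_same

lemma prim_eq (v : L2 a b) {x : ℝ} (hx : x ∈ Icc a b) : prim v x = ∫ t in Ioo a x, v t := by
  rw [prim, intervalIntegral.integral_of_le hx.1, integral_Ioc_eq_integral_Ioo]
  refine setIntegral_congr_fun measurableSet_Ioo fun t ht => ?_
  exact indicator_of_mem (show t ∈ Ioo a b from ⟨ht.1, ht.2.trans_le hx.2⟩) _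

/-- Integration by parts through Fubini's theorem on the triangle `y < x`, which asks no regularity
of `v`. -/
lemma integral_prim_mul (v : L2 a b) (hab : a ≤ b) {η η' : ℝ → ℂ}
    (hη : ∀ x ∈ Icc a b, HasDerivAt η (η' x) x) (hc : ContinuousOn η' (Icc a b)) :
    (∫ x in Ioo a b, prim v x * η' x) + ∫ x in Ioo a b, v x * η x = prim v b * η b := by
  have hηc : ContinuousOn η (Icc a b) := fun x hx => (hη x hx).continuousAt.continuousWithinAt
  have hi' : Integrable η' (volume.restrict (Ioo a b)) :=
    (hc.integrableOn_Icc).mono_set Ioo_subset_Icc_self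
  set μ := volume.restrict (Ioo a b) with hμ
  have hint : Integrable (Function.uncurry fun x y =>
      {p : ℝ × ℝ | p.2 < p.1}.indicator (fun p => η' p.1 * v p.2) (x, y)) (μ.prod μ) :=
    (hi'.mul_prod v.integrable).indicator (measurableSet_lt measurable_snd measurable_fst)
  have h1 : ∀ x ∈ Ioo a b, ∫ y, {p : ℝ × ℝ | p.2 < p.1}.indicator
      (fun p => η' p.1 * v p.2) (x, y) ∂μ = prim v x * η' x := by
    intro x hx
    have e : (fun y => {p : ℝ × ℝ | p.2 < p.1}.indicator (fun p => η' p.1 * v p.2) (x, y)) =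
        (Iio x).indicator fun y => η' x * v y := by
      funext y
      by_cases h : y < x <;> simp [indicator, h]
    rw [e, integral_indicator measurableSet_Iio, hμ, Measure.restrict_restrict measurableSet_Iio,
      integral_const_mul, mul_comm, prim_eq v (Ioo_subset_Icc_self hx)]
    congr 3
    ext y
    simp only [mem_inter_iff, mem_Iio, mem_Ioo]
    constructor
    · rintro ⟨h, h', -⟩; exact ⟨h', h⟩
    · rintro ⟨h, h'⟩; exact ⟨h', h, h'.trans hx.2⟩
  have h2 : ∀ y ∈ Ioo a b, ∫ x, {p : ℝ × ℝ | p.2 < p.1}.indicator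
      (fun p => η' p.1 * v p.2) (x, y) ∂μ = v y * η b - v y * η y := by
    intro y hy
    have e : (fun x => {p : ℝ × ℝ | p.2 < p.1}.indicator (fun p => η' p.1 * v p.2) (x, y)) =
        (Ioi y).indicator fun x => η' x * v y := by
      funext x
      by_cases h : y < x <;> simp [indicator, h]
    have e2 : Ioi y ∩ Ioo a b = Ioo y b := by
      ext x
      simp only [mem_inter_iff, mem_Ioi, mem_Ioo]
      constructor
      · rintro ⟨h, -, h'⟩; exact ⟨h, h'⟩
      · rintro ⟨h, h'⟩; exact ⟨h, hy.1.trans h, h'⟩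
    rw [e, integral_indicator measurableSet_Ioi, hμ, Measure.restrict_restrict measurableSet_Ioi, e2,
      integral_mul_const, ← integral_Ioc_eq_integral_Ioo,
      ← intervalIntegral.integral_of_le hy.2.le]
    have hsub : uIcc y b ⊆ Icc a b := by
      rw [uIcc_of_le hy.2.le]; exact Icc_subset_Icc_left hy.1.le
    rw [intervalIntegral.integral_eq_sub_of_hasDerivAt (fun x hx => hη x (hsub hx))
      ((hc.mono hsub).intervalIntegrable)]
    ring
  have h3 := integral_integral_swap hint
  rw [setIntegral_congr_fun measurableSet_Ioo h1, setIntegral_congr_fun measurableSet_Ioo h2,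
    integral_sub (v.integrable.mul_const _) (v.integrable_mul hηc), integral_mul_const] at h3
  rw [h3, prim_eq v (right_mem_Icc.mpr hab)]
  ring

lemma integral_prim_const_mul (v : L2 a b) (hab : a ≤ b) (c : ℂ) {η η' : ℝ → ℂ}
    (hη : ∀ x ∈ Icc a b, HasDerivAt η (η' x) x) (hc : ContinuousOn η' (Icc a b)) :
    (∫ x in Ioo a b, (c + prim v x) * η' x) + ∫ x in Ioo a b, v x * η x =
      (c + prim v b) * η b - c * η a := by
  have hi' : Integrable η' (volume.restrict (Ioo a b)) :=
    (hc.integrableOn_Icc).mono_set Ioo_subset_Icc_self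
  have hi2 : Integrable (fun x => prim v x * η' x) (volume.restrict (Ioo a b)) :=
    (((continuous_prim v).continuousOn.mul hc).integrableOn_Icc).mono_set Ioo_subset_Icc_self
  simp only [add_mul]
  rw [integral_add (hi'.const_mul c) hi2, integral_const_mul, add_assoc, integral_prim_mul v hab hη hc,
    ← integral_Ioc_eq_integral_Ioo, ← intervalIntegral.integral_of_le hab,
    intervalIntegral.integral_eq_sub_of_hasDerivAt (fun x hx => hη x (by rwa [uIcc_of_le hab] at hx))
      (by rw [← uIcc_of_le hab] at hc; exact hc.intervalIntegrable)]
  ring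

lemma hasWeakDeriv_of_eq (hab : a ≤ b) {u v : L2 a b} {c : ℂ}
    (h : u =ᵐ[volume.restrict (Ioo a b)] fun x => c + prim v x) : HasWeakDeriv u v := by
  intro η hη hs ht
  have hd : ∀ x ∈ Icc a b, HasDerivAt η (deriv η x) x := fun x _ =>
    (hη.differentiable (by simp)).differentiableAt.hasDerivAt
  have h1 := integral_prim_const_mul v hab c hd (hη.continuous_deriv (by simp)).continuousOn
  have ha : η a = 0 := image_eq_zero_of_notMem_tsupport fun h => (ht h).1.false
  have hb : η b = 0 := image_eq_zero_of_notMem_tsupport fun h => (ht h).2.false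
  have h2 : ∫ x in Ioo a b, u x * deriv η x = ∫ x in Ioo a b, (c + prim v x) * deriv η x := by
    refine integral_congr_ae ?_
    filter_upwards [h] with x hx
    rw [hx]
  rw [h2, eq_neg_iff_add_eq_zero, h1, ha, hb]
  ring

/-- A smooth function with integral zero and compact support in `(a, b)` is the derivative of such a
function. -/
lemma exists_primitive_test {η : ℝ → ℂ} (hη : ContDiff ℝ (⊤ : ℕ∞) η)
    (hs : HasCompactSupport η) (ht : tsupport η ⊆ Ioo a b) (h0 : ∫ x in Ioo a b, η x = 0) :
    ∃ ζ : ℝ → ℂ, ContDiff ℝ (⊤ : ℕ∞) ζ ∧ HasCompactSupport ζ ∧ tsupport ζ ⊆ Ioo a b ∧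
      deriv ζ = η := by
  have hη0 : ∀ x, x ∉ Ioo a b → η x = 0 := fun x hx =>
    image_eq_zero_of_notMem_tsupport fun h => hx (ht h)
  rcases (tsupport η).eq_empty_or_nonempty with he | hne
  · rw [tsupport_eq_empty_iff] at he
    exact ⟨0, contDiff_const, HasCompactSupport.zero, by simp, by rw [he]; exact deriv_const' 0⟩
  obtain ⟨c, hcm, hc⟩ := hs.isCompact.exists_isLeast hne
  obtain ⟨d, hdm, hd⟩ := hs.isCompact.exists_isGreatest hne
  have hcη : ∀ x, x < c → η x = 0 := fun x hx =>
    image_eq_zero_of_notMem_tsupport fun h => absurd (hc h) (not_le.mpr hx)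
  have hdη : ∀ x, d < x → η x = 0 := fun x hx =>
    image_eq_zero_of_notMem_tsupport fun h => absurd (hd h) (not_le.mpr hx)
  have hder : ∀ x, HasDerivAt (fun x => ∫ t in a..x, η t) (η x) x := fun x =>
    intervalIntegral.integral_hasDerivAt_right (hη.continuous.intervalIntegrable _ _)
      hη.continuous.aestronglyMeasurable.stronglyMeasurableAtFilter hη.continuous.continuousAt
  have hderiv : deriv (fun x => ∫ t in a..x, η t) = η := funext fun x => (hder x).deriv
  have hac : a < c := (ht hcm).1
  have hdb : d < b := (ht hdm).2
  have hcd : c ≤ d := hc hdm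
  have hab : a < b := by linarith
  have hz1 : ∀ x, x < c → ∫ t in a..x, η t = 0 := by
    intro x hx
    rw [intervalIntegral.integral_congr (g := fun _ => 0) fun t ht => hcη t ?_]
    · simp
    · rcases le_total a x with h | h
      · rw [uIcc_of_le h] at ht; linarith [ht.2]
      · rw [uIcc_of_ge h] at ht; linarith [ht.2]
  have hz2 : ∀ x, d < x → ∫ t in a..x, η t = 0 := by
    intro x hx
    have h1 : ∫ t in a..b, η t = 0 := by
      rw [intervalIntegral.integral_of_le hab.le, integral_Ioc_eq_integral_Ioo, h0]
    have h2 : ∫ t in b..x, η t = 0 := by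
      rw [intervalIntegral.integral_congr (g := fun _ => 0) fun t ht => hdη t ?_]
      · simp
      · rcases le_total b x with h | h
        · rw [uIcc_of_le h] at ht; linarith [ht.1]
        · rw [uIcc_of_ge h] at ht; linarith [ht.1]
    rw [← intervalIntegral.integral_add_adjacent_intervals (b := b)
      (hη.continuous.intervalIntegrable _ _) (hη.continuous.intervalIntegrable _ _), h1, h2, add_zero]
  have hsub : tsupport (fun x => ∫ t in a..x, η t) ⊆ Icc c d := by
    refine closure_minimal (fun x hx => ?_) isClosed_Icc
    by_contra h
    rw [mem_Icc, not_and_or, not_le, not_le] at h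
    rcases h with h | h
    · exact hx (hz1 x h)
    · exact hx (hz2 x h)
  refine ⟨fun x => ∫ t in a..x, η t, ?_, ?_, ?_, hderiv⟩
  · rw [contDiff_infty_iff_deriv]
    exact ⟨fun x => (hder x).differentiableAt, by rw [hderiv]; exact hη⟩
  · exact HasCompactSupport.of_support_subset_isCompact isCompact_Icc
      ((subset_tsupport _).trans hsub)
  · exact hsub.trans fun x hx => ⟨hac.trans_le hx.1, hx.2.trans_lt hdb⟩

lemma ae_eq_zero_of_integral_test {w : ℝ → ℂ} (hw : Integrable w (volume.restrict (Ioo a b)))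
    (h : ∀ η : ℝ → ℂ, ContDiff ℝ (⊤ : ℕ∞) η → HasCompactSupport η → tsupport η ⊆ Ioo a b →
      ∫ x in Ioo a b, w x * η x = 0) : w =ᵐ[volume.restrict (Ioo a b)] 0 := by
  have h1 : ∀ᵐ x, x ∈ Ioo a b → w x = 0 := by
    refine isOpen_Ioo.ae_eq_zero_of_integral_contDiff_smul_eq_zero
      (IntegrableOn.locallyIntegrableOn hw) fun g hg hgs hgt => ?_
    have hts : tsupport (fun x => (g x : ℂ)) ⊆ tsupport g :=
      closure_mono fun x hx hx0 => hx (by simp [hx0])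
    have h2 := h (fun x => (g x : ℂ)) (Complex.ofRealCLM.contDiff.comp hg)
      (hgs.comp_left (g := fun x : ℝ => (x : ℂ)) rfl) (hts.trans hgt)
    rw [← h2, setIntegral_eq_integral_of_forall_compl_eq_zero]
    · congr 1 with x
      rw [Complex.real_smul, mul_comm]
    · intro x hx
      have : g x = 0 := image_eq_zero_of_notMem_tsupport fun h => hx (hgt h)
      simp [this]
  rw [Filter.EventuallyEq, ae_restrict_iff' measurableSet_Ioo]
  exact h1

lemma exists_test_integral_one (hab : a < b) : ∃ η : ℝ → ℂ, ContDiff ℝ (⊤ : ℕ∞) η ∧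
    HasCompactSupport η ∧ tsupport η ⊆ Ioo a b ∧ ∫ x in Ioo a b, η x = 1 := by
  have hr : 0 < (b - a) / 4 := by linarith
  set f : ContDiffBump ((a + b) / 2) := ⟨(b - a) / 8, (b - a) / 4, by linarith, by linarith⟩ with hf
  have hsupp : tsupport (fun x => ((f.normed volume x : ℝ) : ℂ)) ⊆ Ioo a b := by
    have hs : Function.support (fun x => ((f.normed volume x : ℝ) : ℂ)) ⊆
        Function.support (f.normed volume) := fun x hx hx0 => hx (by simp [hx0])
    refine (closure_mono hs).trans ?_
    change tsupport (f.normed volume) ⊆ _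
    rw [f.tsupport_normed_eq, Real.closedBall_eq_Icc]
    refine fun x hx => ?_
    have hro : f.rOut = (b - a) / 4 := rfl
    rw [hro] at hx
    exact ⟨by linarith [hx.1], by linarith [hx.2]⟩
  refine ⟨fun x => (f.normed volume x : ℂ), Complex.ofRealCLM.contDiff.comp f.contDiff_normed,
    f.hasCompactSupport_normed.comp_left (g := fun x : ℝ => (x : ℂ)) rfl, hsupp, ?_⟩
  rw [setIntegral_eq_integral_of_forall_compl_eq_zero]
  · rw [integral_complex_ofReal, f.integral_normed]; simp
  · intro x hx
    exact image_eq_zero_of_notMem_tsupport (f := fun x => (f.normed volume x : ℂ))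
      fun h => hx (hsupp h)

/-- Du Bois-Reymond's lemma: a test function minus its mean times a fixed bump `η₀` has integral
zero and is thus the derivative of a test function. -/
lemma exists_eq_const_of_weakDeriv_zero (hab : a < b) {w : ℝ → ℂ}
    (hw : Integrable w (volume.restrict (Ioo a b)))
    (h : ∀ η : ℝ → ℂ, ContDiff ℝ (⊤ : ℕ∞) η → HasCompactSupport η → tsupport η ⊆ Ioo a b →
      ∫ x in Ioo a b, w x * deriv η x = 0) : ∃ c, w =ᵐ[volume.restrict (Ioo a b)] fun _ => c := by
  obtain ⟨η₀, hη₀, hs₀, ht₀, h₀⟩ := exists_test_integral_one hab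
  have hint : ∀ η : ℝ → ℂ, Continuous η → HasCompactSupport η →
      Integrable (fun x => w x * η x) (volume.restrict (Ioo a b)) := by
    intro η hη hs
    obtain ⟨C, hC⟩ := hs.exists_bound_of_continuous hη
    exact hw.mul_bdd (c := C) hη.aestronglyMeasurable (.of_forall hC)
  set k := ∫ x in Ioo a b, w x * η₀ x with hk
  refine ⟨k, ?_⟩
  have hwk : Integrable (fun x => w x - k) (volume.restrict (Ioo a b)) :=
    hw.sub (integrable_const k)
  have h1 : (fun x => w x - k) =ᵐ[volume.restrict (Ioo a b)] 0 := by
    refine ae_eq_zero_of_integral_test hwk fun η hη hs ht => ?_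
    set m := ∫ x in Ioo a b, η x with hm
    have hi : Integrable η (volume.restrict (Ioo a b)) :=
      (hη.continuous.integrable_of_hasCompactSupport hs).integrableOn
    have hi₀ : Integrable η₀ (volume.restrict (Ioo a b)) :=
      (hη₀.continuous.integrable_of_hasCompactSupport hs₀).integrableOn
    have hs₀' : HasCompactSupport fun x => m * η₀ x := hs₀.mul_left (f := fun _ => m)
    have hs' : HasCompactSupport (fun x => η x - m * η₀ x) := by
      have := hs.add (f := η) (f' := fun x => -(m * η₀ x)) (hs₀'.comp_left (g := fun z => -z) neg_zero)
      simpa [sub_eq_add_neg, Pi.add_def] using this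
    have ht' : tsupport (fun x => η x - m * η₀ x) ⊆ Ioo a b := by
      refine (closure_minimal (t := tsupport η ∪ tsupport η₀) (fun x hx => ?_)
        ((isClosed_tsupport _).union (isClosed_tsupport _))).trans (union_subset ht ht₀)
      by_contra hx'
      rw [mem_union, not_or] at hx'
      apply hx
      simp [image_eq_zero_of_notMem_tsupport hx'.1, image_eq_zero_of_notMem_tsupport hx'.2]
    obtain ⟨ζ, hζ, hζs, hζt, hζd⟩ := exists_primitive_test (a := a) (b := b)
      (hη.sub (contDiff_const.mul hη₀)) hs' ht' (by
        rw [integral_sub hi (hi₀.const_mul m), integral_const_mul, h₀, ← hm]; ring)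
    have h2 := h ζ hζ hζs hζt
    rw [hζd] at h2
    simp only [mul_sub, mul_left_comm _ m] at h2
    rw [integral_sub (hint η hη.continuous hs) ((hint η₀ hη₀.continuous hs₀).const_mul m),
      integral_const_mul, ← hk] at h2
    simp only [sub_mul]
    rw [integral_sub (hint η hη.continuous hs) (hi.const_mul k), integral_const_mul, ← hm]
    linear_combination h2
  filter_upwards [h1] with x hx
  exact sub_eq_zero.mp hx

/-- `u - prim v` has weak derivative zero. The continuous representative obtained here is the source
of all traces. -/
lemma hasWeakDeriv_iff (hab : a < b) {u v : L2 a b} : HasWeakDeriv u v ↔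
    ∃ c, u =ᵐ[volume.restrict (Ioo a b)] fun x => c + prim v x := by
  refine ⟨fun h => ?_, fun ⟨c, hc⟩ => hasWeakDeriv_of_eq hab.le hc⟩
  have hp : Integrable (prim v) (volume.restrict (Ioo a b)) :=
    ((continuous_prim v).continuousOn.integrableOn_Icc (a := a) (b := b)).mono_set Ioo_subset_Icc_self
  obtain ⟨c, hc⟩ := exists_eq_const_of_weakDeriv_zero hab (u.integrable.sub hp)
    fun η hη hs ht => by
      have hd : ∀ x ∈ Icc a b, HasDerivAt η (deriv η x) x := fun x _ =>
        (hη.differentiable (by simp)).differentiableAt.hasDerivAt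
      have hdc := hη.continuous_deriv (by simp)
      have h1 := integral_prim_mul v hab.le hd hdc.continuousOn
      have hb : η b = 0 := image_eq_zero_of_notMem_tsupport fun h => (ht h).2.false
      have h2 := h η hη hs ht
      have hi2 : Integrable (fun x => prim v x * deriv η x) (volume.restrict (Ioo a b)) :=
        (((continuous_prim v).mul hdc).continuousOn.integrableOn_Icc).mono_set Ioo_subset_Icc_self
      simp only [Pi.sub_apply, sub_mul]
      rw [integral_sub (integrable_L2_mul_test u hdc hs.deriv) hi2, h2]
      rw [hb] at h1
      linear_combination -h1
  refine ⟨c, ?_⟩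
  filter_upwards [hc] with x hx
  rw [← hx, Pi.sub_apply, sub_add_cancel]

lemma HasTrace.unique (hab : a < b) {u : L2 a b} {x : ℝ} (hx : x ∈ Icc a b) {c c' : ℂ}
    (h : HasTrace u x c) (h' : HasTrace u x c') : c = c' := by
  obtain ⟨g, hg, hu, rfl⟩ := h
  obtain ⟨g', hg', hu', rfl⟩ := h'
  refine Measure.eqOn_Icc_of_ae_eq volume hab.ne ?_ hg hg' hx
  rw [Measure.restrict_congr_set Ioo_ae_eq_Icc.symm]
  exact hu.symm.trans hu'

lemma hasTrace_of_eq {u v : L2 a b} {c : ℂ}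
    (h : u =ᵐ[volume.restrict (Ioo a b)] fun x => c + prim v x) (x : ℝ) :
    HasTrace u x (c + prim v x) :=
  ⟨_, (continuous_const.add (continuous_prim v)).continuousOn, h, rfl⟩

lemma HasWeakDeriv.integral_mul (hab : a < b) {u v : L2 a b} (h : HasWeakDeriv u v) {ca cb : ℂ}
    (ha : HasTrace u a ca) (hb : HasTrace u b cb) {η η' : ℝ → ℂ}
    (hη : ∀ x ∈ Icc a b, HasDerivAt η (η' x) x) (hc : ContinuousOn η' (Icc a b)) :
    (∫ x in Ioo a b, u x * η' x) + ∫ x in Ioo a b, v x * η x = cb * η b - ca * η a := by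
  obtain ⟨c, hu⟩ := (hasWeakDeriv_iff hab).mp h
  rw [HasTrace.unique hab (left_mem_Icc.mpr hab.le) ha (hasTrace_of_eq hu a),
    HasTrace.unique hab (right_mem_Icc.mpr hab.le) hb (hasTrace_of_eq hu b), prim_left, add_zero,
    ← integral_prim_const_mul v hab.le c hη hc]
  congr 1
  refine integral_congr_ae ?_
  filter_upwards [hu] with x hx
  rw [hx]

lemma HasWeakDeriv.exists_trace (hab : a < b) {u v : L2 a b} (h : HasWeakDeriv u v) (x : ℝ) :
    ∃ c, HasTrace u x c := by
  obtain ⟨c, hu⟩ := (hasWeakDeriv_iff hab).mp h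
  exact ⟨_, hasTrace_of_eq hu x⟩

lemma HasWeakDeriv.unique {u v v' : L2 a b} (h : HasWeakDeriv u v) (h' : HasWeakDeriv u v') :
    v = v' := by
  have h1 : (fun x => v x - v' x) =ᵐ[volume.restrict (Ioo a b)] 0 := by
    refine ae_eq_zero_of_integral_test (v.integrable.sub v'.integrable) fun η hη hs ht => ?_
    simp only [sub_mul]
    rw [integral_sub (integrable_L2_mul_test v hη.continuous hs)
      (integrable_L2_mul_test v' hη.continuous hs), sub_eq_zero, ← neg_inj, ← h η hη hs ht,
      ← h' η hη hs ht]
  refine Lp.ext ?_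
  filter_upwards [h1] with x hx
  exact sub_eq_zero.mp hx

lemma H1.fn_injective : Function.Injective (H1.fn : H1 a b → L2 a b) := by
  rintro ⟨⟨⟨u, v⟩⟩, hu⟩ ⟨⟨⟨u', v'⟩⟩, hu'⟩ (rfl : u = u')
  have : v = v' := HasWeakDeriv.unique hu hu'
  subst this
  rfl

lemma Hhalf.fn_injective : Function.Injective (Hhalf.fn : Hhalf a b → L2 a b) := by
  rintro ⟨⟨⟨u, q⟩⟩, hu⟩ ⟨⟨⟨u', q'⟩⟩, hu'⟩ (rfl : u = u')
  have : q = q' := Lp.ext (Filter.EventuallyEq.trans hu (Filter.EventuallyEq.symm hu'))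
  subst this
  rfl

end WeakDeriv

/-! ### Even periodic extension in the logarithmic variable -/

namespace LogCos

/-- The frequency `π / log (b / a)`. -/
def freq (a b : ℝ) : ℝ := Real.pi / Real.log (b / a)

/-- The logarithmic variable, normalised to range from `0` to `π`. -/
def angle (a b r : ℝ) : ℝ := freq a b * Real.log (r / a)

/-- The even `2π`-periodic function with values in `[0, π]`. -/
def foldAngle (t : ℝ) : ℝ := Real.arccos (Real.cos t)

/-- The point of `[a, b]` whose logarithmic variable is the folding of `t`. -/
def foldPt (a b t : ℝ) : ℝ := a * Real.exp (foldAngle t / freq a b)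

variable {a b : ℝ}

lemma freq_pos (ha : 0 < a) (hab : a < b) : 0 < freq a b :=
  div_pos Real.pi_pos (Real.log_pos ((one_lt_div ha).mpr hab))

lemma freq_mul_log (ha : 0 < a) (hab : a < b) : freq a b * Real.log (b / a) = Real.pi :=
  div_mul_cancel₀ _ (Real.log_pos ((one_lt_div ha).mpr hab)).ne'

@[simp] lemma angle_left (ha : 0 < a) : angle a b a = 0 := by
  rw [angle, div_self ha.ne', Real.log_one, mul_zero]

lemma angle_right (ha : 0 < a) (hab : a < b) : angle a b b = Real.pi := freq_mul_log ha hab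

lemma hasDerivAt_angle (ha : 0 < a) {r : ℝ} (hr : 0 < r) :
    HasDerivAt (angle a b) (freq a b / r) r := by
  have h := (((hasDerivAt_id r).div_const a).log (div_pos hr ha).ne').const_mul (freq a b)
  refine h.congr_deriv ?_
  simp only [id]
  field_simp

lemma continuousOn_angle (ha : 0 < a) : ContinuousOn (angle a b) (Icc a b) := fun _ hr =>
  (hasDerivAt_angle ha (ha.trans_le hr.1)).continuousAt.continuousWithinAt

lemma continuous_foldAngle : Continuous foldAngle := Real.continuous_arccos.comp Real.continuous_cos

lemma continuous_foldPt : Continuous (foldPt a b) := by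
  have := continuous_foldAngle
  unfold foldPt
  fun_prop

lemma foldAngle_neg (t : ℝ) : foldAngle (-t) = foldAngle t := by rw [foldAngle, Real.cos_neg]; rfl

lemma foldPt_neg (t : ℝ) : foldPt a b (-t) = foldPt a b t := by rw [foldPt, foldAngle_neg]; rfl

lemma foldPt_periodic : Function.Periodic (foldPt a b) (2 * Real.pi) := fun t => by
  rw [foldPt, foldPt, foldAngle, foldAngle, Real.cos_add_two_pi]

lemma foldAngle_of_mem {t : ℝ} (ht : t ∈ Icc 0 Real.pi) : foldAngle t = t :=
  Real.arccos_cos ht.1 ht.2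

lemma foldAngle_mem (t : ℝ) : foldAngle t ∈ Icc 0 Real.pi :=
  ⟨Real.arccos_nonneg _, Real.arccos_le_pi _⟩

lemma cos_foldAngle (t : ℝ) : Real.cos (foldAngle t) = Real.cos t :=
  Real.cos_arccos (Real.neg_one_le_cos t) (Real.cos_le_one t)

/-- `cos (n t)` is a Chebyshev polynomial in `cos t`, and folding preserves the cosine. -/
lemma cos_mul_foldAngle (n : ℤ) (t : ℝ) : Real.cos (n * foldAngle t) = Real.cos (n * t) := by
  rw [← Polynomial.Chebyshev.T_real_cos, ← Polynomial.Chebyshev.T_real_cos, cos_foldAngle]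

lemma angle_foldPt (ha : 0 < a) (hab : a < b) (t : ℝ) : angle a b (foldPt a b t) = foldAngle t := by
  have := (freq_pos ha hab).ne'
  rw [angle, foldPt, mul_div_cancel_left₀ _ ha.ne', Real.log_exp]
  field_simp

lemma angle_mem_Ioo (ha : 0 < a) (hab : a < b) {r : ℝ} (hr : r ∈ Ioo a b) :
    angle a b r ∈ Ioo 0 Real.pi := by
  have hf := freq_pos ha hab
  constructor
  · exact mul_pos hf (Real.log_pos ((one_lt_div ha).mpr hr.1))
  · rw [← freq_mul_log ha hab]
    have : 0 < r := ha.trans hr.1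
    exact mul_lt_mul_of_pos_left (Real.log_lt_log (by positivity) (by gcongr; exact hr.2)) hf

lemma foldPt_of_mem (t : ℝ) (ht : t ∈ Icc 0 Real.pi) :
    foldPt a b t = a * Real.exp (t / freq a b) := by rw [foldPt, foldAngle_of_mem ht]

lemma foldPt_angle (ha : 0 < a) (hab : a < b) {r : ℝ} (hr : r ∈ Ioo a b) :
    foldPt a b (angle a b r) = r := by
  have hr0 : 0 < r := ha.trans hr.1
  rw [foldPt_of_mem _ (Ioo_subset_Icc_self (angle_mem_Ioo ha hab hr)), angle,
    mul_div_cancel_left₀ _ (freq_pos ha hab).ne', Real.exp_log (by positivity)]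
  field_simp

lemma foldPt_mem_Ioo (ha : 0 < a) (hab : a < b) {t : ℝ} (ht : t ∈ Ioo 0 Real.pi) :
    foldPt a b t ∈ Ioo a b := by
  have hf := freq_pos ha hab
  rw [foldPt_of_mem t (Ioo_subset_Icc_self ht)]
  constructor
  · exact lt_mul_of_one_lt_right ha (Real.one_lt_exp_iff.mpr (div_pos ht.1 hf))
  · have h1 : t / freq a b < Real.log (b / a) := by
      rw [div_lt_iff₀ hf, mul_comm, freq_mul_log ha hab]; exact ht.2
    calc a * Real.exp (t / freq a b) < a * Real.exp (Real.log (b / a)) := by gcongr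
      _ = b := by
        rw [Real.exp_log (div_pos (ha.trans hab) ha)]; field_simp

lemma injOn_angle (ha : 0 < a) (hab : a < b) : InjOn (angle a b) (Ioo a b) := fun r hr s hs h => by
  rw [← foldPt_angle ha hab hr, h, foldPt_angle ha hab hs]

lemma image_angle (ha : 0 < a) (hab : a < b) : angle a b '' Ioo a b = Ioo 0 Real.pi := by
  refine Subset.antisymm (image_subset_iff.mpr fun r hr => angle_mem_Ioo ha hab hr) fun t ht =>
    ⟨_, foldPt_mem_Ioo ha hab ht, ?_⟩
  rw [angle_foldPt ha hab, foldAngle_of_mem (Ioo_subset_Icc_self ht)]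

/-- The Lipschitz constant of the folding is one. -/
lemma abs_foldAngle_sub_le (s t : ℝ) : |foldAngle s - foldAngle t| ≤ |s - t| := by
  have hs := foldAngle_mem s
  have ht := foldAngle_mem t
  by_contra! h
  have hlt : |s - t| < Real.pi := by
    refine h.trans_le (abs_le.mpr ⟨?_, ?_⟩) <;> linarith [hs.1, hs.2, ht.1, ht.2]
  -- Were the folded points farther apart, the cosine of their distance would be smaller. By the
  -- addition formula it is not: cosines are unchanged and sines are replaced by their absolute
  -- values.
  have h1 : Real.cos (foldAngle s - foldAngle t) < Real.cos (s - t) := by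
    rw [← Real.cos_abs, ← Real.cos_abs (s - t)]
    refine Real.cos_lt_cos_of_nonneg_of_le_pi (abs_nonneg _) (abs_le.mpr ⟨?_, ?_⟩) h <;>
      linarith [hs.1, hs.2, ht.1, ht.2]
  rw [Real.cos_sub, Real.cos_sub, cos_foldAngle, cos_foldAngle] at h1
  have h2 : Real.sin s * Real.sin t ≤ Real.sin (foldAngle s) * Real.sin (foldAngle t) := by
    rw [foldAngle, foldAngle, Real.sin_arccos, Real.sin_arccos, ← Real.abs_sin_eq_sqrt_one_sub_cos_sq,
      ← Real.abs_sin_eq_sqrt_one_sub_cos_sq, ← abs_mul]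
    exact le_abs_self _
  linarith

section Lintegral

open ENNReal

lemma lintegral_comp_foldPt_Ioo (ha : 0 < a) (hab : a < b) (φ : ℝ → ℝ≥0∞) :
    ∫⁻ t in Ioo 0 Real.pi, φ (foldPt a b t) =
      ∫⁻ r in Ioo a b, ENNReal.ofReal (freq a b / r) * φ r := by
  have hf := freq_pos ha hab
  rw [← image_angle ha hab, lintegral_image_eq_lintegral_abs_deriv_mul measurableSet_Ioo
    (fun r hr => (hasDerivAt_angle ha (ha.trans hr.1)).hasDerivWithinAt) (injOn_angle ha hab)]
  refine setLIntegral_congr_fun measurableSet_Ioo fun r hr => ?_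
  have : 0 < r := ha.trans hr.1
  rw [foldPt_angle ha hab hr, abs_of_pos (by positivity)]

lemma lintegral_periodic {φ : ℝ → ℝ≥0∞} (h : Function.Periodic φ (2 * Real.pi)) (c d : ℝ) :
    ∫⁻ t in Ioc c (c + 2 * Real.pi), φ t = ∫⁻ t in Ioc d (d + 2 * Real.pi), φ t := by
  refine (isAddFundamentalDomain_Ioc Real.two_pi_pos c).setLIntegral_eq
    (isAddFundamentalDomain_Ioc Real.two_pi_pos d) φ fun g x => ?_
  obtain ⟨_, n, rfl⟩ := g
  rw [AddSubgroup.vadd_def, vadd_eq_add, add_comm]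
  exact h.zsmul n x

lemma lintegral_comp_foldPt (ha : 0 < a) (hab : a < b) (c : ℝ) (φ : ℝ → ℝ≥0∞) :
    ∫⁻ t in Ioc c (c + 2 * Real.pi), φ (foldPt a b t) =
      ∫⁻ r in Ioo a b, ENNReal.ofReal (2 * freq a b / r) * φ r := by
  have hf := freq_pos ha hab
  have hpi := Real.pi_pos
  have hper : Function.Periodic (fun t => φ (foldPt a b t)) (2 * Real.pi) := fun t => by
    simp only [foldPt_periodic t]
  rw [lintegral_periodic hper c (-Real.pi), show -Real.pi + 2 * Real.pi = Real.pi by ring,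
    ← Ioc_union_Ioc_eq_Ioc (by linarith : -Real.pi ≤ 0) hpi.le,
    lintegral_union measurableSet_Ioc (Ioc_disjoint_Ioc_of_le le_rfl)]
  have h1 : ∫⁻ t in Ioc (-Real.pi) 0, φ (foldPt a b t) = ∫⁻ t in Ioc 0 Real.pi, φ (foldPt a b t) := by
    have h := (Measure.measurePreserving_neg (volume : Measure ℝ)).setLIntegral_comp_preimage_emb
      (MeasurableEquiv.neg ℝ).measurableEmbedding (fun t => φ (foldPt a b t)) (Ico 0 Real.pi)
    simp only [foldPt_neg] at h
    have hpre : (Neg.neg : ℝ → ℝ) ⁻¹' Ico 0 Real.pi = Ioc (-Real.pi) 0 := by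
      ext t; simp only [mem_preimage, mem_Ico, mem_Ioc]; constructor <;> rintro ⟨h, h'⟩ <;>
        constructor <;> linarith
    rw [hpre] at h
    rw [h]
    exact setLIntegral_congr Ico_ae_eq_Ioc
  rw [h1, setLIntegral_congr Ioo_ae_eq_Ioc.symm, lintegral_comp_foldPt_Ioo ha hab, ← two_mul,
    ← lintegral_const_mul' _ _ (by simp)]
  refine setLIntegral_congr_fun measurableSet_Ioo fun r hr => ?_
  have : 0 < r := ha.trans hr.1
  rw [← mul_assoc, mul_div_assoc, ENNReal.ofReal_mul zero_le_two, ENNReal.ofReal_ofNat]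

/-- The image of Lebesgue measure under the folding. -/
lemma map_foldPt (ha : 0 < a) (hab : a < b) (c : ℝ) :
    Measure.map (foldPt a b) (volume.restrict (Ioc c (c + 2 * Real.pi))) =
      (volume.restrict (Ioo a b)).withDensity fun r => ENNReal.ofReal (2 * freq a b / r) := by
  ext s hs
  rw [Measure.map_apply continuous_foldPt.measurable hs, withDensity_apply _ hs,
    ← lintegral_indicator_one (continuous_foldPt.measurable hs)]
  have h := lintegral_comp_foldPt ha hab c (s.indicator 1)
  have e : (fun t => s.indicator (1 : ℝ → ℝ≥0∞) (foldPt a b t)) =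
      (foldPt a b ⁻¹' s).indicator 1 := by
    funext t; simp only [indicator, mem_preimage]; rfl
  rw [e] at h
  rw [h, ← lintegral_indicator hs]
  congr 1 with r
  by_cases hr : r ∈ s <;> simp [hr]

end Lintegral

lemma density_le (ha : 0 < a) (hab : a < b) :
    (volume.restrict (Ioo a b)).withDensity (fun r => ENNReal.ofReal (2 * freq a b / r)) ≤
      ENNReal.ofReal (2 * freq a b / a) • volume.restrict (Ioo a b) := by
  have hf := freq_pos ha hab
  rw [← withDensity_const]
  refine withDensity_mono ?_
  filter_upwards [ae_restrict_mem measurableSet_Ioo] with r hr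
  refine ENNReal.ofReal_le_ofReal ?_
  gcongr
  exact hr.1.le

lemma memLp_comp_foldPt (ha : 0 < a) (hab : a < b) (f : L2 a b) (c : ℝ) :
    MemLp (fun t => f (foldPt a b t)) 2 (volume.restrict (Ioc c (c + 2 * Real.pi))) := by
  have h : MemLp f 2 (Measure.map (foldPt a b) (volume.restrict (Ioc c (c + 2 * Real.pi)))) := by
    rw [map_foldPt ha hab]
    exact (Lp.memLp f).of_measure_le_smul ENNReal.ofReal_ne_top (density_le ha hab)
  exact h.comp_of_map continuous_foldPt.aemeasurable

lemma integral_comp_foldPt (ha : 0 < a) (hab : a < b) {E : Type*} [NormedAddCommGroup E]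
    [NormedSpace ℝ E] {φ : ℝ → E} (hφ : AEStronglyMeasurable φ (volume.restrict (Ioo a b))) (c : ℝ) :
    ∫ t in c..c + 2 * Real.pi, φ (foldPt a b t) = ∫ r in Ioo a b, (2 * freq a b / r) • φ r := by
  have hf := freq_pos ha hab
  rw [intervalIntegral.integral_of_le (by linarith [Real.pi_pos]),
    ← integral_map continuous_foldPt.aemeasurable, map_foldPt ha hab,
    integral_withDensity_eq_integral_toReal_smul₀ (by fun_prop) (by simp)]
  · refine setIntegral_congr_fun measurableSet_Ioo fun r hr => ?_
    have : 0 < r := ha.trans hr.1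
    rw [ENNReal.toReal_ofReal (by positivity)]
  · rw [map_foldPt ha hab]
    exact hφ.mono_ac (withDensity_absolutelyContinuous _ _)

/-! ### Fourier coefficients and Parseval's identity -/

/-- The `n`-th cosine coefficient with respect to `dr / r`. -/
def cosCoeff (f : L2 a b) (n : ℕ) : ℂ := ∫ r in Ioo a b, f r * (Real.cos (n * angle a b r) / r : ℝ)

lemma hasSum_sq_fourier {G : ℝ → ℂ} (hG : MemLp G 2 (volume.restrict (Ioc (-Real.pi) Real.pi))) :
    HasSum (fun k : ℤ => ‖∫ t in (-Real.pi)..Real.pi, Complex.exp (-(k * t * Complex.I)) * G t‖ ^ 2)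
      (2 * Real.pi * ∫ t in (-Real.pi)..Real.pi, ‖G t‖ ^ 2) := by
  have hpi := Real.pi_pos
  have h := (hasSum_sq_fourierCoeffOn (by linarith : -Real.pi < Real.pi) hG).mul_left
    ((2 * Real.pi) ^ 2)
  have e : Real.pi - -Real.pi = 2 * Real.pi := by ring
  refine h.of_eq (fun k => ?_) ?_
  · rw [fourierCoeffOn_eq_integral, norm_smul]
    have : ‖1 / (Real.pi - -Real.pi)‖ = 1 / (2 * Real.pi) := by
      rw [e, Real.norm_of_nonneg (by positivity)]
    rw [this, ← mul_pow, ← mul_assoc, mul_one_div_cancel (by positivity), one_mul]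
    congr 2
    refine intervalIntegral.integral_congr fun t _ => ?_
    simp only [fourier_coe_apply, smul_eq_mul]
    congr 2
    have : (Real.pi : ℂ) ≠ 0 := by exact_mod_cast hpi.ne'
    push_cast
    field_simp
    ring
  · rw [e, smul_eq_mul]
    field_simp

lemma aestronglyMeasurable_mul_cos (f : L2 a b) (n : ℕ) : AEStronglyMeasurable
    (fun r => f r * ((Real.cos (n * angle a b r) : ℝ) : ℂ)) (volume.restrict (Ioo a b)) := by
  refine (Lp.aestronglyMeasurable f).mul ?_
  refine (Measurable.complex_ofReal ?_).aestronglyMeasurable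
  unfold angle
  fun_prop

lemma intervalIntegrable_of_memLp {G : ℝ → ℂ}
    (hG : MemLp G 2 (volume.restrict (Ioc (-Real.pi) Real.pi))) {η : ℝ → ℂ} (hη : Continuous η) :
    IntervalIntegrable (fun t => η t * G t) volume (-Real.pi) Real.pi := by
  rw [intervalIntegrable_iff_integrableOn_Ioc_of_le (by linarith [Real.pi_pos])]
  obtain ⟨C, hC⟩ := (isCompact_Icc (a := -Real.pi) (b := Real.pi)).exists_bound_of_continuousOn
    hη.continuousOn
  refine (hG.integrable one_le_two).bdd_mul (c := C) hη.aestronglyMeasurable ?_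
  filter_upwards [ae_restrict_mem measurableSet_Ioc] with x hx
  exact hC x (Ioc_subset_Icc_self hx)

/-- The folded function is even, so averaging over `k` and `-k` turns the exponential into a cosine.
Folding covers `(a, b)` twice with density `freq / r`, hence the factor 2. -/
lemma integral_exp_mul_comp_foldPt (ha : 0 < a) (hab : a < b) (f : L2 a b) (k : ℤ) :
    ∫ t in (-Real.pi)..Real.pi, Complex.exp (-(k * t * Complex.I)) * f (foldPt a b t) =
      2 * freq a b * cosCoeff f k.natAbs := by
  have e : -Real.pi + 2 * Real.pi = Real.pi := by ring
  have hG := memLp_comp_foldPt ha hab f (-Real.pi)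
  rw [e] at hG
  have h1 : ∫ t in (-Real.pi)..Real.pi, Complex.exp (-(k * t * Complex.I)) * f (foldPt a b t) =
      ∫ t in (-Real.pi)..Real.pi, Complex.exp (k * t * Complex.I) * f (foldPt a b t) := by
    have h := intervalIntegral.integral_comp_neg (a := -Real.pi) (b := Real.pi)
      (fun t : ℝ => Complex.exp (-(k * t * Complex.I)) * f (foldPt a b t))
    rw [neg_neg] at h
    rw [← h]
    refine intervalIntegral.integral_congr fun t _ => ?_
    simp only [foldPt_neg]
    push_cast
    ring_nf
  have h2 : ∫ t in (-Real.pi)..Real.pi, Complex.exp (-(k * t * Complex.I)) * f (foldPt a b t) =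
      ∫ t in (-Real.pi)..Real.pi, f (foldPt a b t) *
        ((Real.cos (k.natAbs * angle a b (foldPt a b t)) : ℝ) : ℂ) := by
    have h3 : (2 : ℂ) * ∫ t in (-Real.pi)..Real.pi, Complex.exp (-(k * t * Complex.I)) *
        f (foldPt a b t) = 2 * ∫ t in (-Real.pi)..Real.pi, f (foldPt a b t) *
        ((Real.cos (k.natAbs * angle a b (foldPt a b t)) : ℝ) : ℂ) := by
      rw [two_mul]
      nth_rw 2 [h1]
      rw [← intervalIntegral.integral_add
        (intervalIntegrable_of_memLp hG (by fun_prop)) (intervalIntegrable_of_memLp hG (by fun_prop)),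
        ← intervalIntegral.integral_const_mul]
      refine intervalIntegral.integral_congr fun t _ => ?_
      simp only [angle_foldPt ha hab]
      have h4 : Real.cos (k.natAbs * foldAngle t) = Real.cos (k * t) := by
        rw [← cos_mul_foldAngle, Nat.cast_natAbs, Int.cast_abs]
        rcases abs_cases (k : ℝ) with h | h
        · rw [h.1]
        · rw [h.1, neg_mul, Real.cos_neg]
      rw [h4, Complex.ofReal_cos, Complex.cos]
      push_cast
      ring_nf
    exact mul_left_cancel₀ two_ne_zero h3
  rw [h2]
  have h5 := integral_comp_foldPt ha hab (aestronglyMeasurable_mul_cos f k.natAbs) (-Real.pi)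
  rw [e] at h5
  rw [h5, cosCoeff, ← integral_const_mul]
  refine setIntegral_congr_fun measurableSet_Ioo fun r hr => ?_
  simp only [Complex.real_smul]
  push_cast
  ring

lemma norm_exp_sub_one_sq (x : ℝ) : ‖Complex.exp (x * Complex.I) - 1‖ ^ 2 = 4 * Real.sin (x / 2) ^ 2 := by
  rw [Complex.sq_norm, Complex.normSq_apply, Complex.sub_re, Complex.sub_im,
    Complex.exp_ofReal_mul_I_re, Complex.exp_ofReal_mul_I_im]
  have h1 : Real.cos x = 1 - 2 * Real.sin (x / 2) ^ 2 := by
    have := Real.cos_two_mul (x / 2)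
    rw [Real.cos_sq', mul_div_cancel₀ x two_ne_zero] at this
    linarith
  have h2 := Real.sin_sq_add_cos_sq x
  simp only [Complex.one_re, Complex.one_im, sub_zero]
  nlinarith

lemma memLp_comp_foldPt_add (ha : 0 < a) (hab : a < b) (f : L2 a b) (h : ℝ) :
    MemLp (fun t => f (foldPt a b (t + h))) 2 (volume.restrict (Ioc (-Real.pi) Real.pi)) := by
  have h1 := memLp_comp_foldPt ha hab f (-Real.pi + h)
  have h2 := (measurePreserving_add_right (volume : Measure ℝ) h).restrict_preimage
    (measurableSet_Ioc (a := -Real.pi + h) (b := -Real.pi + h + 2 * Real.pi))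
  have h3 : (fun t => t + h) ⁻¹' Ioc (-Real.pi + h) (-Real.pi + h + 2 * Real.pi) =
      Ioc (-Real.pi) Real.pi := by
    ext t; simp only [mem_preimage, mem_Ioc]
    constructor <;> rintro ⟨h, h'⟩ <;> constructor <;> linarith
  rw [h3] at h2
  exact h1.comp_measurePreserving h2

/-- Translation by `h` multiplies the `k`-th Fourier coefficient by `exp (i k h)`. Integrated
against `h⁻²` this will give the Sobolev–Slobodeckij seminorm. -/
lemma hasSum_translate (ha : 0 < a) (hab : a < b) (f : L2 a b) (h : ℝ) :
    HasSum (fun k : ℤ => 4 * Real.sin (k * h / 2) ^ 2 * ((2 * freq a b) ^ 2 * ‖cosCoeff f k.natAbs‖ ^ 2))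
      (2 * Real.pi * ∫ t in (-Real.pi)..Real.pi,
        ‖f (foldPt a b (t + h)) - f (foldPt a b t)‖ ^ 2) := by
  have e : -Real.pi + 2 * Real.pi = Real.pi := by ring
  have hG := memLp_comp_foldPt ha hab f (-Real.pi)
  rw [e] at hG
  have hGh := memLp_comp_foldPt_add ha hab f h
  refine (hasSum_sq_fourier (hGh.sub hG)).of_eq (fun k => ?_) rfl
  have h1 : ∫ t in (-Real.pi)..Real.pi, Complex.exp (-(k * t * Complex.I)) * f (foldPt a b (t + h)) =
      Complex.exp ((k * h : ℝ) * Complex.I) *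
      ∫ t in (-Real.pi)..Real.pi, Complex.exp (-(k * t * Complex.I)) * f (foldPt a b t) := by
    set F : ℝ → ℂ := fun t => Complex.exp (-(k * t * Complex.I)) * f (foldPt a b t) with hF
    have hper : Function.Periodic F (2 * Real.pi) := fun t => by
      simp only [hF, foldPt_periodic t]
      congr 1
      refine Complex.exp_eq_exp_iff_exists_int.mpr ⟨-k, ?_⟩
      push_cast
      ring
    have h2 := hper.intervalIntegral_add_eq (-Real.pi) (-Real.pi + h)
    rw [e] at h2
    rw [h2, ← intervalIntegral.integral_const_mul]
    have h3 := intervalIntegral.integral_comp_add_right (a := -Real.pi) (b := Real.pi)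
      (fun t => Complex.exp ((k * h : ℝ) * Complex.I) * F t) h
    rw [show -Real.pi + h + 2 * Real.pi = Real.pi + h by ring, ← h3]
    refine intervalIntegral.integral_congr fun t _ => ?_
    simp only [hF]
    rw [← mul_assoc, ← Complex.exp_add]
    congr 2
    push_cast
    ring
  have h2 : ∫ t in (-Real.pi)..Real.pi, Complex.exp (-(k * t * Complex.I)) *
      ((fun t => f (foldPt a b (t + h))) - fun t => f (foldPt a b t)) t =
      (Complex.exp ((k * h : ℝ) * Complex.I) - 1) * (2 * freq a b * cosCoeff f k.natAbs) := by
    rw [← integral_exp_mul_comp_foldPt ha hab, sub_mul, one_mul, ← h1, ← intervalIntegral.integral_sub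
      (intervalIntegrable_of_memLp hGh (by fun_prop)) (intervalIntegrable_of_memLp hG (by fun_prop))]
    simp only [Pi.sub_apply, mul_sub]
  have h3 := norm_exp_sub_one_sq (k * h)
  rw [h2, norm_mul, norm_mul, norm_mul, Complex.norm_ofNat,
    Complex.norm_of_nonneg (freq_pos ha hab).le]
  linear_combination (-((2 * freq a b) ^ 2 * ‖cosCoeff f k.natAbs‖ ^ 2)) * h3

lemma hasSum_cosCoeff (ha : 0 < a) (hab : a < b) (f : L2 a b) :
    HasSum (fun k : ℤ => (2 * freq a b) ^ 2 * ‖cosCoeff f k.natAbs‖ ^ 2)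
      (2 * Real.pi * ∫ r in Ioo a b, (2 * freq a b / r) * ‖f r‖ ^ 2) := by
  have e : -Real.pi + 2 * Real.pi = Real.pi := by ring
  have hG := memLp_comp_foldPt ha hab f (-Real.pi)
  rw [e] at hG
  refine (hasSum_sq_fourier hG).of_eq (fun k => ?_) ?_
  · rw [integral_exp_mul_comp_foldPt ha hab, norm_mul, norm_mul, Complex.norm_ofNat,
      Complex.norm_of_nonneg (freq_pos ha hab).le]
    ring
  · have h5 := integral_comp_foldPt ha hab (φ := fun r => ‖f r‖ ^ 2)
      ((Lp.aestronglyMeasurable f).norm.pow 2) (-Real.pi)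
    rw [e] at h5
    rw [h5]
    rfl

end LogCos

/-! ### Multiplication operators -/

section MulOp

variable {a b : ℝ}

lemma memLp_of_continuousOn {η : ℝ → ℂ} (hη : ContinuousOn η (Icc a b)) (p : ENNReal) :
    MemLp η p (volume.restrict (Ioo a b)) := by
  obtain ⟨C, hC⟩ := isCompact_Icc.exists_bound_of_continuousOn hη
  refine MemLp.of_bound ((hη.mono Ioo_subset_Icc_self).aestronglyMeasurable measurableSet_Ioo) C ?_
  filter_upwards [ae_restrict_mem measurableSet_Ioo] with x hx
  exact hC x (Ioo_subset_Icc_self hx)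

/-- Multiplication by a bounded function. -/
def mulOp {m : ℝ → ℂ} (hm : MemLp m ⊤ (volume.restrict (Ioo a b))) : L2 a b →L[ℂ] L2 a b :=
  (ContinuousLinearMap.mul ℂ ℂ).holderL (volume.restrict (Ioo a b)) ⊤ 2 2 (hm.toLp m)

lemma mulOp_coe {m : ℝ → ℂ} (hm : MemLp m ⊤ (volume.restrict (Ioo a b))) (f : L2 a b) :
    mulOp hm f =ᵐ[volume.restrict (Ioo a b)] fun r => m r * f r := by
  have h : mulOp hm f =ᵐ[volume.restrict (Ioo a b)] fun r => hm.toLp m r * f r :=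
    (ContinuousLinearMap.mul ℂ ℂ).coeFn_holder (r := 2) (hm.toLp m) f
  filter_upwards [h, hm.coeFn_toLp] with r h1 h2
  rw [h1, h2]

lemma mulOp_mulOp {m m' m'' : ℝ → ℂ} (hm : MemLp m ⊤ (volume.restrict (Ioo a b)))
    (hm' : MemLp m' ⊤ (volume.restrict (Ioo a b))) (hm'' : MemLp m'' ⊤ (volume.restrict (Ioo a b)))
    (h : ∀ r ∈ Ioo a b, m r * m' r = m'' r) (f : L2 a b) : mulOp hm (mulOp hm' f) = mulOp hm'' f := by
  refine Lp.ext ?_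
  filter_upwards [mulOp_coe hm (mulOp hm' f), mulOp_coe hm' f, mulOp_coe hm'' f,
    ae_restrict_mem measurableSet_Ioo] with r h1 h2 h3 hr
  rw [h1, h2, h3, ← mul_assoc, h r hr]

lemma mulOp_eq_self {m : ℝ → ℂ} (hm : MemLp m ⊤ (volume.restrict (Ioo a b)))
    (h : ∀ r ∈ Ioo a b, m r = 1) (f : L2 a b) : mulOp hm f = f := by
  refine Lp.ext ?_
  filter_upwards [mulOp_coe hm f, ae_restrict_mem measurableSet_Ioo] with r h1 hr
  rw [h1, h r hr, one_mul]

lemma L2.inner_eq (f g : L2 a b) : inner ℂ f g = ∫ r in Ioo a b, g r * conj (f r) := by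
  rw [MeasureTheory.L2.inner_def]
  rfl

lemma continuousOn_sqrt_inv (ha : 0 < a) : ContinuousOn (fun r : ℝ => (((√r)⁻¹ : ℝ) : ℂ)) (Icc a b) :=
  Complex.continuous_ofReal.comp_continuousOn <| Real.continuous_sqrt.continuousOn.inv₀ fun _ hr =>
    (Real.sqrt_pos.mpr (ha.trans_le hr.1)).ne'

lemma memLp_sqrt_inv (ha : 0 < a) :
    MemLp (fun r : ℝ => (((√r)⁻¹ : ℝ) : ℂ)) ⊤ (volume.restrict (Ioo a b)) :=
  memLp_of_continuousOn (continuousOn_sqrt_inv ha) _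

lemma memLp_sqrt : MemLp (fun r : ℝ => ((√r : ℝ) : ℂ)) ⊤ (volume.restrict (Ioo a b)) :=
  memLp_of_continuousOn (by fun_prop) _

lemma memLp_id : MemLp (fun r : ℝ => (r : ℂ)) ⊤ (volume.restrict (Ioo a b)) :=
  memLp_of_continuousOn (by fun_prop) _

lemma continuousOn_ofReal_inv (ha : 0 < a) : ContinuousOn (fun r : ℝ => ((r : ℂ))⁻¹) (Icc a b) :=
  ContinuousOn.inv₀ (by fun_prop) fun r hr => by exact_mod_cast (ha.trans_le hr.1).ne'

lemma memLp_inv (ha : 0 < a) : MemLp (fun r : ℝ => ((r : ℂ))⁻¹) ⊤ (volume.restrict (Ioo a b)) :=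
  memLp_of_continuousOn (continuousOn_ofReal_inv ha) _

/-- Multiplication by `r ^ (-1/2)` as an isomorphism. -/
def sqrtInvEquiv (b : ℝ) (ha : 0 < a) : L2 a b ≃L[ℂ] L2 a b :=
  ContinuousLinearEquiv.equivOfInverse (mulOp (memLp_sqrt_inv ha)) (mulOp memLp_sqrt)
    (fun f => by
      rw [mulOp_mulOp _ _ (memLp_of_continuousOn (η := fun _ => 1) continuousOn_const ⊤) ?_ f,
        mulOp_eq_self _ fun _ _ => rfl]
      intro r hr
      rw [← Complex.ofReal_mul, mul_inv_cancel₀ (Real.sqrt_pos.mpr (ha.trans hr.1)).ne',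
        Complex.ofReal_one])
    (fun f => by
      rw [mulOp_mulOp _ _ (memLp_of_continuousOn (η := fun _ => 1) continuousOn_const ⊤) ?_ f,
        mulOp_eq_self _ fun _ _ => rfl]
      intro r hr
      rw [← Complex.ofReal_mul, inv_mul_cancel₀ (Real.sqrt_pos.mpr (ha.trans hr.1)).ne',
        Complex.ofReal_one])

end MulOp

/-! ### The cosine basis -/

namespace LogCos

variable {a b : ℝ}

lemma integral_cos_angle (ha : 0 < a) (hab : a < b) (k : ℤ) :
    ∫ r in Ioo a b, Real.cos (k * angle a b r) / r = if k = 0 then Real.pi / freq a b else 0 := by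
  have hf := freq_pos ha hab
  have hpos : ∀ r ∈ uIcc a b, 0 < r := fun r hr => by
    rw [uIcc_of_le hab.le] at hr; exact ha.trans_le hr.1
  rw [← integral_Ioc_eq_integral_Ioo, ← intervalIntegral.integral_of_le hab.le]
  have hc : ContinuousOn (fun r => Real.cos (k * angle a b r) / r) (uIcc a b) := by
    have := continuousOn_angle (b := b) ha
    rw [← uIcc_of_le hab.le] at this
    exact ContinuousOn.div (by fun_prop) (by fun_prop) fun r hr => (hpos r hr).ne'
  split_ifs with h
  · subst h
    rw [intervalIntegral.integral_eq_sub_of_hasDerivAt (f := fun r => angle a b r / freq a b)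
      (fun r hr => ?_) hc.intervalIntegrable, angle_right ha hab, angle_left ha]
    · ring
    · refine ((hasDerivAt_angle ha (hpos r hr)).div_const _).congr_deriv ?_
      have := hpos r hr
      simp
      field_simp
  · have hk : (k : ℝ) ≠ 0 := by exact_mod_cast h
    rw [intervalIntegral.integral_eq_sub_of_hasDerivAt
      (f := fun r => Real.sin (k * angle a b r) / (k * freq a b))
      (fun r hr => ?_) hc.intervalIntegrable, angle_right ha hab, angle_left ha, Real.sin_int_mul_pi]
    · simp
    · refine ((((hasDerivAt_angle ha (hpos r hr)).const_mul (k : ℝ)).sin).div_const _).congr_deriv ?_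
      have := hpos r hr
      field_simp

/-- The normalising constants. -/
def cn (a b : ℝ) (n : ℕ) : ℝ := if n = 0 then √(freq a b / Real.pi) else √(2 * freq a b / Real.pi)

lemma cn_pos (ha : 0 < a) (hab : a < b) (n : ℕ) : 0 < cn a b n := by
  have := freq_pos ha hab
  unfold cn
  split_ifs <;> positivity

lemma cn_le (ha : 0 < a) (hab : a < b) (n : ℕ) : cn a b n ≤ √(2 * freq a b / Real.pi) := by
  have := freq_pos ha hab
  unfold cn
  split_ifs
  · gcongr; linarith
  · exact le_rfl

lemma cn_sq (ha : 0 < a) (hab : a < b) (n : ℕ) :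
    cn a b n ^ 2 = if n = 0 then freq a b / Real.pi else 2 * freq a b / Real.pi := by
  have := freq_pos ha hab
  unfold cn
  split_ifs <;> exact Real.sq_sqrt (by positivity)

/-- The normalised cosine modes. -/
def mode (a b : ℝ) (n : ℕ) (r : ℝ) : ℝ := cn a b n * Real.cos (n * angle a b r)

/-- The normalised sine modes. -/
def sinMode (a b : ℝ) (n : ℕ) (r : ℝ) : ℝ := cn a b n * Real.sin (n * angle a b r)

lemma continuousOn_mode (ha : 0 < a) (n : ℕ) : ContinuousOn (mode a b n) (Icc a b) := by
  have := continuousOn_angle (b := b) ha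
  unfold mode
  fun_prop

lemma continuousOn_sinMode (ha : 0 < a) (n : ℕ) : ContinuousOn (sinMode a b n) (Icc a b) := by
  have := continuousOn_angle (b := b) ha
  unfold sinMode
  fun_prop

lemma integrable_cos_angle (ha : 0 < a) (k : ℤ) :
    Integrable (fun r => Real.cos (k * angle a b r) / r) (volume.restrict (Ioo a b)) := by
  have hc : ContinuousOn (fun r => Real.cos (k * angle a b r) / r) (Icc a b) := by
    have := continuousOn_angle (b := b) ha
    exact ContinuousOn.div (by fun_prop) (by fun_prop) fun r hr => (ha.trans_le hr.1).ne'
  exact hc.integrableOn_Icc.mono_set Ioo_subset_Icc_self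

lemma integral_mode_mul (ha : 0 < a) (hab : a < b) (n m : ℕ) :
    ∫ r in Ioo a b, mode a b n r * mode a b m r / r = if n = m then 1 else 0 := by
  have hf := freq_pos ha hab
  have e : ∀ r, mode a b n r * mode a b m r / r = cn a b n * cn a b m / 2 *
      (Real.cos (((n : ℤ) - m : ℤ) * angle a b r) / r +
        Real.cos (((n : ℤ) + m : ℤ) * angle a b r) / r) := by
    intro r
    rw [mode, mode]
    push_cast
    rw [sub_mul, add_mul, Real.cos_sub, Real.cos_add]
    ring
  simp only [e]
  rw [integral_const_mul, integral_add (integrable_cos_angle ha _) (integrable_cos_angle ha _),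
    integral_cos_angle ha hab, integral_cos_angle ha hab]
  by_cases h : n = m
  · subst h
    have h2 := cn_sq ha hab n
    rw [if_pos rfl, if_pos (by ring), ← sq, h2]
    by_cases h0 : n = 0
    · subst h0
      simp only [Nat.cast_zero, add_zero, if_true]
      field_simp
      norm_num
    · rw [if_neg h0, if_neg (by omega)]
      field_simp
      norm_num
  · rw [if_neg h, if_neg (by omega), if_neg (by omega)]
    ring

lemma integral_sinMode_mul (ha : 0 < a) (hab : a < b) (n m : ℕ) :
    ∫ r in Ioo a b, sinMode a b (n + 1) r * sinMode a b (m + 1) r / r = if n = m then 1 else 0 := by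
  have hf := freq_pos ha hab
  have e : ∀ r, sinMode a b (n + 1) r * sinMode a b (m + 1) r / r =
      cn a b (n + 1) * cn a b (m + 1) / 2 *
      (Real.cos (((n : ℤ) - m : ℤ) * angle a b r) / r -
        Real.cos (((n : ℤ) + m + 2 : ℤ) * angle a b r) / r) := by
    intro r
    have e1 : (((n : ℤ) - m : ℤ) : ℝ) * angle a b r =
        (n + 1 : ℕ) * angle a b r - (m + 1 : ℕ) * angle a b r := by push_cast; ring
    have e2 : (((n : ℤ) + m + 2 : ℤ) : ℝ) * angle a b r =
        (n + 1 : ℕ) * angle a b r + (m + 1 : ℕ) * angle a b r := by push_cast; ring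
    rw [sinMode, sinMode, e1, e2, Real.cos_sub, Real.cos_add]
    ring
  simp only [e]
  rw [integral_const_mul, integral_sub (integrable_cos_angle ha _) (integrable_cos_angle ha _),
    integral_cos_angle ha hab, integral_cos_angle ha hab]
  by_cases h : n = m
  · subst h
    have h2 := cn_sq ha hab (n + 1)
    rw [if_pos rfl, if_pos (by ring), ← sq, h2, if_neg (by omega), if_neg (by omega)]
    field_simp
    norm_num
  · rw [if_neg h, if_neg (by omega), if_neg (by omega)]
    ring

/-- A real continuous function, divided by the square root of the variable, as an element of
`L²`. -/
def weighted (ha : 0 < a) {η : ℝ → ℝ} (hη : ContinuousOn η (Icc a b)) : L2 a b :=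
  (memLp_of_continuousOn (η := fun r => (((√r)⁻¹ : ℝ) : ℂ) * η r)
    ((continuousOn_sqrt_inv ha).mul (Complex.continuous_ofReal.comp_continuousOn hη)) 2).toLp

lemma inner_weighted (ha : 0 < a) {η : ℝ → ℝ} (hη : ContinuousOn η (Icc a b)) (f : L2 a b) :
    inner ℂ (weighted ha hη) f = ∫ r in Ioo a b, f r * ((η r / √r : ℝ) : ℂ) := by
  rw [L2.inner_eq]
  refine integral_congr_ae ?_
  filter_upwards [MemLp.coeFn_toLp (memLp_of_continuousOn (η := fun r => (((√r)⁻¹ : ℝ) : ℂ) * η r)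
    ((continuousOn_sqrt_inv ha).mul (Complex.continuous_ofReal.comp_continuousOn hη)) 2)] with r hr
  rw [weighted, hr, map_mul, Complex.conj_ofReal, Complex.conj_ofReal]
  push_cast
  ring

lemma inner_weighted_weighted (ha : 0 < a) {η ζ : ℝ → ℝ} (hη : ContinuousOn η (Icc a b))
    (hζ : ContinuousOn ζ (Icc a b)) :
    inner ℂ (weighted ha hη) (weighted ha hζ) = ((∫ r in Ioo a b, η r * ζ r / r : ℝ) : ℂ) := by
  rw [inner_weighted, ← integral_complex_ofReal]
  refine integral_congr_ae ?_
  filter_upwards [MemLp.coeFn_toLp (memLp_of_continuousOn (η := fun r => (((√r)⁻¹ : ℝ) : ℂ) * ζ r)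
    ((continuousOn_sqrt_inv ha).mul (Complex.continuous_ofReal.comp_continuousOn hζ)) 2),
    ae_restrict_mem measurableSet_Ioo] with r hr hr'
  rw [weighted, hr, ← Complex.ofReal_mul, ← Complex.ofReal_mul]
  congr 1
  have h0 : 0 < r := ha.trans hr'.1
  have h1 := Real.sqrt_pos.mpr h0
  have h2 : r = √r * √r := (Real.mul_self_sqrt h0.le).symm
  have h3 : (√r)⁻¹ * (√r)⁻¹ = r⁻¹ := by rw [← mul_inv, ← h2]
  rw [div_eq_mul_inv, div_eq_mul_inv, ← h3]
  ring

lemma orthonormal_mode (ha : 0 < a) (hab : a < b) :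
    Orthonormal ℂ fun n => weighted ha (continuousOn_mode (b := b) ha n) := by
  rw [orthonormal_iff_ite]
  intro n m
  rw [inner_weighted_weighted, integral_mode_mul ha hab]
  split_ifs <;> simp

lemma orthonormal_sinMode (ha : 0 < a) (hab : a < b) :
    Orthonormal ℂ fun n => weighted ha (continuousOn_sinMode (b := b) ha (n + 1)) := by
  rw [orthonormal_iff_ite]
  intro n m
  rw [inner_weighted_weighted, integral_sinMode_mul ha hab]
  split_ifs <;> simp

lemma inner_mode_sqrtInv (ha : 0 < a) (n : ℕ) (f : L2 a b) :
    inner ℂ (weighted ha (continuousOn_mode (b := b) ha n)) (mulOp (memLp_sqrt_inv ha) f) =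
      cn a b n * cosCoeff f n := by
  rw [inner_weighted, cosCoeff, ← integral_const_mul]
  refine integral_congr_ae ?_
  filter_upwards [mulOp_coe (memLp_sqrt_inv ha) f, ae_restrict_mem measurableSet_Ioo] with r hr hr'
  have h0 : 0 < r := ha.trans hr'.1
  have h2 : (r : ℂ) = (√r : ℝ) * (√r : ℝ) := by rw [← Complex.ofReal_mul, Real.mul_self_sqrt h0.le]
  rw [hr, mode]
  push_cast
  conv_rhs => rw [h2]
  ring

lemma eq_zero_of_cosCoeff (ha : 0 < a) (hab : a < b) {f : L2 a b} (h : ∀ n, cosCoeff f n = 0) :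
    f = 0 := by
  have hf := freq_pos ha hab
  have h1 := hasSum_cosCoeff ha hab f
  simp only [h, norm_zero] at h1
  have h2 : 2 * Real.pi * ∫ r in Ioo a b, (2 * freq a b / r) * ‖f r‖ ^ 2 = 0 :=
    h1.unique (by simp)
  have h3 : ∫ r in Ioo a b, (2 * freq a b / r) * ‖f r‖ ^ 2 = 0 :=
    (mul_eq_zero.mp h2).resolve_left Real.two_pi_pos.ne'
  have hnn : 0 ≤ᵐ[volume.restrict (Ioo a b)] fun r => (2 * freq a b / r) * ‖f r‖ ^ 2 := by
    filter_upwards [ae_restrict_mem measurableSet_Ioo] with r hr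
    have : 0 < r := ha.trans hr.1
    simp only [Pi.zero_apply]
    positivity
  have hint : Integrable (fun r => (2 * freq a b / r) * ‖f r‖ ^ 2) (volume.restrict (Ioo a b)) := by
    refine ((Lp.memLp f).integrable_norm_pow two_ne_zero).bdd_mul (c := 2 * freq a b / a)
      (by fun_prop) ?_
    filter_upwards [ae_restrict_mem measurableSet_Ioo] with r hr
    have : 0 < r := ha.trans hr.1
    rw [Real.norm_of_nonneg (by positivity)]
    gcongr
    exact hr.1.le
  rw [integral_eq_zero_iff_of_nonneg_ae hnn hint] at h3
  refine Lp.ext ?_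
  filter_upwards [h3, Lp.coeFn_zero ℂ 2 (volume.restrict (Ioo a b)),
    ae_restrict_mem measurableSet_Ioo] with r hr h0 hr'
  have : 0 < r := ha.trans hr'.1
  have h4 : 2 * freq a b / r ≠ 0 := by positivity
  rw [h0]
  simpa [h4] using hr

lemma orthogonal_mode (ha : 0 < a) (hab : a < b) : (Submodule.span ℂ
    (range fun n => weighted ha (continuousOn_mode (b := b) ha n)))ᗮ = ⊥ := by
  rw [Submodule.eq_bot_iff]
  intro f hf
  have h1 : (sqrtInvEquiv b ha).symm f = 0 := by
    refine eq_zero_of_cosCoeff ha hab fun n => ?_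
    have h2 := inner_mode_sqrtInv ha n ((sqrtInvEquiv b ha).symm f)
    have h3 : mulOp (memLp_sqrt_inv ha) ((sqrtInvEquiv b ha).symm f) = f :=
      (sqrtInvEquiv b ha).apply_symm_apply f
    rw [h3, Submodule.inner_right_of_mem_orthogonal (Submodule.subset_span (mem_range_self n)) hf] at h2
    have : (cn a b n : ℂ) ≠ 0 := by exact_mod_cast (cn_pos ha hab n).ne'
    exact (mul_eq_zero.mp h2.symm).resolve_left this
  simpa using h1

/-- The Hilbert basis of cosine modes. -/
def basis (ha : 0 < a) (hab : a < b) : HilbertBasis ℕ ℂ (L2 a b) :=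
  HilbertBasis.mkOfOrthogonalEqBot (orthonormal_mode ha hab) (orthogonal_mode ha hab)

/-- The cosine transform. -/
def U (ha : 0 < a) (hab : a < b) : L2 a b ≃L[ℂ] SeqL2 :=
  (sqrtInvEquiv b ha).trans (basis ha hab).repr.toContinuousLinearEquiv

lemma U_eq (ha : 0 < a) (hab : a < b) (f : L2 a b) :
    U ha hab f = (basis ha hab).repr (mulOp (memLp_sqrt_inv ha) f) := rfl

lemma U_apply (ha : 0 < a) (hab : a < b) (f : L2 a b) (n : ℕ) :
    U ha hab f n = cn a b n * cosCoeff f n := by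
  rw [U_eq, HilbertBasis.repr_apply_apply, basis, HilbertBasis.coe_mkOfOrthogonalEqBot,
    inner_mode_sqrtInv]

lemma U_apply_eq_integral (ha : 0 < a) (hab : a < b) (f : L2 a b) (n : ℕ) :
    U ha hab f n = ∫ r in Ioo a b, f r * ((mode a b n r / r : ℝ) : ℂ) := by
  rw [U_apply, cosCoeff, ← integral_const_mul]
  congr 1 with r
  rw [mode]
  push_cast
  ring

/-- The weight `1 / r` of the transform is exactly the factor in front of the modewise formula, so
the dual pairings of the theorem become inner products in `ℓ²`. -/
lemma inner_U (ha : 0 < a) (hab : a < b) (ξ f : L2 a b) :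
    inner ℂ (U ha hab ξ) (U ha hab f) = ∫ r in Ioo a b, (r : ℂ)⁻¹ * f r * conj (ξ r) := by
  rw [U_eq, U_eq, LinearIsometryEquiv.inner_map_map, L2.inner_eq]
  refine integral_congr_ae ?_
  filter_upwards [mulOp_coe (memLp_sqrt_inv ha) f, mulOp_coe (memLp_sqrt_inv ha) ξ,
    ae_restrict_mem measurableSet_Ioo] with r h1 h2 hr'
  have h0 : 0 < r := ha.trans hr'.1
  have h3 : (r : ℂ) = (√r : ℝ) * (√r : ℝ) := by rw [← Complex.ofReal_mul, Real.mul_self_sqrt h0.le]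
  rw [h1, h2, map_mul, Complex.conj_ofReal, h3, mul_inv]
  push_cast
  ring

end LogCos

/-! ### Traces, the product rule, essential bounds and Gronwall's lemma -/

section Auxiliary

variable {a b : ℝ}

lemma HasTrace.mulOp {m : ℝ → ℂ} (hm : ContinuousOn m (Icc a b)) {u : L2 a b} {x : ℝ} {c : ℂ}
    (h : HasTrace u x c) : HasTrace (mulOp (memLp_of_continuousOn hm ⊤) u) x (m x * c) := by
  obtain ⟨g, hg, hu, rfl⟩ := h
  refine ⟨fun r => m r * g r, hm.mul hg, ?_, rfl⟩
  filter_upwards [mulOp_coe (memLp_of_continuousOn hm ⊤) u, hu] with r h1 h2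
  rw [h1, h2]

lemma HasWeakDeriv.mulOp (hab : a < b) {m m' : ℝ → ℂ} (hm : ∀ x ∈ Icc a b, HasDerivAt m (m' x) x)
    (hmc : ContinuousOn m (Icc a b)) (hc : ContinuousOn m' (Icc a b)) {u v : L2 a b}
    (h : HasWeakDeriv u v) : HasWeakDeriv (mulOp (memLp_of_continuousOn hmc ⊤) u)
      (mulOp (memLp_of_continuousOn hmc ⊤) v + mulOp (memLp_of_continuousOn hc ⊤) u) := by
  intro η hη hs ht
  have hdc : Continuous (deriv η) := hη.continuous_deriv (by simp)
  have hη0 := hη.continuous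
  have ha : η a = 0 := image_eq_zero_of_notMem_tsupport fun h => (ht h).1.false
  have hb : η b = 0 := image_eq_zero_of_notMem_tsupport fun h => (ht h).2.false
  obtain ⟨ca, hca⟩ := h.exists_trace hab a
  obtain ⟨cb, hcb⟩ := h.exists_trace hab b
  have h1 := h.integral_mul hab hca hcb (η := fun x => m x * η x)
    (η' := fun x => m' x * η x + m x * deriv η x)
    (fun x hx => (hm x hx).mul (hη.differentiable (by simp)).differentiableAt.hasDerivAt)
    (by fun_prop)
  rw [ha, hb] at h1
  simp only [mul_add] at h1
  rw [integral_add (u.integrable_mul (by fun_prop)) (u.integrable_mul (by fun_prop))] at h1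
  have e1 : ∫ x in Ioo a b, _root_.mulOp (memLp_of_continuousOn hmc ⊤) u x * deriv η x =
      ∫ x in Ioo a b, u x * (m x * deriv η x) := by
    refine integral_congr_ae ?_
    filter_upwards [mulOp_coe (memLp_of_continuousOn hmc ⊤) u] with x hx
    rw [hx]; ring
  have e2 : ∫ x in Ioo a b, (_root_.mulOp (memLp_of_continuousOn hmc ⊤) v +
      _root_.mulOp (memLp_of_continuousOn hc ⊤) u) x * η x =
      (∫ x in Ioo a b, v x * (m x * η x)) + ∫ x in Ioo a b, u x * (m' x * η x) := by
    rw [← integral_add (v.integrable_mul (by fun_prop)) (u.integrable_mul (by fun_prop))]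
    refine integral_congr_ae ?_
    filter_upwards [mulOp_coe (memLp_of_continuousOn hmc ⊤) v,
      mulOp_coe (memLp_of_continuousOn hc ⊤) u, Lp.coeFn_add
      (_root_.mulOp (memLp_of_continuousOn hmc ⊤) v) (_root_.mulOp (memLp_of_continuousOn hc ⊤) u)]
      with x hx hx' hx''
    rw [hx'', Pi.add_apply, hx, hx']; ring
  rw [e1, e2]
  linear_combination h1

lemma MemLp.exists_ae_bound {m : ℝ → ℂ} (hm : MemLp m ⊤ (volume.restrict (Ioo a b))) :
    ∃ C, 0 ≤ C ∧ ∀ᵐ r ∂(volume.restrict (Ioo a b)), ‖m r‖ ≤ C := by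
  have h := hm.eLpNorm_lt_top
  rw [eLpNorm_exponent_top] at h
  refine ⟨(eLpNormEssSup m (volume.restrict (Ioo a b))).toReal, ENNReal.toReal_nonneg, ?_⟩
  filter_upwards [ae_le_eLpNormEssSup (f := m) (μ := volume.restrict (Ioo a b))] with r hr
  rw [← ENNReal.ofReal_le_ofReal_iff ENNReal.toReal_nonneg, ENNReal.ofReal_toReal h.ne,
    ofReal_norm]
  exact hr

/-- Gronwall's lemma on an interval, from the right end point. -/
lemma eq_zero_of_le_integral {G : ℝ → ℝ} (hG : Continuous G) (hG0 : ∀ x, 0 ≤ G x) {C : ℝ}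
    (hC : 0 ≤ C) (h : ∀ x ∈ Icc a b, G x ≤ C * ∫ t in x..b, G t) {x : ℝ} (hx : x ∈ Icc a b) :
    G x = 0 := by
  set P : ℝ → ℝ := fun x => ∫ t in x..b, G t with hP
  have hd : ∀ x, HasDerivAt P (-G x) x := fun x =>
    intervalIntegral.integral_hasDerivAt_left (hG.intervalIntegrable _ _)
      hG.aestronglyMeasurable.stronglyMeasurableAtFilter hG.continuousAt
  -- Since `P' = -G ≥ -C P`, the product `exp (C x) P x` is nondecreasing; it vanishes at `b`, so `P
  -- ≤ 0`.
  have hE : ∀ x, HasDerivAt (fun x => Real.exp (C * x) * P x)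
      (Real.exp (C * x) * (C * P x - G x)) x := fun x => by
    have h1 := (((hasDerivAt_id x).const_mul C).exp).mul (hd x)
    refine h1.congr_deriv ?_
    simp only [id]
    ring
  have hmono : MonotoneOn (fun x => Real.exp (C * x) * P x) (Icc a b) := by
    refine monotoneOn_of_deriv_nonneg (convex_Icc a b)
      (fun y _ => (hE y).continuousAt.continuousWithinAt)
      (fun y _ => (hE y).differentiableAt.differentiableWithinAt) fun y hy => ?_
    rw [(hE y).deriv]
    exact mul_nonneg (Real.exp_pos _).le (sub_nonneg.mpr (h y (interior_subset hy)))
  have h1 := hmono hx (right_mem_Icc.mpr (hx.1.trans hx.2)) hx.2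
  have hPb : P b = 0 := intervalIntegral.integral_same
  simp only [hPb, mul_zero] at h1
  have h2 : P x ≤ 0 := by
    by_contra! h3
    exact absurd h1 (not_le.mpr (mul_pos (Real.exp_pos _) h3))
  refine le_antisymm ((h x hx).trans ?_) (hG0 x)
  exact mul_nonpos_of_nonneg_of_nonpos hC h2

end Auxiliary

namespace LogCos

variable {a b : ℝ}

/-! ### Cosine series of differentiable functions -/

lemma hasDerivAt_mode (ha : 0 < a) (n : ℕ) {r : ℝ} (hr : 0 < r) :
    HasDerivAt (mode a b n) (-(n * freq a b * sinMode a b n r / r)) r := by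
  have h := (((hasDerivAt_angle (b := b) ha hr).const_mul (n : ℝ)).cos).const_mul (cn a b n)
  refine h.congr_deriv ?_
  rw [sinMode]
  ring

lemma hasDerivAt_sinMode (ha : 0 < a) (n : ℕ) {r : ℝ} (hr : 0 < r) :
    HasDerivAt (sinMode a b n) (n * freq a b * mode a b n r / r) r := by
  have h := (((hasDerivAt_angle (b := b) ha hr).const_mul (n : ℝ)).sin).const_mul (cn a b n)
  refine h.congr_deriv ?_
  rw [mode]
  ring

lemma sinMode_left (ha : 0 < a) (n : ℕ) : sinMode a b n a = 0 := by
  rw [sinMode, angle_left ha, mul_zero, Real.sin_zero, mul_zero]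

lemma sinMode_right (ha : 0 < a) (hab : a < b) (n : ℕ) : sinMode a b n b = 0 := by
  rw [sinMode, angle_right ha hab, Real.sin_nat_mul_pi, mul_zero]

lemma continuousOn_div_self (ha : 0 < a) {η : ℝ → ℝ} (hη : ContinuousOn η (Icc a b)) :
    ContinuousOn (fun r => η r / r) (Icc a b) :=
  hη.div continuousOn_id fun _ hr => (ha.trans_le hr.1).ne'

/-- The sine modes vanish at both end points, so integration by parts leaves no boundary term. -/
lemma integral_mul_sinMode (ha : 0 < a) (hab : a < b) {u v : L2 a b} (h : HasWeakDeriv u v) (n : ℕ) :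
    ∫ r in Ioo a b, v r * (sinMode a b n r : ℂ) = -(n * freq a b * U ha hab u n) := by
  obtain ⟨ca, hca⟩ := h.exists_trace hab a
  obtain ⟨cb, hcb⟩ := h.exists_trace hab b
  have h1 := h.integral_mul hab hca hcb (η := fun r => (sinMode a b n r : ℂ))
    (η' := fun r => ((n * freq a b * mode a b n r / r : ℝ) : ℂ))
    (fun r hr => (hasDerivAt_sinMode ha n (ha.trans_le hr.1)).ofReal_comp)
    (Complex.continuous_ofReal.comp_continuousOn
      (continuousOn_div_self ha (continuousOn_const.mul (continuousOn_mode ha n))))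
  simp only [sinMode_left ha, sinMode_right ha hab, Complex.ofReal_zero, mul_zero, sub_zero] at h1
  rw [U_apply_eq_integral, ← integral_const_mul, eq_neg_iff_add_eq_zero, ← h1, add_comm]
  congr 1
  refine setIntegral_congr_fun measurableSet_Ioo fun r _ => ?_
  push_cast
  ring

lemma U_mulOp_id (ha : 0 < a) (hab : a < b) (h : L2 a b) (n : ℕ) :
    U ha hab (mulOp memLp_id h) n = ∫ r in Ioo a b, h r * (mode a b n r : ℂ) := by
  rw [U_apply_eq_integral]
  refine integral_congr_ae ?_
  filter_upwards [mulOp_coe memLp_id h, ae_restrict_mem measurableSet_Ioo] with r hr hr'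
  have : (r : ℂ) ≠ 0 := by exact_mod_cast (ha.trans hr'.1).ne'
  rw [hr]
  push_cast
  field_simp

/-- The cosine coefficients of a function with `(r u')' = h`. -/
lemma coeff_of_weakDeriv (ha : 0 < a) (hab : a < b) {u v h : L2 a b} (hu : HasWeakDeriv u v)
    (hv : HasWeakDeriv (mulOp memLp_id v) h) {k : ℂ} (h0 : HasTrace (mulOp memLp_id v) a 0)
    (hk : HasTrace (mulOp memLp_id v) b k) (n : ℕ) :
    (freq a b ^ 2 * n ^ 2) * U ha hab u n + U ha hab (mulOp memLp_id h) n = k * mode a b n b := by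
  have h1 := hv.integral_mul hab h0 hk (η := fun r => (mode a b n r : ℂ))
    (η' := fun r => ((-(n * freq a b * sinMode a b n r / r) : ℝ) : ℂ))
    (fun r hr => (hasDerivAt_mode ha n (ha.trans_le hr.1)).ofReal_comp)
    (Complex.continuous_ofReal.comp_continuousOn
      (continuousOn_div_self ha (continuousOn_const.mul (continuousOn_sinMode ha n))).neg)
  rw [zero_mul, sub_zero] at h1
  rw [← h1, U_mulOp_id]
  congr 1
  have h2 : ∫ r in Ioo a b, mulOp memLp_id v r *
      ((-(n * freq a b * sinMode a b n r / r) : ℝ) : ℂ) =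
      ∫ r in Ioo a b, (-(n * freq a b : ℝ) : ℂ) * (v r * (sinMode a b n r : ℂ)) := by
    refine integral_congr_ae ?_
    filter_upwards [mulOp_coe memLp_id v, ae_restrict_mem measurableSet_Ioo] with r hr hr'
    have : (r : ℂ) ≠ 0 := by exact_mod_cast (ha.trans hr'.1).ne'
    rw [hr]
    push_cast
    field_simp
  rw [h2, integral_const_mul, integral_mul_sinMode ha hab hu]
  push_cast
  ring

lemma summable_of_bound (ha : 0 < a) (hab : a < b) {x : SeqL2} {C : ℝ}
    (h : ∀ n : ℕ, ‖(freq a b ^ 2 * n ^ 2 : ℂ) * x n‖ ≤ C) : Summable fun n => ‖x n‖ := by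
  have hf := freq_pos ha hab
  have h1 : Summable fun n : ℕ => (C / freq a b ^ 2) * (1 / (n : ℝ) ^ 2) :=
    (Real.summable_one_div_nat_pow.mpr one_lt_two).mul_left _
  refine h1.of_norm_bounded_eventually_nat ?_
  filter_upwards [eventually_gt_atTop 0] with n hn
  have hn' : (0 : ℝ) < n := by exact_mod_cast hn
  have h2 := h n
  rw [norm_mul, norm_mul, norm_pow, norm_pow, Complex.norm_of_nonneg hf.le, Complex.norm_natCast] at h2
  rw [norm_norm, div_mul_div_comm, mul_one, le_div_iff₀ (by positivity)]
  linarith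

lemma abs_mode_le (ha : 0 < a) (hab : a < b) (n : ℕ) (r : ℝ) :
    |mode a b n r| ≤ √(2 * freq a b / Real.pi) := by
  rw [mode, abs_mul, abs_of_pos (cn_pos ha hab n)]
  exact (mul_le_of_le_one_right (cn_pos ha hab n).le (Real.abs_cos_le_one _)).trans (cn_le ha hab n)

lemma norm_mul_mode_le (ha : 0 < a) (hab : a < b) (x : ℂ) (n : ℕ) (r : ℝ) :
    ‖x * (mode a b n r : ℂ)‖ ≤ ‖x‖ * √(2 * freq a b / Real.pi) := by
  rw [norm_mul, Complex.norm_real]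
  gcongr
  exact abs_mode_le ha hab n r

lemma continuousOn_series (ha : 0 < a) (hab : a < b) {x : ℕ → ℂ} (hs : Summable fun n => ‖x n‖) :
    ContinuousOn (fun r => ∑' n, x n * (mode a b n r : ℂ)) (Icc a b) :=
  continuousOn_tsum (fun n => continuousOn_const.mul
    (Complex.continuous_ofReal.comp_continuousOn (continuousOn_mode ha n)))
    (hs.mul_right (√(2 * freq a b / Real.pi))) fun n r _ => norm_mul_mode_le ha hab _ n r

/-- An absolutely convergent cosine series represents its sum. -/
lemma ae_eq_series (ha : 0 < a) (hab : a < b) {f : L2 a b}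
    (hs : Summable fun n => ‖U ha hab f n‖) :
    f =ᵐ[volume.restrict (Ioo a b)] fun r => ∑' n, U ha hab f n * (mode a b n r : ℂ) := by
  have hc := continuousOn_series ha hab hs
  set S : ℝ → ℂ := fun r => ∑' n, U ha hab f n * (mode a b n r : ℂ) with hS
  have hm := memLp_of_continuousOn hc 2
  have key : U ha hab (hm.toLp S) = U ha hab f := by
    ext m
    rw [U_apply_eq_integral]
    have h1 : ∫ r in Ioo a b, hm.toLp S r * ((mode a b m r / r : ℝ) : ℂ) =
        ∫ r in Ioo a b, ∑' n, U ha hab f n * ((mode a b n r * mode a b m r / r : ℝ) : ℂ) := by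
      refine integral_congr_ae ?_
      filter_upwards [hm.coeFn_toLp] with r hr
      rw [hr, ← tsum_mul_right]
      congr 1 with n
      push_cast
      ring
    have hcn : ∀ n, ContinuousOn (fun r => mode a b n r * mode a b m r / r) (Icc a b) := fun n =>
      continuousOn_div_self ha ((continuousOn_mode ha n).mul (continuousOn_mode ha m))
    have hint : ∀ n, Integrable (fun r => U ha hab f n * ((mode a b n r * mode a b m r / r : ℝ) : ℂ))
        (volume.restrict (Ioo a b)) := fun n =>
      ((continuousOn_const.mul (Complex.continuous_ofReal.comp_continuousOn
        (hcn n))).integrableOn_Icc).mono_set Ioo_subset_Icc_self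
    set B := √(2 * freq a b / Real.pi) with hB
    have h2 : HasSum (fun n => ∫ r in Ioo a b, U ha hab f n *
        ((mode a b n r * mode a b m r / r : ℝ) : ℂ))
        (∫ r in Ioo a b, ∑' n, U ha hab f n * ((mode a b n r * mode a b m r / r : ℝ) : ℂ)) := by
      have hb : ∀ n, ∀ᵐ r ∂(volume.restrict (Ioo a b)), ‖U ha hab f n *
          ((mode a b n r * mode a b m r / r : ℝ) : ℂ)‖ ≤ ‖U ha hab f n‖ * (B * B / a) := by
        intro n
        filter_upwards [ae_restrict_mem measurableSet_Ioo] with r hr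
        have hr0 : 0 < r := ha.trans hr.1
        rw [norm_mul, Complex.norm_real, Real.norm_eq_abs, abs_div, abs_mul, abs_of_pos hr0]
        gcongr
        · exact abs_mode_le ha hab n r
        · exact abs_mode_le ha hab m r
        · exact hr.1.le
      refine hasSum_integral_of_dominated_convergence
        (fun n _ => ‖U ha hab f n‖ * (B * B / a)) (fun n => (hint n).1) hb
        (.of_forall fun r => hs.mul_right _) (integrable_const _) ?_
      filter_upwards [ae_all_iff.mpr hb] with r hr
      exact (Summable.of_norm_bounded (hs.mul_right _) hr).hasSum
    rw [h1]
    refine h2.unique ?_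
    have h3 : ∀ n, ∫ r in Ioo a b, U ha hab f n * ((mode a b n r * mode a b m r / r : ℝ) : ℂ) =
        if n = m then U ha hab f m else 0 := by
      intro n
      rw [integral_const_mul, integral_complex_ofReal, integral_mode_mul ha hab]
      split_ifs with h
      · rw [h]; simp
      · simp
    simp only [h3]
    exact hasSum_ite_eq m _
  rw [EquivLike.apply_eq_iff_eq] at key
  rw [← key]
  exact hm.coeFn_toLp

lemma hasTrace_series (ha : 0 < a) (hab : a < b) {f : L2 a b}
    (hs : Summable fun n => ‖U ha hab f n‖) (x : ℝ) :
    HasTrace f x (∑' n, U ha hab f n * (mode a b n x : ℂ)) :=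
  ⟨_, continuousOn_series ha hab hs, ae_eq_series ha hab hs, rfl⟩

lemma hasSum_series (ha : 0 < a) (hab : a < b) {x : ℕ → ℂ} (hs : Summable fun n => ‖x n‖) (r : ℝ) :
    HasSum (fun n => (mode a b n r : ℂ) * x n) (∑' n, x n * (mode a b n r : ℂ)) := by
  have h := (Summable.of_norm_bounded (hs.mul_right (√(2 * freq a b / Real.pi)))
    fun n => norm_mul_mode_le ha hab (x n) n r).hasSum
  exact h.of_eq (fun n => mul_comm _ _) rfl

end LogCos

namespace LogCos

variable {a b ω ς : ℝ} {𝔫 : ℝ → ℝ}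

/-! ### The transversal operator in terms of cosine coefficients -/

lemma memLp_potential (ω : ℝ) (h𝔫 : MemLp 𝔫 ⊤ (volume.restrict (Ioo a b))) :
    MemLp (fun r : ℝ => ((-(ω ^ 2 * 𝔫 r * r ^ 2) : ℝ) : ℂ)) ⊤ (volume.restrict (Ioo a b)) := by
  have h1 : MemLp (fun r : ℝ => r ^ 2) ⊤ (volume.restrict (Ioo a b)) := by
    have := (memLp_of_continuousOn (a := a) (b := b) (η := fun r : ℝ => ((r ^ 2 : ℝ) : ℂ))
      (by fun_prop) ⊤).re
    exact this
  have h2 : MemLp (fun r : ℝ => 𝔫 r * r ^ 2) ⊤ (volume.restrict (Ioo a b)) := h1.mul' h𝔫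
  refine MemLp.ofReal ?_
  have h3 := (h2.const_mul (ω ^ 2)).neg
  refine h3.ae_eq (.of_forall fun r => ?_)
  simp only [Pi.neg_apply, mul_assoc]
  rfl

/-- Multiplication by `- ω² 𝔫 r²`. -/
def potential (ω : ℝ) (h𝔫 : MemLp 𝔫 ⊤ (volume.restrict (Ioo a b))) : L2 a b →L[ℂ] L2 a b :=
  mulOp (memLp_potential ω h𝔫)

/-- `φ₁ + r φ₂` is the derivative of the flux `r φ'`, so the equation reads `r (r φ')' = - ω² 𝔫 r² φ
- f`. -/
lemma isModalImage_iff_weak (h𝔫 : MemLp 𝔫 ⊤ (volume.restrict (Ioo a b)))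
    (φ f φ₁ φ₂ : L2 a b) : (f =ᵐ[volume.restrict (Ioo a b)] fun r =>
      -(r : ℂ) * (φ₁ r + (r : ℂ) * φ₂ r) - (ω : ℂ) ^ 2 * (𝔫 r : ℂ) * (r : ℂ) ^ 2 * φ r) ↔
    mulOp memLp_id (φ₁ + mulOp memLp_id φ₂) = potential ω h𝔫 φ - f := by
  have hae : ∀ᵐ r ∂(volume.restrict (Ioo a b)),
      mulOp memLp_id (φ₁ + mulOp memLp_id φ₂) r = r * (φ₁ r + r * φ₂ r) ∧
      (potential ω h𝔫 φ - f) r = ((-(ω ^ 2 * 𝔫 r * r ^ 2) : ℝ) : ℂ) * φ r - f r := by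
    filter_upwards [mulOp_coe memLp_id (φ₁ + mulOp memLp_id φ₂), Lp.coeFn_add φ₁ (mulOp memLp_id φ₂),
      mulOp_coe memLp_id φ₂, Lp.coeFn_sub (potential ω h𝔫 φ) f, mulOp_coe (memLp_potential ω h𝔫) φ]
      with r h1 h2 h3 h4 h5
    rw [h1, h2, Pi.add_apply, h3, h4, Pi.sub_apply, potential, h5]
    exact ⟨rfl, rfl⟩
  constructor
  · intro h
    refine Lp.ext ?_
    filter_upwards [hae, h] with r h1 h2
    rw [h1.1, h1.2, h2]
    push_cast
    ring
  · intro h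
    filter_upwards [hae] with r h1
    have h2 := h1.1.symm.trans ((congrArg (fun g : L2 a b => g r) h).trans h1.2)
    push_cast at h2
    linear_combination h2

/-- The functional equation for the cosine coefficients. -/
def CoeffRel (ha : 0 < a) (hab : a < b) (ω ς : ℝ) (h𝔫 : MemLp 𝔫 ⊤ (volume.restrict (Ioo a b)))
    (φ f : L2 a b) (c : ℂ) : Prop :=
  HasSum (fun n => (mode a b n b : ℂ) * U ha hab φ n) c ∧ ∀ n : ℕ,
    (freq a b ^ 2 * n ^ 2) * U ha hab φ n + U ha hab (potential ω h𝔫 φ) n +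
      Complex.I * (ω * ς * b) * mode a b n b * c = U ha hab f n

lemma weakDeriv_mulOp_id (hab : a < b) {u v : L2 a b} (h : HasWeakDeriv u v) :
    HasWeakDeriv (mulOp memLp_id u) (u + mulOp memLp_id v) := by
  have h1 := h.mulOp hab (m := fun r : ℝ => (r : ℂ)) (m' := fun _ => 1)
    (fun x _ => Complex.ofRealCLM.hasDerivAt) (by fun_prop) (by fun_prop)
  rw [mulOp_eq_self _ fun _ _ => rfl, add_comm] at h1
  exact h1

lemma summable_of_coeff (ha : 0 < a) (hab : a < b) {φ g : L2 a b} {k : ℂ}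
    (h : ∀ n : ℕ, (freq a b ^ 2 * n ^ 2) * U ha hab φ n + U ha hab g n = k * mode a b n b) :
    Summable fun n => ‖U ha hab φ n‖ := by
  refine summable_of_bound ha hab (C := ‖k‖ * √(2 * freq a b / Real.pi) + ‖U ha hab g‖) fun n => ?_
  have h1 := h n
  rw [← eq_sub_iff_add_eq] at h1
  rw [h1]
  exact (norm_sub_le _ _).trans (add_le_add (norm_mul_mode_le ha hab k n b)
    (norm_apply_le _ n))

/-- The flux `r φ'` vanishes at `a` and equals `- i ω ς b φ(b)` at `b`. Integrating by parts against
the modes turns this boundary flux into the rank one term. -/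
lemma _root_.IsModalImage.coeffRel (ha : 0 < a) (hab : a < b)
    (h𝔫 : MemLp 𝔫 ⊤ (volume.restrict (Ioo a b))) {φ f : L2 a b}
    (h : IsModalImage a b ω ς 𝔫 φ f) : ∃ c, CoeffRel ha hab ω ς h𝔫 φ f c := by
  obtain ⟨φ₁, φ₂, h1, h2, h0, ⟨c, c', hc, hc', hcc⟩, hf⟩ := h
  rw [isModalImage_iff_weak h𝔫] at hf
  have hid : ContinuousOn (fun r : ℝ => (r : ℂ)) (Icc a b) := by fun_prop
  have t0 := h0.mulOp hid
  have t1 := hc'.mulOp hid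
  rw [mul_zero] at t0
  have h3 := coeff_of_weakDeriv ha hab h1 (weakDeriv_mulOp_id hab h2) t0 t1
  rw [hf] at h3
  have hs := summable_of_coeff ha hab h3
  have h4 := HasTrace.unique hab (right_mem_Icc.mpr hab.le) hc (hasTrace_series ha hab hs b)
  refine ⟨c, ?_, fun n => ?_⟩
  · rw [h4]
    exact hasSum_series ha hab hs b
  · have h5 := h3 n
    rw [map_sub] at h5
    simp only [lp.coeFn_sub, Pi.sub_apply] at h5
    linear_combination h5 + (b : ℂ) * mode a b n b * hcc

lemma U_eq_zero_of_const (ha : 0 < a) (hab : a < b) {g : L2 a b}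
    (h : ∀ n, n ≠ 0 → U ha hab g n = 0) : ∃ c : ℂ, g =ᵐ[volume.restrict (Ioo a b)] fun _ => c := by
  have hs : Summable fun n => ‖U ha hab g n‖ :=
    summable_of_ne_finset_zero (s := {0}) fun n hn => by
      rw [h n (by simpa using hn), norm_zero]
  refine ⟨U ha hab g 0 * (cn a b 0 : ℂ), ?_⟩
  filter_upwards [ae_eq_series ha hab hs] with r hr
  rw [hr, tsum_eq_single 0 fun n hn => by rw [h n hn, zero_mul], mode]
  simp

/-- Solution of the boundary value problem from the cosine coefficients. -/
lemma CoeffRel.exists_ode {ha : 0 < a} {hab : a < b} {h𝔫 : MemLp 𝔫 ⊤ (volume.restrict (Ioo a b))}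
    {φ f : L2 a b} {c : ℂ} (hφ : CoeffRel ha hab ω ς h𝔫 φ f c) : ∃ (φ₁ h : L2 a b) (C : ℂ),
    h = mulOp (memLp_inv ha) (potential ω h𝔫 φ - f) ∧
    (mulOp memLp_id φ₁ =ᵐ[volume.restrict (Ioo a b)] prim h) ∧
    (φ =ᵐ[volume.restrict (Ioo a b)] fun x => C + prim φ₁ x) ∧
    prim h b = -(Complex.I * (ω * ς * b) * c) ∧ C + prim φ₁ b = c := by
  have hb : (b : ℂ) ≠ 0 := by exact_mod_cast (ha.trans hab).ne'
  -- The solution is rebuilt by two integrations: `h` is the derivative of the flux, its primitive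
  -- `ψ` is the flux, and `φ₁ = ψ / r` is the derivative of φ.
  set h : L2 a b := mulOp (memLp_inv ha) (potential ω h𝔫 φ - f) with hh
  have hmψ : MemLp (prim h) 2 (volume.restrict (Ioo a b)) :=
    memLp_of_continuousOn (continuous_prim h).continuousOn 2
  set ψ : L2 a b := hmψ.toLp with hψ
  have hψe : ψ =ᵐ[volume.restrict (Ioo a b)] prim h := hmψ.coeFn_toLp
  set φ₁ : L2 a b := mulOp (memLp_inv ha) ψ with hφ₁
  have hone : ∀ g : L2 a b, mulOp memLp_id (mulOp (memLp_inv ha) g) = g := fun g => by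
    rw [mulOp_mulOp _ _ (memLp_of_continuousOn (η := fun _ => 1) continuousOn_const ⊤) ?_ g,
      mulOp_eq_self _ fun _ _ => rfl]
    intro r hr
    have : (r : ℂ) ≠ 0 := by exact_mod_cast (ha.trans hr.1).ne'
    exact mul_inv_cancel₀ this
  have hidφ : mulOp memLp_id φ₁ = ψ := hone ψ
  have hmχ : MemLp (prim φ₁) 2 (volume.restrict (Ioo a b)) :=
    memLp_of_continuousOn (continuous_prim φ₁).continuousOn 2
  set χ : L2 a b := hmχ.toLp with hχ
  have hχe : χ =ᵐ[volume.restrict (Ioo a b)] prim φ₁ := hmχ.coeFn_toLp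
  have hψe' : ψ =ᵐ[volume.restrict (Ioo a b)] fun x => 0 + prim h x := by
    simpa only [zero_add] using hψe
  have hχd : HasWeakDeriv χ φ₁ := hasWeakDeriv_of_eq hab.le (c := 0) (by
    simpa only [zero_add] using hχe)
  have hψd : HasWeakDeriv (mulOp memLp_id φ₁) h := by
    rw [hidφ]; exact hasWeakDeriv_of_eq hab.le hψe'
  have t0 : HasTrace (mulOp memLp_id φ₁) a 0 := by
    rw [hidφ]; simpa using hasTrace_of_eq hψe' a
  have t1 : HasTrace (mulOp memLp_id φ₁) b (prim h b) := by
    rw [hidφ]; simpa using hasTrace_of_eq hψe' b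
  have h3 := coeff_of_weakDeriv ha hab hχd hψd t0 t1
  rw [hh, hone, ← hh] at h3
  have h4 : ∀ n : ℕ, (freq a b ^ 2 * n ^ 2) * U ha hab φ n + U ha hab (potential ω h𝔫 φ - f) n =
      -(Complex.I * (ω * ς * b) * c) * mode a b n b := by
    intro n
    have h5 := hφ.2 n
    rw [map_sub]
    simp only [lp.coeFn_sub, Pi.sub_apply]
    linear_combination h5
  -- For `n = 0` the frequency term drops out of both relations, which leaves the value of the flux
  -- at `b`.
  have hpb : prim h b = -(Complex.I * (ω * ς * b) * c) := by
    have e0 : (mode a b 0 b : ℂ) ≠ 0 := by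
      have := (cn_pos ha hab 0).ne'
      simpa [mode] using this
    refine mul_right_cancel₀ e0 ?_
    rw [← h3 0, ← h4 0]
    simp
  -- The modes with `n ≠ 0` have nonzero frequency, so they determine φ up to a constant.
  obtain ⟨C, hC⟩ := U_eq_zero_of_const ha hab (g := φ - χ) fun n hn => by
    have hf : (freq a b : ℂ) ≠ 0 := by exact_mod_cast (freq_pos ha hab).ne'
    have hn' : (n : ℂ) ≠ 0 := by exact_mod_cast hn
    have h5 := h3 n
    rw [hpb, ← h4 n] at h5
    rw [map_sub]
    simp only [lp.coeFn_sub, Pi.sub_apply]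
    refine mul_left_cancel₀ (mul_ne_zero (pow_ne_zero 2 hf) (pow_ne_zero 2 hn')) ?_
    linear_combination -h5
  have hφe : φ =ᵐ[volume.restrict (Ioo a b)] fun x => C + prim φ₁ x := by
    filter_upwards [hC, hχe, Lp.coeFn_sub φ χ] with r h1 h2 h3
    rw [h3, Pi.sub_apply, h2] at h1
    linear_combination h1
  refine ⟨φ₁, h, C, rfl, ?_, hφe, hpb, ?_⟩
  · rw [hidφ]; exact hψe
  · have hs := summable_of_coeff ha hab h4
    rw [HasTrace.unique hab (right_mem_Icc.mpr hab.le) (hasTrace_of_eq hφe b)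
      (hasTrace_series ha hab hs b)]
    exact (hasSum_series ha hab hs b).unique hφ.1

lemma CoeffRel.isModalImage {ha : 0 < a} {hab : a < b}
    {h𝔫 : MemLp 𝔫 ⊤ (volume.restrict (Ioo a b))} {φ f : L2 a b} {c : ℂ}
    (hφ : CoeffRel ha hab ω ς h𝔫 φ f c) : IsModalImage a b ω ς 𝔫 φ f := by
  obtain ⟨φ₁, h, C, hh, hψ, hφe, hpb, hc⟩ := hφ.exists_ode
  have hb : (b : ℂ) ≠ 0 := by exact_mod_cast (ha.trans hab).ne'
  have hψ' : mulOp memLp_id φ₁ =ᵐ[volume.restrict (Ioo a b)] fun x => 0 + prim h x := by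
    simpa only [zero_add] using hψ
  have hinv : ∀ g : L2 a b, mulOp (memLp_inv ha) (mulOp memLp_id g) = g := fun g => by
    rw [mulOp_mulOp _ _ (memLp_of_continuousOn (η := fun _ => 1) continuousOn_const ⊤) ?_ g,
      mulOp_eq_self _ fun _ _ => rfl]
    intro r hr
    have : (r : ℂ) ≠ 0 := by exact_mod_cast (ha.trans hr.1).ne'
    exact inv_mul_cancel₀ this
  have hci : ContinuousOn (fun r : ℝ => -((r : ℂ) ^ 2)⁻¹) (Icc a b) :=
    (ContinuousOn.inv₀ (by fun_prop) fun r hr => by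
      have : (r : ℂ) ≠ 0 := by exact_mod_cast (ha.trans_le hr.1).ne'
      exact pow_ne_zero 2 this).neg
  have hd := (hasWeakDeriv_of_eq hab.le hψ').mulOp hab (m := fun r : ℝ => ((r : ℂ))⁻¹)
    (m' := fun r => -((r : ℂ) ^ 2)⁻¹) (fun x hx => by
      have hx0 : (x : ℂ) ≠ 0 := by exact_mod_cast (ha.trans_le hx.1).ne'
      exact ((Complex.ofRealCLM.hasDerivAt (x := x)).inv hx0).congr_deriv (by simp; field_simp))
    (continuousOn_ofReal_inv ha) hci
  set φ₂ := mulOp (memLp_of_continuousOn (continuousOn_ofReal_inv ha) ⊤) h +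
    mulOp (memLp_of_continuousOn hci ⊤) (mulOp memLp_id φ₁) with hφ₂
  have hd' : HasWeakDeriv φ₁ φ₂ := by
    rw [show φ₁ = mulOp (memLp_of_continuousOn (continuousOn_ofReal_inv ha) ⊤) (mulOp memLp_id φ₁)
      from (hinv φ₁).symm]
    exact hd
  have ht : ∀ x, HasTrace φ₁ x ((x : ℂ)⁻¹ * prim h x) := fun x => by
    have := (hasTrace_of_eq hψ' x).mulOp (continuousOn_ofReal_inv ha)
    rw [zero_add] at this
    rwa [show mulOp (memLp_of_continuousOn (continuousOn_ofReal_inv ha) ⊤) (mulOp memLp_id φ₁) = φ₁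
      from hinv φ₁] at this
  refine ⟨φ₁, φ₂, hasWeakDeriv_of_eq hab.le hφe, hd', ?_, ⟨c, _, ?_, ht b, ?_⟩, ?_⟩
  · simpa using ht a
  · rw [← hc]; exact hasTrace_of_eq hφe b
  · rw [hpb]
    field_simp
    ring
  · rw [isModalImage_iff_weak h𝔫]
    refine Lp.ext ?_
    filter_upwards [mulOp_coe memLp_id (φ₁ + mulOp memLp_id φ₂),
      Lp.coeFn_add φ₁ (mulOp memLp_id φ₂), mulOp_coe memLp_id φ₂,
      Lp.coeFn_add (mulOp (memLp_of_continuousOn (continuousOn_ofReal_inv ha) ⊤) h)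
        (mulOp (memLp_of_continuousOn hci ⊤) (mulOp memLp_id φ₁)),
      mulOp_coe (memLp_of_continuousOn (continuousOn_ofReal_inv ha) ⊤) h,
      mulOp_coe (memLp_of_continuousOn hci ⊤) (mulOp memLp_id φ₁), mulOp_coe memLp_id φ₁,
      mulOp_coe (memLp_inv ha) (potential ω h𝔫 φ - f), ae_restrict_mem measurableSet_Ioo]
      with r h1 h2 h3 h4 h5 h6 h7 h8 hr
    have : (r : ℂ) ≠ 0 := by exact_mod_cast (ha.trans hr.1).ne'
    rw [h1, h2, Pi.add_apply, h3, hφ₂, h4, Pi.add_apply, h5, h6, h7, hh, h8]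
    field_simp
    ring

/-- Uniqueness for the initial value problem at the right end point. -/
lemma CoeffRel.eq_zero {ha : 0 < a} {hab : a < b} {h𝔫 : MemLp 𝔫 ⊤ (volume.restrict (Ioo a b))}
    {φ : L2 a b} {z : ℂ} (hφ : CoeffRel ha hab ω ς h𝔫 φ (z • φ) 0) : φ = 0 := by
  obtain ⟨φ₁, h, C, hh, hψ, hφe, hpb, hc⟩ := hφ.exists_ode
  rw [mul_zero, neg_zero] at hpb
  obtain ⟨K, hK, hKb⟩ := MemLp.exists_ae_bound (memLp_potential ω h𝔫)
  -- `p` is φ and `q` the flux. They solve a linear first order system with bounded coefficients,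
  -- and both vanish at `b` because `c = 0`; Gronwall's lemma applies to `‖p‖ + ‖q‖`.
  set p : ℝ → ℂ := fun x => C + prim φ₁ x with hp
  set q : ℝ → ℂ := prim h with hq
  have hpc : Continuous p := continuous_const.add (continuous_prim φ₁)
  have hqc : Continuous q := continuous_prim h
  have hGc : Continuous fun x => ‖p x‖ + ‖q x‖ := hpc.norm.add hqc.norm
  have hG0 : ∀ x, 0 ≤ ‖p x‖ + ‖q x‖ := fun x => by positivity
  have e1 : ∀ᵐ r, ‖(Ioo a b).indicator φ₁ r‖ ≤ a⁻¹ * (‖p r‖ + ‖q r‖) := by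
    have h1 : ∀ᵐ r ∂(volume.restrict (Ioo a b)), ‖φ₁ r‖ ≤ a⁻¹ * (‖p r‖ + ‖q r‖) := by
      filter_upwards [hψ, mulOp_coe memLp_id φ₁, ae_restrict_mem measurableSet_Ioo] with r h1 h2 hr
      have hr0 : 0 < r := ha.trans hr.1
      rw [h2] at h1
      rw [← h1, norm_mul, Complex.norm_of_nonneg hr0.le, inv_mul_eq_div, le_div_iff₀ ha]
      nlinarith [norm_nonneg (φ₁ r), norm_nonneg (p r), hr.1]
    rw [ae_restrict_iff' measurableSet_Ioo] at h1
    filter_upwards [h1] with r hr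
    by_cases hm : r ∈ Ioo a b
    · rw [indicator_of_mem hm]; exact hr hm
    · rw [indicator_of_notMem hm, norm_zero]
      exact mul_nonneg (inv_nonneg.mpr ha.le) (hG0 r)
  have e2 : ∀ᵐ r, ‖(Ioo a b).indicator h r‖ ≤ a⁻¹ * (K + ‖z‖) * (‖p r‖ + ‖q r‖) := by
    have h1 : ∀ᵐ r ∂(volume.restrict (Ioo a b)), ‖h r‖ ≤ a⁻¹ * (K + ‖z‖) * (‖p r‖ + ‖q r‖) := by
      filter_upwards [mulOp_coe (memLp_inv ha) (potential ω h𝔫 φ - z • φ),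
        Lp.coeFn_sub (potential ω h𝔫 φ) (z • φ), Lp.coeFn_smul z φ,
        mulOp_coe (memLp_potential ω h𝔫) φ, hKb, hφe,
        ae_restrict_mem measurableSet_Ioo] with r h1 h2 h3 h4 h5 h6 hr
      have hr0 : 0 < r := ha.trans hr.1
      rw [hh, h1, h2, Pi.sub_apply, potential, h4, h3, Pi.smul_apply, smul_eq_mul, ← sub_mul, h6,
        norm_mul, norm_mul, norm_inv, Complex.norm_of_nonneg hr0.le, mul_assoc a⁻¹]
      have h7 : ‖((-(ω ^ 2 * 𝔫 r * r ^ 2) : ℝ) : ℂ) - z‖ ≤ K + ‖z‖ :=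
        (norm_sub_le _ _).trans (by gcongr)
      have h8 : ‖C + prim φ₁ r‖ ≤ ‖p r‖ + ‖q r‖ := by
        simp only [hp]; linarith [norm_nonneg (q r)]
      gcongr
      exact hr.1.le
    rw [ae_restrict_iff' measurableSet_Ioo] at h1
    filter_upwards [h1] with r hr
    by_cases hm : r ∈ Ioo a b
    · rw [indicator_of_mem hm]; exact hr hm
    · rw [indicator_of_notMem hm, norm_zero]
      exact mul_nonneg (by positivity) (hG0 r)
  have hint : ∀ (v : L2 a b) (x y : ℝ), IntervalIntegrable ((Ioo a b).indicator v) volume x y :=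
    fun v x y => ((integrable_indicator_iff measurableSet_Ioo).mpr v.integrable).intervalIntegrable
  have hstep : ∀ (v : L2 a b) (M : ℝ),
      (∀ᵐ r, ‖(Ioo a b).indicator v r‖ ≤ M * (‖p r‖ + ‖q r‖)) → ∀ x ∈ Icc a b,
      ‖prim v b - prim v x‖ ≤ M * ∫ t in x..b, (‖p t‖ + ‖q t‖) := by
    intro v M hM x hx
    rw [prim, prim, intervalIntegral.integral_interval_sub_left (hint v _ _) (hint v _ _),
      ← intervalIntegral.integral_const_mul]
    refine intervalIntegral.norm_integral_le_of_norm_le hx.2 ?_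
      ((continuous_const.mul hGc).intervalIntegrable _ _)
    filter_upwards [hM] with r hr _
    exact hr
  have hzero : ∀ x ∈ Icc a b, ‖p x‖ + ‖q x‖ = 0 := fun x hx =>
    eq_zero_of_le_integral hGc hG0 (C := a⁻¹ + a⁻¹ * (K + ‖z‖)) (by positivity) (fun y hy => by
      have s1 := hstep φ₁ _ e1 y hy
      have s2 := hstep h _ e2 y hy
      have t1 : prim φ₁ b - prim φ₁ y = -p y := by
        simp only [hp]; linear_combination hc
      have t2 : q b - q y = -q y := by
        rw [hpb, zero_sub]
      rw [t1, norm_neg] at s1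
      rw [← hq, t2, norm_neg] at s2
      rw [add_mul]
      exact add_le_add s1 s2) hx
  refine Lp.ext ?_
  filter_upwards [hφe, Lp.coeFn_zero ℂ 2 (volume.restrict (Ioo a b)),
    ae_restrict_mem measurableSet_Ioo] with r h1 h2 hr
  rw [h1, h2]
  have h3 := hzero r (Ioo_subset_Icc_self hr)
  have h4 : ‖p r‖ = 0 := by linarith [norm_nonneg (p r), norm_nonneg (q r)]
  exact norm_eq_zero.mp h4

lemma inner_U_potential (ha : 0 < a) (hab : a < b) (h𝔫 : MemLp 𝔫 ⊤ (volume.restrict (Ioo a b)))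
    (f g : L2 a b) : inner ℂ (U ha hab (potential ω h𝔫 f)) (U ha hab g) =
      inner ℂ (U ha hab f) (U ha hab (potential ω h𝔫 g)) := by
  rw [inner_U, inner_U]
  refine integral_congr_ae ?_
  filter_upwards [mulOp_coe (memLp_potential ω h𝔫) f, mulOp_coe (memLp_potential ω h𝔫) g]
    with r h1 h2
  rw [potential, h1, h2, map_mul, Complex.conj_ofReal]
  ring

/-- The transversal operator in the cosine basis. -/
def modalData (ha : 0 < a) (hab : a < b) (hω : 0 < ω) (hς : 0 < ς)
    (h𝔫 : MemLp 𝔫 ⊤ (volume.restrict (Ioo a b))) : ModalData where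
  rho := freq a b
  rho_pos := freq_pos ha hab
  del n := mode a b n b
  bd := √(2 * freq a b / Real.pi)
  abs_del_le n := abs_mode_le ha hab n b
  kap := ω * ς * b
  kap_pos := mul_pos (mul_pos hω hς) (ha.trans hab)
  -- The identity is subtracted to compensate the 1 in the diagonal entries, which keeps them away
  -- from zero.
  W := (U ha hab : L2 a b →L[ℂ] SeqL2) ∘L potential ω h𝔫 ∘L
    ((U ha hab).symm : SeqL2 →L[ℂ] L2 a b) - ContinuousLinearMap.id ℂ SeqL2
  W_symm x y := by
    have h := inner_U_potential (ω := ω) ha hab h𝔫 ((U ha hab).symm x) ((U ha hab).symm y)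
    rw [ContinuousLinearEquiv.apply_symm_apply, ContinuousLinearEquiv.apply_symm_apply] at h
    simp only [sub_apply, ContinuousLinearMap.comp_apply, ContinuousLinearEquiv.coe_coe,
      ContinuousLinearMap.id_apply, inner_sub_left, inner_sub_right, h]
  unique' z x hx h := by
    have hx' : x = U ha hab ((U ha hab).symm x) := by simp
    have h1 : CoeffRel ha hab ω ς h𝔫 ((U ha hab).symm x) (z • (U ha hab).symm x) 0 := by
      refine ⟨by rw [← hx']; exact hx, fun n => ?_⟩
      have h2 := h n
      simp only [sub_apply, ContinuousLinearMap.comp_apply, ContinuousLinearEquiv.coe_coe,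
        ContinuousLinearMap.id_apply, lp.coeFn_sub, Pi.sub_apply] at h2
      rw [map_smul, ← hx']
      simp only [lp.coeFn_smul, Pi.smul_apply, smul_eq_mul]
      rw [← h2]
      push_cast
      ring
    rw [hx', h1.eq_zero, map_zero]

lemma isModalImage_iff (ha : 0 < a) (hab : a < b) (hω : 0 < ω) (hς : 0 < ς)
    (h𝔫 : MemLp 𝔫 ⊤ (volume.restrict (Ioo a b))) (φ f : L2 a b) : IsModalImage a b ω ς 𝔫 φ f ↔
      (modalData ha hab hω hς h𝔫).Rel (U ha hab φ) (U ha hab f) := by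
  have key : (∃ c, CoeffRel ha hab ω ς h𝔫 φ f c) ↔
      (modalData ha hab hω hς h𝔫).Rel (U ha hab φ) (U ha hab f) := by
    refine exists_congr fun c => and_congr_right fun _ => forall_congr' fun n => ?_
    have hW : (modalData ha hab hω hς h𝔫).W (U ha hab φ) n =
        U ha hab (potential ω h𝔫 φ) n - U ha hab φ n := by
      simp only [modalData, sub_apply, ContinuousLinearMap.comp_apply, ContinuousLinearEquiv.coe_coe,
        ContinuousLinearMap.id_apply, lp.coeFn_sub, Pi.sub_apply,
        ContinuousLinearEquiv.symm_apply_apply]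
    rw [hW, ModalData.lam]
    simp only [modalData]
    push_cast
    constructor <;> intro h <;> linear_combination h
  rw [← key]
  exact ⟨fun h => h.coeffRel ha hab h𝔫, fun ⟨c, h⟩ => h.isModalImage⟩

end LogCos

/-! ### Weighted sequence spaces and Sobolev spaces -/

section Lift

variable {a b : ℝ}

lemma exists_weighted_map {E : Type*} [NormedAddCommGroup E] [NormedSpace ℂ E] (L : E →L[ℂ] SeqL2)
    (w : ℕ → ℂ) {C : ℝ} (hC : 0 ≤ C)
    (h : ∀ u, ∀ N, ∑ n ∈ Finset.range N, ‖w n * L u n‖ ^ 2 ≤ (C * ‖u‖) ^ 2) :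
    ∃ J : E →L[ℂ] SeqL2, ∀ u n, J u n = w n * L u n := by
  have hs : ∀ u, ∀ s : Finset ℕ, ∑ n ∈ s, ‖w n * L u n‖ ^ 2 ≤ (C * ‖u‖) ^ 2 := fun u s => by
    obtain ⟨N, hN⟩ := s.exists_nat_subset_range
    exact (Finset.sum_le_sum_of_subset_of_nonneg hN fun _ _ _ => by positivity).trans (h u N)
  have hm : ∀ u, Memℓp (fun n => w n * L u n) 2 := fun u =>
    memℓp_iff.mpr (summable_of_sum_le (fun _ => by positivity) (hs u))
  refine ⟨LinearMap.mkContinuous ⟨⟨fun u => ⟨fun n => w n * L u n, hm u⟩, fun u v => ?_⟩,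
    fun c u => ?_⟩ C fun u => ?_, fun u n => rfl⟩
  · ext n
    change w n * L (u + v) n = w n * L u n + w n * L v n
    rw [map_add, lp.coeFn_add, Pi.add_apply, mul_add]
  · ext n
    change w n * L (c • u) n = c * (w n * L u n)
    rw [map_smul, lp.coeFn_smul, Pi.smul_apply, smul_eq_mul, mul_left_comm]
  · exact norm_le_of_sq_le (by positivity) (hs u)

lemma L2.norm_fst_le {X : Type*} [NormedAddCommGroup X] (p : WithLp 2 (L2 a b × X)) : ‖p.fst‖ ≤ ‖p‖ := by
  have h := WithLp.prod_norm_sq_eq_of_L2 p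
  nlinarith [norm_nonneg p, norm_nonneg p.fst, sq_nonneg ‖p.snd‖]

lemma L2.norm_snd_le {X : Type*} [NormedAddCommGroup X] (p : WithLp 2 (L2 a b × X)) : ‖p.snd‖ ≤ ‖p‖ := by
  have h := WithLp.prod_norm_sq_eq_of_L2 p
  nlinarith [norm_nonneg p, norm_nonneg p.snd, sq_nonneg ‖p.fst‖]

/-- Linearity is inherited from the first component through injectivity; only the second component
needs an estimate. -/
lemma exists_lift {X : Type*} [NormedAddCommGroup X] [NormedSpace ℂ X]
    (S : Submodule ℂ (WithLp 2 (L2 a b × X)))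
    (hinj : Function.Injective fun p : S => (p : WithLp 2 (L2 a b × X)).fst)
    (T : SeqL2 →L[ℂ] L2 a b) {C : ℝ}
    (h : ∀ x, ∃ p : S, (p : WithLp 2 (L2 a b × X)).fst = T x ∧
      ‖(p : WithLp 2 (L2 a b × X)).snd‖ ≤ C * ‖x‖) :
    ∃ E : SeqL2 →L[ℂ] S, ∀ x, (E x : WithLp 2 (L2 a b × X)).fst = T x := by
  choose p hp hpn using h
  refine ⟨LinearMap.mkContinuous ⟨⟨p, fun x y => hinj ?_⟩, fun c x => hinj ?_⟩ (‖T‖ + C)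
    fun x => ?_, hp⟩
  · simp only [hp, map_add, Submodule.coe_add, WithLp.add_fst]
  · simp only [hp, map_smul, Submodule.coe_smul, WithLp.smul_fst, RingHom.id_apply]
  · change ‖(p x : WithLp 2 (L2 a b × X))‖ ≤ _
    have h1 := WithLp.prod_norm_sq_eq_of_L2 (p x : WithLp 2 (L2 a b × X))
    have h2 := hpn x
    have h3 := T.le_opNorm x
    rw [← hp x] at h3
    set P := (p x : WithLp 2 (L2 a b × X))
    have h4 : ‖P‖ ≤ ‖P.fst‖ + ‖P.snd‖ := by
      refine abs_le_of_sq_le_sq' ?_ (by positivity) |>.2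
      rw [h1]
      nlinarith [norm_nonneg P.fst, norm_nonneg P.snd]
    rw [add_mul]
    linarith

/-- The embedding of `H¹` in `L²`. -/
def H1.fnL (a b : ℝ) : H1 a b →L[ℂ] L2 a b :=
  LinearMap.mkContinuous ⟨⟨H1.fn, fun _ _ => rfl⟩, fun _ _ => rfl⟩ 1 fun u => by
    rw [one_mul]; exact L2.norm_fst_le (u : WithLp 2 (L2 a b × L2 a b))

/-- The embedding of `H^{1/2}` in `L²`. -/
def Hhalf.fnL (a b : ℝ) : Hhalf a b →L[ℂ] L2 a b :=
  LinearMap.mkContinuous ⟨⟨Hhalf.fn, fun _ _ => rfl⟩, fun _ _ => rfl⟩ 1 fun u => by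
    rw [one_mul]; exact L2.norm_fst_le (u : WithLp 2 (L2 a b × L2sq a b))

@[simp] lemma H1.fnL_apply (u : H1 a b) : H1.fnL a b u = H1.fn u := rfl

@[simp] lemma Hhalf.fnL_apply (u : Hhalf a b) : Hhalf.fnL a b u = Hhalf.fn u := rfl

lemma hasWeakDeriv_of_hasDerivAt (hab : a < b) {η η' : ℝ → ℂ}
    (hη : ∀ x ∈ Icc a b, HasDerivAt η (η' x) x) (hc : ContinuousOn η' (Icc a b)) {u v : L2 a b}
    (hu : u =ᵐ[volume.restrict (Ioo a b)] η) (hv : v =ᵐ[volume.restrict (Ioo a b)] η') :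
    HasWeakDeriv u v := by
  refine hasWeakDeriv_of_eq hab.le (c := η a) ?_
  filter_upwards [hu, ae_restrict_mem measurableSet_Ioo] with x hx hx'
  have hsub : Icc a x ⊆ Icc a b := Icc_subset_Icc_right hx'.2.le
  have h1 : ∫ t in Ioo a x, v t = ∫ t in Ioo a x, η' t :=
    integral_congr_ae (ae_restrict_of_ae_restrict_of_subset (Ioo_subset_Ioo_right hx'.2.le) hv)
  rw [hx, prim_eq v (Ioo_subset_Icc_self hx'), h1, ← integral_Ioc_eq_integral_Ioo,
    ← intervalIntegral.integral_of_le hx'.1.le,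
    intervalIntegral.integral_eq_sub_of_hasDerivAt
      (fun t ht => hη t (hsub (by rwa [uIcc_of_le hx'.1.le] at ht)))
      ((hc.mono (by rw [uIcc_of_le hx'.1.le]; exact hsub)).intervalIntegrable)]
  ring

lemma hasSum_integral_mul {f : ℕ → L2 a b} {u : L2 a b} (h : HasSum f u) {η : ℝ → ℂ}
    (hη : ContinuousOn η (Icc a b)) :
    HasSum (fun n => ∫ x in Ioo a b, f n x * η x) (∫ x in Ioo a b, u x * η x) := by
  have hm := memLp_of_continuousOn (a := a) (b := b) (η := fun x => conj (η x))
    (Complex.continuous_conj.comp_continuousOn hη) 2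
  have key : ∀ g : L2 a b, inner ℂ (hm.toLp) g = ∫ x in Ioo a b, g x * η x := fun g => by
    rw [L2.inner_eq]
    refine integral_congr_ae ?_
    filter_upwards [hm.coeFn_toLp] with x hx
    rw [hx, Complex.conj_conj]
  have h1 := h.mapL (innerSL ℂ hm.toLp)
  simp only [innerSL_apply_apply, key] at h1
  exact h1

lemma HasWeakDeriv.hasSum {f g : ℕ → L2 a b} {u v : L2 a b} (hf : HasSum f u) (hg : HasSum g v)
    (h : ∀ n, HasWeakDeriv (f n) (g n)) : HasWeakDeriv u v := by
  intro η hη hs ht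
  have h1 := hasSum_integral_mul hf (hη.continuous_deriv (by simp)).continuousOn
  have h2 := (hasSum_integral_mul hg hη.continuous.continuousOn).neg
  refine h1.unique (h2.of_eq (fun n => ?_) rfl)
  exact h n η hη hs ht

end Lift

namespace LogCos

variable {a b ω ς : ℝ} {𝔫 : ℝ → ℝ} (ha : 0 < a) (hab : a < b) (hω : 0 < ω) (hς : 0 < ς)
  (h𝔫 : MemLp 𝔫 ⊤ (volume.restrict (Ioo a b)))

lemma inner_sinMode_sqrt (n : ℕ) (v : L2 a b) :
    inner ℂ (weighted ha (continuousOn_sinMode (b := b) ha n)) (mulOp memLp_sqrt v) =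
      ∫ r in Ioo a b, v r * (sinMode a b n r : ℂ) := by
  rw [inner_weighted]
  refine integral_congr_ae ?_
  filter_upwards [mulOp_coe memLp_sqrt v, ae_restrict_mem measurableSet_Ioo] with r hr hr'
  have : ((√r : ℝ) : ℂ) ≠ 0 := by exact_mod_cast (Real.sqrt_pos.mpr (ha.trans hr'.1)).ne'
  rw [hr]
  push_cast
  field_simp

/-- Bessel's inequality for the sine modes applied to `√r v`. The term `n = 0` is zero, hence the
shift of the index. -/
lemma sum_sq_deriv_le {u v : L2 a b} (h : HasWeakDeriv u v) (N : ℕ) :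
    ∑ n ∈ Finset.range N, ‖(n * freq a b : ℂ) * U ha hab u n‖ ^ 2 ≤ ‖mulOp memLp_sqrt v‖ ^ 2 := by
  refine le_trans (Finset.sum_le_sum_of_subset_of_nonneg (Finset.range_mono N.le_succ)
    fun _ _ _ => by positivity) ?_
  rw [Finset.sum_range_succ']
  have h1 := (orthonormal_sinMode ha hab).sum_inner_products_le (mulOp memLp_sqrt v)
    (s := Finset.range N)
  refine le_trans (le_of_eq ?_) h1
  simp only [Nat.cast_zero, zero_mul, norm_zero, ne_eq, OfNat.ofNat_ne_zero, not_false_eq_true,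
    zero_pow, add_zero]
  refine Finset.sum_congr rfl fun n _ => ?_
  rw [inner_sinMode_sqrt, integral_mul_sinMode ha hab h, norm_neg]

lemma norm_sq_mul_sq (x : ℂ) (n : ℕ) : ‖((modalData ha hab hω hς h𝔫).sq n : ℂ) * x‖ ^ 2 =
    ‖(n * freq a b : ℂ) * x‖ ^ 2 + ‖x‖ ^ 2 := by
  have hf := freq_pos ha hab
  have h1 := ModalData.sq_mul_sq (D := modalData ha hab hω hς h𝔫) n
  have h2 : (modalData ha hab hω hς h𝔫).lam n = freq a b ^ 2 * n ^ 2 + 1 := rfl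
  rw [norm_mul, norm_mul, norm_mul, Complex.norm_of_nonneg (ModalData.sq_pos n).le,
    Complex.norm_natCast, Complex.norm_of_nonneg hf.le]
  rw [h2] at h1
  linear_combination (‖x‖ ^ 2) * h1

/-- The square root of the diagonal part on `H¹`. -/
lemma exists_J1 : ∃ J : H1 a b →L[ℂ] SeqL2, ∀ u n,
    J u n = (modalData ha hab hω hς h𝔫).sq n * U ha hab (H1.fn u) n := by
  refine exists_weighted_map ((U ha hab : L2 a b →L[ℂ] SeqL2) ∘L H1.fnL a b) _
    (C := ‖(U ha hab : L2 a b →L[ℂ] SeqL2)‖ + ‖mulOp (a := a) (b := b) memLp_sqrt‖)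
    (by positivity) fun u N => ?_
  simp only [ContinuousLinearMap.comp_apply, ContinuousLinearEquiv.coe_coe, H1.fnL_apply,
    norm_sq_mul_sq, Finset.sum_add_distrib]
  have h1 := sum_sq_deriv_le ha hab (show HasWeakDeriv (H1.fn u) _ from u.2) N
  have h2 : ‖mulOp memLp_sqrt (u : WithLp 2 (L2 a b × L2 a b)).snd‖ ≤
      ‖mulOp (a := a) (b := b) memLp_sqrt‖ * ‖u‖ :=
    (ContinuousLinearMap.le_opNorm _ _).trans (by gcongr; exact L2.norm_snd_le (u : WithLp 2 (L2 a b × L2 a b)))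
  have h3 : ∑ n ∈ Finset.range N, ‖U ha hab (H1.fn u) n‖ ^ 2 ≤ ‖U ha hab (H1.fn u)‖ ^ 2 :=
    sum_le_hasSum _ (fun _ _ => by positivity) (SeqL2.hasSum_norm_sq _)
  have h4 : ‖U ha hab (H1.fn u)‖ ≤ ‖(U ha hab : L2 a b →L[ℂ] SeqL2)‖ * ‖u‖ :=
    ((U ha hab : L2 a b →L[ℂ] SeqL2).le_opNorm _).trans (by gcongr; exact L2.norm_fst_le (u : WithLp 2 (L2 a b × L2 a b)))
  calc _ ≤ (‖mulOp (a := a) (b := b) memLp_sqrt‖ * ‖u‖) ^ 2 +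
        (‖(U ha hab : L2 a b →L[ℂ] SeqL2)‖ * ‖u‖) ^ 2 :=
        add_le_add (h1.trans (by gcongr)) (h3.trans (by gcongr))
    _ ≤ _ := by
        have := mul_nonneg (mul_nonneg (norm_nonneg (mulOp (a := a) (b := b) memLp_sqrt))
          (norm_nonneg u)) (mul_nonneg (norm_nonneg (U ha hab : L2 a b →L[ℂ] SeqL2)) (norm_nonneg u))
        nlinarith

/-- The cosine modes in `L²`. -/
def modeL2 (n : ℕ) : L2 a b :=
  (memLp_of_continuousOn (η := fun r => (mode a b n r : ℂ))
    (Complex.continuous_ofReal.comp_continuousOn (continuousOn_mode ha n)) 2).toLp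

lemma modeL2_coe (n : ℕ) :
    modeL2 (b := b) ha n =ᵐ[volume.restrict (Ioo a b)] fun r => (mode a b n r : ℂ) :=
  MemLp.coeFn_toLp _

lemma U_modeL2 (n : ℕ) : U ha hab (modeL2 ha n) = lp.single 2 n 1 := by
  ext m
  rw [U_apply_eq_integral]
  have h1 : ∫ r in Ioo a b, modeL2 (b := b) ha n r * ((mode a b m r / r : ℝ) : ℂ) =
      ∫ r in Ioo a b, ((mode a b n r * mode a b m r / r : ℝ) : ℂ) := by
    refine integral_congr_ae ?_
    filter_upwards [modeL2_coe ha n] with r hr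
    rw [hr]
    push_cast
    ring
  rw [h1, integral_complex_ofReal, integral_mode_mul ha hab, lp.single_apply]
  rcases eq_or_ne n m with h | h
  · subst h; simp
  · rw [if_neg h]; simp [h.symm]

lemma hasSum_modeL2 (x : SeqL2) : HasSum (fun n => x n • modeL2 (b := b) ha n)
    ((U ha hab).symm x) := by
  have h1 := (lp.hasSum_single (by norm_num) x).mapL ((U ha hab).symm : SeqL2 →L[ℂ] L2 a b)
  refine h1.of_eq (fun n => ?_) rfl
  rw [ContinuousLinearEquiv.coe_coe, ContinuousLinearEquiv.eq_symm_apply, map_smul, U_modeL2]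
  ext m
  simp only [lp.coeFn_smul, Pi.smul_apply, lp.single_apply, smul_eq_mul]
  rcases eq_or_ne m n with h | h
  · subst h; simp
  · simp [h]

lemma hasWeakDeriv_modeL2 (hab : a < b) (n : ℕ) : HasWeakDeriv (modeL2 (b := b) ha n)
    ((-(n * freq a b : ℝ) : ℂ) • mulOp (memLp_sqrt_inv ha)
      (weighted ha (continuousOn_sinMode (b := b) ha n))) := by
  refine hasWeakDeriv_of_hasDerivAt hab
    (fun r hr => (hasDerivAt_mode ha n (ha.trans_le hr.1)).ofReal_comp)
    (Complex.continuous_ofReal.comp_continuousOn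
      (continuousOn_div_self ha (continuousOn_const.mul (continuousOn_sinMode ha n))).neg)
    (modeL2_coe ha n) ?_
  filter_upwards [Lp.coeFn_smul (-(n * freq a b : ℝ) : ℂ) (mulOp (memLp_sqrt_inv ha)
      (weighted ha (continuousOn_sinMode (b := b) ha n))),
    mulOp_coe (memLp_sqrt_inv ha) (weighted ha (continuousOn_sinMode (b := b) ha n)),
    MemLp.coeFn_toLp (memLp_of_continuousOn (η := fun r => (((√r)⁻¹ : ℝ) : ℂ) * sinMode a b n r)
      ((continuousOn_sqrt_inv ha).mul (Complex.continuous_ofReal.comp_continuousOn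
        (continuousOn_sinMode (b := b) ha n))) 2), ae_restrict_mem measurableSet_Ioo]
    with r h1 h2 h3 hr
  have h0 : 0 < r := ha.trans hr.1
  have h4 : (r : ℂ) = (√r : ℝ) * (√r : ℝ) := by rw [← Complex.ofReal_mul, Real.mul_self_sqrt h0.le]
  rw [h1, Pi.smul_apply, h2, weighted, h3, smul_eq_mul]
  push_cast
  rw [div_eq_mul_inv, h4, mul_inv]
  ring

/-- The shift of a sequence. -/
lemma _root_.SeqL2.exists_shift : ∃ T : SeqL2 →L[ℂ] SeqL2, ∀ x n, T x n = x (n + 1) := by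
  have hs : ∀ (x : SeqL2) (s : Finset ℕ), ∑ n ∈ s, ‖x (n + 1)‖ ^ 2 ≤ ‖x‖ ^ 2 := fun x s => by
    have h := Finset.sum_map s ⟨fun n : ℕ => n + 1, add_left_injective 1⟩ (fun n => ‖x n‖ ^ 2)
    exact h.symm.le.trans (sum_le_hasSum _ (fun _ _ => by positivity) (SeqL2.hasSum_norm_sq x))
  refine ⟨LinearMap.mkContinuous ⟨⟨fun x => ⟨fun n => x (n + 1), memℓp_iff.mpr
    (summable_of_sum_le (fun _ => by positivity) (hs x))⟩, fun _ _ => rfl⟩, fun _ _ => rfl⟩ 1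
    fun x => ?_, fun _ _ => rfl⟩
  rw [one_mul]
  exact norm_le_of_sq_le (norm_nonneg x) (hs x)

/-- The inverse square root of the diagonal part maps into `H¹`. -/
lemma exists_E1 : ∃ E : SeqL2 →L[ℂ] H1 a b, ∀ x,
    H1.fn (E x) = (U ha hab).symm ((modalData ha hab hω hς h𝔫).sInv x) := by
  obtain ⟨T, hT⟩ := SeqL2.exists_shift
  set D := modalData ha hab hω hς h𝔫 with hD
  have hf := freq_pos ha hab
  have hbd : ∀ n : ℕ, ‖(-((n + 1 : ℕ) * freq a b : ℝ) : ℂ) * ((D.sq (n + 1) : ℂ))⁻¹‖ ≤ 1 := by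
    intro n
    have h1 := ModalData.sq_mul_sq (D := D) (n + 1)
    have h2 : D.lam (n + 1) = freq a b ^ 2 * (n + 1 : ℕ) ^ 2 + 1 := rfl
    have h3 := ModalData.sq_pos (D := D) (n + 1)
    rw [norm_mul, norm_neg, norm_inv, Complex.norm_of_nonneg h3.le,
      Complex.norm_of_nonneg (by positivity), ← div_eq_mul_inv, div_le_one h3]
    refine abs_le_of_sq_le_sq' ?_ h3.le |>.2
    rw [h2] at h1
    nlinarith
  -- `Y x` lists the sine coefficients of the derivative. The multipliers are bounded by 1 since
  -- `√λₙ ≥ n freq`; the index is shifted because the mode 0 is constant.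
  set Y : SeqL2 →L[ℂ] SeqL2 := SeqL2.diag _ hbd * T with hY
  set S := (orthonormal_sinMode ha hab).orthogonalFamily.linearIsometry with hS
  set V : SeqL2 →L[ℂ] L2 a b := mulOp (memLp_sqrt_inv ha) ∘L S.toContinuousLinearMap ∘L Y with hV
  refine exists_lift (H1 a b) H1.fn_injective (((U ha hab).symm : SeqL2 →L[ℂ] L2 a b) ∘L D.sInv)
    (C := ‖V‖) fun x => ?_
  refine ⟨⟨WithLp.toLp 2 ((U ha hab).symm (D.sInv x), V x), ?_⟩, rfl, V.le_opNorm x⟩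
  change HasWeakDeriv ((U ha hab).symm (D.sInv x)) (V x)
  have h1 := hasSum_modeL2 ha hab (D.sInv x)
  rw [← hasSum_nat_add_iff' 1] at h1
  have h2 := ((orthonormal_sinMode ha hab).orthogonalFamily.hasSum_linearIsometry (Y x)).mapL
    (mulOp (memLp_sqrt_inv ha))
  have h3 : HasWeakDeriv ((U ha hab).symm (D.sInv x) - ∑ i ∈ Finset.range 1,
      D.sInv x i • modeL2 (b := b) ha i) (V x) := by
    refine HasWeakDeriv.hasSum h1 h2 fun n => ?_
    have h4 := (hasWeakDeriv_modeL2 ha hab (n + 1)).smul (D.sInv x (n + 1))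
    convert h4 using 1
    rw [LinearIsometry.toSpanSingleton_apply, map_smul, smul_smul]
    congr 1
    rw [hY, mul_apply_eq_comp, SeqL2.diag_apply, hT, ModalData.sInv_apply]
    ring
  have h5 := (hasWeakDeriv_modeL2 ha hab 0).smul (D.sInv x 0)
  have h6 := h3.add h5
  simpa using h6

end LogCos

/-! ### The fractional space and the cosine coefficients -/

section SinSquare

open ENNReal

/-- With `x = k h`, `4 sin² (x / 2)` is below both `x²` and 4, so its product with `1 + x²` is at
most `5 x²`. The integral of `(1 + x²)⁻¹` is π. -/
lemma lintegral_sin_sq_le (k : ℤ) :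
    ∫⁻ h in Ioc (-Real.pi) Real.pi, ENNReal.ofReal (4 * Real.sin (k * h / 2) ^ 2 / h ^ 2) ≤
      ENNReal.ofReal (5 * Real.pi * k.natAbs) := by
  rcases eq_or_ne k 0 with h0 | h0
  · simp [h0]
  have hk : (k : ℝ) ≠ 0 := by exact_mod_cast h0
  have hpt : ∀ h : ℝ, 4 * Real.sin (k * h / 2) ^ 2 / h ^ 2 ≤ 5 * k ^ 2 * (1 + (k * h) ^ 2)⁻¹ := by
    intro h
    rcases eq_or_ne h 0 with h0 | h0
    · subst h0; simp; positivity
    have h1 : 4 * Real.sin (k * h / 2) ^ 2 ≤ (k * h) ^ 2 := by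
      have h2 : |Real.sin (k * h / 2)| ≤ |k * h / 2| := Real.abs_sin_le_abs
      have := sq_le_sq.mpr h2
      nlinarith
    have h2 := Real.sin_sq_le_one (k * h / 2)
    rw [← div_eq_mul_inv, div_le_div_iff₀ (by positivity) (by positivity)]
    nlinarith [mul_le_mul_of_nonneg_right h2 (sq_nonneg (k * h))]
  have hi : Integrable fun h : ℝ => 5 * (k : ℝ) ^ 2 * (1 + (k * h) ^ 2)⁻¹ :=
    (integrable_inv_one_add_sq.comp_mul_left' hk).const_mul _
  calc _ ≤ ∫⁻ h in Ioc (-Real.pi) Real.pi, ENNReal.ofReal (5 * k ^ 2 * (1 + (k * h) ^ 2)⁻¹) :=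
        lintegral_mono fun h => ENNReal.ofReal_le_ofReal (hpt h)
    _ ≤ ∫⁻ h : ℝ, ENNReal.ofReal (5 * k ^ 2 * (1 + (k * h) ^ 2)⁻¹) := setLIntegral_le_lintegral _ _
    _ = _ := by
      rw [← ofReal_integral_eq_lintegral_ofReal hi (ae_of_all _ fun _ => by positivity),
        integral_const_mul,
        Measure.integral_comp_mul_left (fun x : ℝ => (1 + x ^ 2)⁻¹), integral_univ_inv_one_add_sq,
        smul_eq_mul, Nat.cast_natAbs, Int.cast_abs, abs_inv]
      congr 1
      have : (k : ℝ) ^ 2 = |(k : ℝ)| ^ 2 := (sq_abs _).symm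
      rw [this]
      have : |(k : ℝ)| ≠ 0 := abs_ne_zero.mpr hk
      field_simp

/-- On `0 < h ≤ π / |k|` Jordan's inequality bounds the integrand below by `4 k² / π²`. -/
lemma le_lintegral_sin_sq (k : ℤ) : ENNReal.ofReal (4 / Real.pi * k.natAbs) ≤
    ∫⁻ h in Ioc (-Real.pi) Real.pi, ENNReal.ofReal (4 * Real.sin (k * h / 2) ^ 2 / h ^ 2) := by
  rcases eq_or_ne k 0 with h0 | h0
  · simp [h0]
  have hpi := Real.pi_pos
  have hk : 1 ≤ |(k : ℝ)| := by exact_mod_cast Int.one_le_abs h0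
  have hk0 : 0 < |(k : ℝ)| := by linarith
  have hsub : Ioc 0 (Real.pi / |(k : ℝ)|) ⊆ Ioc (-Real.pi) Real.pi :=
    Ioc_subset_Ioc (by linarith) (div_le_self hpi.le hk)
  calc _ = ∫⁻ h in Ioc 0 (Real.pi / |(k : ℝ)|), ENNReal.ofReal (4 * k ^ 2 / Real.pi ^ 2) := by
        rw [setLIntegral_const, Real.volume_Ioc, sub_zero, ← ENNReal.ofReal_mul (by positivity),
          Nat.cast_natAbs, Int.cast_abs]
        congr 1
        have : (k : ℝ) ^ 2 = |(k : ℝ)| ^ 2 := (sq_abs _).symm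
        rw [this]
        field_simp
    _ ≤ ∫⁻ h in Ioc 0 (Real.pi / |(k : ℝ)|),
        ENNReal.ofReal (4 * Real.sin (k * h / 2) ^ 2 / h ^ 2) := by
      refine setLIntegral_mono' measurableSet_Ioc fun h hh => ENNReal.ofReal_le_ofReal ?_
      have h1 : |(k : ℝ) * h / 2| = |(k : ℝ)| * h / 2 := by
        rw [abs_div, abs_mul, abs_of_pos hh.1, abs_two]
      have h2 : |(k : ℝ) * h / 2| ≤ Real.pi / 2 := by
        have := (le_div_iff₀ hk0).mp hh.2
        rw [h1]; linarith
      have h3 := Real.mul_abs_le_abs_sin h2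
      have h4 := pow_le_pow_left₀ (by positivity) h3 2
      rw [sq_abs, mul_pow, sq_abs] at h4
      have h5 : 0 < h := hh.1
      rw [le_div_iff₀ (by positivity)]
      refine le_trans (le_of_eq ?_) (mul_le_mul_of_nonneg_left h4 (by norm_num : (0 : ℝ) ≤ 4))
      ring
    _ ≤ _ := lintegral_mono_set hsub

lemma tsum_int_natAbs_le (f : ℕ → ℝ≥0∞) : ∑' k : ℤ, f k.natAbs ≤ 2 * ∑' n, f n := by
  have h := (HasSum.of_nat_of_neg_add_one (f := fun k : ℤ => f k.natAbs)
    ENNReal.summable.hasSum ENNReal.summable.hasSum).tsum_eq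
  rw [h, two_mul]
  refine add_le_add (le_of_eq (tsum_congr fun n => rfl)) (le_trans (le_of_eq (tsum_congr fun n => ?_))
    (ENNReal.tsum_comp_le_tsum_of_injective (add_left_injective 1) f))
  rw [Int.natAbs_neg]
  rfl

lemma le_tsum_int_natAbs (f : ℕ → ℝ≥0∞) : ∑' n, f n ≤ ∑' k : ℤ, f k.natAbs :=
  ENNReal.tsum_comp_le_tsum_of_injective (f := ((↑) : ℕ → ℤ)) Nat.cast_injective
    fun k : ℤ => f k.natAbs

end SinSquare

/-- The square of the difference quotient. -/
def gagliardo (v : ℝ → ℂ) (x y : ℝ) : ENNReal := ENNReal.ofReal (‖v x - v y‖ ^ 2 / (x - y) ^ 2)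

lemma measurable_gagliardo {v : ℝ → ℂ} (hv : Measurable v) :
    Measurable fun z : ℝ × ℝ => gagliardo v z.1 z.2 := by
  unfold gagliardo
  fun_prop

lemma gagliardo_le {v : ℝ → ℂ} {x y d c : ℝ} (h : |x - y| ≤ c * |d|) :
    ENNReal.ofReal (‖v x - v y‖ ^ 2 / d ^ 2) ≤ ENNReal.ofReal (c ^ 2) * gagliardo v x y := by
  rw [gagliardo, ← ENNReal.ofReal_mul (by positivity)]
  refine ENNReal.ofReal_le_ofReal ?_
  rcases eq_or_ne x y with h0 | h0
  · simp [h0]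
  rcases eq_or_ne d 0 with h1 | h1
  · simp [h1]; positivity
  have h2 : 0 < (x - y) ^ 2 := by have := sub_ne_zero.mpr h0; positivity
  have h3 : (x - y) ^ 2 ≤ c ^ 2 * d ^ 2 := by
    have := pow_le_pow_left₀ (abs_nonneg _) h 2
    rwa [sq_abs, mul_pow, sq_abs] at this
  rw [← mul_div_assoc, div_le_div_iff₀ (by positivity) h2]
  nlinarith [mul_le_mul_of_nonneg_left h3 (sq_nonneg ‖v x - v y‖)]

lemma le_gagliardo {v : ℝ → ℂ} {x y d c : ℝ} (h0 : x ≠ y) (h : |d| ≤ c * |x - y|) (hd : d ≠ 0) :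
    gagliardo v x y ≤ ENNReal.ofReal (c ^ 2) * ENNReal.ofReal (‖v x - v y‖ ^ 2 / d ^ 2) := by
  rw [gagliardo, ← ENNReal.ofReal_mul (by positivity)]
  refine ENNReal.ofReal_le_ofReal ?_
  have h2 : 0 < (x - y) ^ 2 := by have := sub_ne_zero.mpr h0; positivity
  have h3 : d ^ 2 ≤ c ^ 2 * (x - y) ^ 2 := by
    have := pow_le_pow_left₀ (abs_nonneg _) h 2
    rwa [sq_abs, mul_pow, sq_abs] at this
  rw [← mul_div_assoc, div_le_div_iff₀ h2 (by positivity)]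
  nlinarith [mul_le_mul_of_nonneg_left h3 (sq_nonneg ‖v x - v y‖)]

namespace LogCos

open ENNReal

variable {a b : ℝ} (ha : 0 < a) (hab : a < b)

/-- The translation seminorm of the folded function. -/
def translationEnergy (v : L2 a b) : ℝ≥0∞ :=
  ∫⁻ h in Ioc (-Real.pi) Real.pi, ∫⁻ t in Ioc (-Real.pi) Real.pi,
    ENNReal.ofReal (‖v (foldPt a b (t + h)) - v (foldPt a b t)‖ ^ 2 / h ^ 2)

lemma measurable_translation (v : L2 a b) : Measurable fun z : ℝ × ℝ =>
    ENNReal.ofReal (‖v (foldPt a b (z.2 + z.1)) - v (foldPt a b z.2)‖ ^ 2 / z.1 ^ 2) := by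
  have hv : Measurable v := (Lp.stronglyMeasurable v).measurable
  have hX : Measurable (foldPt a b) := continuous_foldPt.measurable
  fun_prop

/-- Parseval's identity for each `h`, integrated term by term. The inner integrals are comparable to
`|k|`. -/
lemma translationEnergy_eq (ha : 0 < a) (hab : a < b) (v : L2 a b) : translationEnergy v =
    ∑' k : ℤ, ENNReal.ofReal ((2 * freq a b) ^ 2 * ‖cosCoeff v k.natAbs‖ ^ 2 / (2 * Real.pi)) *
      ∫⁻ h in Ioc (-Real.pi) Real.pi, ENNReal.ofReal (4 * Real.sin (k * h / 2) ^ 2 / h ^ 2) := by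
  have hpi := Real.pi_pos
  have h1 : ∀ h, ∫⁻ t in Ioc (-Real.pi) Real.pi,
      ENNReal.ofReal (‖v (foldPt a b (t + h)) - v (foldPt a b t)‖ ^ 2 / h ^ 2) =
      ∑' k : ℤ, ENNReal.ofReal ((2 * freq a b) ^ 2 * ‖cosCoeff v k.natAbs‖ ^ 2 / (2 * Real.pi)) *
        ENNReal.ofReal (4 * Real.sin (k * h / 2) ^ 2 / h ^ 2) := by
    intro h
    have hG := memLp_comp_foldPt ha hab v (-Real.pi)
    rw [show -Real.pi + 2 * Real.pi = Real.pi by ring] at hG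
    have hm := ((memLp_comp_foldPt_add ha hab v h).sub hG).integrable_norm_pow two_ne_zero
    simp only [Pi.sub_apply] at hm
    have hs := (hasSum_translate ha hab v h).mul_right ((2 * Real.pi)⁻¹ * (h ^ 2)⁻¹)
    rw [← ofReal_integral_eq_lintegral_ofReal (hm.div_const _) (ae_of_all _ fun _ => by positivity)]
    rw [intervalIntegral.integral_of_le (by linarith)] at hs
    have hs' := hs.of_eq (b := ∫ t in Ioc (-Real.pi) Real.pi,
      ‖v (foldPt a b (t + h)) - v (foldPt a b t)‖ ^ 2 / h ^ 2) (fun k => rfl) (by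
        rw [integral_div]
        field_simp)
    rw [← hs'.tsum_eq, ENNReal.ofReal_tsum_of_nonneg (fun _ => by positivity) hs'.summable]
    refine tsum_congr fun k => ?_
    rw [← ENNReal.ofReal_mul (by positivity)]
    congr 1
    rw [div_eq_mul_inv, div_eq_mul_inv]
    ring
  simp only [translationEnergy, h1]
  rw [lintegral_tsum fun k => by fun_prop]
  refine tsum_congr fun k => ?_
  rw [lintegral_const_mul' _ _ ENNReal.ofReal_ne_top]

lemma foldAngle_div_freq_mem (ha : 0 < a) (hab : a < b) (t : ℝ) :
    foldAngle t / freq a b ∈ Icc 0 (Real.log (b / a)) := by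
  have hf := freq_pos ha hab
  have ht := foldAngle_mem t
  refine ⟨div_nonneg ht.1 hf.le, ?_⟩
  rw [div_le_iff₀ hf, mul_comm, freq_mul_log ha hab]
  exact ht.2

lemma dist_foldPt_le (ha : 0 < a) (hab : a < b) (s t : ℝ) :
    |foldPt a b s - foldPt a b t| ≤ b / freq a b * |s - t| := by
  have hf := freq_pos ha hab
  wlog hst : foldAngle t ≤ foldAngle s generalizing s t
  · rw [abs_sub_comm, abs_sub_comm s]
    exact this t s (le_of_not_ge hst)
  have h1 := (foldAngle_div_freq_mem ha hab s).2
  have h2 : a * Real.exp (foldAngle s / freq a b) ≤ b := by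
    have := Real.exp_le_exp.mpr h1
    rw [Real.exp_log (div_pos (ha.trans hab) ha), le_div_iff₀ ha] at this
    linarith
  have h3 := Real.add_one_le_exp (foldAngle t / freq a b - foldAngle s / freq a b)
  rw [Real.exp_sub, ← sub_div, le_div_iff₀ (Real.exp_pos _)] at h3
  have h4 := (le_abs_self _).trans (abs_foldAngle_sub_le s t)
  have h5 : 0 ≤ (foldAngle s - foldAngle t) / freq a b := div_nonneg (sub_nonneg.mpr hst) hf.le
  have h6 : (foldAngle t - foldAngle s) / freq a b = -((foldAngle s - foldAngle t) / freq a b) := by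
    rw [← neg_div, neg_sub]
  rw [h6] at h3
  unfold foldPt
  rw [← mul_sub, abs_of_nonneg (mul_nonneg ha.le (sub_nonneg.mpr (by gcongr)))]
  calc a * (Real.exp (foldAngle s / freq a b) - Real.exp (foldAngle t / freq a b))
      ≤ (a * Real.exp (foldAngle s / freq a b)) * ((foldAngle s - foldAngle t) / freq a b) := by
        nlinarith
    _ ≤ b * (|s - t| / freq a b) := by
        have hb : 0 < b := ha.trans hab
        gcongr
    _ = _ := by ring

lemma le_dist_foldPt (ha : 0 < a) (hab : a < b) {s t : ℝ} (hs : s ∈ Icc 0 Real.pi)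
    (ht : t ∈ Icc 0 Real.pi) : |s - t| ≤ freq a b / a * |foldPt a b s - foldPt a b t| := by
  have hf := freq_pos ha hab
  wlog hst : t ≤ s generalizing s t
  · rw [abs_sub_comm, abs_sub_comm (foldPt a b s)]
    exact this ht hs (le_of_not_ge hst)
  have h1 : 1 ≤ Real.exp (t / freq a b) := Real.one_le_exp (div_nonneg ht.1 hf.le)
  have h3 := Real.add_one_le_exp (s / freq a b - t / freq a b)
  rw [Real.exp_sub, ← sub_div, le_div_iff₀ (Real.exp_pos _)] at h3
  have h5 : 0 ≤ (s - t) / freq a b := div_nonneg (sub_nonneg.mpr hst) hf.le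
  rw [foldPt_of_mem s hs, foldPt_of_mem t ht, ← mul_sub, abs_of_nonneg (sub_nonneg.mpr hst),
    abs_of_nonneg (mul_nonneg ha.le (sub_nonneg.mpr (by gcongr)))]
  calc s - t = freq a b * ((s - t) / freq a b) := by field_simp
    _ ≤ freq a b * (Real.exp (s / freq a b) - Real.exp (t / freq a b)) := by
        gcongr
        nlinarith
    _ = _ := by field_simp

/-- Folding is Lipschitz on the whole line, so difference quotients of the periodic extension are
dominated by those of `v`. Distances cost `(b / freq)²`, and each of the two changes of variables
costs `2 freq / a`. -/
lemma translationEnergy_le (ha : 0 < a) (hab : a < b) (v : L2 a b) : translationEnergy v ≤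
    ENNReal.ofReal ((b / freq a b) ^ 2 * (2 * freq a b / a) ^ 2) *
      ∫⁻ x in Ioo a b, ∫⁻ y in Ioo a b, gagliardo v x y := by
  have hf := freq_pos ha hab
  have hb : 0 < b := ha.trans hab
  have hv : Measurable v := (Lp.stronglyMeasurable v).measurable
  have hX : Measurable (foldPt a b) := continuous_foldPt.measurable
  have hH := measurable_gagliardo hv
  have hcut : ∀ φ : ℝ → ℝ≥0∞, ∫⁻ r in Ioo a b, ENNReal.ofReal (2 * freq a b / r) * φ r ≤
      ENNReal.ofReal (2 * freq a b / a) * ∫⁻ r in Ioo a b, φ r := fun φ => by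
    rw [← lintegral_const_mul' _ _ ENNReal.ofReal_ne_top]
    refine setLIntegral_mono' measurableSet_Ioo fun r hr => ?_
    gcongr
    exact hr.1.le
  calc translationEnergy v
      ≤ ∫⁻ h in Ioc (-Real.pi) Real.pi, ∫⁻ t in Ioc (-Real.pi) Real.pi,
          ENNReal.ofReal ((b / freq a b) ^ 2) * gagliardo v (foldPt a b (t + h)) (foldPt a b t) := by
        refine lintegral_mono fun h => lintegral_mono fun t => gagliardo_le ?_
        have := dist_foldPt_le ha hab (t + h) t
        rwa [add_sub_cancel_left] at this
    _ = ∫⁻ t in Ioc (-Real.pi) Real.pi, ∫⁻ h in Ioc (-Real.pi) Real.pi,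
          ENNReal.ofReal ((b / freq a b) ^ 2) * gagliardo v (foldPt a b (t + h)) (foldPt a b t) := by
        refine lintegral_lintegral_swap (Measurable.aemeasurable ?_)
        refine Measurable.const_mul ?_ _
        exact hH.comp (f := fun z : ℝ × ℝ => (foldPt a b (z.2 + z.1), foldPt a b z.2)) (by fun_prop)
    _ ≤ ∫⁻ t in Ioc (-Real.pi) Real.pi, ENNReal.ofReal ((b / freq a b) ^ 2) *
          (ENNReal.ofReal (2 * freq a b / a) * ∫⁻ x in Ioo a b, gagliardo v x (foldPt a b t)) := by
        refine lintegral_mono fun t => ?_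
        rw [lintegral_const_mul' _ _ ENNReal.ofReal_ne_top]
        gcongr
        have h1 := (measurePreserving_add_left volume t).setLIntegral_comp_preimage_emb
          (MeasurableEquiv.addLeft t).measurableEmbedding
          (fun s => gagliardo v (foldPt a b s) (foldPt a b t)) (Ioc (t + -Real.pi) (t + -Real.pi + 2 * Real.pi))
        have h2 : (fun x => t + x) ⁻¹' Ioc (t + -Real.pi) (t + -Real.pi + 2 * Real.pi) =
            Ioc (-Real.pi) Real.pi := by
          ext x; simp only [mem_preimage, mem_Ioc]
          constructor <;> rintro ⟨h, h'⟩ <;> constructor <;> linarith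
        rw [h2] at h1
        rw [h1, lintegral_comp_foldPt ha hab _ (fun x => gagliardo v x (foldPt a b t))]
        exact hcut _
    _ ≤ _ := by
        have h3 := lintegral_comp_foldPt ha hab (-Real.pi)
          (fun y => ∫⁻ x in Ioo a b, gagliardo v x y)
        rw [show -Real.pi + 2 * Real.pi = Real.pi by ring] at h3
        rw [lintegral_const_mul' _ _ ENNReal.ofReal_ne_top,
          lintegral_const_mul' _ _ ENNReal.ofReal_ne_top, h3, ENNReal.ofReal_mul (by positivity),
          sq (2 * freq a b / a), ENNReal.ofReal_mul (by positivity), mul_assoc, mul_assoc,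
          lintegral_lintegral_swap hH.aemeasurable]
        gcongr
        exact hcut _

/-- Only points in `(0, π)` are used, where folding is the identity and distances compare in the
opposite direction; their difference `h` lies in `(-π, π)`. Here `(b / freq)²` comes from the
changes of variables and `(freq / a)²` from the distances. -/
lemma le_translationEnergy (ha : 0 < a) (hab : a < b) (v : L2 a b) :
    ∫⁻ x in Ioo a b, ∫⁻ y in Ioo a b, gagliardo v x y ≤
      ENNReal.ofReal ((b / freq a b) ^ 2 * (freq a b / a) ^ 2) * translationEnergy v := by
  have hf := freq_pos ha hab
  have hb : 0 < b := ha.trans hab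
  have hpi := Real.pi_pos
  have hv : Measurable v := (Lp.stronglyMeasurable v).measurable
  have hX : Measurable (foldPt a b) := continuous_foldPt.measurable
  have hH := measurable_gagliardo hv
  have hcut : ∀ φ : ℝ → ℝ≥0∞, ∫⁻ r in Ioo a b, φ r ≤ ENNReal.ofReal (b / freq a b) *
      ∫⁻ t in Ioo 0 Real.pi, φ (foldPt a b t) := fun φ => by
    rw [lintegral_comp_foldPt_Ioo ha hab, ← lintegral_const_mul' _ _ ENNReal.ofReal_ne_top]
    refine setLIntegral_mono' measurableSet_Ioo fun r hr => ?_
    have hr0 : 0 < r := ha.trans hr.1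
    rw [← mul_assoc, ← ENNReal.ofReal_mul (by positivity)]
    refine le_mul_of_one_le_left' (ENNReal.one_le_ofReal.mpr ?_)
    rw [div_mul_div_cancel₀ hf.ne', one_le_div hr0]
    exact hr.2.le
  have hin : ∀ t ∈ Ioo 0 Real.pi, ∫⁻ s in Ioo 0 Real.pi, gagliardo v (foldPt a b s) (foldPt a b t) ≤
      ENNReal.ofReal ((freq a b / a) ^ 2) * ∫⁻ h in Ioc (-Real.pi) Real.pi,
        ENNReal.ofReal (‖v (foldPt a b (t + h)) - v (foldPt a b t)‖ ^ 2 / h ^ 2) := by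
    intro t ht
    rw [← lintegral_const_mul' _ _ ENNReal.ofReal_ne_top]
    have h1 := (measurePreserving_add_left volume t).setLIntegral_comp_preimage_emb
      (MeasurableEquiv.addLeft t).measurableEmbedding
      (fun s => gagliardo v (foldPt a b s) (foldPt a b t)) (Ioo 0 Real.pi)
    rw [← h1]
    have hsub : (fun x => t + x) ⁻¹' Ioo 0 Real.pi ⊆ Ioc (-Real.pi) Real.pi := by
      intro x; simp only [mem_preimage, mem_Ioo, mem_Ioc]; rintro ⟨h, h'⟩
      constructor <;> linarith [ht.1, ht.2]
    refine le_trans (setLIntegral_mono' (measurableSet_Ioo.preimage (by fun_prop)) fun h hh => ?_)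
      (lintegral_mono_set hsub)
    rcases eq_or_ne h 0 with h0 | h0
    · subst h0; simp [gagliardo]
    have h2 := le_dist_foldPt ha hab (Ioo_subset_Icc_self hh) (Ioo_subset_Icc_self ht)
    rw [add_sub_cancel_left] at h2
    refine le_gagliardo (fun h3 => h0 ?_) h2 h0
    rw [h3, sub_self, abs_zero, mul_zero] at h2
    exact abs_nonpos_iff.mp h2
  calc ∫⁻ x in Ioo a b, ∫⁻ y in Ioo a b, gagliardo v x y
      ≤ ENNReal.ofReal (b / freq a b) * ∫⁻ s in Ioo 0 Real.pi,
          ENNReal.ofReal (b / freq a b) * ∫⁻ t in Ioo 0 Real.pi,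
            gagliardo v (foldPt a b s) (foldPt a b t) := by
        refine (hcut _).trans ?_
        gcongr with s
        exact hcut _
    _ = ENNReal.ofReal ((b / freq a b) ^ 2) * ∫⁻ t in Ioo 0 Real.pi, ∫⁻ s in Ioo 0 Real.pi,
            gagliardo v (foldPt a b s) (foldPt a b t) := by
        rw [lintegral_const_mul' _ _ ENNReal.ofReal_ne_top, ← mul_assoc,
          ← ENNReal.ofReal_mul (by positivity), ← sq]
        congr 1
        refine lintegral_lintegral_swap (Measurable.aemeasurable ?_)
        exact hH.comp (f := fun z : ℝ × ℝ => (foldPt a b z.1, foldPt a b z.2)) (by fun_prop)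
    _ ≤ ENNReal.ofReal ((b / freq a b) ^ 2) * ∫⁻ t in Ioc (-Real.pi) Real.pi,
          ENNReal.ofReal ((freq a b / a) ^ 2) * ∫⁻ h in Ioc (-Real.pi) Real.pi,
        ENNReal.ofReal (‖v (foldPt a b (t + h)) - v (foldPt a b t)‖ ^ 2 / h ^ 2) := by
        refine mul_le_mul_right ?_ _
        exact (setLIntegral_mono' measurableSet_Ioo hin).trans
          (lintegral_mono_set ((Ioo_subset_Ioo_left (neg_nonpos.mpr hpi.le)).trans Ioo_subset_Ioc_self))
    _ = _ := by
        rw [lintegral_const_mul' _ _ ENNReal.ofReal_ne_top, ← mul_assoc,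
          ← ENNReal.ofReal_mul (by positivity), translationEnergy]
        congr 1
        exact (lintegral_lintegral_swap (measurable_translation v).aemeasurable).symm

lemma ofReal_cosCoeff_mul (ha : 0 < a) (hab : a < b) (v : L2 a b) (n : ℕ) {c : ℝ} :
    ENNReal.ofReal ((2 * freq a b) ^ 2 * ‖cosCoeff v n‖ ^ 2 / (2 * Real.pi)) *
      ENNReal.ofReal (c * n) =
    ENNReal.ofReal (c * freq a b) * ENNReal.ofReal (n * ‖U ha hab v n‖ ^ 2) := by
  have hf := freq_pos ha hab
  rw [← ENNReal.ofReal_mul (by positivity), ← ENNReal.ofReal_mul' (by positivity), U_apply, norm_mul,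
    Complex.norm_of_nonneg (cn_pos ha hab n).le, mul_pow _ _ 2, mul_pow (cn a b n), cn_sq ha hab]
  rcases eq_or_ne n 0 with h | h
  · simp [h]
  · rw [if_neg h]
    congr 1
    field_simp

/-- The square of the `H^{1/2}` seminorm in terms of the coefficients. -/
def halfEnergy (x : SeqL2) : ℝ≥0∞ := ∑' n : ℕ, ENNReal.ofReal (n * ‖x n‖ ^ 2)

lemma exists_lintegral_gagliardo_le (ha : 0 < a) (hab : a < b) : ∃ C : ℝ, 0 ≤ C ∧ ∀ v : L2 a b,
    ∫⁻ x in Ioo a b, ∫⁻ y in Ioo a b, gagliardo v x y ≤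
      ENNReal.ofReal C * halfEnergy (U ha hab v) := by
  have hf := freq_pos ha hab
  have hpi := Real.pi_pos
  refine ⟨(b / freq a b) ^ 2 * (freq a b / a) ^ 2 * (5 * Real.pi * freq a b * 2), by positivity,
    fun v => (le_translationEnergy ha hab v).trans ?_⟩
  rw [ENNReal.ofReal_mul (p := (b / freq a b) ^ 2 * (freq a b / a) ^ 2) (by positivity), mul_assoc]
  refine mul_le_mul_right ?_ _
  rw [translationEnergy_eq ha hab, ENNReal.ofReal_mul (by positivity), ENNReal.ofReal_ofNat, mul_assoc]
  refine le_trans ?_ (mul_le_mul_right (tsum_int_natAbs_le _) _)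
  rw [← ENNReal.tsum_mul_left]
  refine ENNReal.tsum_le_tsum fun k => ?_
  rw [← ofReal_cosCoeff_mul ha hab]
  gcongr
  exact lintegral_sin_sq_le k

lemma exists_le_lintegral_gagliardo (ha : 0 < a) (hab : a < b) : ∃ C : ℝ, 0 ≤ C ∧ ∀ v : L2 a b,
    halfEnergy (U ha hab v) ≤
      ENNReal.ofReal C * ∫⁻ x in Ioo a b, ∫⁻ y in Ioo a b, gagliardo v x y := by
  have hf := freq_pos ha hab
  have hpi := Real.pi_pos
  refine ⟨(4 / Real.pi * freq a b)⁻¹ * ((b / freq a b) ^ 2 * (2 * freq a b / a) ^ 2), by positivity,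
    fun v => ?_⟩
  rw [ENNReal.ofReal_mul (by positivity), mul_assoc]
  refine le_trans ?_ (mul_le_mul_right (translationEnergy_le ha hab v) _)
  have h1 : ENNReal.ofReal (4 / Real.pi * freq a b) * halfEnergy (U ha hab v) ≤
      translationEnergy v := by
    rw [translationEnergy_eq ha hab, halfEnergy]
    refine (mul_le_mul_right (le_tsum_int_natAbs _) _).trans ?_
    rw [← ENNReal.tsum_mul_left]
    refine ENNReal.tsum_le_tsum fun k => ?_
    rw [← ofReal_cosCoeff_mul ha hab]
    gcongr
    exact le_lintegral_sin_sq k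
  rw [ENNReal.ofReal_inv_of_pos (by positivity), ← ENNReal.div_eq_inv_mul,
    ENNReal.le_div_iff_mul_le (.inl (by positivity)) (.inl ENNReal.ofReal_ne_top), mul_comm]
  exact h1

lemma enorm_diffQuotient_sq (v : ℝ → ℂ) (x y : ℝ) :
    ‖(v x - v y) / ((|x - y| : ℝ) : ℂ)‖ₑ ^ 2 = gagliardo v x y := by
  rw [gagliardo, ← ofReal_norm, ← ENNReal.ofReal_pow (norm_nonneg _), norm_div,
    Complex.norm_of_nonneg (abs_nonneg _), div_pow, sq_abs]

lemma eLpNorm_diffQuotient_sq (v : L2 a b) :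
    eLpNorm (fun z : ℝ × ℝ => (v z.1 - v z.2) / ((|z.1 - z.2| : ℝ) : ℂ)) 2
      ((volume.restrict (Ioo a b)).prod (volume.restrict (Ioo a b))) ^ 2 =
    ∫⁻ x in Ioo a b, ∫⁻ y in Ioo a b, gagliardo v x y := by
  have h := eLpNorm_nnreal_pow_eq_lintegral (p := 2)
    (μ := (volume.restrict (Ioo a b)).prod (volume.restrict (Ioo a b)))
    (f := fun z : ℝ × ℝ => (v z.1 - v z.2) / ((|z.1 - z.2| : ℝ) : ℂ)) two_ne_zero
  simp only [NNReal.coe_ofNat, ENNReal.rpow_ofNat, ENNReal.coe_ofNat, enorm_diffQuotient_sq] at h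
  rw [h, lintegral_prod _ (measurable_gagliardo (Lp.stronglyMeasurable v).measurable).aemeasurable]

variable {ω ς : ℝ} {𝔫 : ℝ → ℝ} (hω : 0 < ω) (hς : 0 < ς)
  (h𝔫 : MemLp 𝔫 ⊤ (volume.restrict (Ioo a b)))

lemma modalData_sq_le (n : ℕ) : (modalData ha hab hω hς h𝔫).sq n ≤ freq a b * n + 1 := by
  have hf := freq_pos ha hab
  refine Real.sqrt_le_iff.mpr ⟨by positivity, ?_⟩
  change freq a b ^ 2 * n ^ 2 + 1 ≤ _
  have : 0 ≤ freq a b * n := by positivity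
  nlinarith

lemma le_modalData_sq (n : ℕ) : freq a b * n ≤ (modalData ha hab hω hς h𝔫).sq n := by
  refine Real.le_sqrt_of_sq_le ?_
  change _ ≤ freq a b ^ 2 * n ^ 2 + 1
  nlinarith

lemma norm_sq_qr_mul (n : ℕ) (x : ℂ) : ‖((modalData ha hab hω hς h𝔫).qr n : ℂ) * x‖ ^ 2 =
    (modalData ha hab hω hς h𝔫).sq n * ‖x‖ ^ 2 := by
  rw [norm_mul, Complex.norm_of_nonneg (ModalData.qr_pos n).le, mul_pow, sq, ModalData.qr_mul_qr]

/-- The fourth root of the diagonal part on `H^{1/2}`. -/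
lemma exists_Jh : ∃ J : Hhalf a b →L[ℂ] SeqL2, ∀ u n,
    J u n = (modalData ha hab hω hς h𝔫).qr n * U ha hab (Hhalf.fn u) n := by
  have hf := freq_pos ha hab
  obtain ⟨C, hC, hCb⟩ := exists_le_lintegral_gagliardo ha hab
  set K := ‖(U ha hab : L2 a b →L[ℂ] SeqL2)‖ with hK
  refine exists_weighted_map ((U ha hab : L2 a b →L[ℂ] SeqL2) ∘L Hhalf.fnL a b) _
    (C := √(freq a b * C + K ^ 2)) (by positivity) fun u N => ?_
  simp only [ContinuousLinearMap.comp_apply, ContinuousLinearEquiv.coe_coe, Hhalf.fnL_apply,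
    norm_sq_qr_mul]
  set q := (u : WithLp 2 (L2 a b × L2sq a b)).snd with hq
  have hqn : ‖q‖ ≤ ‖u‖ := L2.norm_snd_le (u : WithLp 2 (L2 a b × L2sq a b))
  have h1 : ∫⁻ x in Ioo a b, ∫⁻ y in Ioo a b, gagliardo (Hhalf.fn u) x y = ENNReal.ofReal (‖q‖ ^ 2) := by
    rw [← eLpNorm_diffQuotient_sq, ← eLpNorm_congr_ae (show HasDiffQuotient (Hhalf.fn u) q from u.2),
      ← Lp.enorm_def, ← ofReal_norm, ENNReal.ofReal_pow (norm_nonneg _)]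
  have h2 : ∑ n ∈ Finset.range N, (n : ℝ) * ‖U ha hab (Hhalf.fn u) n‖ ^ 2 ≤ C * ‖q‖ ^ 2 := by
    have h3 := hCb (Hhalf.fn u)
    rw [h1, ← ENNReal.ofReal_mul hC] at h3
    refine (ENNReal.ofReal_le_ofReal_iff (by positivity)).mp (le_trans ?_ h3)
    rw [ENNReal.ofReal_sum_of_nonneg fun _ _ => by positivity]
    exact ENNReal.sum_le_tsum _
  have h3 : ∑ n ∈ Finset.range N, ‖U ha hab (Hhalf.fn u) n‖ ^ 2 ≤ ‖U ha hab (Hhalf.fn u)‖ ^ 2 :=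
    sum_le_hasSum _ (fun _ _ => by positivity) (SeqL2.hasSum_norm_sq _)
  have h4 : ‖U ha hab (Hhalf.fn u)‖ ≤ K * ‖u‖ :=
    ((U ha hab : L2 a b →L[ℂ] SeqL2).le_opNorm _).trans
      (by gcongr; exact L2.norm_fst_le (u : WithLp 2 (L2 a b × L2sq a b)))
  calc _ ≤ ∑ n ∈ Finset.range N, (freq a b * (n * ‖U ha hab (Hhalf.fn u) n‖ ^ 2) +
        ‖U ha hab (Hhalf.fn u) n‖ ^ 2) := by
        refine Finset.sum_le_sum fun n _ => ?_
        have := mul_le_mul_of_nonneg_right (modalData_sq_le ha hab hω hς h𝔫 n)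
          (sq_nonneg ‖U ha hab (Hhalf.fn u) n‖)
        linarith
    _ ≤ freq a b * (C * ‖u‖ ^ 2) + (K * ‖u‖) ^ 2 := by
        rw [Finset.sum_add_distrib, ← Finset.mul_sum]
        refine add_le_add (mul_le_mul_of_nonneg_left (h2.trans ?_) hf.le) (h3.trans ?_) <;> gcongr
    _ = _ := by
        rw [mul_pow, mul_pow, Real.sq_sqrt (by positivity)]
        ring

/-- The inverse fourth root of the diagonal part maps into `H^{1/2}`. -/
lemma exists_Eh : ∃ E : SeqL2 →L[ℂ] Hhalf a b, ∀ x,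
    Hhalf.fn (E x) = (U ha hab).symm ((modalData ha hab hω hς h𝔫).qInv x) := by
  have hf := freq_pos ha hab
  set D := modalData ha hab hω hς h𝔫 with hD
  obtain ⟨C, hC, hCb⟩ := exists_lintegral_gagliardo_le ha hab
  refine exists_lift (Hhalf a b) Hhalf.fn_injective (((U ha hab).symm : SeqL2 →L[ℂ] L2 a b) ∘L D.qInv)
    (C := √(C * (freq a b)⁻¹)) fun x => ?_
  set v : L2 a b := (U ha hab).symm (D.qInv x) with hv
  have h1 : halfEnergy (U ha hab v) ≤ ENNReal.ofReal ((freq a b)⁻¹ * ‖x‖ ^ 2) := by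
    have hs := (SeqL2.hasSum_norm_sq x).mul_left (freq a b)⁻¹
    rw [← hs.tsum_eq, ENNReal.ofReal_tsum_of_nonneg (fun _ => by positivity) hs.summable]
    refine ENNReal.tsum_le_tsum fun n => ENNReal.ofReal_le_ofReal ?_
    have h2 := norm_sq_qr_mul ha hab hω hς h𝔫 n (D.qInv x n)
    have h3 : (D.qr n : ℂ) ≠ 0 := by exact_mod_cast (ModalData.qr_pos n).ne'
    rw [ModalData.qInv_apply, mul_inv_cancel_left₀ h3, ← ModalData.qInv_apply] at h2
    rw [hv, ContinuousLinearEquiv.apply_symm_apply, h2, inv_mul_eq_div, le_div_iff₀ hf]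
    have := mul_le_mul_of_nonneg_right (le_modalData_sq ha hab hω hς h𝔫 n)
      (sq_nonneg ‖D.qInv x n‖)
    linarith
  have h2 : eLpNorm (fun z : ℝ × ℝ => (v z.1 - v z.2) / ((|z.1 - z.2| : ℝ) : ℂ)) 2
      ((volume.restrict (Ioo a b)).prod (volume.restrict (Ioo a b))) ≤
      ENNReal.ofReal (√(C * (freq a b)⁻¹) * ‖x‖) := by
    refine (ENNReal.pow_le_pow_left_iff two_ne_zero).mp ?_
    rw [eLpNorm_diffQuotient_sq, ← ENNReal.ofReal_pow (by positivity), mul_pow,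
      Real.sq_sqrt (by positivity), mul_assoc, ENNReal.ofReal_mul hC]
    exact (hCb v).trans (mul_le_mul_right h1 _)
  have hmeas : Measurable v := (Lp.stronglyMeasurable v).measurable
  have hm : MemLp (fun z : ℝ × ℝ => (v z.1 - v z.2) / ((|z.1 - z.2| : ℝ) : ℂ)) 2
      ((volume.restrict (Ioo a b)).prod (volume.restrict (Ioo a b))) :=
    ⟨Measurable.aestronglyMeasurable (by fun_prop), h2.trans_lt ENNReal.ofReal_lt_top⟩
  refine ⟨⟨WithLp.toLp 2 (v, hm.toLp), hm.coeFn_toLp⟩, rfl, ?_⟩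
  change ‖hm.toLp‖ ≤ _
  rw [Lp.norm_toLp]
  exact ENNReal.toReal_le_of_le_ofReal (by positivity) h2

end LogCos

/-! ### Root systems and the Dirichlet-to-Neumann operator -/

lemma SeqL2.inner_add_inner_eq {p q r s t v : SeqL2}
    (h : ∀ n, conj (p n) * q n + conj (r n) * s n = conj (t n) * v n) :
    inner ℂ p q + inner ℂ r s = inner ℂ t v :=
  ((hasSum_inner p q).add (hasSum_inner r s)).unique ((hasSum_inner t v).of_eq h rfl)

lemma SeqL2.inner_eq_of_mul_eq {p q t v : SeqL2} (h : ∀ n, conj (p n) * q n = conj (t n) * v n) :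
    inner ℂ p q = inner ℂ t v :=
  (hasSum_inner p q).unique ((hasSum_inner t v).of_eq h rfl)

lemma ContinuousLinearMap.eq_of_dense_comp {X Y : Type*} [NormedAddCommGroup X] [NormedSpace ℂ X]
    [NormedAddCommGroup Y] [NormedSpace ℂ Y] {D D' : X →L[ℂ] Y} (E : SeqL2 →L[ℂ] X)
    (hE : Function.Surjective E) {s : Set SeqL2} (hs : Dense s) (h : ∀ x ∈ s, D (E x) = D' (E x)) :
    D = D' := by
  have h1 : (D ∘ E : SeqL2 → Y) = D' ∘ E :=
    Continuous.ext_on hs (D.continuous.comp E.continuous) (D'.continuous.comp E.continuous) h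
  ext u
  obtain ⟨x, rfl⟩ := hE u
  exact congrFun h1 x

namespace LogCos

variable {a b ω ς : ℝ} {𝔫 : ℝ → ℝ} (ha : 0 < a) (hab : a < b) (hω : 0 < ω) (hς : 0 < ς)
  (h𝔫 : MemLp 𝔫 ⊤ (volume.restrict (Ioo a b)))

/-- By compactness of the resolvent the spectrum consists of eigenvalues: off `eigs` the operator `1
- (z + τ) K` is invertible and yields the resolvent, while a resolvent at an eigenvalue would map 0
to an eigenvector. -/
lemma mem_modalSpectrum_iff {z : ℂ} :
    z ∈ modalSpectrum a b ω ς 𝔫 ↔ z ∈ (modalData ha hab hω hς h𝔫).eigs := by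
  constructor
  · intro hz
    by_contra h
    refine hz ?_
    have h1 := ModalData.IsResolvent.isResolvent_of_isUnit rfl
      (ModalData.isUnit_of_forall (D := modalData ha hab hω hς h𝔫) (z := z) fun φ hφ => by
        by_contra h0
        exact h ⟨φ, hφ, h0⟩)
    set R := Ring.inverse (1 - (z + (modalData ha hab hω hς h𝔫).tau) • (modalData ha hab hω hς h𝔫).K) *
      (modalData ha hab hω hς h𝔫).K
    refine ⟨((U ha hab).symm : SeqL2 →L[ℂ] L2 a b) ∘L R ∘L (U ha hab : L2 a b →L[ℂ] SeqL2),
      fun f => ?_, fun φ g hφ => ?_⟩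
    · rw [isModalImage_iff ha hab hω hς h𝔫]
      simpa using h1.rel (U ha hab f)
    · rw [isModalImage_iff ha hab hω hς h𝔫, h1] at hφ
      simp [hφ]
  · rintro ⟨φ, hφ, h0⟩ ⟨R, -, hR⟩
    refine h0 ?_
    have h1 := hR ((U ha hab).symm φ) (z • (U ha hab).symm φ)
      ((isModalImage_iff ha hab hω hς h𝔫 _ _).mpr (by simpa using hφ))
    rw [sub_self, map_zero] at h1
    simpa using h1.symm

lemma mem_modalRootSpace_iff {z : ℂ} {φ : L2 a b} : φ ∈ modalRootSpace a b ω ς 𝔫 z ↔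
    ∃ m, U ha hab φ ∈ (modalData ha hab hω hς h𝔫).rootN z m := by
  refine exists_congr fun m => ?_
  rw [ModalData.mem_rootN_iff_chain]
  constructor
  · rintro ⟨x, h0, rfl, h⟩
    refine ⟨fun i => U ha hab (x i), by simp [h0], rfl, fun i hi => ?_⟩
    have := (isModalImage_iff ha hab hω hς h𝔫 _ _).mp (h i hi)
    rwa [map_add, map_smul] at this
  · rintro ⟨x, h0, h1, h⟩
    refine ⟨fun i => (U ha hab).symm (x i), by simp [h0], by simp [h1], fun i hi => ?_⟩
    exact (isModalImage_iff ha hab hω hς h𝔫 _ _).mpr (by simpa using h i hi)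

lemma exists_basis_modalRootSpace (ha : 0 < a) (hab : a < b) (hω : 0 < ω) (hς : 0 < ς)
    (h𝔫 : MemLp 𝔫 ⊤ (volume.restrict (Ioo a b))) {z : ℂ}
    (hz : z ∈ modalSpectrum a b ω ς 𝔫) :
    ∃ (J : ℕ) (y : ℕ → L2 a b), 1 ≤ J ∧ y 0 = 0 ∧
      (∀ j ∈ Finset.Icc 1 J, IsModalImage a b ω ς 𝔫 (y j) (z • y j + y (j - 1))) ∧
      LinearIndepOn ℂ y (Icc 1 J) ∧
      (Submodule.span ℂ (y '' Icc 1 J) : Set (L2 a b)) = modalRootSpace a b ω ς 𝔫 z := by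
  rw [mem_modalSpectrum_iff ha hab hω hς h𝔫] at hz
  obtain ⟨J, y, hJ, h0, hch, hli, hsp, hmax⟩ := ModalData.exists_jordan_basis hz
  refine ⟨J, fun j => (U ha hab).symm (y j), hJ, by simp [h0], fun j hj => ?_, ?_, ?_⟩
  · obtain ⟨i, rfl⟩ : ∃ i, j = i + 1 := ⟨j - 1, by have := Finset.mem_Icc.mp hj; omega⟩
    refine (isModalImage_iff ha hab hω hς h𝔫 _ _).mpr ?_
    simpa using hch i (by have := Finset.mem_Icc.mp hj; omega)
  · exact hli.map_injOn ((U ha hab).symm : SeqL2 →L[ℂ] L2 a b).toLinearMap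
      ((U ha hab).symm.injective.injOn)
  · ext φ
    rw [mem_modalRootSpace_iff ha hab hω hς h𝔫]
    have h1 : (fun j => (U ha hab).symm (y j)) '' Icc 1 J =
        ((U ha hab).symm : SeqL2 →L[ℂ] L2 a b).toLinearMap '' (y '' Icc 1 J) := by
      rw [image_image]; rfl
    rw [h1, Submodule.span_image, hsp]
    constructor
    · rintro ⟨x, hx, rfl⟩
      exact ⟨J, by simpa using hx⟩
    · rintro ⟨m, hm⟩
      exact ⟨_, hmax m hm, by simp⟩

lemma nonempty_rootSystem (ha : 0 < a) (hab : a < b) (hω : 0 < ω) (hς : 0 < ς)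
    (h𝔫 : MemLp 𝔫 ⊤ (volume.restrict (Ioo a b))) :
    Nonempty (RootSystem a b ω ς 𝔫) := by
  have he : modalSpectrum a b ω ς 𝔫 = (modalData ha hab hω hς h𝔫).eigs :=
    Set.ext fun z => mem_modalSpectrum_iff ha hab hω hς h𝔫
  have hc : Countable (modalSpectrum a b ω ς 𝔫) := by
    rw [he]; exact ModalData.eigs_countable.to_subtype
  have hi : Infinite (modalSpectrum a b ω ς 𝔫) := by
    rw [he]; exact ModalData.eigs_infinite.to_subtype
  obtain ⟨hd⟩ := nonempty_denumerable (modalSpectrum a b ω ς 𝔫)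
  set e := (Denumerable.eqv (modalSpectrum a b ω ς 𝔫)).symm with hedef
  choose J y hJ h0 hch hli hsp using fun n =>
    exists_basis_modalRootSpace ha hab hω hς h𝔫 (e n).2
  exact ⟨{
    eig := fun n => e n
    eig_injective := Subtype.val_injective.comp e.injective
    range_eig := by
      rw [show (fun n => (e n : ℂ)) = Subtype.val ∘ e from rfl, e.surjective.range_comp,
        Subtype.range_coe]
    len := J
    len_pos := hJ
    vec := y
    vec_zero := h0
    chain := hch
    linearIndepOn := hli
    span_eq := hsp }⟩

end LogCos

/-! ### The modewise formula as a square root, and uniqueness of the extensions -/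

namespace RootSystem

open LogCos

variable {a b ω ς : ℝ} {𝔫 : ℝ → ℝ} (ha : 0 < a) (hab : a < b) (hω : 0 < ω) (hς : 0 < ς)
  (h𝔫 : MemLp 𝔫 ⊤ (volume.restrict (Ioo a b))) (Φ : RootSystem a b ω ς 𝔫)

lemma modeSum_single {n j : ℕ} (hj : j ∈ Finset.Icc 1 (Φ.len n)) :
    Φ.modeSum n (Pi.single j 1) = Φ.vec n j := by
  rw [modeSum, Finset.sum_eq_single j]
  · simp
  · intro i _ hi
    simp [hi]
  · exact fun h => absurd hj h

lemma roots_le {S : Submodule ℂ SeqL2}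
    (h : ∀ n, ∀ j ∈ Finset.Icc 1 (Φ.len n), U ha hab (Φ.vec n j) ∈ S) :
    (modalData ha hab hω hς h𝔫).roots ≤ S := by
  refine iSup_le fun z => iSup_le fun m x hx => ?_
  by_cases hz : z ∈ (modalData ha hab hω hς h𝔫).eigs
  · rw [← mem_modalSpectrum_iff ha hab hω hς h𝔫, ← Φ.range_eig] at hz
    obtain ⟨n, rfl⟩ := hz
    have h1 : (U ha hab).symm x ∈ modalRootSpace a b ω ς 𝔫 (Φ.eig n) :=
      (mem_modalRootSpace_iff ha hab hω hς h𝔫).mpr ⟨m, by simpa using hx⟩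
    rw [← Φ.span_eq, SetLike.mem_coe] at h1
    have h2 : Submodule.span ℂ (Φ.vec n '' Icc 1 (Φ.len n)) ≤
        S.comap (U ha hab : L2 a b →L[ℂ] SeqL2).toLinearMap := by
      rw [Submodule.span_le]
      rintro _ ⟨j, hj, rfl⟩
      exact h n j (Finset.mem_Icc.mpr hj)
    simpa using h2 h1
  · rw [ModalData.rootN_eq_bot hz, Submodule.mem_bot] at hx
    rw [hx]
    exact S.zero_mem

lemma eig_mem_slitPlane (ha : 0 < a) (hab : a < b) (hω : 0 < ω) (hς : 0 < ς)
    (h𝔫 : MemLp 𝔫 ⊤ (volume.restrict (Ioo a b))) (n : ℕ) : Φ.eig n ∈ Complex.slitPlane := by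
  have h : Φ.eig n ∈ modalSpectrum a b ω ς 𝔫 := Φ.range_eig ▸ mem_range_self n
  rw [mem_modalSpectrum_iff ha hab hω hς h𝔫] at h
  obtain ⟨φ, hφ, h0⟩ := h
  exact Or.inr (hφ.im_pos h0).ne'

lemma exists_H1_vec {n j : ℕ} (hj : j ∈ Finset.Icc 1 (Φ.len n)) : ∃ u : H1 a b, H1.fn u = Φ.vec n j := by
  obtain ⟨φ₁, _, h, -⟩ := Φ.chain n j hj
  exact ⟨⟨WithLp.toLp 2 (Φ.vec n j, φ₁), h⟩, rfl⟩

/-- With `β = i w` and `w` the principal root of the eigenvalue, `i β = -w` and `2 i β = -2 w`. The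
powers of the latter are odd, so a global sign comes out and the Taylor coefficients of the square
root remain. -/
lemma neg_dtnCoeff (n : ℕ) (p : ℕ → ℂ) {j : ℕ} (hj : j ≤ Φ.len n) :
    -Φ.dtnCoeff n p j = ∑ k ∈ Finset.Icc j (Φ.len n), sqrtCoeff (Φ.eig n ^ (1 / 2 : ℂ)) (k - j) * p k := by
  have hI : ∀ w : ℂ, Complex.I * (Complex.I * w) = -w := fun w => by
    rw [← mul_assoc, Complex.I_mul_I, neg_one_mul]
  rw [dtnCoeff, modalBeta, ← Finset.add_sum_Ioc_eq_sum_Icc hj, Nat.sub_self, hI, mul_assoc 2, hI,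
    neg_add, neg_mul, neg_neg, ← Finset.sum_neg_distrib]
  have h2 : Finset.Icc (j + 1) (Φ.len n) = Finset.Ioc j (Φ.len n) := by ext; simp
  rw [h2]
  refine congrArg₂ _ rfl (Finset.sum_congr rfl fun k hk => ?_)
  obtain ⟨m, rfl⟩ := Nat.exists_eq_add_of_le (Finset.mem_Ioc.mp hk).1
  have e1 : j + 1 + m - j - 1 = m := by omega
  have e2 : 2 * (j + 1 + m - j) - 1 = 2 * m + 1 := by omega
  have e3 : j + 1 + m - j = m + 1 := by omega
  rw [e1, e2, e3, sqrtCoeff, mul_neg, Odd.neg_pow ⟨m, rfl⟩]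
  rw [div_neg]
  ring

/-- The operator with symbol `√T - √(diag λ)` represents the modewise formula. -/
lemma sq_mul_add {B : SeqL2 →L[ℂ] SeqL2}
    (hB : ∀ w : ℂ, 0 < w.re → ∀ (m : ℕ) (x : ℕ → SeqL2), x 0 = 0 →
      (∀ i < m, (modalData ha hab hω hς h𝔫).Rel (x (i + 1)) (w ^ 2 • x (i + 1) + x i)) →
      ∀ j ≤ m, ∀ n, (modalData ha hab hω hς h𝔫).sq n * x j n + B (x j) n =
        ∑ l ∈ Finset.range j, sqrtCoeff w l * x (j - l) n)
    (n : ℕ) (p : ℕ → ℂ) (k : ℕ) :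
    (modalData ha hab hω hς h𝔫).sq k * U ha hab (Φ.modeSum n p) k + B (U ha hab (Φ.modeSum n p)) k =
      -U ha hab (Φ.modeSum n (Φ.dtnCoeff n p)) k := by
  have hcoe : ∀ (s : Finset ℕ) (f : ℕ → ℂ) (g : ℕ → SeqL2), (∑ j ∈ s, f j • g j : SeqL2) k =
      ∑ j ∈ s, f j * g j k := fun s f g => by
    rw [lp.coeFn_sum, Finset.sum_apply]
    rfl
  set w := Φ.eig n ^ (1 / 2 : ℂ) with hw
  have hw2 : w ^ 2 = Φ.eig n := by rw [hw]; simp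
  have hre : 0 < w.re := by
    have := modalBeta_im_pos (Φ.eig_mem_slitPlane ha hab hω hς h𝔫 n)
    simpa [modalBeta, hw] using this
  have hx := hB w hre (Φ.len n) (fun j => U ha hab (Φ.vec n j)) (by simp [Φ.vec_zero]) fun i hi => by
    have h1 := Φ.chain n (i + 1) (Finset.mem_Icc.mpr ⟨by omega, hi⟩)
    rw [isModalImage_iff ha hab hω hς h𝔫, map_add, map_smul] at h1
    rwa [hw2]
  simp only [modeSum, map_sum, map_smul, hcoe]
  rw [Finset.mul_sum, ← Finset.sum_add_distrib, ← Finset.sum_neg_distrib]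
  have h1 : ∀ j ∈ Finset.Icc 1 (Φ.len n), (modalData ha hab hω hς h𝔫).sq k *
      (p j * U ha hab (Φ.vec n j) k) + p j * B (U ha hab (Φ.vec n j)) k =
      ∑ i ∈ Finset.Icc 1 j, sqrtCoeff w (j - i) * p j * U ha hab (Φ.vec n i) k := by
    intro j hj
    have h2 := hx j (Finset.mem_Icc.mp hj).2 k
    calc _ = p j * ∑ l ∈ Finset.range j, sqrtCoeff w l * U ha hab (Φ.vec n (j - l)) k := by
          rw [← h2]; ring
      _ = ∑ l ∈ Finset.range j, sqrtCoeff w l * p j * U ha hab (Φ.vec n (j - l)) k := by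
          rw [Finset.mul_sum]
          exact Finset.sum_congr rfl fun l _ => by ring
      _ = _ := by
          refine Finset.sum_nbij' (fun l => j - l) (fun i => j - i) ?_ ?_ ?_ ?_ ?_
          · intro l hl; simp only [Finset.mem_range, Finset.mem_Icc] at *; omega
          · intro l hl; simp only [Finset.mem_range, Finset.mem_Icc] at *; omega
          · intro l hl; simp only [Finset.mem_range] at *; omega
          · intro l hl; simp only [Finset.mem_Icc] at *; omega
          · intro l hl
            simp only [Finset.mem_range] at hl
            rw [show j - (j - l) = l by omega]
  -- Interchange over the triangle `i ≤ j`: lowering the index along the chain becomes the upper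
  -- triangular action on the coefficients `p`.
  rw [Finset.sum_congr rfl h1, Finset.sum_comm' (t' := Finset.Icc 1 (Φ.len n))
    (s' := fun i => Finset.Icc i (Φ.len n)) (by intro i j; simp only [Finset.mem_Icc]; omega)]
  refine Finset.sum_congr rfl fun i hi => ?_
  rw [← neg_mul, Φ.neg_dtnCoeff n p (Finset.mem_Icc.mp hi).2, Finset.sum_mul]

variable {Φ}

/-- `E` and `J` identify `H¹` with `ℓ²`. The subspace on which the two operators agree contains all
root vectors, and in these coordinates their span is dense by `dense_roots_sInv`. -/
lemma ExtendsDtNH1.unique (ha : 0 < a) (hab : a < b) (hω : 0 < ω) (hς : 0 < ς)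
    (h𝔫 : MemLp 𝔫 ⊤ (volume.restrict (Ioo a b)))
    {D D' : H1 a b →L[ℂ] L2 a b} (h : Φ.ExtendsDtNH1 D)
    (h' : Φ.ExtendsDtNH1 D') : D = D' := by
  obtain ⟨J, hJ⟩ := exists_J1 ha hab hω hς h𝔫
  obtain ⟨E, hE⟩ := exists_E1 ha hab hω hς h𝔫
  have hsurj : Function.Surjective E := fun u => ⟨J u, H1.fn_injective ?_⟩
  · refine ContinuousLinearMap.eq_of_dense_comp E hsurj
      (ModalData.dense_roots_sInv (D := modalData ha hab hω hς h𝔫)) fun x hx => ?_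
    let S : Submodule ℂ SeqL2 :=
      Submodule.map ((U ha hab : L2 a b →L[ℂ] SeqL2) ∘L H1.fnL a b).toLinearMap (D - D').ker
    have hS : (modalData ha hab hω hς h𝔫).roots ≤ S := Φ.roots_le ha hab hω hς h𝔫 fun n j hj => by
      obtain ⟨u, hu⟩ := Φ.exists_H1_vec hj
      refine ⟨u, ?_, by simp [hu]⟩
      rw [← Φ.modeSum_single hj] at hu
      have : D u = D' u := Lp.ext ((h n _ u hu).trans (h' n _ u hu).symm)
      simp [this]
    obtain ⟨u, hu, hux⟩ := hS hx
    have hEx : E x = u := H1.fn_injective (by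
      rw [hE, ← hux]
      simp)
    rw [hEx]
    simpa [sub_eq_zero] using hu
  · rw [hE]
    refine (U ha hab).symm_apply_eq.mpr ?_
    ext n
    have := ModalData.sq_pos (D := modalData ha hab hω hς h𝔫) n
    rw [ModalData.sInv_apply, hJ, inv_mul_cancel_left₀ (by exact_mod_cast this.ne')]

lemma ExtendsDtNL2.unique (ha : 0 < a) (hab : a < b) (hω : 0 < ω) (hς : 0 < ς)
    (h𝔫 : MemLp 𝔫 ⊤ (volume.restrict (Ioo a b)))
    {D D' : L2 a b →L[ℂ] H1Dual a b} (h : Φ.ExtendsDtNL2 D)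
    (h' : Φ.ExtendsDtNL2 D') : D = D' := by
  refine ContinuousLinearMap.eq_of_dense_comp (X := L2 a b) (Y := H1Dual a b) ((U ha hab).symm : SeqL2 →L[ℂ] L2 a b)
    (U ha hab).symm.surjective (ModalData.dense_roots (D := modalData ha hab hω hς h𝔫)) fun x hx => ?_
  let S : Submodule ℂ SeqL2 := ((D - D') ∘L ((U ha hab).symm : SeqL2 →L[ℂ] L2 a b)).ker
  have hS : (modalData ha hab hω hς h𝔫).roots ≤ S := Φ.roots_le ha hab hω hς h𝔫 fun n j hj => by
    have : D (Φ.vec n j) = D' (Φ.vec n j) := by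
      ext ξ
      rw [← Φ.modeSum_single hj, h, h']
    simp [S, this]
  have := hS hx
  simpa [S, sub_eq_zero] using this

lemma _root_.H1.exists_Hhalf (ha : 0 < a) (hab : a < b) (hω : 0 < ω) (hς : 0 < ς)
    (h𝔫 : MemLp 𝔫 ⊤ (volume.restrict (Ioo a b)))
    (u : H1 a b) : ∃ v : Hhalf a b, Hhalf.fn v = H1.fn u := by
  obtain ⟨J, hJ⟩ := exists_J1 ha hab hω hς h𝔫
  obtain ⟨E, hE⟩ := exists_Eh ha hab hω hς h𝔫
  refine ⟨E ((modalData ha hab hω hς h𝔫).qInv (J u)), ?_⟩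
  rw [hE]
  refine (U ha hab).symm_apply_eq.mpr ?_
  ext n
  have h1 := ModalData.qr_pos (D := modalData ha hab hω hς h𝔫) n
  have h2 : ((modalData ha hab hω hς h𝔫).qr n : ℂ) ≠ 0 := by exact_mod_cast h1.ne'
  rw [ModalData.qInv_apply, ModalData.qInv_apply, hJ, ← ModalData.qr_mul_qr]
  push_cast
  field_simp

/-- The argument for `H¹` with fourth roots, hence `dense_roots_qInv`. Root vectors belong to
`H^{1/2}` because they belong to `H¹`. -/
lemma ExtendsDtNHhalf.unique (ha : 0 < a) (hab : a < b) (hω : 0 < ω) (hς : 0 < ς)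
    (h𝔫 : MemLp 𝔫 ⊤ (volume.restrict (Ioo a b)))
    {D D' : Hhalf a b →L[ℂ] HhalfDual a b} (h : Φ.ExtendsDtNHhalf D)
    (h' : Φ.ExtendsDtNHhalf D') : D = D' := by
  obtain ⟨J, hJ⟩ := exists_Jh ha hab hω hς h𝔫
  obtain ⟨E, hE⟩ := exists_Eh ha hab hω hς h𝔫
  have hsurj : Function.Surjective E := fun u => ⟨J u, Hhalf.fn_injective ?_⟩
  · refine ContinuousLinearMap.eq_of_dense_comp (Y := HhalfDual a b) E hsurj
      (ModalData.dense_roots_qInv (D := modalData ha hab hω hς h𝔫)) fun x hx => ?_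
    let S : Submodule ℂ SeqL2 :=
      Submodule.map ((U ha hab : L2 a b →L[ℂ] SeqL2) ∘L Hhalf.fnL a b).toLinearMap (D - D').ker
    have hS : (modalData ha hab hω hς h𝔫).roots ≤ S := Φ.roots_le ha hab hω hς h𝔫 fun n j hj => by
      obtain ⟨u', hu'⟩ := Φ.exists_H1_vec hj
      obtain ⟨u, hu⟩ := H1.exists_Hhalf ha hab hω hς h𝔫 u'
      rw [hu'] at hu
      refine ⟨u, ?_, by simp [hu]⟩
      rw [← Φ.modeSum_single hj] at hu
      have : D u = D' u := by
        ext ξ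
        rw [h n _ u hu, h' n _ u hu]
      simp [this]
    obtain ⟨u, hu, hux⟩ := hS hx
    have hEx : E x = u := Hhalf.fn_injective (by
      rw [hE, ← hux]
      simp)
    rw [hEx]
    simpa [sub_eq_zero] using hu
  · rw [hE]
    refine (U ha hab).symm_apply_eq.mpr ?_
    ext n
    have := ModalData.qr_pos (D := modalData ha hab hω hς h𝔫) n
    rw [ModalData.qInv_apply, hJ, inv_mul_cancel_left₀ (by exact_mod_cast this.ne')]

end RootSystem

/-! ### The three operators and their compatibility -/

/-- The functionals `ξ ↦ ⟪J ξ, x⟫`. -/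
def SeqL2.pairing {X : Type*} [NormedAddCommGroup X] [NormedSpace ℂ X] (J : X →L[ℂ] SeqL2) :
    SeqL2 →L[ℂ] X →L⋆[ℂ] ℂ :=
  ((innerSL ℂ).comp J).flip

namespace LogCos

variable {a b : ℝ} (ha : 0 < a) (hab : a < b)

/-- The operator `u ↦ -r⁻¹ (J + B) u` on `H¹`. -/
def dtnH1 (J : H1 a b →L[ℂ] SeqL2) (B : SeqL2 →L[ℂ] SeqL2) : H1 a b →L[ℂ] L2 a b :=
  -(mulOp (memLp_inv ha) ∘L ((U ha hab).symm : SeqL2 →L[ℂ] L2 a b) ∘L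
    (J + B ∘L (U ha hab : L2 a b →L[ℂ] SeqL2) ∘L H1.fnL a b))

/-- The operator `L² → (H¹)'` with the form `-⟪J ξ, u⟫ - ⟪ξ, B u⟫`. -/
def dtnL2 (J : H1 a b →L[ℂ] SeqL2) (B : SeqL2 →L[ℂ] SeqL2) : L2 a b →L[ℂ] H1Dual a b :=
  -(pairing J ∘L (U ha hab : L2 a b →L[ℂ] SeqL2) +
    pairing ((U ha hab : L2 a b →L[ℂ] SeqL2) ∘L H1.fnL a b) ∘L B ∘L (U ha hab : L2 a b →L[ℂ] SeqL2))

/-- The operator `H^{1/2} → (H^{1/2})'` with the form `-⟪J ξ, J u⟫ - ⟪ξ, B u⟫`. -/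
def dtnHhalf (J : Hhalf a b →L[ℂ] SeqL2) (B : SeqL2 →L[ℂ] SeqL2) : Hhalf a b →L[ℂ] HhalfDual a b :=
  -(pairing J ∘L J + pairing ((U ha hab : L2 a b →L[ℂ] SeqL2) ∘L Hhalf.fnL a b) ∘L B ∘L
    (U ha hab : L2 a b →L[ℂ] SeqL2) ∘L Hhalf.fnL a b)

lemma dtnH1_apply (J : H1 a b →L[ℂ] SeqL2) (B : SeqL2 →L[ℂ] SeqL2) (u : H1 a b) :
    dtnH1 ha hab J B u =ᵐ[volume.restrict (Ioo a b)]
      fun r => (r : ℂ)⁻¹ * ((U ha hab).symm (-(J u + B (U ha hab (H1.fn u))))) r := by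
  have h : dtnH1 ha hab J B u =
      mulOp (memLp_inv ha) ((U ha hab).symm (-(J u + B (U ha hab (H1.fn u))))) := by
    rw [map_neg, map_neg]
    rfl
  rw [h]
  exact mulOp_coe _ _

lemma dtnL2_apply (J : H1 a b →L[ℂ] SeqL2) (B : SeqL2 →L[ℂ] SeqL2) (u : L2 a b) (ξ : H1 a b) :
    dtnL2 ha hab J B u ξ =
      -(inner ℂ (J ξ) (U ha hab u) + inner ℂ (U ha hab (H1.fn ξ)) (B (U ha hab u))) := rfl

lemma dtnHhalf_apply (J : Hhalf a b →L[ℂ] SeqL2) (B : SeqL2 →L[ℂ] SeqL2) (u ξ : Hhalf a b) :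
    dtnHhalf ha hab J B u ξ =
      -(inner ℂ (J ξ) (J u) + inner ℂ (U ha hab (Hhalf.fn ξ)) (B (U ha hab (Hhalf.fn u)))) := rfl

end LogCos

open LogCos

/-- The theorem on the Dirichlet-to-Neumann operator, in terms of the cosine transform. -/
lemma exists_dtn {r₁ r₂ ω ς : ℝ} {𝔫 : ℝ → ℝ} (hr₁ : 0 < r₁) (hr : r₁ < r₂) (hω : 0 < ω)
    (hς : 0 < ς) (h𝔫 : MemLp 𝔫 ⊤ (volume.restrict (Ioo r₁ r₂))) :
    ∃ (D₁ : H1 r₁ r₂ →L[ℂ] L2 r₁ r₂) (D₀ : L2 r₁ r₂ →L[ℂ] H1Dual r₁ r₂)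
      (Dh : Hhalf r₁ r₂ →L[ℂ] HhalfDual r₁ r₂),
      (∀ Φ : RootSystem r₁ r₂ ω ς 𝔫,
        Φ.ExtendsDtNH1 D₁ ∧ Φ.ExtendsDtNL2 D₀ ∧ Φ.ExtendsDtNHhalf Dh) ∧
      (∀ u ξ : H1 r₁ r₂, D₀ (H1.fn u) ξ = ∫ r in Ioo r₁ r₂, D₁ u r * conj (H1.fn ξ r)) ∧
      (∀ (u ξ : Hhalf r₁ r₂) (ξ' : H1 r₁ r₂), H1.fn ξ' = Hhalf.fn ξ →
        Dh u ξ = D₀ (Hhalf.fn u) ξ') := by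
  set D := modalData hr₁ hr hω hς h𝔫 with hD
  -- `B` depends on the `ModalData` alone and is chosen before any root system, so the three
  -- operators serve every `Φ`.
  obtain ⟨B, hB⟩ := D.exists_sqrt_sub_sqrt
  obtain ⟨J, hJ⟩ := exists_J1 hr₁ hr hω hς h𝔫
  obtain ⟨Jh, hJh⟩ := exists_Jh hr₁ hr hω hς h𝔫
  have hkey := fun (Φ : RootSystem r₁ r₂ ω ς 𝔫) => Φ.sq_mul_add hr₁ hr hω hς h𝔫 hB
  have hqq : ∀ n, (D.qr n : ℂ) * D.qr n = D.sq n := fun n => by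
    exact_mod_cast ModalData.qr_mul_qr n
  have hdual : ∀ (Φ : RootSystem r₁ r₂ ω ς 𝔫) (n : ℕ) (p : ℕ → ℂ) (f : L2 r₁ r₂),
      ∫ r in Ioo r₁ r₂, Φ.dtnMode n p r * conj (f r) =
        inner ℂ (U hr₁ hr f) (U hr₁ hr (Φ.modeSum n (Φ.dtnCoeff n p))) := fun Φ n p f => by
    rw [inner_U]
    rfl
  refine ⟨dtnH1 hr₁ hr J B, dtnL2 hr₁ hr J B, dtnHhalf hr₁ hr Jh B, fun Φ => ⟨?_, ?_, ?_⟩, ?_, ?_⟩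
  · intro n p u hu
    have h1 : (U hr₁ hr).symm (-(J u + B (U hr₁ hr (H1.fn u)))) = Φ.modeSum n (Φ.dtnCoeff n p) := by
      refine (U hr₁ hr).symm_apply_eq.mpr ?_
      ext k
      have h2 := hkey Φ n p k
      rw [lp.coeFn_neg, Pi.neg_apply, lp.coeFn_add, Pi.add_apply, hJ, hu, h2, neg_neg]
    have h2 := dtnH1_apply hr₁ hr J B u
    rw [h1] at h2
    exact h2
  · intro n p ξ
    rw [hdual, dtnL2_apply, neg_eq_iff_eq_neg, ← inner_neg_right]
    refine inner_add_inner_eq fun k => ?_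
    have h2 := hkey Φ n p k
    rw [hJ, map_mul, Complex.conj_ofReal, lp.coeFn_neg, Pi.neg_apply, ← h2]
    ring
  · intro n p u hu ξ
    rw [hdual, dtnHhalf_apply, neg_eq_iff_eq_neg, ← inner_neg_right, hu]
    refine inner_add_inner_eq fun k => ?_
    have h2 := hkey Φ n p k
    rw [hJh, hJh, hu, map_mul, Complex.conj_ofReal, lp.coeFn_neg, Pi.neg_apply, ← h2, ← hqq]
    ring
  · intro u ξ
    have h1 : ∫ r in Ioo r₁ r₂, dtnH1 hr₁ hr J B u r * conj (H1.fn ξ r) =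
        inner ℂ (U hr₁ hr (H1.fn ξ)) (-(J u + B (U hr₁ hr (H1.fn u)))) := by
      rw [← (U hr₁ hr).apply_symm_apply (-(J u + B (U hr₁ hr (H1.fn u)))), inner_U]
      refine integral_congr_ae ?_
      filter_upwards [dtnH1_apply hr₁ hr J B u] with r h
      rw [h]
    rw [h1, dtnL2_apply, inner_neg_right, inner_add_right]
    congr 2
    -- `√λ` is real and can be moved from one argument to the other.
    refine inner_eq_of_mul_eq fun k => ?_
    rw [hJ, hJ, map_mul, Complex.conj_ofReal]
    ring
  · intro u ξ ξ' h
    rw [dtnHhalf_apply, dtnL2_apply, h]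
    congr 2
    -- The two fourth roots, one on each argument, combine to the square root carried by `ξ'` alone.
    refine inner_eq_of_mul_eq fun k => ?_
    rw [hJ, hJh, hJh, map_mul, map_mul, Complex.conj_ofReal, Complex.conj_ofReal, h, ← hqq]
    ring

end

theorem mainTheorem9 (r₁ r₂ ω ς : ℝ) (𝔫 : ℝ → ℝ) (hr₁ : 0 < r₁) (hr : r₁ < r₂) (hω : 0 < ω)
    (hς : 0 < ς) (h𝔫 : MemLp 𝔫 ⊤ (volume.restrict (Ioo r₁ r₂))) :
    Nonempty (RootSystem r₁ r₂ ω ς 𝔫) ∧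
    ∃ (D₁ : H1 r₁ r₂ →L[ℂ] L2 r₁ r₂) (D₀ : L2 r₁ r₂ →L[ℂ] H1Dual r₁ r₂)
      (Dh : Hhalf r₁ r₂ →L[ℂ] HhalfDual r₁ r₂),
      (∀ Φ : RootSystem r₁ r₂ ω ς 𝔫,
        (Φ.ExtendsDtNH1 D₁ ∧ ∀ D, Φ.ExtendsDtNH1 D → D = D₁) ∧
        (Φ.ExtendsDtNL2 D₀ ∧ ∀ D, Φ.ExtendsDtNL2 D → D = D₀) ∧
        (Φ.ExtendsDtNHhalf Dh ∧ ∀ D, Φ.ExtendsDtNHhalf D → D = Dh)) ∧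
      (∀ u ξ : H1 r₁ r₂, D₀ (H1.fn u) ξ = ∫ r in Ioo r₁ r₂, D₁ u r * conj (H1.fn ξ r)) ∧
      (∀ (u ξ : Hhalf r₁ r₂) (ξ' : H1 r₁ r₂), H1.fn ξ' = Hhalf.fn ξ → Dh u ξ = D₀ (Hhalf.fn u) ξ') := by
  refine ⟨LogCos.nonempty_rootSystem hr₁ hr hω hς h𝔫, ?_⟩
  obtain ⟨D₁, D₀, Dh, h, hc⟩ := exists_dtn hr₁ hr hω hς h𝔫
  refine ⟨D₁, D₀, Dh, fun Φ => ?_, hc⟩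
  obtain ⟨h₁, h₀, hh⟩ := h Φ
  exact ⟨⟨h₁, fun _ hD => hD.unique hr₁ hr hω hς h𝔫 h₁⟩,
    ⟨h₀, fun _ hD => hD.unique hr₁ hr hω hς h𝔫 h₀⟩, ⟨hh, fun _ hD => hD.unique hr₁ hr hω hς h𝔫 hh⟩⟩
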